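/- **Conventions.** A circuit over $\{\mathrm{U}(2),\mathrm{CNOT}\}$ is a finite sequence of layers; each layer consists of single-qubit unitaries and CNOT gates acting on pairwise disjoint qubits. Its depth is the number of layers. All qubits start in $|0\rangle$. In a given layer a qubit is *active* if a gate of the layer acts on it or if it is not in the state $|0\rangle$; the *spacetime allocation* of the circuit is the sum over its layers of the number of active qubits. Ancillas are the qubits used by the circuit other than the $n$ data qubits. For $0\ne x\in\mathbb{C}^{N}$, $N=2^n$, a circuit *prepares* $x$ if, started with all qubits in $|0\rangle$, it ends exactly in the state $\frac{1}{\|x\|}\sum_{i=0}^{N-1}x_i|i\rangle$ of the data qubits, with every ancilla returned to $|0\rangle$ (no garbage). **The SP+CSP circuit.** For integers $0\le m<n$ and $x\neq0$ the SP+CSP circuit first applies a circuit $U_{\mathrm{SP}}$ that prepares $\frac1{\|y\|}\sum_{i<2^m}y_i|i\rangle$ on the first $m$ data qubits, where $y_i^2=\sum_{l<2^{n-m}}|x_{i2^{n-m}+l}|^2$, and then a circuit $U_{\mathrm{CSP}}$ that, controlled on the first $m$ qubits being in $|k\rangle$, prepares the normalised $k$-th block $(x_{k2^{n-m}+l})_{l<2^{n-m}}$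 (if it is nonzero) in the other $n-m$ qubits. For a vector $v$ of $2^{r}$ amplitudes, $0\le s<r$ and $0\le p<2^s$, put $\theta_{s,p}=2\arccos\sqrt{\textstyle\sum_{l<2^{r-s-1}}|v_{p2^{r-s}+l}|^2\big/\sum_{l<2^{r-s}}|v_{p2^{r-s}+l}|^2}$. Here $0/0$ is read as $0$. $U_{\mathrm{SP}}$ ($r=m$, $v=y$): rotate the angle qubits $A_{s,p}$ by $\mathrm R_y(\theta_{s,p})$ in parallel; apply SPF, which, for $s=0,1,\dots$, swaps the angle qubit $A_{s,p}$ with $p$ given by the first $s$ data qubits into the $s$-th data qubit; apply $X$ to all flag qubits $F_{s,p}$ and apply FLAG, which flips those $F_{s,p}$ with $p$ equal to the first $s$ data bits; undo the remaining rotations by $\mathrm R_y(-\theta_{s,p})$ on $A_{s,p}$ controlled on $F_{s,p}$; apply $\mathrm{FLAG}^\dagger$ and $X$ to all flags. $U_{\mathrm{CSP}}$ ($r=n-m$): apply $X$ to all flags; apply LOADF, which for address $k$ loads the states $\mathrm R_y(\theta^{(k)}_{s,p})|0\rangle$ of the $k$-th block (for $s=n-m-1$ with the phases of the amplitudes $x_j$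 included) into those buffer qubits $B_{s,p}$ whose flag is $1$; apply SPF with the buffer as angle register, FLAG, $\mathrm{LOADF}^\dagger$, $\mathrm{FLAG}^\dagger$, and $X$ to all flags. SPF, FLAG and LOADF are compiled into CNOT and single-qubit gates by tree-like copying of control bits, layers of parallel controlled swaps and, in LOADF, one parallel layer of doubly controlled rotations and phases between a set-up circuit and its inverse; copies are allocated as late as possible. **Theorem.** There are absolute constants $c,K>0$ such that: 1. For all integers $0\le m<n$ and all $0\neq x\in\mathbb{C}^{2^n}$ the SP+CSP circuit is a circuit over $\{\mathrm{U}(2),\mathrm{CNOT}\}$ that prepares $x$ exactly. Its depth $D$ satisfies $c\,n\le D\le K\,n$, it uses at most $K\,2^n$ ancillas, which start and end in $|0\rangle$, and its spacetime allocation $\mathrm{SA}$ satisfies $c\,2^n\le\mathrm{SA}\le K\,(m2^m+2^n+(n-m)2^{n-m})$. If moreover $\lceil\log_2 n\rceil\le m\le\lfloor n-\log_2 n\rfloor$, then $\mathrm{SA}\le K\,2^n$. 2. Depth and spacetime allocation are optimal up to constant factors: for every $n\ge1$ there is $0\neq x\in\mathbb{C}^{2^n}$ such that every circuit over $\{\mathrm{U}(2),\mathrm{CNOT}\}$,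 with any number of ancillas, that prepares $x$ has depth at least $c\,n$ and spacetime allocation at least $c\,2^n$. -/

import Mathlib

open scoped BigOperators

noncomputable section

namespace QSP

/-! ### Circuits over the gate set {U(2), CNOT} -/

/-- The single-qubit unitaries. -/
abbrev U2 : Type := Matrix.unitaryGroup (Fin 2) ℂ

/-- An elementary gate on qubits labelled by `Q`: an arbitrary single-qubit unitary, or a CNOT with
control `c` and target `t`. -/
inductive Gate (Q : Type) : Type
  | u (U : U2) (q : Q) : Gate Q
  | cnot (c t : Q) : Gate Q

/-- The qubits a gate acts on. -/
def Gate.qubits {Q : Type} : Gate Q → List Q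
  | .u _ q => [q]
  | .cnot c t => [c, t]

/-- The inverse gate. -/
def Gate.dagger {Q : Type} : Gate Q → Gate Q
  | .u U q => .u U⁻¹ q
  | .cnot c t => .cnot c t

/-- A layer: gates that are executed in the same time step. -/
abbrev Layer (Q : Type) : Type := List (Gate Q)

/-- A circuit: its layers, in the order of execution. -/
abbrev Circuit (Q : Type) : Type := List (Layer Q)

/-- The qubits touched by the gates of a layer, listed with repetitions. -/
def Layer.qubits {Q : Type} (L : Layer Q) : List Q := L.flatMap Gate.qubits

/-- The qubits touched by the gates of a circuit, listed with repetitions. -/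
def Circuit.qubits {Q : Type} (C : Circuit Q) : List Q := C.flatMap Layer.qubits

/-- In every layer the gates act on pairwise disjoint sets of qubits, and the control of each CNOT
differs from its target. -/
def Circuit.Valid {Q : Type} (C : Circuit Q) : Prop := ∀ L ∈ C, (Layer.qubits L).Nodup

/-- The depth is the number of layers. -/
def Circuit.depth {Q : Type} (C : Circuit Q) : ℕ := C.length

/-- The inverse circuit. -/
def Circuit.dagger {Q : Type} (C : Circuit Q) : Circuit Q :=
  (C.map fun L => L.map Gate.dagger).reverse

/-! ### Action on states -/

/-- Pure states of the qubits labelled by `Q`, as families of amplitudes in the computational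
basis. The set `Q` of labels may be infinite (an unlimited supply of fresh ancillas); a circuit
touches only finitely many of them. -/
abbrev State (Q : Type) : Type := (Q → Fin 2) → ℂ

/-- The action of a gate. -/
def Gate.apply {Q : Type} [DecidableEq Q] : Gate Q → State Q → State Q
  | .u U q, ψ => fun b => ∑ v : Fin 2, U.1 (b q) v * ψ (Function.update b q v)
  | .cnot c t, ψ => fun b => ψ (Function.update b t (b t + b c))

/-- The action of a layer. -/
def Layer.apply {Q : Type} [DecidableEq Q] (L : Layer Q) (ψ : State Q) : State Q :=
  L.foldl (fun φ g => g.apply φ) ψ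

/-- The action of a circuit. -/
def Circuit.run {Q : Type} [DecidableEq Q] (C : Circuit Q) (ψ : State Q) : State Q :=
  C.foldl (fun φ L => Layer.apply L φ) ψ

open Classical in
/-- The state in which every qubit is `|0⟩`. -/
def zeroState (Q : Type) : State Q := fun b => if ∀ q, b q = 0 then 1 else 0

/-- The number whose binary digits are `b 0, b 1, …, b (n-1)`, most significant digit first. -/
def bitsToNat {n : ℕ} (b : Fin n → Fin 2) : ℕ := ∑ i : Fin n, (b i : ℕ) * 2 ^ (n - 1 - (i : ℕ))

/-- The entries of a vector, indexed by natural numbers (zero outside the range). -/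
def coeff {N : ℕ} (x : EuclideanSpace ℂ (Fin N)) (j : ℕ) : ℂ :=
  if h : j < N then x ⟨j, h⟩ else 0

open Classical in
/-- The state in which the data qubits `d 0, …, d (n-1)` are in the normalised state
`‖x‖⁻¹ ∑ i, x i |i⟩` and all other qubits are in the state `|0⟩`. -/
def dataState {Q : Type} {n : ℕ} (d : Fin n ↪ Q) (x : EuclideanSpace ℂ (Fin (2 ^ n))) : State Q :=
  fun b => if ∀ q, q ∉ Set.range d → b q = 0 then
    coeff x (bitsToNat fun i => b (d i)) / (‖x‖ : ℂ) else 0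

/-- Exact garbage-free state preparation: started with all qubits in `|0⟩`, the circuit leaves the
data qubits in the state `x / ‖x‖` and returns every ancilla to `|0⟩`. -/
def Circuit.Prepares {Q : Type} [DecidableEq Q] {n : ℕ} (C : Circuit Q) (d : Fin n ↪ Q)
    (x : EuclideanSpace ℂ (Fin (2 ^ n))) : Prop :=
  C.run (zeroState Q) = dataState d x

/-- The number of ancillas, i.e. of qubits used by the circuit that are not data qubits. -/
def Circuit.numAncillas {Q : Type} {n : ℕ} (C : Circuit Q) (d : Fin n ↪ Q) : ℕ :=
  {q | q ∈ C.qubits ∧ q ∉ Set.range d}.ncard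

/-- The active qubits in a layer that is applied to the state `ψ`: those that a gate of the layer
acts on, and those that are not in the state `|0⟩`. -/
def activeQubits {Q : Type} (L : Layer Q) (ψ : State Q) : Set Q :=
  {q | q ∈ Layer.qubits L ∨ ∃ b, b q = 1 ∧ ψ b ≠ 0}

/-- The sum over the layers of the number of active qubits, for the initial state `ψ`. -/
def Circuit.allocationFrom {Q : Type} [DecidableEq Q] : State Q → Circuit Q → ℕ
  | _, [] => 0
  | ψ, L :: C => (activeQubits L ψ).ncard + Circuit.allocationFrom (Layer.apply L ψ) C

/-- The spacetime allocation of a circuit that is started with all qubits in `|0⟩`. -/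
def Circuit.spacetimeAllocation {Q : Type} [DecidableEq Q] (C : Circuit Q) : ℕ :=
  Circuit.allocationFrom (zeroState Q) C

/-! ### Parallel composition -/

/-- Two circuits side by side, both starting at the same time. -/
def par₂ {Q : Type} : Circuit Q → Circuit Q → Circuit Q
  | [], D => D
  | L :: C, [] => L :: C
  | L :: C, K :: D => (L ++ K) :: par₂ C D

/-- Circuits side by side, all starting at the same time. -/
def par {Q : Type} (Cs : List (Circuit Q)) : Circuit Q := Cs.foldr par₂ []

/-- Circuits side by side, all ending at the same time, so that the qubits of the shorter ones are
allocated as late as possible. -/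
def parEnd {Q : Type} (Cs : List (Circuit Q)) : Circuit Q := (par (Cs.map List.reverse)).reverse

/-! ### Gates -/

/-- The Pauli matrix `X`. -/
def gX : U2 := ⟨!![0, 1; 1, 0], by
  rw [Matrix.mem_unitaryGroup_iff]
  ext i j
  fin_cases i <;> fin_cases j <;>
    simp [Matrix.mul_apply, Fin.sum_univ_two, Matrix.star_apply]⟩

/-- The diagonal matrix with entries `exp (i α)` and `exp (i β)`. -/
def gDiag (α β : ℝ) : U2 := ⟨!![Complex.exp (α * Complex.I), 0; 0, Complex.exp (β * Complex.I)], by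
  rw [Matrix.mem_unitaryGroup_iff]
  ext i j
  fin_cases i <;> fin_cases j <;>
    simp [Matrix.mul_apply, Fin.sum_univ_two, Matrix.star_apply, ← Complex.exp_conj,
      ← Complex.exp_add]⟩

/-- The Hadamard gate. -/
def gH : U2 := ⟨!![(1 / √2 : ℝ), (1 / √2 : ℝ); (1 / √2 : ℝ), -(1 / √2 : ℝ)], by
  have h : ((√2 : ℝ) : ℂ) * (√2 : ℝ) = 2 := by
    rw [← Complex.ofReal_mul, Real.mul_self_sqrt (by norm_num)]
    norm_num
  have h0 : ((√2 : ℝ) : ℂ) ≠ 0 := by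
    intro h1
    rw [h1] at h
    norm_num at h
  have h2 : ((√2 : ℝ) : ℂ)⁻¹ * ((√2 : ℝ) : ℂ)⁻¹ = 1 / 2 := by
    rw [← mul_inv, h]
    norm_num
  rw [Matrix.mem_unitaryGroup_iff]
  ext i j
  fin_cases i <;> fin_cases j <;>
    simp [Matrix.mul_apply, Fin.sum_univ_two, Matrix.star_apply, h2] <;> norm_num⟩

/-- The rotation about the `y`-axis. -/
def gRy (θ : ℝ) : U2 := ⟨!![(Real.cos (θ / 2) : ℝ), -(Real.sin (θ / 2) : ℝ);
    (Real.sin (θ / 2) : ℝ), (Real.cos (θ / 2) : ℝ)], by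
  have h : ((Real.cos (θ / 2) : ℝ) : ℂ) * (Real.cos (θ / 2) : ℝ)
      + (Real.sin (θ / 2) : ℝ) * (Real.sin (θ / 2) : ℝ) = 1 := by
    rw [← Complex.ofReal_mul, ← Complex.ofReal_mul, ← Complex.ofReal_add]
    rw [← sq, ← sq, Real.cos_sq_add_sin_sq]
    norm_num
  rw [Matrix.mem_unitaryGroup_iff]
  ext i j
  fin_cases i <;> fin_cases j <;>
    simp [Matrix.mul_apply, Fin.sum_univ_two, Matrix.star_apply, -Complex.ofReal_cos,
      -Complex.ofReal_sin] <;>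
    first | linear_combination h | ring⟩

/-- The rotation about the `z`-axis. -/
def gRz (θ : ℝ) : U2 := gDiag (-θ / 2) (θ / 2)

/-- The phase gate `diag (1, exp (i α))`. -/
def gPhase (α : ℝ) : U2 := gDiag 0 α

/-- The gate `T`. -/
def gT : U2 := gPhase (Real.pi / 4)

/-- The inverse of `T`. -/
def gTdg : U2 := gPhase (-(Real.pi / 4))

/-- The Toffoli gate with controls `a`, `b` and target `t`. -/
def toffoli {Q : Type} (a b t : Q) : Circuit Q :=
  [[.u gH t],
   [.cnot b t],
   [.u gTdg t],
   [.cnot a t],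
   [.u gT t],
   [.cnot b t],
   [.u gTdg t, .u gT b],
   [.cnot a t],
   [.cnot a b, .u gT t],
   [.u gT a, .u gTdg b, .u gH t],
   [.cnot a b]]

/-- The SWAP gate. -/
def swap {Q : Type} (a b : Q) : Circuit Q := [[.cnot a b], [.cnot b a], [.cnot a b]]

/-- The Fredkin gate: `a` and `b` are swapped if `c` is `1`. -/
def cswap {Q : Type} (c a b : Q) : Circuit Q := [[.cnot b a]] ++ toffoli c a b ++ [[.cnot b a]]

/-- The rotation about the `y`-axis by the angle `θ` on `t`, controlled by `c`. -/
def cRy {Q : Type} (θ : ℝ) (c t : Q) : Circuit Q :=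
  [[.cnot c t], [.u (gRy (-θ / 2)) t], [.cnot c t], [.u (gRy (θ / 2)) t]]

/-- The doubly controlled rotation about the `y`-axis. -/
def ccRy {Q : Type} (θ : ℝ) (a b t : Q) : Circuit Q :=
  toffoli a b t ++ [[.u (gRy (-θ / 2)) t]] ++ toffoli a b t ++ [[.u (gRy (θ / 2)) t]]

/-- The doubly controlled rotation about the `z`-axis. -/
def ccRz {Q : Type} (θ : ℝ) (a b t : Q) : Circuit Q :=
  toffoli a b t ++ [[.u (gRz (-θ / 2)) t]] ++ toffoli a b t ++ [[.u (gRz (θ / 2)) t]]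

/-- The phase `exp (i α)`, controlled by `a` and `b`: a controlled rotation about the `z`-axis
followed by a phase gate on the control. -/
def ccPhase {Q : Type} (α : ℝ) (a b : Q) : Circuit Q :=
  [[.cnot a b], [.u (gRz (-α / 2)) b], [.cnot a b], [.u (gRz (α / 2)) b], [.u (gPhase (α / 2)) a]]

/-! ### Subroutines -/

/-- The copying layer `⊕_t` on the register `R` of size `c`: qubit `j` is copied to the fresh qubit
`j + 2 ^ t`, for all `j < 2 ^ t` in parallel. -/
def copyLayer {Q : Type} (R : ℕ → Q) (c t : ℕ) : Circuit Q :=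
  [((List.range (2 ^ t)).filter fun j => j + 2 ^ t < c).map fun j => .cnot (R j) (R (j + 2 ^ t))]

/-- The circuit `COPY_c`, of depth `⌈log₂ c⌉`, on the register `R` of size `c`. -/
def copy {Q : Type} (R : ℕ → Q) (c : ℕ) : Circuit Q :=
  (List.range (Nat.clog 2 c)).flatMap fun t => copyLayer R c t

/-- The circuit `CS_t`: `2 ^ t` parallel controlled swaps, with controls in `R` and targets in
`S`. -/
def cs {Q : Type} (t : ℕ) (R S : ℕ → Q) : Circuit Q :=
  par ((List.range (2 ^ t)).map fun i => cswap (R i) (S i) (S (i + 2 ^ t)))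

/-- The circuit `C` if `p` holds, and the empty circuit otherwise. -/
def onlyIf {Q : Type} (p : Bool) (C : Circuit Q) : Circuit Q := if p then C else []

/-- The operations of SPF in time step `τ = 3 i + j`, where `j = 0, 1, 2` numbers the three
parallelised sequences of iteration `i`. Here `D q` is the register of the copies of the `q`-th data
qubit, with `D q 0` the data qubit itself, and `A u` is the `u`-th angle register, of size `2 ^ u`.
At time `3 q + 2` the angle qubit `A q 0` is swapped into the data qubit `q`, at time `3 q + 4 + 2 k`
the circuit `CS_k` acts on `D q` and `A (q + 1 + k)`, and the copying layer `⊕_k` acts on `D q` at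
time `3 q + 5 + 2 k`. The SWAP gates are left out if `inject` is false. -/
def spfStep {Q : Type} (inject : Bool) (D A : ℕ → ℕ → Q) (m τ : ℕ) : Circuit Q :=
  par ((List.range m).flatMap fun q =>
    [onlyIf (inject && τ == 3 * q + 2) (swap (D q 0) (A q 0))]
    ++ ((List.range (m - 1 - q)).map fun k =>
        onlyIf (τ == 3 * q + 4 + 2 * k) (cs k (D q) (A (q + 1 + k))))
    ++ ((List.range (m - 2 - q)).map fun k =>
        onlyIf (τ == 3 * q + 5 + 2 * k) (copyLayer (D q) (2 ^ (m - 2 - q)) k)))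

/-- The circuit SPF, which injects the angle states of the register `A` into `m` data qubits. The
second half runs through the time steps of the first half backwards, without the SWAP gates. -/
def spf {Q : Type} (D A : ℕ → ℕ → Q) (m : ℕ) : Circuit Q :=
  ((List.range (3 * m)).flatMap fun τ => spfStep true D A m τ)
  ++ ((List.range (3 * m)).reverse.flatMap fun τ => spfStep false D A m τ)

/-- The circuit FLAG, which flips the bit `F s p` for every `s < m`, where `p` is the number formed
by the first `s` data qubits (starting from flags that are all `1`). -/
def flag {Q : Type} (D F : ℕ → ℕ → Q) (m : ℕ) : Circuit Q :=
  [(List.range m).map fun j => .u gX (F j 0)]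
  ++ par ((List.range (m - 1)).map fun q => copy (D q) (2 ^ (m - 2 - q)))
  ++ ((List.range (m - 1)).flatMap fun i =>
      par ((List.range (m - 1 - i)).map fun q => cs i (D q) (F (q + 1 + i))))
  ++ Circuit.dagger (par ((List.range (m - 1)).map fun q => copy (D q) (2 ^ (m - 2 - q))))

/-- The circuit CopySwap: the `j`-th control bit (`j = 0` the least significant one) is copied to
the register `R j` of size `2 ^ j`, and the qubit `S 0` is moved to `S k`, where `k` is the number
formed by the `m` control bits. -/
def copySwap {Q : Type} (R : ℕ → ℕ → Q) (S : ℕ → Q) (m : ℕ) : Circuit Q :=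
  (List.range m).flatMap fun i =>
    par (cs i (R i) S ::
      ((List.range m).filter fun j => i < j).map fun j => copyLayer (R j) (2 ^ j) i)

/-! ### The registers -/

/-- The qubits. The pairs `(s, p)` with `p < 2 ^ s` that index angles are numbered by
`e = 2 ^ s - 1 + p`. -/
inductive Qubit : Type
  /-- the data qubits -/
  | data (q : ℕ)
  /-- the copies of the data qubit `q`, `i ≥ 1`, in SPF and FLAG -/
  | dataCopy (q i : ℕ)
  /-- the angle register `A` of SP -/
  | angle (e : ℕ)
  /-- the flag register `F` (`k = 0`) and its copies -/
  | flag (e k : ℕ)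
  /-- the copies of the `j`-th address bit that control the loading of the address register -/
  | addr (j i : ℕ)
  /-- the copies of the `j`-th address bit that control the moves in the `e`-th block of the buffer -/
  | blockAddr (e j i : ℕ)
  /-- the expanded (one-hot) address register `A` of CSP (`l = 0`) and its copies -/
  | sel (k l : ℕ)
  /-- the buffer register `B` (`k = 0`) and the other positions of each of its blocks -/
  | buf (e k : ℕ)
  deriving DecidableEq

/-- The number of the pair `(s, p)`. -/
def node (s p : ℕ) : ℕ := 2 ^ s - 1 + p

/-- The component `s` of the pair with number `e`. -/
def nodeLevel (e : ℕ) : ℕ := Nat.log 2 (e + 1)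

/-- The component `p` of the pair with number `e`. -/
def nodePos (e : ℕ) : ℕ := e + 1 - 2 ^ nodeLevel e

/-- The register of the copies of the data qubit `q`. -/
def dataReg (q i : ℕ) : Qubit := if i = 0 then .data q else .dataCopy q i

/-- The register of the copies of the `j`-th bit (`j = 0` the least significant one) of the address,
which is held by the data qubits `0, …, m - 1`. -/
def addrReg (m j i : ℕ) : Qubit := if i = 0 then .data (m - 1 - j) else .addr j i

/-- The register consisting of the `j`-th address bit and the qubits onto which it is copied for the
blocks of the buffer. -/
def addrFan (m j i : ℕ) : Qubit := if i = 0 then .data (m - 1 - j) else .blockAddr (i - 1) j 0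

/-! ### The SP circuit -/

/-- The rotation angle `θ_{s,p}` for a vector of `2 ^ m` nonnegative amplitudes `v`. -/
def treeAngle (v : ℕ → ℝ) (m s p : ℕ) : ℝ :=
  2 * Real.arccos
    (√(∑ l ∈ Finset.range (2 ^ (m - s - 1)), v (p * 2 ^ (m - s) + l) ^ 2)
      / √(∑ l ∈ Finset.range (2 ^ (m - s)), v (p * 2 ^ (m - s) + l) ^ 2))

/-- The circuit `U_SP` for the angles `θ`, indexed by the numbers `e` of the pairs `(s, p)`. -/
def spCircuit (m : ℕ) (θ : ℕ → ℝ) : Circuit Qubit :=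
  let E := List.range (2 ^ m - 1)
  let D : ℕ → ℕ → Qubit := dataReg
  let A : ℕ → ℕ → Qubit := fun s p => .angle (node s p)
  let F : ℕ → ℕ → Qubit := fun s p => .flag (node s p) 0
  [E.map fun e => .u (gRy (θ e)) (.angle e)]
  ++ spf D A m
  ++ [E.map fun e => .u gX (.flag e 0)]
  ++ flag D F m
  ++ par (E.map fun e => cRy (-θ e) (.flag e 0) (.angle e))
  ++ Circuit.dagger (flag D F m)
  ++ [E.map fun e => .u gX (.flag e 0)]

/-! ### The CSP circuit -/

/-- The circuit Setup: it loads the address into a one-hot register and copies it, copies the flags,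
and moves the qubits of the buffer to the position given by the address. All copies are allocated as
late as possible. -/
def setup (n m : ℕ) : Circuit Qubit :=
  [[.u gX (.sel 0 0)]]
  ++ copySwap (addrReg m) (fun k => .sel k 0) m
  ++ parEnd
    (((List.range (2 ^ m)).map fun k => copy (fun l => .sel k l) (2 ^ (n - m) - 1))
    ++ ((List.range (2 ^ (n - m) - 1)).map fun e => copy (fun k => .flag e k) (2 ^ m))
    ++ [par ((List.range m).map fun j => copy (addrFan m j) (2 ^ (n - m)))
      ++ par ((List.range (2 ^ (n - m) - 1)).map fun e =>
          copySwap (fun j i => .blockAddr e j i) (fun k => .buf e k) m)])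

/-- The circuit LOADF: Setup, then one layer of doubly controlled gates, then the inverse of Setup.
The gate with indices `(k, e)` is the rotation about the `y`-axis by `θ k e`, followed by the rotation
about the `z`-axis by `δ k e` and the global phase `α k e`. -/
def loadf (n m : ℕ) (θ δ α : ℕ → ℕ → ℝ) : Circuit Qubit :=
  setup n m
  ++ par ((List.range (2 ^ m)).flatMap fun k => (List.range (2 ^ (n - m) - 1)).map fun e =>
      ccRy (θ k e) (.flag e k) (.sel k e) (.buf e k)
      ++ ccRz (δ k e) (.flag e k) (.sel k e) (.buf e k)
      ++ ccPhase (α k e) (.flag e k) (.sel k e))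
  ++ Circuit.dagger (setup n m)

/-- The circuit `U_CSP` for the angles and phases `θ`, `δ`, `α`, indexed by the values `k` of the
`m` address qubits and the numbers `e` of the pairs `(s, p)`. -/
def cspCircuit (n m : ℕ) (θ δ α : ℕ → ℕ → ℝ) : Circuit Qubit :=
  let E := List.range (2 ^ (n - m) - 1)
  let D : ℕ → ℕ → Qubit := fun q i => dataReg (m + q) i
  let B : ℕ → ℕ → Qubit := fun s p => .buf (node s p) 0
  let F : ℕ → ℕ → Qubit := fun s p => .flag (node s p) 0
  [E.map fun e => .u gX (.flag e 0)]
  ++ loadf n m θ δ α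
  ++ spf D B (n - m)
  ++ flag D F (n - m)
  ++ Circuit.dagger (loadf n m θ δ α)
  ++ Circuit.dagger (flag D F (n - m))
  ++ [E.map fun e => .u gX (.flag e 0)]

/-! ### The SP+CSP circuit -/

/-- The amplitude `y_i`, the square root of `∑ |x_j|²` over the `j` whose first `m` bits are those of
`i`. -/
def blockAmplitude {n : ℕ} (m : ℕ) (x : EuclideanSpace ℂ (Fin (2 ^ n))) (i : ℕ) : ℝ :=
  √(∑ l ∈ Finset.range (2 ^ (n - m)), ‖coeff x (i * 2 ^ (n - m) + l)‖ ^ 2)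

/-- The rotation angle of SP with number `e`. -/
def spAngle {n : ℕ} (m : ℕ) (x : EuclideanSpace ℂ (Fin (2 ^ n))) (e : ℕ) : ℝ :=
  treeAngle (blockAmplitude m x) m (nodeLevel e) (nodePos e)

/-- The rotation angle of CSP for the address `k` with number `e`. -/
def cspAngle {n : ℕ} (m : ℕ) (x : EuclideanSpace ℂ (Fin (2 ^ n))) (k e : ℕ) : ℝ :=
  treeAngle (fun j => ‖coeff x (k * 2 ^ (n - m) + j)‖) (n - m) (nodeLevel e) (nodePos e)

/-- The phase `φ_j` of the `j`-th amplitude in the block with address `k`. -/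
def cspPhase {n : ℕ} (m : ℕ) (x : EuclideanSpace ℂ (Fin (2 ^ n))) (k j : ℕ) : ℝ :=
  Complex.arg (coeff x (k * 2 ^ (n - m) + j))

/-- The angle of the rotation about the `z`-axis: `φ_{2p+1} - φ_{2p}` on the last level of the tree,
and `0` on the others. -/
def cspRz {n : ℕ} (m : ℕ) (x : EuclideanSpace ℂ (Fin (2 ^ n))) (k e : ℕ) : ℝ :=
  if nodeLevel e + 1 = n - m then
    cspPhase m x k (2 * nodePos e + 1) - cspPhase m x k (2 * nodePos e) else 0

/-- The global phase: `(φ_{2p} + φ_{2p+1}) / 2` on the last level of the tree, and `0` on the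
others. -/
def cspGlobalPhase {n : ℕ} (m : ℕ) (x : EuclideanSpace ℂ (Fin (2 ^ n))) (k e : ℕ) : ℝ :=
  if nodeLevel e + 1 = n - m then
    (cspPhase m x k (2 * nodePos e) + cspPhase m x k (2 * nodePos e + 1)) / 2 else 0

/-- The SP+CSP circuit, which prepares the first `m` qubits by `U_SP` and then the other `n - m`
qubits by `U_CSP`, controlled on the first `m`. -/
def spcspCircuit (n m : ℕ) (x : EuclideanSpace ℂ (Fin (2 ^ n))) : Circuit Qubit :=
  spCircuit m (spAngle m x)
  ++ cspCircuit n m (cspAngle m x) (cspRz m x) (cspGlobalPhase m x)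

/-- The data qubits of the SP+CSP circuit. -/
def dataQubits (n : ℕ) : Fin n ↪ Qubit :=
  ⟨fun i => .data i, fun _ _ h => Fin.ext (Qubit.data.inj h)⟩

end QSP

end

/-! Exact preparation. Circuits act linearly, so it suffices to follow basis states. SPF, FLAG and
Setup permute basis states, which `Maps` and `MapsOn` record; only the rotations create
superpositions. An assignment `f` of bits to the nodes of the angle tree determines one path from
the root to a leaf `i`. SPF moves the bits on this path into the data qubits and leaves zeros
behind, while all other nodes keep their bits. Since the rotated angle register is a product over
the nodes, the sum over `f` splits (`sum_clearPath`) into one term per leaf: the product of the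
amplitudes on its path, times the untouched product state of the nodes off the path. This residue
depends on `i` only through the set of nodes off the path, and that set is what FLAG writes into the
flags. Hence flag-controlled inverse rotations (`run_unrotate`) or the inverse of LOADF
(`run_cspCircuit_prefix`, `run_cspCircuit`) erase it. The product along a path telescopes, because
cosine and sine of half an angle are the square roots of the relative weights of the two subtrees
(`gRy_treeAngle`, `prod_gRy_treeAngle`); with the phases on the last level this gives the amplitudes
of `x` (`prod_loadMatrix`, `spcsp_prepares`).

Costs. The depth is a sum of linear bounds, and the number of touches of qubits by gates is
`O(2^n)`, which bounds the ancillas. Depth times number of qubits would give only `n 2^n` for the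
allocation. The factor `n` disappears because registers double just before they are needed: a qubit
that appears in round `i` of `m` lives for `O(m - i)` layers, and `∑ (m - i)^2 2^i = O(2^m)`
(`sum_sq_two_pow_le`, `weight_copySwap_le`). The inverse of Setup is charged by reversing time
(`allocationFrom_conj_le`). Between the parts of CSP only `O(n + 2^(n-m))` qubits can be nonzero
(`cspBase`), and these may stay for the whole depth. What survives is `m 2^m + 2^n + (n-m) 2^(n-m)`.

Lower bounds. The final amplitudes lie in the field generated over `ℚ` by the matrix entries of the
gates. A vector with an entry `1` and `2^n - 1` algebraically independent entries therefore needs at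
least `(2^n - 1)/4` gates, and every gate contributes to the allocation. For the depth, gates
outside the backward light cone of the data qubits can be moved to the end, where they do not affect
ratios of amplitudes (`coeff_mem_of_apply_eq_dataState`). At depth `D` the light cone has at most `n
(2^D - 1)` gates (`exists_lightCone`), which forces `n = O(D)`. -/

open scoped BigOperators

noncomputable section

namespace QSP

/-! ### Calculus of circuits: parallel composition, linearity, commutation and inverses. -/

section

variable {Q : Type}

/-! ### Qubits of a circuit -/

theorem Circuit.qubits_nil : Circuit.qubits ([] : Circuit Q) = [] := rfl

theorem Circuit.qubits_cons (L : Layer Q) (C : Circuit Q) :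
    Circuit.qubits (L :: C) = Layer.qubits L ++ Circuit.qubits C := by
  simp [Circuit.qubits]

theorem Circuit.qubits_append (C D : Circuit Q) :
    Circuit.qubits (C ++ D) = Circuit.qubits C ++ Circuit.qubits D := by
  simp [Circuit.qubits]

theorem Layer.qubits_cons (g : Gate Q) (L : Layer Q) :
    Layer.qubits (g :: L) = g.qubits ++ Layer.qubits L := by
  simp [Layer.qubits]

theorem Layer.qubits_append (L K : Layer Q) :
    Layer.qubits (L ++ K) = Layer.qubits L ++ Layer.qubits K := by
  simp [Layer.qubits]

theorem Gate.qubits_dagger (g : Gate Q) : g.dagger.qubits = g.qubits := by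
  cases g <;> rfl

theorem Layer.qubits_dagger (L : Layer Q) :
    Layer.qubits (L.map Gate.dagger) = Layer.qubits L := by
  simp [Layer.qubits, List.flatMap_map, Gate.qubits_dagger]

theorem Circuit.mem_qubits {C : Circuit Q} {q : Q} :
    q ∈ C.qubits ↔ ∃ L ∈ C, q ∈ Layer.qubits L := by
  simp [Circuit.qubits]

theorem Circuit.qubits_flatten (C : Circuit Q) :
    Layer.qubits C.flatten = C.qubits := by
  induction C with
  | nil => rfl
  | cons L C ih => rw [List.flatten_cons, Layer.qubits_append, Circuit.qubits_cons, ih]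

theorem Circuit.dagger_append (C D : Circuit Q) :
    Circuit.dagger (C ++ D) = Circuit.dagger D ++ Circuit.dagger C := by
  simp [Circuit.dagger]

theorem Circuit.dagger_cons (L : Layer Q) (C : Circuit Q) :
    Circuit.dagger (L :: C) = Circuit.dagger C ++ [L.map Gate.dagger] := by
  simp [Circuit.dagger]

theorem Circuit.length_dagger (C : Circuit Q) : (Circuit.dagger C).length = C.length := by
  simp [Circuit.dagger]

theorem Gate.dagger_dagger (g : Gate Q) : g.dagger.dagger = g := by
  cases g <;> simp [Gate.dagger]

theorem Circuit.dagger_dagger (C : Circuit Q) : Circuit.dagger (Circuit.dagger C) = C := by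
  have h : Gate.dagger ∘ Gate.dagger = (id : Gate Q → Gate Q) := funext Gate.dagger_dagger
  simp [Circuit.dagger, List.map_reverse, Function.comp_def, Gate.dagger_dagger]

theorem Circuit.mem_qubits_dagger {C : Circuit Q} {q : Q} :
    q ∈ (Circuit.dagger C).qubits ↔ q ∈ C.qubits := by
  simp only [Circuit.mem_qubits, Circuit.dagger, List.mem_reverse, List.mem_map]
  constructor
  · rintro ⟨_, ⟨L, hL, rfl⟩, hq⟩
    exact ⟨L, hL, by rwa [Layer.qubits_dagger] at hq⟩
  · rintro ⟨L, hL, hq⟩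
    exact ⟨_, ⟨L, hL, rfl⟩, by rwa [Layer.qubits_dagger]⟩

theorem Circuit.Valid.dagger {C : Circuit Q} (h : C.Valid) : (Circuit.dagger C).Valid := by
  intro L hL
  simp only [Circuit.dagger, List.mem_reverse, List.mem_map] at hL
  obtain ⟨L, hL, rfl⟩ := hL
  rw [Layer.qubits_dagger]
  exact h L hL

theorem Circuit.valid_append {C D : Circuit Q} : (C ++ D).Valid ↔ C.Valid ∧ D.Valid := by
  simp only [Circuit.Valid, List.mem_append]
  exact ⟨fun h => ⟨fun L hL => h L (.inl hL), fun L hL => h L (.inr hL)⟩,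
    fun h L hL => hL.elim (h.1 L) (h.2 L)⟩

theorem Circuit.valid_nil : Circuit.Valid ([] : Circuit Q) := by simp [Circuit.Valid]

theorem Circuit.valid_cons {L : Layer Q} {C : Circuit Q} :
    Circuit.Valid (L :: C) ↔ (Layer.qubits L).Nodup ∧ C.Valid := by
  simp [Circuit.Valid]

theorem Circuit.valid_flatMap {ι : Type*} {l : List ι} {f : ι → Circuit Q}
    (h : ∀ i ∈ l, (f i).Valid) : Circuit.Valid (l.flatMap f) := by
  intro L hL
  obtain ⟨i, hi, hL⟩ := List.mem_flatMap.1 hL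
  exact h i hi L hL

/-- The circuits act on disjoint sets of qubits. -/
def Disj (C D : Circuit Q) : Prop := ∀ q ∈ C.qubits, q ∉ D.qubits

/-! ### Parallel composition -/

theorem par₂_nil (C : Circuit Q) : par₂ C [] = C := by cases C <;> rfl

theorem mem_qubits_par₂ {C D : Circuit Q} {q : Q} :
    q ∈ (par₂ C D).qubits ↔ q ∈ C.qubits ∨ q ∈ D.qubits := by
  induction C generalizing D with
  | nil => simp [par₂, Circuit.qubits_nil]
  | cons L C ih =>
    cases D with
    | nil => simp [par₂, Circuit.qubits_nil]
    | cons K D =>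
      simp only [par₂, Circuit.qubits_cons, List.mem_append, ih, Layer.qubits_append]
      tauto

theorem mem_qubits_par {Cs : List (Circuit Q)} {q : Q} :
    q ∈ (par Cs).qubits ↔ ∃ C ∈ Cs, q ∈ C.qubits := by
  induction Cs with
  | nil => simp [par, Circuit.qubits_nil]
  | cons C Cs ih =>
    rw [par, List.foldr_cons, ← par, mem_qubits_par₂, ih]
    simp

theorem mem_qubits_reverse {C : Circuit Q} {q : Q} :
    q ∈ Circuit.qubits C.reverse ↔ q ∈ C.qubits := by
  simp [Circuit.mem_qubits]

theorem valid_reverse {C : Circuit Q} : Circuit.Valid C.reverse ↔ C.Valid := by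
  simp [Circuit.Valid]

theorem mem_qubits_parEnd {Cs : List (Circuit Q)} {q : Q} :
    q ∈ (parEnd Cs).qubits ↔ ∃ C ∈ Cs, q ∈ C.qubits := by
  rw [parEnd, mem_qubits_reverse, mem_qubits_par]
  constructor
  · rintro ⟨_, hD, hq⟩
    obtain ⟨C, hC, rfl⟩ := List.mem_map.1 hD
    exact ⟨C, hC, mem_qubits_reverse.1 hq⟩
  · rintro ⟨C, hC, hq⟩
    exact ⟨C.reverse, List.mem_map_of_mem hC, mem_qubits_reverse.2 hq⟩

theorem mem_qubits_flatten {Cs : List (Circuit Q)} {q : Q} :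
    q ∈ Circuit.qubits Cs.flatten ↔ ∃ C ∈ Cs, q ∈ C.qubits := by
  simp only [Circuit.mem_qubits, List.mem_flatten]
  constructor
  · rintro ⟨L, ⟨C, hC, hL⟩, hq⟩
    exact ⟨C, hC, L, hL, hq⟩
  · rintro ⟨C, hC, L, hL, hq⟩
    exact ⟨L, ⟨C, hC, hL⟩, hq⟩

theorem valid_par₂ {C D : Circuit Q} (hC : C.Valid) (hD : D.Valid) (h : Disj C D) :
    (par₂ C D).Valid := by
  induction C generalizing D with
  | nil => simpa [par₂] using hD
  | cons L C ih =>
    cases D with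
    | nil => simpa [par₂] using hC
    | cons K D =>
      rw [Circuit.valid_cons] at hC hD
      simp only [par₂, Circuit.valid_cons, Layer.qubits_append]
      refine ⟨List.Nodup.append hC.1 hD.1 fun q h1 h2 => ?_, ih hC.2 hD.2 fun q h1 h2 => ?_⟩
      · exact h q (by simp [Circuit.qubits_cons, h1]) (by simp [Circuit.qubits_cons, h2])
      · exact h q (by simp [Circuit.qubits_cons, h1]) (by simp [Circuit.qubits_cons, h2])

theorem valid_par {Cs : List (Circuit Q)} (hC : ∀ C ∈ Cs, C.Valid) (h : Cs.Pairwise Disj) :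
    (par Cs).Valid := by
  induction Cs with
  | nil => exact Circuit.valid_nil
  | cons C Cs ih =>
    rw [par, List.foldr_cons, ← par]
    rw [List.pairwise_cons] at h
    refine valid_par₂ (hC C (by simp)) (ih (fun D hD => hC D (by simp [hD])) h.2) ?_
    intro q hq hq'
    obtain ⟨D, hD, hq'⟩ := mem_qubits_par.1 hq'
    exact h.1 D hD q hq hq'

theorem disj_reverse {C D : Circuit Q} (h : Disj C D) : Disj C.reverse D.reverse := by
  intro q hq hq'
  exact h q (mem_qubits_reverse.1 hq) (mem_qubits_reverse.1 hq')

theorem valid_parEnd {Cs : List (Circuit Q)} (hC : ∀ C ∈ Cs, C.Valid) (h : Cs.Pairwise Disj) :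
    (parEnd Cs).Valid := by
  rw [parEnd, valid_reverse]
  refine valid_par ?_ ?_
  · intro C hC'
    obtain ⟨D, hD, rfl⟩ := List.mem_map.1 hC'
    exact valid_reverse.2 (hC D hD)
  · rw [List.pairwise_map]
    exact h.imp disj_reverse

theorem pairwise_range_map {n : ℕ} {f : ℕ → Circuit Q}
    (h : ∀ i < n, ∀ j < n, i ≠ j → Disj (f i) (f j)) :
    ((List.range n).map f).Pairwise Disj := by
  rw [List.pairwise_map]
  refine List.Pairwise.imp_of_mem ?_ List.nodup_range
  intro i j hi hj hij
  exact h i (List.mem_range.1 hi) j (List.mem_range.1 hj) hij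

theorem disj_par {C : Circuit Q} {Cs : List (Circuit Q)} (h : ∀ D ∈ Cs, Disj C D) :
    Disj C (par Cs) := by
  intro q hq hq'
  obtain ⟨D, hD, hq'⟩ := mem_qubits_par.1 hq'
  exact h D hD q hq hq'

/-! ### Action on states -/

variable [DecidableEq Q]

theorem Layer.apply_nil (ψ : State Q) : Layer.apply [] ψ = ψ := rfl

theorem Layer.apply_cons (g : Gate Q) (L : Layer Q) (ψ : State Q) :
    Layer.apply (g :: L) ψ = Layer.apply L (g.apply ψ) := rfl

theorem Layer.apply_append (L K : Layer Q) (ψ : State Q) :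
    Layer.apply (L ++ K) ψ = Layer.apply K (Layer.apply L ψ) := by
  simp [Layer.apply]

theorem Circuit.run_nil (ψ : State Q) : Circuit.run [] ψ = ψ := rfl

theorem Circuit.run_cons (L : Layer Q) (C : Circuit Q) (ψ : State Q) :
    Circuit.run (L :: C) ψ = Circuit.run C (Layer.apply L ψ) := rfl

theorem Circuit.run_append (C D : Circuit Q) (ψ : State Q) :
    Circuit.run (C ++ D) ψ = Circuit.run D (Circuit.run C ψ) := by
  simp [Circuit.run]

theorem Circuit.run_eq_flatten (C : Circuit Q) (ψ : State Q) :
    C.run ψ = Layer.apply C.flatten ψ := by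
  induction C generalizing ψ with
  | nil => rfl
  | cons L C ih => rw [Circuit.run_cons, ih, List.flatten_cons, Layer.apply_append]

/-- A layer may be executed one gate after the other. -/
theorem Circuit.run_layer_map {ι : Type*} (l : List ι) (f : ι → Gate Q) (ψ : State Q) :
    Circuit.run [l.map f] ψ = Circuit.run ((l.map fun i => [[f i]]).flatten) ψ := by
  rw [Circuit.run_eq_flatten, Circuit.run_eq_flatten]
  congr 1
  induction l with
  | nil => rfl
  | cons i l ih => simpa using ih

theorem Gate.isLinearMap (g : Gate Q) : IsLinearMap ℂ g.apply := by
  constructor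
  · intro ψ φ
    cases g with
    | u U q =>
      funext b
      simp [Gate.apply, mul_add]
      ring
    | cnot c t => rfl
  · intro a ψ
    cases g with
    | u U q =>
      funext b
      simp [Gate.apply]
      ring
    | cnot c t => rfl

theorem Layer.isLinearMap (L : Layer Q) : IsLinearMap ℂ (Layer.apply L) := by
  induction L with
  | nil => exact ⟨fun _ _ => rfl, fun _ _ => rfl⟩
  | cons g L ih =>
    refine ⟨fun ψ φ => ?_, fun a ψ => ?_⟩
    · simp only [Layer.apply_cons, g.isLinearMap.map_add, ih.map_add]
    · simp only [Layer.apply_cons, g.isLinearMap.map_smul, ih.map_smul]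

theorem Circuit.isLinearMap (C : Circuit Q) : IsLinearMap ℂ C.run := by
  have h : C.run = Layer.apply C.flatten := funext C.run_eq_flatten
  rw [h]
  exact Layer.isLinearMap _

theorem Circuit.run_smul (C : Circuit Q) (a : ℂ) (ψ : State Q) :
    C.run (a • ψ) = a • C.run ψ := C.isLinearMap.map_smul a ψ

theorem Circuit.run_sum {ι : Type*} (C : Circuit Q) (s : Finset ι) (ψ : ι → State Q) :
    C.run (∑ i ∈ s, ψ i) = ∑ i ∈ s, C.run (ψ i) :=
  map_sum (C.isLinearMap.mk' _) ψ s

/-! ### Commuting circuits -/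

theorem Gate.apply_comm {g h : Gate Q} (hd : ∀ q ∈ g.qubits, q ∉ h.qubits) (ψ : State Q) :
    g.apply (h.apply ψ) = h.apply (g.apply ψ) := by
  funext b
  cases g with
  | u U q =>
    cases h with
    | u V p =>
      have hqp : q ≠ p := by simpa [Gate.qubits] using hd
      simp only [Gate.apply, Finset.mul_sum, Function.update_of_ne hqp,
        Function.update_of_ne hqp.symm]
      rw [Finset.sum_comm]
      refine Finset.sum_congr rfl fun v _ => Finset.sum_congr rfl fun w _ => ?_
      rw [Function.update_comm hqp]
      ring
    | cnot c t =>
      have hq : q ≠ c ∧ q ≠ t := by simpa [Gate.qubits] using hd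
      simp only [Gate.apply, Function.update_of_ne hq.2,
        Function.update_of_ne hq.1.symm, Function.update_of_ne hq.2.symm,
        Function.update_comm hq.2]
  | cnot c t =>
    cases h with
    | u V p =>
      have hp : c ≠ p ∧ t ≠ p := by simpa [Gate.qubits] using hd
      simp only [Gate.apply, Function.update_of_ne hp.1, Function.update_of_ne hp.2,
        Function.update_of_ne hp.2.symm,
        Function.update_comm hp.2]
    | cnot c' t' =>
      simp only [Gate.qubits, List.mem_cons, List.not_mem_nil, or_false, not_or,
        forall_eq_or_imp, forall_eq] at hd
      obtain ⟨⟨-, h2⟩, h3, h4⟩ := hd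
      simp only [Gate.apply, Function.update_of_ne h2, Function.update_of_ne h4,
        Function.update_of_ne (Ne.symm h3),
        Function.update_of_ne (Ne.symm h4), Function.update_comm h4]

theorem Layer.apply_comm_gate {g : Gate Q} {L : Layer Q}
    (hd : ∀ q ∈ g.qubits, q ∉ Layer.qubits L) (ψ : State Q) :
    Layer.apply L (g.apply ψ) = g.apply (Layer.apply L ψ) := by
  induction L generalizing ψ with
  | nil => rfl
  | cons h L ih =>
    simp only [Layer.qubits_cons, List.mem_append, not_or] at hd
    rw [Layer.apply_cons, Layer.apply_cons, ← Gate.apply_comm (fun q hq => (hd q hq).1),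
      ih fun q hq => (hd q hq).2]

theorem Layer.apply_comm {L K : Layer Q}
    (hd : ∀ q ∈ Layer.qubits L, q ∉ Layer.qubits K) (ψ : State Q) :
    Layer.apply K (Layer.apply L ψ) = Layer.apply L (Layer.apply K ψ) := by
  induction L generalizing ψ with
  | nil => rfl
  | cons g L ih =>
    simp only [Layer.qubits_cons, List.mem_append] at hd
    rw [Layer.apply_cons, Layer.apply_cons, ih (fun q hq => hd q (.inr hq)),
      Layer.apply_comm_gate fun q hq => hd q (.inl hq)]

theorem Circuit.run_comm {C D : Circuit Q} (hd : Disj C D) (ψ : State Q) :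
    D.run (C.run ψ) = C.run (D.run ψ) := by
  simp only [Circuit.run_eq_flatten]
  refine Layer.apply_comm ?_ ψ
  simp only [Circuit.qubits_flatten]
  exact hd

/-- Interleaving the layers of two disjoint circuits is harmless because the rest of one circuit
commutes with each layer of the other. Semantic statements can therefore be proved for sequential
execution, costs for parallel execution. -/
theorem run_par₂ {C D : Circuit Q} (hd : Disj C D) (ψ : State Q) :
    (par₂ C D).run ψ = D.run (C.run ψ) := by
  induction C generalizing D ψ with
  | nil => rfl
  | cons L C ih =>
    cases D with
    | nil => rfl
    | cons K D =>
      have h1 : Disj C D := fun q hq hq' => hd q (by simp [Circuit.qubits_cons, hq])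
        (by simp [Circuit.qubits_cons, hq'])
      have h2 : Disj C [K] := fun q hq hq' => hd q (by simp [Circuit.qubits_cons, hq]) (by
        simp only [Circuit.qubits_cons, Circuit.qubits_nil, List.append_nil] at hq'
        simp [Circuit.qubits_cons, hq'])
      rw [par₂, Circuit.run_cons, ih h1, Layer.apply_append, Circuit.run_cons, Circuit.run_cons]
      exact congrArg (Circuit.run D) (Circuit.run_comm h2 (Layer.apply L ψ)).symm

/-- `parEnd` aligns circuits at their last layers by reversing the order of the layers (without
inverting gates), so the commutation argument of `run_par₂` is needed once more with the common
layers at the end. -/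
theorem run_par₂_reverse {C D : Circuit Q} (hd : Disj C D) (ψ : State Q) :
    Circuit.run (par₂ C D).reverse ψ = Circuit.run D.reverse (Circuit.run C.reverse ψ) := by
  induction C generalizing D ψ with
  | nil => rfl
  | cons L C ih =>
    cases D with
    | nil => rfl
    | cons K D =>
      have h1 : Disj C D := fun q hq hq' => hd q (by simp [Circuit.qubits_cons, hq])
        (by simp [Circuit.qubits_cons, hq'])
      have h2 : Disj [L] D.reverse := fun q hq hq' => hd q (by
        simp only [Circuit.qubits_cons, Circuit.qubits_nil, List.append_nil] at hq
        simp [Circuit.qubits_cons, hq]) (by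
        rw [Circuit.qubits_cons, List.mem_append]
        exact .inr (mem_qubits_reverse.1 hq'))
      rw [par₂, List.reverse_cons, List.reverse_cons, List.reverse_cons, Circuit.run_append,
        Circuit.run_append, Circuit.run_append, ih h1, Circuit.run_comm h2]
      simp only [Circuit.run_cons, Circuit.run_nil, Layer.apply_append]

theorem run_par {Cs : List (Circuit Q)} (h : Cs.Pairwise Disj) (ψ : State Q) :
    (par Cs).run ψ = Circuit.run Cs.flatten ψ := by
  induction Cs generalizing ψ with
  | nil => rfl
  | cons C Cs ih =>
    rw [List.pairwise_cons] at h
    rw [par, List.foldr_cons, ← par, run_par₂ (disj_par h.1), ih h.2, List.flatten_cons,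
      Circuit.run_append]

theorem run_parEnd {Cs : List (Circuit Q)} (h : Cs.Pairwise Disj) (ψ : State Q) :
    (parEnd Cs).run ψ = Circuit.run Cs.flatten ψ := by
  induction Cs generalizing ψ with
  | nil => rfl
  | cons C Cs ih =>
    rw [List.pairwise_cons] at h
    have h1 : Disj C.reverse (par (Cs.map List.reverse)) := by
      refine disj_par fun D hD => ?_
      obtain ⟨E, hE, rfl⟩ := List.mem_map.1 hD
      exact disj_reverse (h.1 E hE)
    rw [parEnd, List.map_cons, par, List.foldr_cons, ← par, run_par₂_reverse h1,
      List.reverse_reverse, ← parEnd, ih h.2, List.flatten_cons, Circuit.run_append]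

/-! ### Inverse circuits -/

/-- For a CNOT this needs the control to differ from the target, which is what `Nodup` supplies. -/
theorem Gate.dagger_apply_apply {g : Gate Q} (hg : g.qubits.Nodup) (ψ : State Q) :
    g.dagger.apply (g.apply ψ) = ψ := by
  funext b
  cases g with
  | u U q =>
    have hU : (U⁻¹).1 * U.1 = 1 := congrArg Subtype.val (inv_mul_cancel U)
    have h : ∀ i j, ∑ v, (U⁻¹).1 i v * U.1 v j = if i = j then 1 else 0 := fun i j => by
      rw [← Matrix.mul_apply, hU, Matrix.one_apply]
    simp only [Gate.dagger, Gate.apply, Function.update_self, Function.update_idem,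
      Finset.mul_sum, ← mul_assoc]
    rw [Finset.sum_comm]
    simp only [← Finset.sum_mul, h]
    simp
  | cnot c t =>
    have hct : c ≠ t := by simpa [Gate.qubits] using hg
    have h2 : ∀ x : Fin 2, x + x = 0 := by decide
    simp [Gate.dagger, Gate.apply, hct, add_assoc, h2]

theorem Layer.dagger_apply_apply {L : Layer Q} (hL : (Layer.qubits L).Nodup) (ψ : State Q) :
    Layer.apply (L.map Gate.dagger) (Layer.apply L ψ) = ψ := by
  induction L generalizing ψ with
  | nil => rfl
  | cons g L ih =>
    rw [Layer.qubits_cons, List.nodup_append] at hL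
    obtain ⟨h1, h2, h3⟩ := hL
    have h4 : ∀ q ∈ g.dagger.qubits, q ∉ Layer.qubits L := fun q hq hq' =>
      h3 q (by rwa [Gate.qubits_dagger] at hq) q hq' rfl
    rw [List.map_cons, Layer.apply_cons, Layer.apply_cons, ← Layer.apply_comm_gate h4,
      Gate.dagger_apply_apply h1, ih h2]

theorem Circuit.Valid.run_dagger_run {C : Circuit Q} (hC : C.Valid) (ψ : State Q) :
    (Circuit.dagger C).run (C.run ψ) = ψ := by
  induction C generalizing ψ with
  | nil => rfl
  | cons L C ih =>
    rw [Circuit.valid_cons] at hC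
    rw [Circuit.dagger_cons, Circuit.run_append, Circuit.run_cons L C, ih hC.2]
    exact Layer.dagger_apply_apply hC.1 ψ

end

/-! ### Circuits as permutations of basis states, and the composite gates. -/

section

variable {Q : Type}

/-! ### Basis states -/

open Classical in
/-- The computational basis state `|b⟩`. -/
def ket (b : Q → Fin 2) : State Q := fun b' => if b' = b then 1 else 0

theorem ket_apply_self (b : Q → Fin 2) : ket b b = 1 := by simp [ket]

theorem ket_apply_of_ne {b b' : Q → Fin 2} (h : b' ≠ b) : ket b b' = 0 := by simp [ket, h]

theorem ket_congr {P : Type} {b₁ b₁' : Q → Fin 2} {b₂ b₂' : P → Fin 2}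
    (h : b₁' = b₁ ↔ b₂' = b₂) : ket b₁ b₁' = ket b₂ b₂' := by
  by_cases h' : b₂' = b₂
  · simp [ket, h.2 h', h']
  · simp [ket, mt h.1 h', h']

theorem zeroState_eq_ket : zeroState Q = ket 0 := by
  funext b
  have h : (∀ q, b q = 0) ↔ b = 0 := by simp [funext_iff]
  by_cases hb : b = 0
  · rw [zeroState, if_pos (h.2 hb), hb, ket_apply_self]
  · rw [zeroState, if_neg (mt h.1 hb), ket_apply_of_ne hb]

/-- Translation of a state by a pattern of bit flips. -/
def shift (c : Q → Fin 2) (ψ : State Q) : State Q := fun b => ψ (b + c)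

theorem fin2_add_self (x : Fin 2) : x + x = 0 := by revert x; decide

theorem shift_ket (c b : Q → Fin 2) : shift c (ket b) = ket (b + c) := by
  have h : c + c = 0 := funext fun q => fin2_add_self (c q)
  funext b'
  have : b' + c = b ↔ b' = b + c := by
    constructor
    · rintro rfl
      rw [add_assoc, h, add_zero]
    · rintro rfl
      rw [add_assoc, h, add_zero]
  exact ket_congr this

variable [DecidableEq Q]

theorem Gate.apply_shift {g : Gate Q} {c : Q → Fin 2} (hc : ∀ q ∈ g.qubits, c q = 0)
    (ψ : State Q) : g.apply (shift c ψ) = shift c (g.apply ψ) := by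
  funext b
  cases g with
  | u U q =>
    have hq : c q = 0 := by simpa [Gate.qubits] using hc
    have h : ∀ v, Function.update b q v + c = Function.update (b + c) q v := by
      intro v
      funext p
      by_cases hp : p = q
      · subst hp
        simp [hq]
      · simp [hp]
    simp only [Gate.apply, shift, h, Pi.add_apply, hq, add_zero]
  | cnot a t =>
    have hq : c a = 0 ∧ c t = 0 := by simpa [Gate.qubits] using hc
    have h : ∀ v, Function.update b t v + c = Function.update (b + c) t v := by
      intro v
      funext p
      by_cases hp : p = t
      · subst hp
        simp [hq.2]
      · simp [hp]
    simp only [Gate.apply, shift, h, Pi.add_apply, hq, add_zero]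

/-- Flipping qubits that the circuit does not touch commutes with it. This is the tool for
transporting a computation from one background bit string to another in `MapsOn.congr`. -/
theorem Circuit.run_shift {C : Circuit Q} {c : Q → Fin 2} (hc : ∀ q ∈ C.qubits, c q = 0)
    (ψ : State Q) : C.run (shift c ψ) = shift c (C.run ψ) := by
  simp only [Circuit.run_eq_flatten]
  rw [← Circuit.qubits_flatten] at hc
  generalize List.flatten C = L at hc ⊢
  induction L generalizing ψ with
  | nil => rfl
  | cons g L ih =>
    simp only [Layer.qubits_cons, List.mem_append] at hc
    have h1 : ∀ q ∈ g.qubits, c q = 0 := fun q hq => hc q (.inl hq)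
    rw [Layer.apply_cons, Layer.apply_cons, Gate.apply_shift h1, ih _ fun q hq => hc q (.inr hq)]

/-- The circuit `C` maps the basis state `|b⟩` to the basis state `|b'⟩`. -/
def Maps (C : Circuit Q) (b b' : Q → Fin 2) : Prop := C.run (ket b) = ket b'

/-- The circuit `C` maps the basis state `|b⟩` to a basis state that agrees with `b'` on the qubits
of `C`. -/
def MapsOn (C : Circuit Q) (b b' : Q → Fin 2) : Prop :=
  Maps C b fun q => if q ∈ C.qubits then b' q else b q

theorem Maps.append {C D : Circuit Q} {b b' b'' : Q → Fin 2} (h : Maps C b b')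
    (h' : Maps D b' b'') : Maps (C ++ D) b b'' := by
  rw [Maps, Circuit.run_append, h, h']

theorem maps_nil (b : Q → Fin 2) : Maps [] b b := rfl

theorem Maps.dagger {C : Circuit Q} (hC : C.Valid) {b b' : Q → Fin 2} (h : Maps C b b') :
    Maps (Circuit.dagger C) b' b := by
  rw [Maps, ← h, hC.run_dagger_run]

theorem Maps.mapsOn {C : Circuit Q} {b b' b'' : Q → Fin 2} (h : Maps C b b'')
    (h1 : ∀ q ∈ C.qubits, b'' q = b' q) (h2 : ∀ q ∉ C.qubits, b'' q = b q) : MapsOn C b b' := by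
  rw [MapsOn]
  convert h using 1
  funext q
  split_ifs with hq
  · exact (h1 q hq).symm
  · exact (h2 q hq).symm

theorem MapsOn.maps {C : Circuit Q} {b b' : Q → Fin 2} (h : MapsOn C b b')
    (h' : ∀ q ∉ C.qubits, b' q = b q) : Maps C b b' := by
  rw [MapsOn] at h
  convert h using 1
  funext q
  split_ifs with hq
  · rfl
  · exact h' q hq

theorem mapsOn_nil (b b' : Q → Fin 2) : MapsOn [] b b' := by
  simp [MapsOn, Circuit.qubits_nil, maps_nil]

/-- The action of a circuit does not depend on the qubits that it does not touch. -/
theorem MapsOn.congr {C : Circuit Q} {b b' β β' : Q → Fin 2} (h : MapsOn C b b')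
    (hb : ∀ q ∈ C.qubits, β q = b q) (hb' : ∀ q ∈ C.qubits, β' q = b' q) : MapsOn C β β' := by
  have h2 : ∀ x y : Fin 2, x + (x + y) = y := by decide
  have hc : ∀ q ∈ C.qubits, (b + β) q = 0 := fun q hq => by
    rw [Pi.add_apply, hb q hq, fin2_add_self]
  -- `b + β` is the set of positions where the strings differ; none of them belongs to `C`.
  have h1 : ket β = shift (b + β) (ket b) := by
    rw [shift_ket]
    congr 1
    funext q
    simp [h2]
  rw [MapsOn, Maps, h1, Circuit.run_shift hc, h, shift_ket]
  congr 1
  funext q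
  by_cases hq : q ∈ C.qubits
  · simp only [Pi.add_apply, hq, if_true, hb q hq, hb' q hq, fin2_add_self, add_zero]
  · simp only [Pi.add_apply, hq, if_false, h2]

/-- Since `MapsOn` speaks only about the circuit's own qubits, one global target string `b'` can be
checked separately for each of the disjoint circuits. The parallel rounds of SPF, FLAG, CopySwap and
Setup are verified in this way. -/
theorem MapsOn.flatten {Cs : List (Circuit Q)} (hd : Cs.Pairwise Disj) {b b' : Q → Fin 2}
    (h : ∀ C ∈ Cs, MapsOn C b b') : MapsOn (Cs.flatten : Circuit Q) b b' := by
  induction Cs generalizing b with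
  | nil => exact mapsOn_nil b b'
  | cons C Cs ih =>
    rw [List.pairwise_cons] at hd
    have hC := h C (by simp)
    -- The tail starts from a string that `C` has already changed; by disjointness the tail does not
    -- see the change.
    have h1 := ih (b := fun q => if q ∈ C.qubits then b' q else b q) hd.2 fun D hD =>
      (h D (by simp [hD])).congr (fun q hq => by
        simp [show q ∉ C.qubits from fun hq' => hd.1 D hD q hq' hq]) fun q _ => rfl
    rw [MapsOn, List.flatten_cons]
    refine Maps.append hC ?_
    rw [MapsOn] at h1
    convert h1 using 1
    funext q
    rw [Circuit.qubits_append]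
    by_cases h2 : q ∈ C.qubits <;> by_cases h3 : q ∈ Circuit.qubits Cs.flatten <;> simp [h2, h3]

theorem MapsOn.par {Cs : List (Circuit Q)} (hd : Cs.Pairwise Disj) {b b' : Q → Fin 2}
    (h : ∀ C ∈ Cs, MapsOn C b b') : MapsOn (par Cs) b b' := by
  have h1 := MapsOn.flatten hd h
  rw [MapsOn, Maps, run_par hd]
  rw [MapsOn, Maps] at h1
  rw [h1]
  congr 1
  funext q
  simp only [mem_qubits_par, mem_qubits_flatten]

theorem MapsOn.parEnd {Cs : List (Circuit Q)} (hd : Cs.Pairwise Disj) {b b' : Q → Fin 2}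
    (h : ∀ C ∈ Cs, MapsOn C b b') : MapsOn (parEnd Cs) b b' := by
  have h1 := MapsOn.flatten hd h
  rw [MapsOn, Maps, run_parEnd hd]
  rw [MapsOn, Maps] at h1
  rw [h1]
  congr 1
  funext q
  simp only [mem_qubits_parEnd, mem_qubits_flatten]

/-- Gates on disjoint sets of qubits in one layer. -/
theorem MapsOn.layer {ι : Type*} {l : List ι} {f : ι → Gate Q}
    (hd : (l.map fun i => ([[f i]] : Circuit Q)).Pairwise Disj) {b b' : Q → Fin 2}
    (h : ∀ i ∈ l, MapsOn [[f i]] b b') : MapsOn [l.map f] b b' := by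
  have h1 := MapsOn.flatten hd (b := b) (b' := b') fun C hC => by
    obtain ⟨i, hi, rfl⟩ := List.mem_map.1 hC
    exact h i hi
  rw [MapsOn, Maps, Circuit.run_layer_map]
  rw [MapsOn, Maps] at h1
  rw [h1]
  congr 1
  funext q
  have h2 : ∀ l : List ι, List.flatten [l.map f] =
      (List.flatten (List.flatten (l.map fun i => [[f i]]))) := by
    intro l
    induction l with
    | nil => rfl
    | cons i l ih => simpa using ih
  rw [← Circuit.qubits_flatten, ← Circuit.qubits_flatten, h2]

/-! ### Gates on basis states -/

theorem update_eq_iff_left (b b' : Q → Fin 2) (q : Q) (v : Fin 2) :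
    Function.update b' q v = b ↔ v = b q ∧ b' = Function.update b q (b' q) := by
  rw [Function.update_eq_iff]
  constructor
  · rintro ⟨h1, h2⟩
    refine ⟨h1, funext fun p => ?_⟩
    by_cases hp : p = q
    · subst hp
      simp
    · simp [hp, h2 p hp]
  · rintro ⟨h1, h2⟩
    refine ⟨h1, fun p hp => ?_⟩
    rw [h2]
    simp [hp]

theorem apply_u_ket (U : U2) (q : Q) (b : Q → Fin 2) :
    (Gate.u U q).apply (ket b) = ∑ v, U.1 v (b q) • ket (Function.update b q v) := by
  funext b'
  simp only [Gate.apply, Finset.sum_apply, Pi.smul_apply, smul_eq_mul]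
  by_cases h : b' = Function.update b q (b' q)
  · have h1 : ∀ v, ket b (Function.update b' q v) = if v = b q then 1 else 0 := by
      intro v
      have : Function.update b' q v = b ↔ v = b q := by
        rw [update_eq_iff_left]
        exact ⟨fun h => h.1, fun h' => ⟨h', h⟩⟩
      by_cases hv : v = b q
      · rw [if_pos hv, this.2 hv, ket_apply_self]
      · rw [if_neg hv, ket_apply_of_ne (mt this.1 hv)]
    have h2 : ∀ v, ket (Function.update b q v) b' = if v = b' q then 1 else 0 := by
      intro v
      by_cases hv : v = b' q
      · rw [if_pos hv, hv, ← h, ket_apply_self]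
      · rw [if_neg hv, ket_apply_of_ne]
        intro h'
        apply hv
        rw [h']
        simp
    simp [h1, h2]
  · have h1 : ∀ v, ket b (Function.update b' q v) = 0 := fun v =>
      ket_apply_of_ne fun h' => h ((update_eq_iff_left b b' q v).1 h').2
    have h2 : ∀ v, ket (Function.update b q v) b' = 0 := fun v =>
      ket_apply_of_ne fun h' => h (by rw [h']; simp)
    simp [h1, h2]

theorem apply_cnot_ket {c t : Q} (h : c ≠ t) (b : Q → Fin 2) :
    (Gate.cnot c t).apply (ket b) = ket (Function.update b t (b t + b c)) := by
  have h2 : ∀ x y : Fin 2, x + y + y = x := by decide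
  funext b'
  refine ket_congr ?_
  constructor
  · rintro rfl
    simp [h, h2]
  · rintro rfl
    simp [h, h2]

theorem maps_cnot {c t : Q} (h : c ≠ t) (b : Q → Fin 2) :
    Maps [[.cnot c t]] b (Function.update b t (b t + b c)) := apply_cnot_ket h b

theorem apply_gDiag_ket (α β : ℝ) (q : Q) (b : Q → Fin 2) :
    (Gate.u (gDiag α β) q).apply (ket b) =
      (if b q = 0 then Complex.exp (α * Complex.I) else Complex.exp (β * Complex.I)) • ket b := by
  rw [apply_u_ket, Fin.sum_univ_two]
  have h : ∀ x : Fin 2, x = 0 ∨ x = 1 := by decide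
  rcases h (b q) with hq | hq
  · have : Function.update b q 0 = b := by rw [← hq]; simp
    simp [hq, gDiag, this]
  · have : Function.update b q 1 = b := by rw [← hq]; simp
    simp [hq, gDiag, this]

theorem apply_gX_ket (q : Q) (b : Q → Fin 2) :
    (Gate.u gX q).apply (ket b) = ket (Function.update b q (b q + 1)) := by
  rw [apply_u_ket, Fin.sum_univ_two]
  have h : ∀ x : Fin 2, x = 0 ∨ x = 1 := by decide
  rcases h (b q) with hq | hq <;> simp [hq, gX]

theorem apply_smul_ket (g : Gate Q) (a : ℂ) (b : Q → Fin 2) :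
    g.apply (a • ket b) = a • g.apply (ket b) := g.isLinearMap.map_smul a _

/-- The part of the Toffoli gate between the two Hadamard gates. -/
def toffoliCore (a b t : Q) : Layer Q :=
  [.cnot b t, .u gTdg t, .cnot a t, .u gT t, .cnot b t, .u gTdg t, .u gT b, .cnot a t,
    .cnot a b, .u gT t, .u gT a, .u gTdg b]

/-- The eighth root of unity that defines the gate `T`. -/
def omega : ℂ := Complex.exp (Real.pi / 4 * Complex.I)

theorem omega_ne_zero : omega ≠ 0 := Complex.exp_ne_zero _

theorem omega_pow_four : omega ^ 4 = -1 := by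
  rw [omega, ← Complex.exp_nat_mul, ← Complex.exp_pi_mul_I]
  congr 1
  push_cast
  ring

theorem apply_gT_ket (q : Q) (b : Q → Fin 2) :
    (Gate.u gT q).apply (ket b) = (if b q = 0 then 1 else omega) • ket b := by
  rw [gT, gPhase, apply_gDiag_ket, omega]
  simp

theorem apply_gTdg_ket (q : Q) (b : Q → Fin 2) :
    (Gate.u gTdg q).apply (ket b) = (if b q = 0 then 1 else omega⁻¹) • ket b := by
  rw [gTdg, gPhase, apply_gDiag_ket, omega, ← Complex.exp_neg]
  simp

theorem fin2_cases (x : Fin 2) : x = 0 ∨ x = 1 := by revert x; decide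

/-- The gates `T` and `T⁻¹` are applied to the parities of `a, b, t`, and for bits `a + b + t -
(a⊕b) - (a⊕t) - (b⊕t) + (a⊕b⊕t) = 4abt`. As `omega ^ 4 = -1`, the total phase is `(-1)^(abt)`. The
target is restored, but `b` still holds `a⊕b`. -/
theorem toffoliCore_ket {a b t : Q} (hab : a ≠ b) (hat : a ≠ t) (hbt : b ≠ t) (β : Q → Fin 2) :
    Layer.apply (toffoliCore a b t) (ket β) =
      (if β a = 1 ∧ β b = 1 ∧ β t = 1 then (-1 : ℂ) else 1) •
        ket (Function.update β b (β b + β a)) := by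
  have h1 := omega_ne_zero
  have h4 := omega_pow_four
  simp only [toffoliCore, Layer.apply_cons, Layer.apply_nil, apply_cnot_ket hbt,
    apply_cnot_ket hat, apply_cnot_ket hab, apply_gT_ket, apply_gTdg_ket, apply_smul_ket, smul_smul,
    Function.update_self, Function.update_of_ne hbt, Function.update_of_ne hat,
    Function.update_of_ne hab, Function.update_of_ne hbt.symm, Function.update_idem]
  have h2 : β t + β b + β a + β b + β a = β t := by
    generalize β t = x, β b = y, β a = z
    revert x y z
    decide
  rw [h2, Function.update_eq_self]
  congr 1
  rcases fin2_cases (β a) with ha | ha <;> rcases fin2_cases (β b) with hb | hb <;>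
    rcases fin2_cases (β t) with ht | ht <;> simp [ha, hb, ht, fin2_add_self, h1]
  linear_combination h4

theorem gH_eq (i j : Fin 2) : gH.1 i j = (1 / √2 : ℝ) * (if i = 1 ∧ j = 1 then -1 else 1) := by
  fin_cases i <;> fin_cases j <;> simp [gH]

/-- The Toffoli gate on basis states. -/
theorem maps_toffoli {a b t : Q} (hab : a ≠ b) (hat : a ≠ t) (hbt : b ≠ t) (β : Q → Fin 2) :
    Maps (toffoli a b t) β (Function.update β t (β t + β a * β b)) := by
  have h0 : (toffoli a b t : Circuit Q).flatten =
      Gate.u gH t :: (toffoliCore a b t ++ [.u gH t, .cnot a b]) := rfl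
  have h2 : (((1 / √2 : ℝ) : ℂ)) * ((1 / √2 : ℝ) : ℂ) = 1 / 2 := by
    rw [← Complex.ofReal_mul, div_mul_div_comm, Real.mul_self_sqrt (by norm_num)]
    norm_num
  have h3 : ∀ v w : Fin 2, Function.update (Function.update (Function.update β t v) b (β b + β a))
      t w = Function.update (Function.update β t w) b (β b + β a) := by
    intro v w
    rw [Function.update_comm hbt, Function.update_idem]
  have h5 : β b + β a + β a = β b := by rw [add_assoc, fin2_add_self, add_zero]
  have h6 : ∀ w, Function.update (Function.update β t w) b (β b) = Function.update β t w := by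
    intro w
    conv_lhs => rw [← Function.update_of_ne hbt w β, Function.update_eq_self]
  -- Between two Hadamard gates the sign `(-1)^(abt)` becomes a flip of `t` controlled by `ab`; the
  -- last CNOT removes `a` from `b`.
  rw [Maps, Circuit.run_eq_flatten, h0, Layer.apply_cons, Layer.apply_append, apply_u_ket]
  simp only [Fin.sum_univ_two, (Layer.isLinearMap _).map_add, (Layer.isLinearMap _).map_smul,
    toffoliCore_ket hab hat hbt, Layer.apply_cons, Layer.apply_nil, apply_u_ket, Function.update_self, Function.update_of_ne hbt,
    Function.update_of_ne hat, Function.update_of_ne hab, Function.update_of_ne hbt.symm, apply_cnot_ket hab, h3,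
    Function.update_idem, h5, h6, gH_eq]
  rcases fin2_cases (β a) with ha | ha <;> rcases fin2_cases (β b) with hb | hb <;>
    rcases fin2_cases (β t) with ht | ht <;> simp [ha, hb, ht]
  all_goals
    push_cast at h2
    rw [one_div] at h2
    simp only [smul_smul, h2]
    module

end

section

variable {Q : Type}

theorem pairwise_map_disj {ι : Type*} {l : List ι} (hl : l.Nodup) {f : ι → Circuit Q}
    (h : ∀ i ∈ l, ∀ j ∈ l, i ≠ j → Disj (f i) (f j)) : (l.map f).Pairwise Disj := by
  rw [List.pairwise_map]
  exact List.Pairwise.imp_of_mem (fun hi hj hij => h _ hi _ hj hij) hl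

theorem mem_qubits_layer {ι : Type*} {l : List ι} {f : ι → Gate Q} {q : Q} :
    q ∈ Circuit.qubits [l.map f] ↔ ∃ i ∈ l, q ∈ (f i).qubits := by
  simp [Circuit.qubits, Layer.qubits]

theorem mem_qubits_gate {g : Gate Q} {q : Q} : q ∈ Circuit.qubits [[g]] ↔ q ∈ g.qubits := by
  simp [Circuit.qubits, Layer.qubits]

theorem valid_layer {ι : Type*} {l : List ι} {f : ι → Gate Q}
    (h : ∀ i ∈ l, (f i).qubits.Nodup)
    (hd : (l.map fun i => ([[f i]] : Circuit Q)).Pairwise Disj) : Circuit.Valid [l.map f] := by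
  rw [Circuit.valid_cons]
  refine ⟨?_, Circuit.valid_nil⟩
  rw [Layer.qubits, List.flatMap_map, List.nodup_flatMap]
  refine ⟨h, ?_⟩
  rw [List.pairwise_map] at hd
  refine hd.imp fun {i j} hij => ?_
  intro q h1 h2
  exact hij q (mem_qubits_gate.2 h1) (mem_qubits_gate.2 h2)

/-! ### Composite gates: qubits and validity -/

theorem mem_qubits_toffoli {a b t q : Q} :
    q ∈ Circuit.qubits (toffoli a b t) ↔ q = a ∨ q = b ∨ q = t := by
  simp [toffoli, Circuit.qubits, Layer.qubits, Gate.qubits]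
  tauto

theorem valid_toffoli {a b t : Q} (hab : a ≠ b) (hat : a ≠ t) (hbt : b ≠ t) :
    Circuit.Valid (toffoli a b t) := by
  simp [toffoli, Circuit.Valid, Layer.qubits, Gate.qubits, hab, hat, hbt, hbt.symm]

theorem mem_qubits_cswap {a b c q : Q} :
    q ∈ Circuit.qubits (cswap c a b) ↔ q = c ∨ q = a ∨ q = b := by
  rw [cswap, Circuit.qubits_append, Circuit.qubits_append, List.mem_append, List.mem_append,
    mem_qubits_toffoli]
  simp [Circuit.qubits, Layer.qubits, Gate.qubits]
  tauto

theorem valid_cswap {a b c : Q} (hca : c ≠ a) (hcb : c ≠ b) (hab : a ≠ b) :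
    Circuit.Valid (cswap c a b) := by
  rw [cswap, Circuit.valid_append, Circuit.valid_append]
  refine ⟨⟨?_, valid_toffoli hca hcb hab⟩, ?_⟩ <;>
    simp [Circuit.Valid, Layer.qubits, Gate.qubits, hab.symm]

theorem mem_qubits_swap {a b q : Q} : q ∈ Circuit.qubits (swap a b) ↔ q = a ∨ q = b := by
  simp [swap, Circuit.qubits, Layer.qubits, Gate.qubits]
  tauto

theorem valid_swap {a b : Q} (hab : a ≠ b) : Circuit.Valid (swap a b) := by
  simp [swap, Circuit.Valid, Layer.qubits, Gate.qubits, hab, hab.symm]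

theorem mem_qubits_cs {t : ℕ} {R S : ℕ → Q} {q : Q} (h : q ∈ Circuit.qubits (cs t R S)) :
    (∃ i < 2 ^ t, q = R i) ∨ ∃ i < 2 ^ (t + 1), q = S i := by
  rw [cs, mem_qubits_par] at h
  obtain ⟨_, hC, hq⟩ := h
  obtain ⟨i, hi, rfl⟩ := List.mem_map.1 hC
  rw [List.mem_range] at hi
  rcases mem_qubits_cswap.1 hq with rfl | rfl | rfl
  · exact .inl ⟨i, hi, rfl⟩
  · exact .inr ⟨i, by rw [pow_succ]; omega, rfl⟩
  · exact .inr ⟨i + 2 ^ t, by rw [pow_succ]; omega, rfl⟩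

theorem mem_qubits_copyLayer {c t : ℕ} {R : ℕ → Q} {q : Q}
    (h : q ∈ Circuit.qubits (copyLayer R c t)) : ∃ i < c, i < 2 ^ (t + 1) ∧ q = R i := by
  rw [copyLayer, mem_qubits_layer] at h
  obtain ⟨i, hi, hq⟩ := h
  simp only [List.mem_filter, List.mem_range, decide_eq_true_eq] at hi
  simp only [Gate.qubits, List.mem_cons, List.not_mem_nil, or_false] at hq
  rw [pow_succ]
  rcases hq with rfl | rfl
  · exact ⟨i, by omega, by omega, rfl⟩
  · exact ⟨i + 2 ^ t, by omega, by omega, rfl⟩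

theorem mem_qubits_copy {c : ℕ} {R : ℕ → Q} {q : Q}
    (h : q ∈ Circuit.qubits (copy R c)) : ∃ i < c, q = R i := by
  rw [copy, Circuit.mem_qubits] at h
  obtain ⟨L, hL, hq⟩ := h
  obtain ⟨t, -, hL⟩ := List.mem_flatMap.1 hL
  obtain ⟨i, hi, -, rfl⟩ := mem_qubits_copyLayer (Circuit.mem_qubits.2 ⟨L, hL, hq⟩)
  exact ⟨i, hi, rfl⟩

/-- The qubits of `R` and `S` that occur in `cs t R S` are distinct. -/
structure CsReg (t : ℕ) (R S : ℕ → Q) : Prop where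
  injR : ∀ i < 2 ^ t, ∀ j < 2 ^ t, R i = R j → i = j
  injS : ∀ i < 2 ^ (t + 1), ∀ j < 2 ^ (t + 1), S i = S j → i = j
  ne : ∀ i < 2 ^ t, ∀ j < 2 ^ (t + 1), R i ≠ S j

theorem CsReg.pairwise {t : ℕ} {R S : ℕ → Q} (h : CsReg t R S) :
    ((List.range (2 ^ t)).map fun i => cswap (R i) (S i) (S (i + 2 ^ t))).Pairwise Disj := by
  refine pairwise_range_map fun i hi j hj hij => ?_
  have e : 2 ^ (t + 1) = 2 ^ t + 2 ^ t := by rw [pow_succ]; omega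
  intro q hq hq'
  rw [mem_qubits_cswap] at hq hq'
  rcases hq with rfl | rfl | rfl <;> rcases hq' with h' | h' | h'
  · exact hij (h.injR _ hi _ hj h')
  · exact h.ne _ hi _ (by omega) h'
  · exact h.ne _ hi _ (by omega) h'
  · exact h.ne _ hj _ (by omega) h'.symm
  · exact hij (h.injS _ (by omega) _ (by omega) h')
  · have := h.injS _ (by omega) _ (by omega) h'
    omega
  · exact h.ne _ hj _ (by omega) h'.symm
  · have := h.injS _ (by omega) _ (by omega) h'
    omega
  · have := h.injS _ (by omega) _ (by omega) h'
    omega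

theorem CsReg.valid {t : ℕ} {R S : ℕ → Q} (h : CsReg t R S) : Circuit.Valid (cs t R S) := by
  refine valid_par ?_ h.pairwise
  intro C hC
  obtain ⟨i, hi, rfl⟩ := List.mem_map.1 hC
  rw [List.mem_range] at hi
  have e : 2 ^ (t + 1) = 2 ^ t + 2 ^ t := by rw [pow_succ]; omega
  refine valid_cswap (h.ne _ hi _ (by omega)) (h.ne _ hi _ (by omega)) fun h' => ?_
  have := h.injS _ (by omega) _ (by omega) h'
  have := Nat.two_pow_pos t
  omega

theorem copyLayer_pairwise {c t : ℕ} {R : ℕ → Q} (h : ∀ i < c, ∀ j < c, R i = R j → i = j) :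
    ((((List.range (2 ^ t)).filter fun j => j + 2 ^ t < c)).map fun j =>
      ([[.cnot (R j) (R (j + 2 ^ t))]] : Circuit Q)).Pairwise Disj := by
  refine pairwise_map_disj (List.nodup_range.filter _) fun i hi j hj hij => ?_
  simp only [List.mem_filter, List.mem_range, decide_eq_true_eq] at hi hj
  intro q hq hq'
  rw [mem_qubits_gate] at hq hq'
  simp only [Gate.qubits, List.mem_cons, List.not_mem_nil, or_false] at hq hq'
  rcases hq with rfl | rfl <;> rcases hq' with h' | h' <;>
  · have := h _ (by omega) _ (by omega) h'
    omega

theorem valid_copyLayer {c t : ℕ} {R : ℕ → Q} (h : ∀ i < c, ∀ j < c, R i = R j → i = j) :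
    Circuit.Valid (copyLayer R c t) := by
  refine valid_layer ?_ (copyLayer_pairwise h)
  intro i hi
  simp only [List.mem_filter, List.mem_range, decide_eq_true_eq] at hi
  simp only [Gate.qubits, List.nodup_cons, List.mem_cons, List.not_mem_nil, or_false,
    not_false_eq_true, List.nodup_nil, and_true]
  intro h'
  have := h _ (by omega) _ (by omega) h'
  have := Nat.two_pow_pos t
  omega

theorem valid_copy {c : ℕ} {R : ℕ → Q} (h : ∀ i < c, ∀ j < c, R i = R j → i = j) :
    Circuit.Valid (copy R c) :=
  Circuit.valid_flatMap fun _ _ => valid_copyLayer h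

theorem mem_qubits_ccRy {θ : ℝ} {a b t q : Q} :
    q ∈ Circuit.qubits (ccRy θ a b t) ↔ q = a ∨ q = b ∨ q = t := by
  simp only [ccRy, Circuit.qubits_append, List.mem_append, mem_qubits_toffoli]
  simp [Circuit.qubits, Layer.qubits, Gate.qubits]
  tauto

theorem mem_qubits_ccRz {θ : ℝ} {a b t q : Q} :
    q ∈ Circuit.qubits (ccRz θ a b t) ↔ q = a ∨ q = b ∨ q = t := by
  simp only [ccRz, Circuit.qubits_append, List.mem_append, mem_qubits_toffoli]
  simp [Circuit.qubits, Layer.qubits, Gate.qubits]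
  tauto

theorem mem_qubits_ccPhase {α : ℝ} {a b q : Q} :
    q ∈ Circuit.qubits (ccPhase α a b) ↔ q = a ∨ q = b := by
  simp [ccPhase, Circuit.qubits, Layer.qubits, Gate.qubits]
  tauto

theorem mem_qubits_cRy {θ : ℝ} {c t q : Q} :
    q ∈ Circuit.qubits (cRy θ c t) ↔ q = c ∨ q = t := by
  simp [cRy, Circuit.qubits, Layer.qubits, Gate.qubits]
  tauto

theorem valid_cRy {θ : ℝ} {c t : Q} (h : c ≠ t) : Circuit.Valid (cRy θ c t) := by
  simp [cRy, Circuit.Valid, Layer.qubits, Gate.qubits, h]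

theorem valid_ccRy {θ : ℝ} {a b t : Q} (hab : a ≠ b) (hat : a ≠ t) (hbt : b ≠ t) :
    Circuit.Valid (ccRy θ a b t) := by
  have h := valid_toffoli hab hat hbt
  simp only [ccRy, Circuit.valid_append, h, true_and, and_true]
  simp [Circuit.Valid, Layer.qubits, Gate.qubits]

theorem valid_ccRz {θ : ℝ} {a b t : Q} (hab : a ≠ b) (hat : a ≠ t) (hbt : b ≠ t) :
    Circuit.Valid (ccRz θ a b t) := by
  have h := valid_toffoli hab hat hbt
  simp only [ccRz, Circuit.valid_append, h, true_and, and_true]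
  simp [Circuit.Valid, Layer.qubits, Gate.qubits]

theorem valid_ccPhase {α : ℝ} {a b : Q} (h : a ≠ b) : Circuit.Valid (ccPhase α a b) := by
  simp [ccPhase, Circuit.Valid, Layer.qubits, Gate.qubits, h]

/-! ### Composite gates on basis states -/

variable [DecidableEq Q]

theorem Maps.of_eq {C : Circuit Q} {b b' b'' : Q → Fin 2} (h : Maps C b b'') (e : b'' = b') :
    Maps C b b' := e ▸ h

theorem maps_gX (q : Q) (b : Q → Fin 2) :
    Maps [[.u gX q]] b (Function.update b q (b q + 1)) := apply_gX_ket q b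

theorem maps_swap {a b : Q} (hab : a ≠ b) (β : Q → Fin 2) :
    Maps (swap a b) β (Function.update (Function.update β a (β b)) b (β a)) := by
  have h := ((maps_cnot hab β).append (maps_cnot hab.symm _)).append (maps_cnot hab _)
  refine Maps.of_eq h (funext fun q => ?_)
  have h1 : ∀ x y : Fin 2, x + (y + x) = y := by decide
  have h2 : ∀ x y : Fin 2, y + x + (x + (y + x)) = x := by decide
  by_cases hb : q = b
  · subst hb
    simp [hab, hab.symm, h2]
  · by_cases ha : q = a
    · subst ha
      simp [hab, hab.symm, h1]
    · simp [ha, hb]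

/-- The first CNOT replaces `a` by `a + b`, the Toffoli gate adds `c (a + b)` to `b`, and the second
CNOT turns the first target into `a + c (a + b)`. -/
theorem maps_cswap {a b c : Q} (hca : c ≠ a) (hcb : c ≠ b) (hab : a ≠ b) (β : Q → Fin 2) :
    Maps (cswap c a b) β fun q => if q = a then (if β c = 1 then β b else β a)
      else if q = b then (if β c = 1 then β a else β b) else β q := by
  have h := ((maps_cnot hab.symm β).append (maps_toffoli hca hcb hab _)).append
    (maps_cnot hab.symm _)
  refine Maps.of_eq h (funext fun q => ?_)
  have h1 : ∀ x y z : Fin 2, (if z = 1 then y else x) = x + y + (y + z * (x + y)) := by decide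
  have h2 : ∀ x y z : Fin 2, (if z = 1 then x else y) = y + z * (x + y) := by decide
  by_cases ha : q = a
  · subst ha
    simp only [if_true, h1]
    simp [hca, hab, hab.symm]
  · by_cases hb : q = b
    · subst hb
      simp only [if_true, h2]
      simp [hca, hab, hab.symm]
    · simp [ha, hb]

theorem mapsOn_swap {a b : Q} (hab : a ≠ b) {β β' : Q → Fin 2} (ha : β' a = β b)
    (hb : β' b = β a) : MapsOn (swap a b) β β' := by
  refine (maps_swap hab β).mapsOn ?_ ?_
  · intro q hq
    rcases mem_qubits_swap.1 hq with rfl | rfl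
    · simp [hab, ha]
    · simp [hb]
  · intro q hq
    rw [mem_qubits_swap, not_or] at hq
    simp [hq.1, hq.2]

/-- The action of `cs t R S` on basis states. -/
theorem mapsOn_cs {t : ℕ} {R S : ℕ → Q} (h : CsReg t R S) {β β' : Q → Fin 2}
    (hR : ∀ i < 2 ^ t, β' (R i) = β (R i))
    (h0 : ∀ i < 2 ^ t, β' (S i) = if β (R i) = 1 then β (S (i + 2 ^ t)) else β (S i))
    (h1 : ∀ i < 2 ^ t, β' (S (i + 2 ^ t)) = if β (R i) = 1 then β (S i) else β (S (i + 2 ^ t))) :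
    MapsOn (cs t R S) β β' := by
  refine MapsOn.par h.pairwise fun C hC => ?_
  obtain ⟨i, hi, rfl⟩ := List.mem_map.1 hC
  rw [List.mem_range] at hi
  have e : 2 ^ (t + 1) = 2 ^ t + 2 ^ t := by rw [pow_succ]; omega
  have hca := h.ne _ hi i (by omega)
  have hcb := h.ne _ hi (i + 2 ^ t) (by omega)
  have hab : S i ≠ S (i + 2 ^ t) := fun h' => by
    have := h.injS _ (by omega) _ (by omega) h'
    have := Nat.two_pow_pos t
    omega
  refine (maps_cswap hca hcb hab β).mapsOn ?_ ?_
  · intro q hq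
    rcases mem_qubits_cswap.1 hq with rfl | rfl | rfl
    · simp [hca, hcb, hR i hi]
    · simp [h0 i hi]
    · simp [hab.symm, h1 i hi]
  · intro q hq
    rw [mem_qubits_cswap, not_or, not_or] at hq
    simp [hq.2.1, hq.2.2]

theorem mapsOn_copyLayer {c t : ℕ} {R : ℕ → Q} (h : ∀ i < c, ∀ j < c, R i = R j → i = j)
    {β β' : Q → Fin 2} (h0 : ∀ i < 2 ^ t, i + 2 ^ t < c → β' (R i) = β (R i))
    (h1 : ∀ i < 2 ^ t, i + 2 ^ t < c → β' (R (i + 2 ^ t)) = β (R (i + 2 ^ t)) + β (R i)) :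
    MapsOn (copyLayer R c t) β β' := by
  refine MapsOn.layer (copyLayer_pairwise h) fun i hi => ?_
  simp only [List.mem_filter, List.mem_range, decide_eq_true_eq] at hi
  have hab : R i ≠ R (i + 2 ^ t) := fun h' => by
    have := h _ (by omega) _ (by omega) h'
    have := Nat.two_pow_pos t
    omega
  refine (maps_cnot hab β).mapsOn ?_ ?_
  · intro q hq
    rw [mem_qubits_gate] at hq
    simp only [Gate.qubits, List.mem_cons, List.not_mem_nil, or_false] at hq
    rcases hq with rfl | rfl
    · simp [hab, h0 i hi.1 hi.2]
    · simp [h1 i hi.1 hi.2]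
  · intro q hq
    rw [mem_qubits_gate] at hq
    simp only [Gate.qubits, List.mem_cons, List.not_mem_nil, or_false, not_or] at hq
    simp [hq.2]

/-- The action of `COPY` on a register whose qubits, except for the first one, are `0`. -/
theorem mapsOn_copy {c : ℕ} {R : ℕ → Q} (h : ∀ i < c, ∀ j < c, R i = R j → i = j)
    {β β' : Q → Fin 2} (h0 : ∀ i < c, β (R i) = if i = 0 then β (R 0) else 0)
    (h1 : ∀ i < c, β' (R i) = β (R 0)) : MapsOn (copy R c) β β' := by
  classical
  -- The number of positions that hold the bit doubles with every layer, up to the cut-off at `c`.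
  have key : ∀ T, Maps ((List.range T).flatMap fun t => copyLayer R c t) β
      fun q => if ∃ i < c, i < 2 ^ T ∧ q = R i then β (R 0) else β q := by
    intro T
    induction T with
    | zero =>
      refine Maps.of_eq (maps_nil β) (funext fun q => ?_)
      split_ifs with hq
      · obtain ⟨i, hi, hi', rfl⟩ := hq
        obtain rfl : i = 0 := by simpa using hi'
        rfl
      · rfl
    | succ T ih =>
      rw [List.range_succ, List.flatMap_append, List.flatMap_singleton]
      refine ih.append ((mapsOn_copyLayer h ?_ ?_).maps ?_)
      · intro i hi hi'
        rw [if_pos ⟨i, by omega, by rw [pow_succ]; omega, rfl⟩, if_pos ⟨i, by omega, hi, rfl⟩]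
      · intro i hi hi'
        have e : ¬ ∃ j < c, j < 2 ^ T ∧ R (i + 2 ^ T) = R j := by
          rintro ⟨j, hj, hj', h'⟩
          have := h _ hi' _ hj h'
          omega
        rw [if_pos ⟨i + 2 ^ T, by omega, by rw [pow_succ]; omega, rfl⟩, if_neg e,
          if_pos ⟨i, by omega, hi, rfl⟩, h0 _ hi', if_neg (by omega), zero_add]
      · intro q hq
        by_cases h1 : ∃ i < c, i < 2 ^ T ∧ q = R i
        · obtain ⟨i, hi, hi', rfl⟩ := h1
          rw [if_pos ⟨i, by omega, by rw [pow_succ]; omega, rfl⟩, if_pos ⟨i, by omega, hi', rfl⟩]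
        · rw [if_neg h1]
          split_ifs with h2
          · obtain ⟨i, hi, hi', rfl⟩ := h2
            have h3 : 2 ^ T ≤ i := by
              by_contra h3
              exact h1 ⟨i, hi, by omega, rfl⟩
            exfalso
            apply hq
            rw [copyLayer, mem_qubits_layer]
            refine ⟨i - 2 ^ T, ?_, ?_⟩
            · simp only [List.mem_filter, List.mem_range, decide_eq_true_eq]
              rw [pow_succ] at hi'
              omega
            · rw [Nat.sub_add_cancel h3]
              simp [Gate.qubits]
          · rfl
  have hc : c ≤ 2 ^ Nat.clog 2 c := Nat.le_pow_clog (by norm_num) c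
  refine (key (Nat.clog 2 c)).mapsOn ?_ ?_
  · intro q hq
    obtain ⟨i, hi, rfl⟩ := mem_qubits_copy hq
    rw [if_pos ⟨i, hi, by omega, rfl⟩, h1 i hi]
  · intro q hq
    split_ifs with h2
    · obtain ⟨i, hi, hi', rfl⟩ := h2
      by_cases hi0 : i = 0
      · rw [hi0]
      · exfalso
        apply hq
        -- Position `i ≠ 0` is written in the layer `⌊log₂ i⌋`, so it does belong to the qubits of
        -- the circuit.
        obtain ⟨t, ht1, ht2⟩ : ∃ t, 2 ^ t ≤ i ∧ i < 2 ^ (t + 1) :=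
          ⟨Nat.log 2 i, Nat.pow_log_le_self 2 hi0, Nat.lt_pow_succ_log_self (by norm_num) i⟩
        have ht : t < Nat.clog 2 c := by
          rw [Nat.lt_clog_iff_pow_lt (by norm_num)]
          omega
        have h3 : R i ∈ Circuit.qubits (copyLayer R c t) := by
          rw [copyLayer, mem_qubits_layer]
          refine ⟨i - 2 ^ t, ?_, ?_⟩
          · simp only [List.mem_filter, List.mem_range, decide_eq_true_eq]
            rw [pow_succ] at ht2
            omega
          · rw [Nat.sub_add_cancel ht1]
            simp [Gate.qubits]
        obtain ⟨L, hL, hq⟩ := Circuit.mem_qubits.1 h3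
        exact Circuit.mem_qubits.2 ⟨L, List.mem_flatMap.2 ⟨t, List.mem_range.2 ht, hL⟩, hq⟩
    · rfl

end

/-! ### Registers indexed by the tree, and the circuit SPF. -/

section

variable {Q : Type}

/-! ### Parallel composition of lists -/

theorem par₂_assoc (C D E : Circuit Q) : par₂ (par₂ C D) E = par₂ C (par₂ D E) := by
  induction C generalizing D E with
  | nil => rfl
  | cons L C ih =>
    cases D with
    | nil => rfl
    | cons K D =>
      cases E with
      | nil => rfl
      | cons M E => simp only [par₂, ih, List.append_assoc]

theorem par_nil : par ([] : List (Circuit Q)) = [] := rfl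

theorem par_cons (C : Circuit Q) (Cs : List (Circuit Q)) : par (C :: Cs) = par₂ C (par Cs) := rfl

theorem par_append (Cs Ds : List (Circuit Q)) : par (Cs ++ Ds) = par₂ (par Cs) (par Ds) := by
  induction Cs with
  | nil => rfl
  | cons C Cs ih => rw [List.cons_append, par_cons, ih, par_cons, par₂_assoc]

theorem par_flatMap {ι : Type*} (l : List ι) (f : ι → List (Circuit Q)) :
    par (l.flatMap f) = par (l.map fun i => par (f i)) := by
  induction l with
  | nil => rfl
  | cons i l ih => rw [List.flatMap_cons, par_append, ih, List.map_cons, par_cons]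

theorem par_singleton (C : Circuit Q) : par [C] = C := par₂_nil C

/-- A family in which at most one member is switched on collapses to that member. This reduces the
schedule of SPF at a fixed time to a single operation per data qubit. -/
theorem par_onlyIf {K k₀ : ℕ} {p : ℕ → Bool} {C : ℕ → Circuit Q} (h : ∀ k, p k = true → k = k₀) :
    par ((List.range K).map fun k => onlyIf (p k) (C k)) =
      if k₀ < K ∧ p k₀ = true then C k₀ else [] := by
  induction K with
  | zero => simp [par_nil]
  | succ K ih =>
    rw [List.range_succ, List.map_append, par_append, ih, List.map_singleton, par_singleton]
    by_cases hK : p K = true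
    · obtain rfl := h K hK
      simp [hK, onlyIf, par₂]
    · have : k₀ < K + 1 ∧ p k₀ = true ↔ k₀ < K ∧ p k₀ = true := by
        constructor
        · rintro ⟨h1, h2⟩
          refine ⟨?_, h2⟩
          rcases Nat.lt_succ_iff_lt_or_eq.1 h1 with h3 | h3
          · exact h3
          · exact absurd (h3 ▸ h2) hK
        · rintro ⟨h1, h2⟩
          exact ⟨by omega, h2⟩
      simp only [this]
      simp [hK, onlyIf, par₂_nil]

/-! ### Overwriting registers -/

open Classical in
/-- The bit string `b` with the qubits `r i`, for the `i` with `P i`, overwritten by `v`. -/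
def overlay {ι : Type*} (P : ι → Prop) (r : ι → Q) (v : ι → Fin 2) (b : Q → Fin 2) : Q → Fin 2 :=
  fun q => if h : ∃ i, P i ∧ r i = q then v h.choose else b q

theorem overlay_apply {ι : Type*} {P : ι → Prop} {r : ι → Q}
    (inj : ∀ i j, P i → P j → r i = r j → i = j) (v : ι → Fin 2) (b : Q → Fin 2) {i : ι}
    (hi : P i) : overlay P r v b (r i) = v i := by
  have h : ∃ j, P j ∧ r j = r i := ⟨i, hi, rfl⟩
  rw [overlay, dif_pos h, inj _ _ h.choose_spec.1 hi h.choose_spec.2]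

theorem overlay_of_ne {ι : Type*} {P : ι → Prop} {r : ι → Q} (v : ι → Fin 2) (b : Q → Fin 2) {q : Q}
    (h : ∀ i, P i → r i ≠ q) : overlay P r v b q = b q := by
  rw [overlay, dif_neg]
  rintro ⟨i, hi, hi'⟩
  exact h i hi hi'

/-- The qubits of the registers `D q`, and those of the registers `A u` of size `2 ^ u`, for
`q, u < m`, are distinct. -/
structure TreeReg (m : ℕ) (D A : ℕ → ℕ → Q) : Prop where
  injD : ∀ q < m, ∀ q' < m, ∀ i i', D q i = D q' i' → q = q' ∧ i = i'
  injA : ∀ u < m, ∀ u' < m, ∀ p < 2 ^ u, ∀ p' < 2 ^ u', A u p = A u' p' → u = u' ∧ p = p'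
  ne : ∀ q < m, ∀ u < m, ∀ p < 2 ^ u, ∀ i, D q i ≠ A u p

/-- The bit string `b` with the registers `D` and `A` overwritten by `v` and `w`. -/
def treeBits (m : ℕ) (D A : ℕ → ℕ → Q) (v w : ℕ → ℕ → Fin 2) (b : Q → Fin 2) : Q → Fin 2 :=
  overlay (fun x : ℕ × ℕ => x.1 < m) (fun x => D x.1 x.2) (fun x => v x.1 x.2)
    (overlay (fun x : ℕ × ℕ => x.1 < m ∧ x.2 < 2 ^ x.1) (fun x => A x.1 x.2) (fun x => w x.1 x.2) b)

namespace TreeReg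

variable {m : ℕ} {D A : ℕ → ℕ → Q} (h : TreeReg m D A) {v w : ℕ → ℕ → Fin 2} {b : Q → Fin 2}

include h

theorem bits_D {q : ℕ} (hq : q < m) (i : ℕ) : treeBits m D A v w b (D q i) = v q i :=
  overlay_apply (P := fun x : ℕ × ℕ => x.1 < m) (r := fun x => D x.1 x.2)
    (fun _ _ hx hy hxy => Prod.ext_iff.2 (h.injD _ hx _ hy _ _ hxy)) _ _ (i := (q, i)) hq

theorem bits_A {u p : ℕ} (hu : u < m) (hp : p < 2 ^ u) :
    treeBits m D A v w b (A u p) = w u p := by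
  rw [treeBits, overlay_of_ne]
  · exact overlay_apply (P := fun x : ℕ × ℕ => x.1 < m ∧ x.2 < 2 ^ x.1) (r := fun x => A x.1 x.2)
      (fun x y hx hy hxy => Prod.ext_iff.2 (h.injA _ hx.1 _ hy.1 _ hx.2 _ hy.2 hxy)) _ _
      (i := (u, p)) ⟨hu, hp⟩
  · exact fun x hx => h.ne _ hx _ hu _ hp _

omit h in
theorem bits_of_ne {x : Q} (h1 : ∀ q < m, ∀ i, D q i ≠ x) (h2 : ∀ u < m, ∀ p < 2 ^ u, A u p ≠ x) :
    treeBits m D A v w b x = b x := by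
  rw [treeBits, overlay_of_ne, overlay_of_ne]
  · exact fun x hx => h2 _ hx.1 _ hx.2
  · exact fun x hx => h1 _ hx _

omit h in
/-- Every qubit belongs to one of the registers or to none of them. -/
theorem cases (m : ℕ) (D A : ℕ → ℕ → Q) (x : Q) : (∃ q < m, ∃ i, x = D q i) ∨
    (∃ u < m, ∃ p < 2 ^ u, x = A u p) ∨
    ((∀ q < m, ∀ i, D q i ≠ x) ∧ ∀ u < m, ∀ p < 2 ^ u, A u p ≠ x) := by
  by_cases h1 : ∃ q < m, ∃ i, x = D q i
  · exact .inl h1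
  · by_cases h2 : ∃ u < m, ∃ p < 2 ^ u, x = A u p
    · exact .inr (.inl h2)
    · exact .inr (.inr ⟨fun q hq i hx => h1 ⟨q, hq, i, hx.symm⟩,
        fun u hu p hp hx => h2 ⟨u, hu, p, hp, hx.symm⟩⟩)

theorem bits_eq {b' : Q → Fin 2} (hD : ∀ q < m, ∀ i, b' (D q i) = v q i)
    (hA : ∀ u < m, ∀ p < 2 ^ u, b' (A u p) = w u p)
    (h0 : ∀ x, (∀ q < m, ∀ i, D q i ≠ x) → (∀ u < m, ∀ p < 2 ^ u, A u p ≠ x) → b' x = b x) :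
    treeBits m D A v w b = b' := by
  funext x
  rcases cases m D A x with ⟨q, hq, i, rfl⟩ | ⟨u, hu, p, hp, rfl⟩ | ⟨h1, h2⟩
  · rw [h.bits_D hq, hD q hq]
  · rw [h.bits_A hu hp, hA u hu p hp]
  · rw [bits_of_ne h1 h2, h0 x h1 h2]

theorem csReg {q u t : ℕ} (hq : q < m) (hu : u < m) (ht : t < u) :
    CsReg t (D q) (A u) := by
  have e : 2 ^ (t + 1) ≤ 2 ^ u := Nat.pow_le_pow_right (by norm_num) ht
  exact ⟨fun i _ j _ hij => (h.injD _ hq _ hq _ _ hij).2,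
    fun i hi j hj hij => (h.injA _ hu _ hu _ (by omega) _ (by omega) hij).2,
    fun i _ j hj => h.ne _ hq _ hu _ (by omega) _⟩

end TreeReg

/-! ### The tree of prefixes -/

/-- The number formed by the first `u` bits of `d`. -/
def pre (d : ℕ → Fin 2) : ℕ → ℕ
  | 0 => 0
  | u + 1 => 2 * pre d u + (d u : ℕ)

theorem pre_lt (d : ℕ → Fin 2) (u : ℕ) : pre d u < 2 ^ u := by
  induction u with
  | zero => simp [pre]
  | succ u ih =>
    have := (d u).isLt
    rw [pre, pow_succ]
    omega

theorem pre_add_div (d : ℕ → Fin 2) (u i : ℕ) : pre d (u + i) / 2 ^ i = pre d u := by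
  induction i with
  | zero => simp
  | succ i ih =>
    have := (d (u + i)).isLt
    rw [← ih, ← add_assoc, pre, pow_succ', ← Nat.div_div_eq_div_mul]
    congr 1
    omega

theorem pre_div (d : ℕ → Fin 2) {u i : ℕ} (h : i ≤ u) : pre d u / 2 ^ i = pre d (u - i) := by
  rw [← pre_add_div d (u - i) i, Nat.sub_add_cancel h]

theorem pre_succ_mod (d : ℕ → Fin 2) (u : ℕ) : pre d (u + 1) % 2 = d u := by
  have := (d u).isLt
  rw [pre]
  omega

/-- The permutation of positions that is made by `2 ^ k` swaps with control `c`. -/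
def csPerm (k : ℕ) (c : Fin 2) (i : ℕ) : ℕ :=
  if c = 1 then (if i < 2 ^ k then i + 2 ^ k else if i < 2 ^ (k + 1) then i - 2 ^ k else i) else i

theorem csPerm_csPerm (k : ℕ) (c : Fin 2) (i : ℕ) : csPerm k c (csPerm k c i) = i := by
  unfold csPerm
  have : 2 ^ (k + 1) = 2 * 2 ^ k := by rw [pow_succ]; omega
  split_ifs <;> omega

theorem csPerm_of_lt {k i : ℕ} (c : Fin 2) (hi : i < 2 ^ k) :
    csPerm k c i = if c = 1 then i + 2 ^ k else i := by
  simp [csPerm, hi]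

theorem csPerm_add {k i : ℕ} (c : Fin 2) (hi : i < 2 ^ k) :
    csPerm k c (i + 2 ^ k) = if c = 1 then i else i + 2 ^ k := by
  have h1 : ¬ i + 2 ^ k < 2 ^ k := by omega
  have h2 : i + 2 ^ k < 2 ^ (k + 1) := by rw [pow_succ]; omega
  simp [csPerm, h1, h2]

/-- The position in the register of size `2 ^ u` from which the qubit at position `i` came, after
`j` rounds of swaps with controls `d 0, …, d (j-1)`. -/
def origin (d : ℕ → Fin 2) (u : ℕ) : ℕ → ℕ → ℕ
  | 0, i => i
  | j + 1, i => origin d u j (csPerm (u - 1 - j) (d j) i)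

theorem origin_injective (d : ℕ → Fin 2) (u j : ℕ) : Function.Injective (origin d u j) := by
  induction j with
  | zero => exact fun _ _ h => h
  | succ j ih =>
    intro x y h
    have := ih h
    rw [← csPerm_csPerm (u - 1 - j) (d j) x, this, csPerm_csPerm]

/-- Each round brings the half selected by the next data bit to the front. After `j` rounds the
first `2^(u-j)` positions therefore hold, in order, the entries whose index begins with the first
`j` data bits; after `u` rounds position `0` holds entry `pre d u`. -/
theorem origin_apply (d : ℕ → Fin 2) {u j i : ℕ} (hj : j ≤ u) (hi : i < 2 ^ (u - j)) :
    origin d u j i = pre d j * 2 ^ (u - j) + i := by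
  induction j generalizing i with
  | zero => simp [origin, pre]
  | succ j ih =>
    obtain ⟨k, rfl⟩ : ∃ k, u = j + 1 + k := ⟨u - (j + 1), by omega⟩
    have e1 : j + 1 + k - (j + 1) = k := by omega
    have e2 : j + 1 + k - j = k + 1 := by omega
    have e3 : j + 1 + k - 1 - j = k := by omega
    rw [e1] at hi
    rw [origin, e1, e3, ih (by omega), e2, pre]
    · rcases (show d j = 0 ∨ d j = 1 by generalize d j = x; revert x; decide) with h | h
      · simp [csPerm, h]
        ring
      · simp [csPerm, h, hi]
        ring
    · rw [e2, csPerm]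
      have : 2 ^ (k + 1) = 2 * 2 ^ k := by rw [pow_succ]; omega
      split_ifs <;> omega

theorem origin_zero (d : ℕ → Fin 2) (u : ℕ) : origin d u u 0 = pre d u := by
  rw [origin_apply d le_rfl (by simp)]
  simp

/-! ### The circuit SPF -/

/-- The operation of SPF at time `τ` with the controls in the register `D q`. -/
def spfOp (inject : Bool) (D A : ℕ → ℕ → Q) (m τ q : ℕ) : Circuit Q :=
  if τ = 3 * q + 2 then (if inject = true then swap (D q 0) (A q 0) else [])
  else if τ < 3 * q + 4 then []
  else if (τ - 3 * q) % 2 = 0 then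
    (if (τ - 3 * q - 4) / 2 < m - 1 - q then
      cs ((τ - 3 * q - 4) / 2) (D q) (A (q + 1 + (τ - 3 * q - 4) / 2)) else [])
  else if (τ - 3 * q - 5) / 2 < m - 2 - q then
    copyLayer (D q) (2 ^ (m - 2 - q)) ((τ - 3 * q - 5) / 2) else []

/-- For fixed `q` the swap, the controlled swaps and the copying layers have pairwise different
times: `3q + 2`, and from `3q + 4` on alternating parities. -/
theorem spfStep_eq (inject : Bool) (D A : ℕ → ℕ → Q) (m τ : ℕ) :
    spfStep inject D A m τ = par ((List.range m).map (spfOp inject D A m τ)) := by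
  rw [spfStep, par_flatMap]
  congr 1
  refine List.map_congr_left fun q _ => ?_
  rw [par_append, par_append, par_singleton,
    par_onlyIf (k₀ := (τ - 3 * q - 4) / 2) (p := fun k => τ == 3 * q + 4 + 2 * k)
      (C := fun k => cs k (D q) (A (q + 1 + k))) (fun k hk => by simp at hk; omega),
    par_onlyIf (k₀ := (τ - 3 * q - 5) / 2) (p := fun k => τ == 3 * q + 5 + 2 * k)
      (C := fun k => copyLayer (D q) (2 ^ (m - 2 - q)) k) (fun k hk => by simp at hk; omega), spfOp]
  simp only [beq_iff_eq]
  by_cases h1 : τ = 3 * q + 2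
  · rw [if_pos h1, if_neg (by omega), if_neg (by omega), par₂_nil, par₂_nil]
    simp [onlyIf, h1]
  · rw [if_neg h1, onlyIf, if_neg (by simp [h1])]
    by_cases h2 : τ < 3 * q + 4
    · rw [if_pos h2, if_neg (by omega), if_neg (by omega), par₂_nil, par₂_nil]
    · rw [if_neg h2]
      by_cases h3 : (τ - 3 * q) % 2 = 0
      · have : τ = 3 * q + 4 + 2 * ((τ - 3 * q - 4) / 2) := by omega
        rw [if_pos h3, if_neg (c := _ ∧ τ = 3 * q + 5 + _) (by omega), par₂_nil, par₂]
        simp only [← this, and_true]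
      · have : τ = 3 * q + 5 + 2 * ((τ - 3 * q - 5) / 2) := by omega
        rw [if_neg h3, if_neg (c := _ ∧ τ = 3 * q + 4 + _) (by omega), par₂, par₂]
        simp only [← this, and_true]

/-- The equation `τ = q + 2 + 2u` is the point: at a given time the register `A u` is used by only
one data qubit `q`. Together with the separate copies `D q` it makes the simultaneous operations
disjoint. -/
theorem mem_qubits_spfOp {inject : Bool} {D A : ℕ → ℕ → Q} {m τ q : ℕ} {x : Q} (hq : q < m)
    (h : x ∈ (spfOp inject D A m τ q).qubits) : (∃ i, x = D q i) ∨
      ∃ u < m, ∃ p < 2 ^ u, x = A u p ∧ τ = q + 2 + 2 * u := by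
  unfold spfOp at h
  split_ifs at h with h1 h2 h3 h4 h5 h6
  · rcases mem_qubits_swap.1 h with rfl | rfl
    · exact .inl ⟨0, rfl⟩
    · exact .inr ⟨q, hq, 0, by simp, rfl, by omega⟩
  · simp [Circuit.qubits_nil] at h
  · simp [Circuit.qubits_nil] at h
  · rcases mem_qubits_cs h with ⟨i, -, rfl⟩ | ⟨i, hi, rfl⟩
    · exact .inl ⟨i, rfl⟩
    · refine .inr ⟨_, by omega, i, lt_of_lt_of_le hi ?_, rfl, by omega⟩
      exact Nat.pow_le_pow_right (by norm_num) (by omega)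
  · simp [Circuit.qubits_nil] at h
  · obtain ⟨i, -, -, rfl⟩ := mem_qubits_copyLayer h
    exact .inl ⟨i, rfl⟩
  · simp [Circuit.qubits_nil] at h

theorem TreeReg.spf_pairwise {m : ℕ} {D A : ℕ → ℕ → Q} (h : TreeReg m D A) (inject : Bool) (τ : ℕ) :
    ((List.range m).map (spfOp inject D A m τ)).Pairwise Disj := by
  refine pairwise_range_map fun q hq q' hq' hne x hx hx' => ?_
  rcases mem_qubits_spfOp hq hx with ⟨i, rfl⟩ | ⟨u, hu, p, hp, rfl, hτ⟩ <;>
    rcases mem_qubits_spfOp hq' hx' with ⟨i', h'⟩ | ⟨u', hu', p', hp', h', hτ'⟩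
  · exact hne (h.injD _ hq _ hq' _ _ h').1
  · exact h.ne _ hq _ hu' _ hp' _ h'
  · exact h.ne _ hq' _ hu _ hp _ h'.symm
  · have := (h.injA _ hu _ hu' _ hp _ hp' h').1
    omega

theorem TreeReg.valid_spfOp {m : ℕ} {D A : ℕ → ℕ → Q} (h : TreeReg m D A) (inject : Bool)
    (τ : ℕ) {q : ℕ} (hq : q < m) : (spfOp inject D A m τ q).Valid := by
  unfold spfOp
  split_ifs with h1 h2 h3 h4 h5 h6
  · exact valid_swap (h.ne _ hq _ hq _ (by simp) _)
  · exact Circuit.valid_nil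
  · exact Circuit.valid_nil
  · exact (h.csReg hq (by omega) (by omega)).valid
  · exact Circuit.valid_nil
  · exact valid_copyLayer fun i _ j _ hij => (h.injD _ hq _ hq _ _ hij).2
  · exact Circuit.valid_nil

theorem TreeReg.valid_spf {m : ℕ} {D A : ℕ → ℕ → Q} (h : TreeReg m D A) : (spf D A m).Valid := by
  have h1 : ∀ inject τ, (spfStep inject D A m τ).Valid := by
    intro inject τ
    rw [spfStep_eq]
    refine valid_par ?_ (h.spf_pairwise _ _)
    intro C hC
    obtain ⟨q, hq, rfl⟩ := List.mem_map.1 hC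
    exact h.valid_spfOp _ _ (List.mem_range.1 hq)
  exact Circuit.valid_append.2
    ⟨Circuit.valid_flatMap fun _ _ => h1 _ _, Circuit.valid_flatMap fun _ _ => h1 _ _⟩

end

section

variable {Q : Type}

theorem control_mem_cs {t : ℕ} {R S : ℕ → Q} {i : ℕ} (hi : i < 2 ^ t) :
    R i ∈ Circuit.qubits (cs t R S) :=
  mem_qubits_par.2 ⟨_, List.mem_map.2 ⟨i, List.mem_range.2 hi, rfl⟩, mem_qubits_cswap.2 (.inl rfl)⟩

theorem target_mem_cs {t : ℕ} {R S : ℕ → Q} {i : ℕ} (hi : i < 2 ^ (t + 1)) :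
    S i ∈ Circuit.qubits (cs t R S) := by
  rw [cs, mem_qubits_par]
  by_cases h : i < 2 ^ t
  · exact ⟨_, List.mem_map.2 ⟨i, List.mem_range.2 h, rfl⟩, mem_qubits_cswap.2 (.inr (.inl rfl))⟩
  · refine ⟨_, List.mem_map.2 ⟨i - 2 ^ t, List.mem_range.2 ?_, rfl⟩,
      mem_qubits_cswap.2 (.inr (.inr ?_))⟩
    · rw [pow_succ] at hi
      omega
    · rw [Nat.sub_add_cancel (by omega)]

theorem mem_copyLayer {c t : ℕ} {R : ℕ → Q} {i : ℕ} (hi : i < c) (h1 : 2 ^ t ≤ i)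
    (h2 : i < 2 ^ (t + 1)) : R i ∈ Circuit.qubits (copyLayer R c t) := by
  rw [copyLayer, mem_qubits_layer]
  refine ⟨i - 2 ^ t, ?_, ?_⟩
  · simp only [List.mem_filter, List.mem_range, decide_eq_true_eq]
    rw [pow_succ] at h2
    omega
  · rw [Nat.sub_add_cancel h1]
    simp [Gate.qubits]

/-! ### The action of SPF on basis states -/

/-- The content of the register `D q` before time step `τ` of SPF. -/
def spfD (inject : Bool) (d : ℕ → Fin 2) (m τ q i : ℕ) : Fin 2 :=
  if (inject = true → 3 * q + 2 < τ) ∧ i < 2 ^ min (m - 2 - q) ((τ - 3 * q - 4) / 2) then d q else 0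

/-- The content of the register `A u` after the swap with the data qubit. -/
def masked (d : ℕ → Fin 2) (a : ℕ → ℕ → Fin 2) (u p : ℕ) : Fin 2 := if p = pre d u then 0 else a u p

/-- The content of the register `A u` before time step `τ` of SPF. -/
def spfA (inject : Bool) (d : ℕ → Fin 2) (a : ℕ → ℕ → Fin 2) (τ u p : ℕ) : Fin 2 :=
  if inject = true ∧ τ ≤ 3 * u + 2 then a u (origin d u (min u (τ - 2 - 2 * u)) p)
  else masked d a u (origin d u (min u (τ - 2 - 2 * u)) p)

/-- The registers before time step `τ` of SPF. -/
structure SpfState (inject : Bool) (d : ℕ → Fin 2) (a : ℕ → ℕ → Fin 2) (m τ : ℕ)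
    (D A : ℕ → ℕ → Q) (b : Q → Fin 2) : Prop where
  eqD : ∀ q < m, ∀ i, b (D q i) = spfD inject d m τ q i
  eqA : ∀ u < m, ∀ p < 2 ^ u, b (A u p) = spfA inject d a τ u p

/-- After all `u` rounds the entry `pre d u` sits at position `0`, and by injectivity of `origin`
nowhere else, so the injection alters no other position. -/
theorem masked_of_ne {d : ℕ → Fin 2} {a : ℕ → ℕ → Fin 2} {u p : ℕ} (h : p ≠ 0) :
    masked d a u (origin d u u p) = a u (origin d u u p) := by
  rw [masked, if_neg]
  rw [← origin_zero]
  exact fun h' => h (origin_injective d u u h')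

/-- Contrapositively, the prescribed contents change only on qubits in use at time `τ`. This and
`mem_spfStep_A` allow `spfStep_maps` to pass from `MapsOn` to `Maps`. -/
theorem mem_spfStep_D {inject : Bool} {D A : ℕ → ℕ → Q} {m τ q i : ℕ} {d : ℕ → Fin 2} (hq : q < m)
    (h : spfD inject d m (τ + 1) q i ≠ spfD inject d m τ q i) :
    D q i ∈ (spfStep inject D A m τ).qubits := by
  rw [spfStep_eq, mem_qubits_par]
  refine ⟨_, List.mem_map.2 ⟨q, List.mem_range.2 hq, rfl⟩, ?_⟩
  by_cases h1 : τ = 3 * q + 2 ∧ inject = true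
  · obtain ⟨rfl, rfl⟩ := h1
    have hi : i = 0 := by
      by_contra hi
      apply h
      rw [spfD, spfD, if_neg, if_neg]
      · rw [show min (m - 2 - q) ((3 * q + 2 - 3 * q - 4) / 2) = 0 by omega]
        omega
      · rw [show min (m - 2 - q) ((3 * q + 2 + 1 - 3 * q - 4) / 2) = 0 by omega]
        omega
    subst hi
    rw [spfOp, if_pos rfl, if_pos rfl]
    exact mem_qubits_swap.2 (.inl rfl)
  by_cases h2 : ∃ k, k < m - 2 - q ∧ τ = 3 * q + 5 + 2 * k
  · obtain ⟨k, hk, rfl⟩ := h2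
    rw [spfD, spfD, show min (m - 2 - q) ((3 * q + 5 + 2 * k + 1 - 3 * q - 4) / 2) = k + 1 by omega,
      show min (m - 2 - q) ((3 * q + 5 + 2 * k - 3 * q - 4) / 2) = k by omega] at h
    have e : 2 ^ (k + 1) = 2 * 2 ^ k := by rw [pow_succ]; omega
    have e' : 2 ^ (k + 1) ≤ 2 ^ (m - 2 - q) := Nat.pow_le_pow_right (by norm_num) (by omega)
    have hi : 2 ^ k ≤ i ∧ i < 2 ^ (k + 1) := by
      by_contra hi
      apply h
      congr 1
      rw [eq_iff_iff]
      constructor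
      · rintro ⟨-, h2⟩
        exact ⟨fun _ => by omega, by omega⟩
      · rintro ⟨-, h2⟩
        exact ⟨fun _ => by omega, by omega⟩
    rw [spfOp, if_neg (by omega), if_neg (by omega), if_neg (by omega), if_pos (by omega),
      show (3 * q + 5 + 2 * k - 3 * q - 5) / 2 = k by omega]
    exact mem_copyLayer (by omega) hi.1 hi.2
  · exfalso
    apply h
    rw [spfD, spfD]
    have e1 : min (m - 2 - q) ((τ + 1 - 3 * q - 4) / 2) = min (m - 2 - q) ((τ - 3 * q - 4) / 2) := by
      by_contra h3
      exact h2 ⟨(τ - 3 * q - 5) / 2, by omega, by omega⟩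
    rw [e1]
    congr 1
    rw [eq_iff_iff]
    constructor
    · rintro ⟨h3, h4⟩
      refine ⟨fun hi => ?_, h4⟩
      have := h3 hi
      have : τ ≠ 3 * q + 2 := fun h' => h1 ⟨h', hi⟩
      omega
    · rintro ⟨h3, h4⟩
      exact ⟨fun hi => by have := h3 hi; omega, h4⟩

theorem mem_spfStep_A {inject : Bool} {D A : ℕ → ℕ → Q} {m τ u p : ℕ} {d : ℕ → Fin 2}
    {a : ℕ → ℕ → Fin 2} (hu : u < m)
    (h : spfA inject d a (τ + 1) u p ≠ spfA inject d a τ u p) :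
    A u p ∈ (spfStep inject D A m τ).qubits := by
  rw [spfStep_eq, mem_qubits_par]
  by_cases h1 : τ = 3 * u + 2 ∧ inject = true
  · obtain ⟨rfl, rfl⟩ := h1
    refine ⟨_, List.mem_map.2 ⟨u, List.mem_range.2 hu, rfl⟩, ?_⟩
    have hp : p = 0 := by
      by_contra hp
      apply h
      rw [spfA, spfA, if_neg (by omega), if_pos ⟨rfl, by omega⟩,
        show min u (3 * u + 2 - 2 - 2 * u) = u by omega,
        show min u (3 * u + 2 + 1 - 2 - 2 * u) = u by omega, masked_of_ne hp]
    subst hp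
    rw [spfOp, if_pos rfl, if_pos rfl]
    exact mem_qubits_swap.2 (.inr rfl)
  by_cases h2 : ∃ q, q < u ∧ τ = q + 2 + 2 * u
  · obtain ⟨q, hq, rfl⟩ := h2
    obtain ⟨k, rfl⟩ : ∃ k, u = q + 1 + k := ⟨u - q - 1, by omega⟩
    refine ⟨_, List.mem_map.2 ⟨q, List.mem_range.2 (by omega), rfl⟩, ?_⟩
    have hp : p < 2 ^ (k + 1) := by
      by_contra hp
      apply h
      have : 2 ^ (k + 1) = 2 * 2 ^ k := by rw [pow_succ]; omega
      have e : csPerm k (d q) p = p := by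
        rw [csPerm]
        split_ifs <;> omega
      rw [spfA, spfA,
        show min (q + 1 + k) (q + 2 + 2 * (q + 1 + k) - 2 - 2 * (q + 1 + k)) = q by omega,
        show min (q + 1 + k) (q + 2 + 2 * (q + 1 + k) + 1 - 2 - 2 * (q + 1 + k)) = q + 1 by omega,
        origin, show q + 1 + k - 1 - q = k by omega, e]
      congr 1
      rw [eq_iff_iff]
      exact ⟨fun h => ⟨h.1, by omega⟩, fun h => ⟨h.1, by omega⟩⟩
    rw [spfOp, if_neg (by omega), if_neg (by omega), if_pos (by omega), if_pos (by omega),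
      show (q + 2 + 2 * (q + 1 + k) - 3 * q - 4) / 2 = k by omega]
    exact target_mem_cs hp
  · exfalso
    apply h
    have e : min u (τ + 1 - 2 - 2 * u) = min u (τ - 2 - 2 * u) := by
      by_contra h3
      exact h2 ⟨τ - 2 - 2 * u, by omega, by omega⟩
    rw [spfA, spfA, e]
    congr 1
    rw [eq_iff_iff]
    constructor
    · rintro ⟨h3, h4⟩
      exact ⟨h3, by omega⟩
    · rintro ⟨h3, h4⟩
      refine ⟨h3, ?_⟩
      have : τ ≠ 3 * u + 2 := fun h' => h1 ⟨h', h3⟩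
      omega

variable [DecidableEq Q]

/-- Both directions are stated because the second half of SPF runs the same involutive operations in
the opposite order. -/
theorem TreeReg.spfOp_cs {m : ℕ} {D A : ℕ → ℕ → Q} (h : TreeReg m D A) {inject : Bool}
    {d : ℕ → Fin 2} {a : ℕ → ℕ → Fin 2} {q k : ℕ} (hq : q < m) (hk : k < m - 1 - q)
    {b b' : Q → Fin 2} (hb : SpfState inject d a m (3 * q + 4 + 2 * k) D A b)
    (hb' : SpfState inject d a m (3 * q + 4 + 2 * k + 1) D A b') :
    MapsOn (cs k (D q) (A (q + 1 + k))) b b' ∧ MapsOn (cs k (D q) (A (q + 1 + k))) b' b := by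
  have hu : q + 1 + k < m := by omega
  have hreg : CsReg k (D q) (A (q + 1 + k)) := h.csReg hq hu (by omega)
  have e : 2 ^ (k + 1) = 2 * 2 ^ k := by rw [pow_succ]; omega
  have e' : 2 ^ (k + 1) ≤ 2 ^ (q + 1 + k) := Nat.pow_le_pow_right (by norm_num) (by omega)
  have hR : ∀ i < 2 ^ k, b (D q i) = d q := by
    intro i hi
    rw [hb.eqD q hq, spfD, if_pos]
    refine ⟨fun _ => by omega, ?_⟩
    rwa [show min (m - 2 - q) ((3 * q + 4 + 2 * k - 3 * q - 4) / 2) = k by omega]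
  have hR' : ∀ i < 2 ^ k, b' (D q i) = d q := by
    intro i hi
    rw [hb'.eqD q hq, spfD, if_pos]
    refine ⟨fun _ => by omega, ?_⟩
    rwa [show min (m - 2 - q) ((3 * q + 4 + 2 * k + 1 - 3 * q - 4) / 2) = k by omega]
  -- A controlled swap on `A u` occurs before `A u` is injected, so the same sequence `α` describes
  -- both moments: the original entries in the first half, the masked ones in the second half.
  obtain ⟨α, hα⟩ : ∃ α : ℕ → Fin 2, ∀ τ j, τ ≤ 3 * (q + 1 + k) + 2 →
      min (q + 1 + k) (τ - 2 - 2 * (q + 1 + k)) = j → ∀ p, spfA inject d a τ (q + 1 + k) p =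
        α (origin d (q + 1 + k) j p) := by
    cases inject with
    | false =>
      refine ⟨masked d a (q + 1 + k), fun τ j hτ hj p => ?_⟩
      rw [spfA, if_neg (by simp), hj]
    | true =>
      refine ⟨a (q + 1 + k), fun τ j hτ hj p => ?_⟩
      rw [spfA, if_pos ⟨rfl, hτ⟩, hj]
  have hS : ∀ p < 2 ^ (k + 1), b (A (q + 1 + k) p) = α (origin d (q + 1 + k) q p) := by
    intro p hp
    rw [hb.eqA _ hu _ (by omega), hα _ q (by omega) (by omega)]
  have hS' : ∀ p < 2 ^ (k + 1), b' (A (q + 1 + k) p) =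
      α (origin d (q + 1 + k) q (csPerm k (d q) p)) := by
    intro p hp
    rw [hb'.eqA _ hu _ (by omega), hα _ (q + 1) (by omega) (by omega), origin,
      show q + 1 + k - 1 - q = k by omega]
  refine ⟨mapsOn_cs hreg (fun i hi => by rw [hR i hi, hR' i hi]) ?_ ?_,
    mapsOn_cs hreg (fun i hi => by rw [hR i hi, hR' i hi]) ?_ ?_⟩
  · intro i hi
    rw [hR i hi, hS' _ (by omega), hS _ (by omega), hS _ (by omega), csPerm_of_lt _ hi]
    split_ifs <;> rfl
  · intro i hi
    rw [hR i hi, hS' _ (by omega), hS _ (by omega), hS _ (by omega), csPerm_add _ hi]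
    split_ifs <;> rfl
  · intro i hi
    rw [hR' i hi, hS' _ (by omega), hS' _ (by omega), hS _ (by omega), csPerm_add _ hi,
      csPerm_of_lt _ hi]
    split_ifs <;> rfl
  · intro i hi
    rw [hR' i hi, hS' _ (by omega), hS' _ (by omega), hS _ (by omega), csPerm_of_lt _ hi,
      csPerm_add _ hi]
    split_ifs <;> rfl

theorem TreeReg.spfOp_copyLayer {m : ℕ} {D A : ℕ → ℕ → Q} (h : TreeReg m D A) {inject : Bool}
    {d : ℕ → Fin 2} {a : ℕ → ℕ → Fin 2} {q k : ℕ} (hq : q < m) (hk : k < m - 2 - q)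
    {b b' : Q → Fin 2} (hb : SpfState inject d a m (3 * q + 5 + 2 * k) D A b)
    (hb' : SpfState inject d a m (3 * q + 5 + 2 * k + 1) D A b') :
    MapsOn (copyLayer (D q) (2 ^ (m - 2 - q)) k) b b' ∧
      MapsOn (copyLayer (D q) (2 ^ (m - 2 - q)) k) b' b := by
  have hR : ∀ i, b (D q i) = if i < 2 ^ k then d q else 0 := by
    intro i
    rw [hb.eqD q hq, spfD,
      show min (m - 2 - q) ((3 * q + 5 + 2 * k - 3 * q - 4) / 2) = k by omega]
    congr 1
    rw [eq_iff_iff]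
    exact ⟨fun h => h.2, fun h => ⟨fun _ => by omega, h⟩⟩
  have hR' : ∀ i, b' (D q i) = if i < 2 ^ (k + 1) then d q else 0 := by
    intro i
    rw [hb'.eqD q hq, spfD,
      show min (m - 2 - q) ((3 * q + 5 + 2 * k + 1 - 3 * q - 4) / 2) = k + 1 by omega]
    congr 1
    rw [eq_iff_iff]
    exact ⟨fun h => h.2, fun h => ⟨fun _ => by omega, h⟩⟩
  have inj : ∀ i < 2 ^ (m - 2 - q), ∀ j < 2 ^ (m - 2 - q), D q i = D q j → i = j :=
    fun i _ j _ hij => (h.injD _ hq _ hq _ _ hij).2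
  have e : 2 ^ (k + 1) = 2 * 2 ^ k := by rw [pow_succ]; omega
  refine ⟨mapsOn_copyLayer inj ?_ ?_, mapsOn_copyLayer inj ?_ ?_⟩ <;> intro i hi _ <;>
    simp only [hR, hR']
  · rw [if_pos (by omega), if_pos hi]
  · rw [if_pos (by omega), if_neg (by omega), if_pos hi, zero_add]
  · rw [if_pos (by omega), if_pos (by omega)]
  · rw [if_neg (by omega), if_pos (by omega), if_pos (by omega), fin2_add_self]

/-- At time `3q + 2` all `q` rounds on `A q` are over, hence `A q 0` holds the entry `pre d q`,
which by `hd` is the data bit `d q`; the data qubit is still `0`. -/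
theorem TreeReg.spfOp_swap {m : ℕ} {D A : ℕ → ℕ → Q} (h : TreeReg m D A)
    {d : ℕ → Fin 2} {a : ℕ → ℕ → Fin 2} (hd : ∀ u < m, d u = a u (pre d u)) {q : ℕ} (hq : q < m)
    {b b' : Q → Fin 2} (hb : SpfState true d a m (3 * q + 2) D A b)
    (hb' : SpfState true d a m (3 * q + 2 + 1) D A b') : MapsOn (swap (D q 0) (A q 0)) b b' := by
  refine mapsOn_swap (h.ne _ hq _ hq _ (by simp) _) ?_ ?_
  · rw [hb'.eqD q hq, hb.eqA q hq 0 (by simp), spfD, if_pos, spfA, if_pos ⟨rfl, le_rfl⟩,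
      show min q (3 * q + 2 - 2 - 2 * q) = q by omega, origin_zero, hd q hq]
    exact ⟨fun _ => by omega, Nat.two_pow_pos _⟩
  · rw [hb.eqD q hq, hb'.eqA q hq 0 (by simp), spfD, if_neg, spfA, if_neg (by omega),
      show min q (3 * q + 2 + 1 - 2 - 2 * q) = q by omega, origin_zero, masked, if_pos rfl]
    rintro ⟨h1, -⟩
    exact absurd (h1 rfl) (by omega)

theorem TreeReg.spfOp_mapsOn {m : ℕ} {D A : ℕ → ℕ → Q} (h : TreeReg m D A) {inject : Bool}
    {d : ℕ → Fin 2} {a : ℕ → ℕ → Fin 2} (hd : ∀ u < m, d u = a u (pre d u)) {q τ : ℕ} (hq : q < m)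
    {b b' : Q → Fin 2} (hb : SpfState inject d a m τ D A b)
    (hb' : SpfState inject d a m (τ + 1) D A b') : MapsOn (spfOp inject D A m τ q) b b' ∧
      (inject = false → MapsOn (spfOp inject D A m τ q) b' b) := by
  unfold spfOp
  split_ifs with h1 h2 h3 h4 h5 h6
  · subst h1 h2
    exact ⟨h.spfOp_swap hd hq hb hb', by simp⟩
  · exact ⟨mapsOn_nil _ _, fun _ => mapsOn_nil _ _⟩
  · exact ⟨mapsOn_nil _ _, fun _ => mapsOn_nil _ _⟩
  · obtain ⟨k, rfl⟩ : ∃ k, τ = 3 * q + 4 + 2 * k := ⟨(τ - 3 * q - 4) / 2, by omega⟩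
    have e : (3 * q + 4 + 2 * k - 3 * q - 4) / 2 = k := by omega
    rw [e] at h5 ⊢
    have := h.spfOp_cs hq h5 hb hb'
    exact ⟨this.1, fun _ => this.2⟩
  · exact ⟨mapsOn_nil _ _, fun _ => mapsOn_nil _ _⟩
  · obtain ⟨k, rfl⟩ : ∃ k, τ = 3 * q + 5 + 2 * k := ⟨(τ - 3 * q - 5) / 2, by omega⟩
    have e : (3 * q + 5 + 2 * k - 3 * q - 5) / 2 = k := by omega
    rw [e] at h6 ⊢
    have := h.spfOp_copyLayer hq h6 hb hb'
    exact ⟨this.1, fun _ => this.2⟩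
  · exact ⟨mapsOn_nil _ _, fun _ => mapsOn_nil _ _⟩

theorem TreeReg.spfStep_maps {m : ℕ} {D A : ℕ → ℕ → Q} (h : TreeReg m D A) (inject : Bool)
    {d : ℕ → Fin 2} {a : ℕ → ℕ → Fin 2} (hd : ∀ u < m, d u = a u (pre d u)) (τ : ℕ)
    (b : Q → Fin 2) :
    Maps (spfStep inject D A m τ) (treeBits m D A (spfD inject d m τ) (spfA inject d a τ) b)
      (treeBits m D A (spfD inject d m (τ + 1)) (spfA inject d a (τ + 1)) b) ∧
    (inject = false → Maps (spfStep inject D A m τ)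
      (treeBits m D A (spfD inject d m (τ + 1)) (spfA inject d a (τ + 1)) b)
      (treeBits m D A (spfD inject d m τ) (spfA inject d a τ) b)) := by
  have hs : ∀ τ, SpfState inject d a m τ D A
      (treeBits m D A (spfD inject d m τ) (spfA inject d a τ) b) := fun τ =>
    ⟨fun q hq i => h.bits_D hq i, fun u hu p hp => h.bits_A hu hp⟩
  have key : ∀ x ∉ (spfStep inject D A m τ).qubits,
      treeBits m D A (spfD inject d m (τ + 1)) (spfA inject d a (τ + 1)) b x =
        treeBits m D A (spfD inject d m τ) (spfA inject d a τ) b x := by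
    intro x hx
    rcases TreeReg.cases m D A x with ⟨q, hq, i, rfl⟩ | ⟨u, hu, p, hp, rfl⟩ | ⟨h1, h2⟩
    · rw [h.bits_D hq, h.bits_D hq]
      by_contra h'
      exact hx (mem_spfStep_D hq h')
    · rw [h.bits_A hu hp, h.bits_A hu hp]
      by_contra h'
      exact hx (mem_spfStep_A hu h')
    · rw [TreeReg.bits_of_ne h1 h2, TreeReg.bits_of_ne h1 h2]
  constructor
  · refine MapsOn.maps ?_ key
    rw [spfStep_eq]
    refine MapsOn.par (h.spf_pairwise _ _) fun C hC => ?_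
    obtain ⟨q, hq, rfl⟩ := List.mem_map.1 hC
    exact (h.spfOp_mapsOn hd (List.mem_range.1 hq) (hs τ) (hs (τ + 1))).1
  · intro hi
    refine MapsOn.maps ?_ fun x hx => (key x hx).symm
    rw [spfStep_eq]
    refine MapsOn.par (h.spf_pairwise _ _) fun C hC => ?_
    obtain ⟨q, hq, rfl⟩ := List.mem_map.1 hC
    exact (h.spfOp_mapsOn hd (List.mem_range.1 hq) (hs τ) (hs (τ + 1))).2 hi

/-- The circuit SPF moves the angle qubit `A u p`, with `p` given by the first `u` data bits, to the
data qubit `u`, and leaves the other angle qubits unchanged. -/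
theorem TreeReg.spf_maps {m : ℕ} {D A : ℕ → ℕ → Q} (h : TreeReg m D A) {d : ℕ → Fin 2}
    {a : ℕ → ℕ → Fin 2} (hd : ∀ u < m, d u = a u (pre d u)) {b b' : Q → Fin 2}
    (hD : ∀ q < m, ∀ i, b (D q i) = 0) (hA : ∀ u < m, ∀ p < 2 ^ u, b (A u p) = a u p)
    (hD' : ∀ q < m, ∀ i, b' (D q i) = if i = 0 then d q else 0)
    (hA' : ∀ u < m, ∀ p < 2 ^ u, b' (A u p) = if p = pre d u then 0 else a u p)
    (h0 : ∀ x, (∀ q < m, ∀ i, D q i ≠ x) → (∀ u < m, ∀ p < 2 ^ u, A u p ≠ x) → b' x = b x) :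
    Maps (spf D A m) b b' := by
  have h1 : ∀ T, Maps ((List.range T).flatMap fun τ => spfStep true D A m τ)
      (treeBits m D A (spfD true d m 0) (spfA true d a 0) b)
      (treeBits m D A (spfD true d m T) (spfA true d a T) b) := by
    intro T
    induction T with
    | zero => exact maps_nil _
    | succ T ih =>
      rw [List.range_succ, List.flatMap_append, List.flatMap_singleton]
      exact ih.append (h.spfStep_maps true hd T b).1
  -- The second half is read as time running from `T` down to `0` along the states without
  -- injection.
  have h2 : ∀ T, Maps ((List.range T).reverse.flatMap fun τ => spfStep false D A m τ)
      (treeBits m D A (spfD false d m T) (spfA false d a T) b)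
      (treeBits m D A (spfD false d m 0) (spfA false d a 0) b) := by
    intro T
    induction T with
    | zero => exact maps_nil _
    | succ T ih =>
      rw [List.range_succ, List.reverse_append, List.reverse_singleton, List.flatMap_append,
        List.flatMap_singleton]
      exact ((h.spfStep_maps false hd T b).2 rfl).append ih
  have e0 : treeBits m D A (spfD true d m 0) (spfA true d a 0) b = b := by
    refine h.bits_eq ?_ ?_ fun _ _ _ => rfl
    · intro q hq i
      rw [hD q hq, spfD, if_neg]
      rintro ⟨h3, -⟩
      exact absurd (h3 rfl) (by omega)
    · intro u hu p hp
      rw [hA u hu p hp, spfA, if_pos ⟨rfl, by omega⟩, show min u (0 - 2 - 2 * u) = 0 by omega]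
      rfl
  have e1 : treeBits m D A (spfD false d m 0) (spfA false d a 0) b = b' := by
    refine h.bits_eq ?_ ?_ h0
    · intro q hq i
      rw [hD' q hq, spfD, show min (m - 2 - q) ((0 - 3 * q - 4) / 2) = 0 by omega]
      simp
    · intro u hu p hp
      rw [hA' u hu p hp, spfA, if_neg (c := false = true ∧ _) (by simp), show min u (0 - 2 - 2 * u) = 0 by omega]
      rfl
  -- By time `3m` every injection, at time `3q + 2` with `q < m`, has taken place, so the two
  -- descriptions of the state coincide and the halves fit together.
  have e2 : treeBits m D A (spfD true d m (3 * m)) (spfA true d a (3 * m)) b =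
      treeBits m D A (spfD false d m (3 * m)) (spfA false d a (3 * m)) b := by
    refine h.bits_eq ?_ ?_ fun x h3 h4 => TreeReg.bits_of_ne h3 h4
    · intro q hq i
      rw [h.bits_D hq, spfD, spfD]
      congr 1
      rw [eq_iff_iff]
      exact ⟨fun h => ⟨fun _ => by omega, h.2⟩, fun h => ⟨fun _ => by omega, h.2⟩⟩
    · intro u hu p hp
      rw [h.bits_A hu hp, spfA, spfA, if_neg (by simp), if_neg (by omega)]
  have h3 := h1 (3 * m)
  rw [e0, e2] at h3
  have h4 := h2 (3 * m)
  rw [e1] at h4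
  exact h3.append h4

end

/-! ### Untouched qubits, and the circuit FLAG. -/

section

variable {Q : Type}

/-! ### Qubits that a circuit does not touch -/

theorem Gate.apply_support [DecidableEq Q] {g : Gate Q} {q : Q} (hq : q ∉ g.qubits) {v : Fin 2}
    {ψ : State Q} (h : ∀ b, ψ b ≠ 0 → b q = v) (b : Q → Fin 2) (hb : g.apply ψ b ≠ 0) :
    b q = v := by
  cases g with
  | u U p =>
    have hp : q ≠ p := by simpa [Gate.qubits] using hq
    by_contra hv
    apply hb
    refine Finset.sum_eq_zero fun w _ => ?_
    have : ψ (Function.update b p w) = 0 := by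
      by_contra h'
      have := h _ h'
      rw [Function.update_of_ne hp] at this
      exact hv this
    rw [this, mul_zero]
  | cnot c t =>
    have ht : q ≠ t := by
      rintro rfl
      simp [Gate.qubits] at hq
    have := h _ hb
    rwa [Function.update_of_ne ht] at this

/-- Formulated for supports of arbitrary states, since the allocation bounds use it for
superpositions, in `ZeroOff.run`. -/
theorem Circuit.run_support [DecidableEq Q] {C : Circuit Q} {q : Q} (hq : q ∉ C.qubits) {v : Fin 2}
    {ψ : State Q} (h : ∀ b, ψ b ≠ 0 → b q = v) (b : Q → Fin 2) (hb : C.run ψ b ≠ 0) :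
    b q = v := by
  rw [Circuit.run_eq_flatten] at hb
  rw [← Circuit.qubits_flatten] at hq
  generalize List.flatten C = L at hq hb
  induction L generalizing ψ with
  | nil => exact h b hb
  | cons g L ih =>
    rw [Layer.qubits_cons, List.mem_append, not_or] at hq
    exact ih (fun b' hb' => Gate.apply_support hq.1 h b' hb') hq.2 hb

theorem Maps.eq_of_notMem [DecidableEq Q] {C : Circuit Q} {b b' : Q → Fin 2} (h : Maps C b b')
    {q : Q} (hq : q ∉ C.qubits) : b' q = b q := by
  refine Circuit.run_support hq (ψ := ket b) (fun β hβ => ?_) b' ?_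
  · by_contra hne
    exact hβ (ket_apply_of_ne fun h' => hne (by rw [h']))
  · rw [show C.run (ket b) = ket b' from h, ket_apply_self]
    exact one_ne_zero

theorem Maps.mapsOn' [DecidableEq Q] {C : Circuit Q} {b b' b'' : Q → Fin 2} (h : Maps C b b'')
    (h1 : ∀ q ∈ C.qubits, b'' q = b' q) : MapsOn C b b' :=
  h.mapsOn h1 fun _ hq => h.eq_of_notMem hq

theorem mapsOn_gX [DecidableEq Q] {q : Q} {b b' : Q → Fin 2} (h : b' q = b q + 1) :
    MapsOn [[.u gX q]] b b' := by
  refine (maps_gX q b).mapsOn' fun p hp => ?_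
  rw [mem_qubits_gate] at hp
  simp only [Gate.qubits, List.mem_cons, List.not_mem_nil, or_false] at hp
  subst hp
  rw [Function.update_self, h]

/-- A layer of single-qubit gates. -/
theorem pairwise_u {ι : Type*} {l : List ι} (hl : l.Nodup) {U : ι → U2} {r : ι → Q}
    (h : ∀ i ∈ l, ∀ j ∈ l, r i = r j → i = j) :
    (l.map fun i => ([[.u (U i) (r i)]] : Circuit Q)).Pairwise Disj := by
  refine pairwise_map_disj hl fun i hi j hj hij q hq hq' => ?_
  rw [mem_qubits_gate] at hq hq'
  simp only [Gate.qubits, List.mem_cons, List.not_mem_nil, or_false] at hq hq'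
  exact hij (h i hi j hj (hq ▸ hq'))

theorem valid_u {ι : Type*} {l : List ι} (hl : l.Nodup) {U : ι → U2} {r : ι → Q}
    (h : ∀ i ∈ l, ∀ j ∈ l, r i = r j → i = j) :
    Circuit.Valid [l.map fun i => .u (U i) (r i)] :=
  valid_layer (fun _ _ => by simp [Gate.qubits]) (pairwise_u hl h)

theorem mem_qubits_u {ι : Type*} {l : List ι} {U : ι → U2} {r : ι → Q} {q : Q} :
    q ∈ Circuit.qubits [l.map fun i => .u (U i) (r i)] ↔ ∃ i ∈ l, q = r i := by
  rw [mem_qubits_layer]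
  simp [Gate.qubits]

/-! ### The circuit FLAG -/

/-- The circuit that copies the data qubits in FLAG. -/
def flagCopy (D : ℕ → ℕ → Q) (m : ℕ) : Circuit Q :=
  par ((List.range (m - 1)).map fun q => copy (D q) (2 ^ (m - 2 - q)))

/-- The `i`-th round of controlled swaps in FLAG. -/
def flagStep (D F : ℕ → ℕ → Q) (m i : ℕ) : Circuit Q :=
  par ((List.range (m - 1 - i)).map fun q => cs i (D q) (F (q + 1 + i)))

theorem flag_eq (D F : ℕ → ℕ → Q) (m : ℕ) : flag D F m =
    [(List.range m).map fun j => .u gX (F j 0)] ++ flagCopy D m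
      ++ ((List.range (m - 1)).flatMap (flagStep D F m)) ++ Circuit.dagger (flagCopy D m) := rfl

namespace TreeReg

variable {m : ℕ} {D F : ℕ → ℕ → Q} (h : TreeReg m D F)
include h

theorem flagCopy_pairwise :
    ((List.range (m - 1)).map fun q => copy (D q) (2 ^ (m - 2 - q))).Pairwise Disj := by
  refine pairwise_range_map fun q hq q' hq' hne x hx hx' => ?_
  obtain ⟨i, -, rfl⟩ := mem_qubits_copy hx
  obtain ⟨i', -, h'⟩ := mem_qubits_copy hx'
  exact hne (h.injD _ (by omega) _ (by omega) _ _ h').1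

theorem valid_flagCopy : (flagCopy D m).Valid := by
  refine valid_par ?_ h.flagCopy_pairwise
  intro C hC
  obtain ⟨q, hq, rfl⟩ := List.mem_map.1 hC
  rw [List.mem_range] at hq
  exact valid_copy fun i _ j _ hij => (h.injD _ (by omega) _ (by omega) _ _ hij).2

theorem flagStep_pairwise (i : ℕ) :
    ((List.range (m - 1 - i)).map fun q => cs i (D q) (F (q + 1 + i))).Pairwise Disj := by
  have e : ∀ q, 2 ^ (i + 1) ≤ 2 ^ (q + 1 + i) := fun q =>
    Nat.pow_le_pow_right (by norm_num) (by omega)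
  refine pairwise_range_map fun q hq q' hq' hne x hx hx' => ?_
  have e1 := e q
  have e2 := e q'
  rcases mem_qubits_cs hx with ⟨j, -, rfl⟩ | ⟨j, hj, rfl⟩ <;>
    rcases mem_qubits_cs hx' with ⟨j', -, h'⟩ | ⟨j', hj', h'⟩
  · exact hne (h.injD _ (by omega) _ (by omega) _ _ h').1
  · exact h.ne _ (by omega) _ (by omega) _ (by omega) _ h'
  · exact h.ne _ (by omega) _ (by omega) _ (by omega) _ h'.symm
  · have := (h.injA _ (by omega) _ (by omega) _ (by omega) _ (by omega) h').1
    omega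

theorem valid_flagX : Circuit.Valid [(List.range m).map fun j => .u gX (F j 0)] :=
  valid_u (U := fun _ => gX) (r := fun j => F j 0) List.nodup_range fun i hi j hj hij =>
    (h.injA _ (List.mem_range.1 hi) _ (List.mem_range.1 hj) _ (by simp) _ (by simp) hij).1

theorem valid_flag : (flag D F m).Valid := by
  rw [flag_eq, Circuit.valid_append, Circuit.valid_append, Circuit.valid_append]
  refine ⟨⟨⟨h.valid_flagX, h.valid_flagCopy⟩, Circuit.valid_flatMap fun i _ => ?_⟩,
    h.valid_flagCopy.dagger⟩
  refine valid_par ?_ (h.flagStep_pairwise i)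
  intro C hC
  obtain ⟨q, hq, rfl⟩ := List.mem_map.1 hC
  rw [List.mem_range] at hq
  exact (h.csReg (by omega) (by omega) (by omega)).valid

/-- The content of the copies of the data qubits in FLAG. -/
def _root_.QSP.flagD (d : ℕ → Fin 2) (m : ℕ) (q x : ℕ) : Fin 2 :=
  if x = 0 ∨ q < m - 1 ∧ x < 2 ^ (m - 2 - q) then d q else 0

/-- The content of the flag register `F u` after `i` rounds of controlled swaps. -/
def _root_.QSP.flagF (d : ℕ → Fin 2) (i u p : ℕ) : Fin 2 :=
  if p = pre d u % 2 ^ min i u then 0 else 1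

variable [DecidableEq Q]

theorem flagCopy_maps {d : ℕ → Fin 2} (w : ℕ → ℕ → Fin 2) (b : Q → Fin 2) :
    Maps (flagCopy D m) (treeBits m D F (fun q x => if x = 0 then d q else 0) w b)
      (treeBits m D F (flagD d m) w b) := by
  refine MapsOn.maps ?_ fun x hx => ?_
  · refine MapsOn.par h.flagCopy_pairwise fun C hC => ?_
    obtain ⟨q, hq, rfl⟩ := List.mem_map.1 hC
    rw [List.mem_range] at hq
    refine mapsOn_copy (fun i _ j _ hij => (h.injD _ (by omega) _ (by omega) _ _ hij).2) ?_ ?_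
    · intro i hi
      rw [h.bits_D (by omega), h.bits_D (by omega), if_pos rfl]
    · intro i hi
      rw [h.bits_D (by omega), h.bits_D (by omega), if_pos rfl, flagD, if_pos (.inr ⟨hq, hi⟩)]
  · rcases TreeReg.cases m D F x with ⟨q, hq, i, rfl⟩ | ⟨u, hu, p, hp, rfl⟩ | ⟨h1, h2⟩
    · rw [h.bits_D hq, h.bits_D hq, flagD]
      by_cases hi : i = 0
      · simp [hi]
      · rw [if_neg hi, if_neg]
        rintro (h' | ⟨h1, h2⟩)
        · exact hi h'
        · apply hx
          rw [flagCopy, mem_qubits_par]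
          refine ⟨_, List.mem_map.2 ⟨q, List.mem_range.2 h1, rfl⟩, ?_⟩
          have h3 : i < 2 ^ (Nat.log 2 i + 1) := Nat.lt_pow_succ_log_self (by norm_num) i
          have h4 : 2 ^ Nat.log 2 i ≤ i := Nat.pow_log_le_self 2 hi
          have h5 := mem_copyLayer (R := D q) h2 h4 h3
          obtain ⟨L, hL, hq⟩ := Circuit.mem_qubits.1 h5
          refine Circuit.mem_qubits.2 ⟨L, List.mem_flatMap.2 ⟨_, List.mem_range.2 ?_, hL⟩, hq⟩
          rw [Nat.lt_clog_iff_pow_lt (by norm_num)]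
          omega
    · rw [h.bits_A hu hp, h.bits_A hu hp]
    · rw [TreeReg.bits_of_ne h1 h2, TreeReg.bits_of_ne h1 h2]

/-- In round `i` the register `F u` is controlled by the data bit `u - 1 - i`, the `i`-th digit of
`pre d u` from the right. The single cleared flag thereby moves from `pre d u mod 2^i` to `pre d u
mod 2^(i+1)`. -/
theorem flagStep_maps {d : ℕ → Fin 2} (b : Q → Fin 2) (i : ℕ) :
    Maps (flagStep D F m i) (treeBits m D F (flagD d m) (flagF d i) b)
      (treeBits m D F (flagD d m) (flagF d (i + 1)) b) := by
  have e : 2 ^ (i + 1) = 2 * 2 ^ i := by rw [pow_succ]; omega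
  have e' : ∀ q, 2 ^ (i + 1) ≤ 2 ^ (q + 1 + i) := fun q =>
    Nat.pow_le_pow_right (by norm_num) (by omega)
  have e0 := Nat.two_pow_pos i
  -- The digit of weight `2^i` in `pre d (q + 1 + i)` is the control bit `d q`.
  have hP : ∀ q, pre d (q + 1 + i) % 2 ^ (i + 1) =
      pre d (q + 1 + i) % 2 ^ i + 2 ^ i * (d q : ℕ) := by
    intro q
    rw [Nat.mod_pow_succ, pre_add_div, pre_succ_mod]
  refine MapsOn.maps ?_ fun x hx => ?_
  · refine MapsOn.par (h.flagStep_pairwise i) fun C hC => ?_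
    obtain ⟨q, hq, rfl⟩ := List.mem_map.1 hC
    rw [List.mem_range] at hq
    have hu : q + 1 + i < m := by omega
    have h1 : ∀ x < 2 ^ i, flagD d m q x = d q := by
      intro x hx
      rw [flagD, if_pos]
      have : 2 ^ i ≤ 2 ^ (m - 2 - q) := Nat.pow_le_pow_right (by norm_num) (by omega)
      omega
    have e1 := e' q
    have e2 := hP q
    have e3 := Nat.mod_lt (pre d (q + 1 + i)) e0
    have e4 : min (i + 1) (q + 1 + i) = i + 1 := by omega
    have e5 : min i (q + 1 + i) = i := by omega
    refine mapsOn_cs (h.csReg (by omega) hu (by omega)) ?_ ?_ ?_ <;> intro x hx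
    · rw [h.bits_D (by omega), h.bits_D (by omega)]
    · rw [h.bits_D (by omega), h.bits_A hu (by omega), h.bits_A hu (by omega),
        h.bits_A hu (by omega), h1 x hx, flagF, flagF, flagF, e4, e5, e2]
      rcases fin2_cases (d q) with hd | hd
      · simp [hd]
      · rw [if_neg, if_pos hd, if_neg] <;> (try rw [hd, Fin.val_one]) <;> omega
    · rw [h.bits_D (by omega), h.bits_A hu (by omega), h.bits_A hu (by omega),
        h.bits_A hu (by omega), h1 x hx, flagF, flagF, flagF, e4, e5, e2]
      rcases fin2_cases (d q) with hd | hd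
      · rw [if_neg, if_neg (by simp [hd]), if_neg] <;>
          (try rw [hd, Fin.val_zero]) <;> omega
      · simp [hd]
  · rcases TreeReg.cases m D F x with ⟨q, hq, j, rfl⟩ | ⟨u, hu, p, hp, rfl⟩ | ⟨h1, h2⟩
    · rw [h.bits_D hq, h.bits_D hq]
    · rw [h.bits_A hu hp, h.bits_A hu hp]
      by_cases hi : i < u
      · obtain ⟨q, rfl⟩ : ∃ q, u = q + 1 + i := ⟨u - 1 - i, by omega⟩
        have h3 : ¬ p < 2 ^ (i + 1) := by
          intro h3
          apply hx
          rw [flagStep, mem_qubits_par]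
          exact ⟨_, List.mem_map.2 ⟨q, List.mem_range.2 (by omega), rfl⟩, target_mem_cs h3⟩
        have e3 := Nat.mod_lt (pre d (q + 1 + i)) e0
        have e4 := Nat.mod_lt (pre d (q + 1 + i)) (Nat.two_pow_pos (i + 1))
        have e5 : min (i + 1) (q + 1 + i) = i + 1 := by omega
        have e6 : min i (q + 1 + i) = i := by omega
        rw [flagF, flagF, e5, e6, if_neg (by omega), if_neg (by omega)]
      · rw [flagF, flagF, show min (i + 1) u = min i u by omega]
    · rw [TreeReg.bits_of_ne h1 h2, TreeReg.bits_of_ne h1 h2]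

/-- The circuit FLAG clears the flags on the path given by the data bits. -/
theorem flag_maps {d : ℕ → Fin 2} {b b' : Q → Fin 2}
    (hD : ∀ q < m, ∀ i, b (D q i) = if i = 0 then d q else 0)
    (hF : ∀ u < m, ∀ p < 2 ^ u, b (F u p) = 1) (hD' : ∀ q < m, ∀ i, b' (D q i) = b (D q i))
    (hF' : ∀ u < m, ∀ p < 2 ^ u, b' (F u p) = if p = pre d u then 0 else 1)
    (h0 : ∀ x, (∀ q < m, ∀ i, D q i ≠ x) → (∀ u < m, ∀ p < 2 ^ u, F u p ≠ x) → b' x = b x) :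
    Maps (flag D F m) b b' := by
  have e0 : treeBits m D F (fun q x => if x = 0 then d q else 0) (fun _ _ => 1) b = b :=
    h.bits_eq hD hF fun _ _ _ => rfl
  have e1 : treeBits m D F (fun q x => if x = 0 then d q else 0) (flagF d (m - 1)) b = b' := by
    refine h.bits_eq (fun q hq i => by rw [hD' q hq, hD q hq]) (fun u hu p hp => ?_) h0
    rw [hF' u hu p hp, flagF, show min (m - 1) u = u by omega, Nat.mod_eq_of_lt (pre_lt d u)]
  have h1 : Maps [(List.range m).map fun j => .u gX (F j 0)] b
      (treeBits m D F (fun q x => if x = 0 then d q else 0) (flagF d 0) b) := by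
    refine MapsOn.maps (MapsOn.layer (pairwise_u (U := fun _ => gX) (r := fun j => F j 0)
      List.nodup_range fun i hi j hj hij => (h.injA _ (List.mem_range.1 hi) _
        (List.mem_range.1 hj) _ (by simp) _ (by simp) hij).1) fun j hj => ?_) fun x hx => ?_
    · rw [List.mem_range] at hj
      refine mapsOn_gX ?_
      rw [h.bits_A hj (by simp), hF j hj 0 (by simp), flagF, if_pos (by simp [Nat.mod_one])]
      rfl
    · rcases TreeReg.cases m D F x with ⟨q, hq, j, rfl⟩ | ⟨u, hu, p, hp, rfl⟩ | ⟨h1, h2⟩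
      · rw [h.bits_D hq, hD q hq]
      · rw [h.bits_A hu hp, hF u hu p hp, flagF, if_neg]
        rintro h'
        apply hx
        rw [Nat.zero_min, pow_zero, Nat.mod_one] at h'
        rw [h']
        exact mem_qubits_u.2 ⟨u, List.mem_range.2 hu, rfl⟩
      · rw [TreeReg.bits_of_ne h1 h2]
  have h2 : ∀ T, Maps ((List.range T).flatMap (flagStep D F m))
      (treeBits m D F (flagD d m) (flagF d 0) b) (treeBits m D F (flagD d m) (flagF d T) b) := by
    intro T
    induction T with
    | zero => exact maps_nil _
    | succ T ih =>
      rw [List.range_succ, List.flatMap_append, List.flatMap_singleton]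
      exact ih.append (h.flagStep_maps b T)
  -- The copies are removed while the flags have their final values; `flagCopy_maps` holds for every
  -- content of the flags.
  have h3 := (h.flagCopy_maps (d := d) (flagF d (m - 1)) b).dagger h.valid_flagCopy
  rw [e1] at h3
  rw [flag_eq]
  exact ((h1.append (h.flagCopy_maps _ b)).append (h2 _)).append h3

end TreeReg

end

/-! ### CopySwap and Setup: moving the buffer to the position given by the address. -/

section

variable {Q : Type}

/-! ### The circuit CopySwap -/

/-- The `j`-th binary digit of `k`. -/
def nbit (k j : ℕ) : Fin 2 := Fin.ofNat 2 (k / 2 ^ j)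

theorem val_nbit (k j : ℕ) : (nbit k j : ℕ) = k / 2 ^ j % 2 := rfl

/-- The qubits of the registers `R j`, for `j < m`, and of the register `S` of size `2 ^ m` are
distinct. -/
structure FanReg (m : ℕ) (R : ℕ → ℕ → Q) (S : ℕ → Q) : Prop where
  injR : ∀ j < m, ∀ j' < m, ∀ i i', R j i = R j' i' → j = j' ∧ i = i'
  injS : ∀ x < 2 ^ m, ∀ x' < 2 ^ m, S x = S x' → x = x'
  ne : ∀ j < m, ∀ i, ∀ x < 2 ^ m, R j i ≠ S x

/-- The bit string `b` with the registers `R` and `S` overwritten by `v` and `w`. -/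
def fanBits (m : ℕ) (R : ℕ → ℕ → Q) (S : ℕ → Q) (v : ℕ → ℕ → Fin 2) (w : ℕ → Fin 2)
    (b : Q → Fin 2) : Q → Fin 2 :=
  overlay (fun x : ℕ × ℕ => x.1 < m) (fun x => R x.1 x.2) (fun x => v x.1 x.2)
    (overlay (fun x : ℕ => x < 2 ^ m) S w b)

/-- The operations of CopySwap in step `i`. -/
def copySwapOps (R : ℕ → ℕ → Q) (S : ℕ → Q) (m i : ℕ) : List (Circuit Q) :=
  cs i (R i) S :: ((List.range m).filter fun j => i < j).map fun j => copyLayer (R j) (2 ^ j) i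

theorem copySwap_eq (R : ℕ → ℕ → Q) (S : ℕ → Q) (m : ℕ) :
    copySwap R S m = (List.range m).flatMap fun i => par (copySwapOps R S m i) := rfl

theorem mem_qubits_copySwapOps {R : ℕ → ℕ → Q} {S : ℕ → Q} {m i : ℕ} {q : Q} (hi : i < m)
    (hq : q ∈ (par (copySwapOps R S m i)).qubits) :
    (∃ j < m, ∃ x < 2 ^ j, q = R j x) ∨ ∃ x < 2 ^ m, q = S x := by
  obtain ⟨C, hC, hq⟩ := mem_qubits_par.1 hq
  rcases List.mem_cons.1 hC with rfl | hC
  · rcases mem_qubits_cs hq with ⟨x, hx, rfl⟩ | ⟨x, hx, rfl⟩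
    · exact .inl ⟨i, hi, x, hx, rfl⟩
    · exact .inr ⟨x, lt_of_lt_of_le hx (Nat.pow_le_pow_right (by norm_num) hi), rfl⟩
  · obtain ⟨j, hj, rfl⟩ := List.mem_map.1 hC
    simp only [List.mem_filter, List.mem_range, decide_eq_true_eq] at hj
    obtain ⟨x, hx, -, rfl⟩ := mem_qubits_copyLayer hq
    exact .inl ⟨j, hj.1, x, hx, rfl⟩

theorem mem_qubits_copySwap {R : ℕ → ℕ → Q} {S : ℕ → Q} {m : ℕ} {q : Q}
    (hq : q ∈ (copySwap R S m).qubits) :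
    (∃ j < m, ∃ x < 2 ^ j, q = R j x) ∨ ∃ x < 2 ^ m, q = S x := by
  obtain ⟨L, hL, hq⟩ := Circuit.mem_qubits.1 hq
  obtain ⟨i, hi, hL⟩ := List.mem_flatMap.1 hL
  exact mem_qubits_copySwapOps (List.mem_range.1 hi) (Circuit.mem_qubits.2 ⟨L, hL, hq⟩)

namespace FanReg

variable {m : ℕ} {R : ℕ → ℕ → Q} {S : ℕ → Q} (h : FanReg m R S)
  {v : ℕ → ℕ → Fin 2} {w : ℕ → Fin 2} {b : Q → Fin 2}

include h

theorem bits_R {j : ℕ} (hj : j < m) (i : ℕ) : fanBits m R S v w b (R j i) = v j i :=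
  overlay_apply (P := fun x : ℕ × ℕ => x.1 < m) (r := fun x => R x.1 x.2)
    (fun _ _ hx hy hxy => Prod.ext_iff.2 (h.injR _ hx _ hy _ _ hxy)) _ _ (i := (j, i)) hj

theorem bits_S {x : ℕ} (hx : x < 2 ^ m) : fanBits m R S v w b (S x) = w x := by
  rw [fanBits, overlay_of_ne]
  · exact overlay_apply (P := fun x : ℕ => x < 2 ^ m) (r := S)
      (fun x y hx hy hxy => h.injS _ hx _ hy hxy) _ _ hx
  · exact fun y hy => h.ne _ hy _ _ hx

omit h in
theorem bits_of_ne {x : Q} (h1 : ∀ j < m, ∀ i, R j i ≠ x) (h2 : ∀ y < 2 ^ m, S y ≠ x) :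
    fanBits m R S v w b x = b x := by
  rw [fanBits, overlay_of_ne, overlay_of_ne]
  · exact fun y hy => h2 _ hy
  · exact fun y hy => h1 _ hy _

omit h in
theorem cases (m : ℕ) (R : ℕ → ℕ → Q) (S : ℕ → Q) (x : Q) : (∃ j < m, ∃ i, x = R j i) ∨
    (∃ y < 2 ^ m, x = S y) ∨ ((∀ j < m, ∀ i, R j i ≠ x) ∧ ∀ y < 2 ^ m, S y ≠ x) := by
  by_cases h1 : ∃ j < m, ∃ i, x = R j i
  · exact .inl h1
  · by_cases h2 : ∃ y < 2 ^ m, x = S y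
    · exact .inr (.inl h2)
    · exact .inr (.inr ⟨fun q hq i hx => h1 ⟨q, hq, i, hx.symm⟩,
        fun y hy hx => h2 ⟨y, hy, hx.symm⟩⟩)

theorem csReg {i : ℕ} (hi : i < m) : CsReg i (R i) S := by
  have e : 2 ^ (i + 1) ≤ 2 ^ m := Nat.pow_le_pow_right (by norm_num) hi
  exact ⟨fun x _ y _ hxy => (h.injR _ hi _ hi _ _ hxy).2,
    fun x hx y hy hxy => h.injS _ (by omega) _ (by omega) hxy,
    fun x _ y hy => h.ne _ hi _ _ (by omega)⟩

theorem copySwap_pairwise {i : ℕ} (hi : i < m) : (copySwapOps R S m i).Pairwise Disj := by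
  have e : 2 ^ (i + 1) ≤ 2 ^ m := Nat.pow_le_pow_right (by norm_num) hi
  rw [copySwapOps, List.pairwise_cons]
  constructor
  · intro C hC
    obtain ⟨j, hj, rfl⟩ := List.mem_map.1 hC
    simp only [List.mem_filter, List.mem_range, decide_eq_true_eq] at hj
    intro q hq hq'
    obtain ⟨x, hx, -, rfl⟩ := mem_qubits_copyLayer hq'
    rcases mem_qubits_cs hq with ⟨y, hy, h'⟩ | ⟨y, hy, h'⟩
    · have := (h.injR _ hj.1 _ hi _ _ h').1
      omega
    · exact h.ne _ hj.1 _ _ (by omega) h'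
  · refine pairwise_map_disj (List.nodup_range.filter _) fun j hj j' hj' hne q hq hq' => ?_
    simp only [List.mem_filter, List.mem_range, decide_eq_true_eq] at hj hj'
    obtain ⟨x, -, -, rfl⟩ := mem_qubits_copyLayer hq
    obtain ⟨y, -, -, h'⟩ := mem_qubits_copyLayer hq'
    exact hne (h.injR _ hj.1 _ hj'.1 _ _ h').1

theorem valid_copySwap : (copySwap R S m).Valid := by
  refine Circuit.valid_flatMap fun i hi => ?_
  rw [List.mem_range] at hi
  refine valid_par ?_ (h.copySwap_pairwise hi)
  intro C hC
  rcases List.mem_cons.1 hC with rfl | hC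
  · exact (h.csReg hi).valid
  · obtain ⟨j, hj, rfl⟩ := List.mem_map.1 hC
    simp only [List.mem_filter, List.mem_range, decide_eq_true_eq] at hj
    exact valid_copyLayer fun x _ y _ hxy => (h.injR _ hj.1 _ hj.1 _ _ hxy).2

/-- The content of the registers `R j` after `i` steps of CopySwap. -/
def _root_.QSP.copySwapR (k i j x : ℕ) : Fin 2 := if x < 2 ^ min i j then nbit k j else 0

/-- The content of the register `S` after `i` steps of CopySwap. -/
def _root_.QSP.copySwapS (k : ℕ) (s : Fin 2) (i x : ℕ) : Fin 2 := if x = k % 2 ^ i then s else 0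

variable [DecidableEq Q]

/-- Step `i` has the required `2^i` copies of address bit `i`, and at the same time doubles the
copies of the bits `j > i`. The qubit `s` moves from `k mod 2^i` to `k mod 2^(i+1)`, so the address
is consumed from the least significant bit. -/
theorem copySwap_step {i : ℕ} (hi : i < m) (k : ℕ) (s : Fin 2) (b : Q → Fin 2) :
    Maps (par (copySwapOps R S m i)) (fanBits m R S (copySwapR k i) (copySwapS k s i) b)
      (fanBits m R S (copySwapR k (i + 1)) (copySwapS k s (i + 1)) b) := by
  have e : 2 ^ (i + 1) = 2 * 2 ^ i := by rw [pow_succ]; omega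
  have e' : 2 ^ (i + 1) ≤ 2 ^ m := Nat.pow_le_pow_right (by norm_num) hi
  have e0 := Nat.two_pow_pos i
  have e1 := Nat.mod_lt k e0
  have e2 : k % 2 ^ (i + 1) = k % 2 ^ i + 2 ^ i * (nbit k i : ℕ) := by
    rw [Nat.mod_pow_succ, val_nbit]
  refine MapsOn.maps (MapsOn.par (h.copySwap_pairwise hi) fun C hC => ?_) fun q hq => ?_
  · rcases List.mem_cons.1 hC with rfl | hC
    · have h1 : ∀ x < 2 ^ i, copySwapR k i i x = nbit k i := fun x hx => by
        rw [copySwapR, min_self, if_pos hx]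
      refine mapsOn_cs (h.csReg hi) ?_ ?_ ?_ <;> intro x hx
      · rw [h.bits_R hi, h.bits_R hi, h1 x hx, copySwapR, show min (i + 1) i = i by omega,
          if_pos hx]
      · rw [h.bits_R hi, h.bits_S (by omega), h.bits_S (by omega), h.bits_S (by omega), h1 x hx,
          copySwapS, copySwapS, copySwapS, e2]
        rcases fin2_cases (nbit k i) with hd | hd
        · simp [hd]
        · rw [if_neg, if_pos hd, if_neg] <;> (try rw [hd, Fin.val_one]) <;> omega
      · rw [h.bits_R hi, h.bits_S (by omega), h.bits_S (by omega), h.bits_S (by omega), h1 x hx,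
          copySwapS, copySwapS, copySwapS, e2]
        rcases fin2_cases (nbit k i) with hd | hd
        · rw [if_neg, if_neg (by simp [hd]), if_neg] <;> (try rw [hd, Fin.val_zero]) <;> omega
        · simp [hd]
    · obtain ⟨j, hj, rfl⟩ := List.mem_map.1 hC
      simp only [List.mem_filter, List.mem_range, decide_eq_true_eq] at hj
      refine mapsOn_copyLayer (fun x _ y _ hxy => (h.injR _ hj.1 _ hj.1 _ _ hxy).2) ?_ ?_ <;>
        intro x hx hx' <;> simp only [h.bits_R hj.1, copySwapR,
          show min (i + 1) j = i + 1 by omega, show min i j = i by omega]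
      · rw [if_pos (by omega), if_pos hx]
      · rw [if_pos (by omega), if_neg (by omega), if_pos hx, zero_add]
  · rw [mem_qubits_par] at hq
    rcases FanReg.cases m R S q with ⟨j, hj, x, rfl⟩ | ⟨x, hx, rfl⟩ | ⟨h1, h2⟩
    · rw [h.bits_R hj, h.bits_R hj, copySwapR, copySwapR]
      by_cases hij : i < j
      · rw [show min (i + 1) j = i + 1 by omega, show min i j = i by omega]
        by_cases hx : 2 ^ i ≤ x ∧ x < 2 ^ (i + 1)
        · exfalso
          apply hq
          have e3 : 2 ^ (i + 1) ≤ 2 ^ j := Nat.pow_le_pow_right (by norm_num) hij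
          exact ⟨_, List.mem_cons_of_mem _ (List.mem_map.2 ⟨j, by simp [hj, hij], rfl⟩),
            mem_copyLayer (by omega) hx.1 hx.2⟩
        · congr 1
          rw [eq_iff_iff]
          omega
      · rw [show min (i + 1) j = min i j by omega]
    · rw [h.bits_S hx, h.bits_S hx]
      have h3 : ¬ x < 2 ^ (i + 1) := fun h3 => hq ⟨_, List.mem_cons_self, target_mem_cs h3⟩
      have e4 := Nat.mod_lt k (Nat.two_pow_pos (i + 1))
      rw [copySwapS, copySwapS, if_neg (by omega), if_neg (by omega)]
    · rw [FanReg.bits_of_ne h1 h2, FanReg.bits_of_ne h1 h2]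

/-- The circuit CopySwap moves the qubit `S 0` to `S k`. -/
theorem copySwap_mapsOn {k : ℕ} (hk : k < 2 ^ m) {s : Fin 2} {b b' : Q → Fin 2}
    (hR : ∀ j < m, ∀ i, b (R j i) = if i = 0 then nbit k j else 0)
    (hS : ∀ x < 2 ^ m, b (S x) = if x = 0 then s else 0)
    (hR' : ∀ j < m, ∀ i < 2 ^ j, b' (R j i) = nbit k j)
    (hS' : ∀ x < 2 ^ m, b' (S x) = if x = k then s else 0) :
    MapsOn (copySwap R S m) b b' := by
  have h1 : ∀ T ≤ m, Maps ((List.range T).flatMap fun i => par (copySwapOps R S m i))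
      (fanBits m R S (copySwapR k 0) (copySwapS k s 0) b)
      (fanBits m R S (copySwapR k T) (copySwapS k s T) b) := by
    intro T hT
    induction T with
    | zero => exact maps_nil _
    | succ T ih =>
      rw [List.range_succ, List.flatMap_append, List.flatMap_singleton]
      exact (ih (by omega)).append (h.copySwap_step (by omega) k s b)
  have e0 : fanBits m R S (copySwapR k 0) (copySwapS k s 0) b = b := by
    funext q
    rcases FanReg.cases m R S q with ⟨j, hj, x, rfl⟩ | ⟨x, hx, rfl⟩ | ⟨h1, h2⟩
    · rw [h.bits_R hj, hR j hj, copySwapR]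
      simp
    · rw [h.bits_S hx, hS x hx, copySwapS, pow_zero, Nat.mod_one]
    · rw [FanReg.bits_of_ne h1 h2]
  have h2 := h1 m le_rfl
  rw [e0] at h2
  refine h2.mapsOn' fun q hq => ?_
  rcases mem_qubits_copySwap hq with ⟨j, hj, x, hx, rfl⟩ | ⟨x, hx, rfl⟩
  · rw [h.bits_R hj, hR' j hj x hx, copySwapR, show min m j = j by omega, if_pos hx]
  · rw [h.bits_S hx, hS' x hx, copySwapS, Nat.mod_eq_of_lt hk]

end FanReg

/-! ### The circuit Setup -/

theorem fanReg_addr (m : ℕ) : FanReg m (addrReg m) fun k => Qubit.sel k 0 := by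
  refine ⟨?_, ?_, ?_⟩
  · intro j hj j' hj' i i' h
    unfold addrReg at h
    split_ifs at h with h1 h2
    · have := Qubit.data.inj h
      omega
    · have := Qubit.addr.inj h
      omega
  · intro x _ x' _ h
    exact (Qubit.sel.inj h).1
  · intro j _ i x _ h
    unfold addrReg at h
    split_ifs at h

theorem fanReg_block (m e : ℕ) :
    FanReg m (fun j i => Qubit.blockAddr e j i) fun k => Qubit.buf e k := by
  refine ⟨?_, ?_, ?_⟩
  · intro j _ j' _ i i' h
    exact (Qubit.blockAddr.inj h).2
  · intro x _ x' _ h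
    exact (Qubit.buf.inj h).2
  · intro j _ i x _ h
    exact Qubit.noConfusion h

theorem addrFan_injective {m : ℕ} {j j' i i' : ℕ} (hj : j < m) (hj' : j' < m)
    (h : addrFan m j i = addrFan m j' i') : j = j' ∧ i = i' := by
  unfold addrFan at h
  split_ifs at h with h1 h2
  · have := Qubit.data.inj h
    omega
  · have := Qubit.blockAddr.inj h
    omega

/-- The circuits that copy the address register, the flags, and the address bits. -/
def fanCopies (n m : ℕ) : Circuit Qubit :=
  par ((List.range m).map fun j => copy (addrFan m j) (2 ^ (n - m)))

/-- The circuits that move the qubits of the buffer. -/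
def blockMoves (n m : ℕ) : Circuit Qubit :=
  par ((List.range (2 ^ (n - m) - 1)).map fun e =>
    copySwap (fun j i => .blockAddr e j i) (fun k => .buf e k) m)

/-- The circuits that Setup executes in parallel. -/
def setupOps (n m : ℕ) : List (Circuit Qubit) :=
  ((List.range (2 ^ m)).map fun k => copy (fun l => .sel k l) (2 ^ (n - m) - 1))
    ++ ((List.range (2 ^ (n - m) - 1)).map fun e => copy (fun k => .flag e k) (2 ^ m))
    ++ [fanCopies n m ++ blockMoves n m]

theorem setup_eq (n m : ℕ) : setup n m = [[.u gX (.sel 0 0)]]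
    ++ copySwap (addrReg m) (fun k => .sel k 0) m ++ parEnd (setupOps n m) := rfl

theorem fanCopies_pairwise (n m : ℕ) :
    ((List.range m).map fun j => copy (addrFan m j) (2 ^ (n - m))).Pairwise Disj := by
  refine pairwise_range_map fun j hj j' hj' hne q hq hq' => ?_
  obtain ⟨i, -, rfl⟩ := mem_qubits_copy hq
  obtain ⟨i', -, h⟩ := mem_qubits_copy hq'
  exact hne (addrFan_injective hj hj' h).1

theorem mem_qubits_fanCopies {n m : ℕ} {q : Qubit} (h : q ∈ (fanCopies n m).qubits) :
    ∃ j < m, ∃ i < 2 ^ (n - m), q = addrFan m j i := by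
  obtain ⟨C, hC, hq⟩ := mem_qubits_par.1 h
  obtain ⟨j, hj, rfl⟩ := List.mem_map.1 hC
  obtain ⟨i, hi, rfl⟩ := mem_qubits_copy hq
  exact ⟨j, List.mem_range.1 hj, i, hi, rfl⟩

theorem valid_fanCopies (n m : ℕ) : (fanCopies n m).Valid := by
  refine valid_par ?_ (fanCopies_pairwise n m)
  intro C hC
  obtain ⟨j, hj, rfl⟩ := List.mem_map.1 hC
  rw [List.mem_range] at hj
  exact valid_copy fun i _ i' _ h => (addrFan_injective hj hj h).2

theorem blockMoves_pairwise (n m : ℕ) : ((List.range (2 ^ (n - m) - 1)).map fun e =>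
    copySwap (fun j i => Qubit.blockAddr e j i) (fun k => .buf e k) m).Pairwise Disj := by
  refine pairwise_range_map fun e _ e' _ hne q hq hq' => ?_
  rcases mem_qubits_copySwap hq with ⟨j, -, i, -, rfl⟩ | ⟨i, -, rfl⟩ <;>
    rcases mem_qubits_copySwap hq' with ⟨j', -, i', -, h⟩ | ⟨i', -, h⟩
  · exact hne (Qubit.blockAddr.inj h).1
  · exact Qubit.noConfusion h
  · exact Qubit.noConfusion h
  · exact hne (Qubit.buf.inj h).1

theorem mem_qubits_blockMoves {n m : ℕ} {q : Qubit} (h : q ∈ (blockMoves n m).qubits) :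
    ∃ e < 2 ^ (n - m) - 1, (∃ j < m, ∃ i < 2 ^ j, q = .blockAddr e j i) ∨
      ∃ k < 2 ^ m, q = .buf e k := by
  obtain ⟨C, hC, hq⟩ := mem_qubits_par.1 h
  obtain ⟨e, he, rfl⟩ := List.mem_map.1 hC
  exact ⟨e, List.mem_range.1 he, mem_qubits_copySwap hq⟩

theorem valid_blockMoves (n m : ℕ) : (blockMoves n m).Valid := by
  refine valid_par ?_ (blockMoves_pairwise n m)
  intro C hC
  obtain ⟨e, -, rfl⟩ := List.mem_map.1 hC
  exact (fanReg_block m e).valid_copySwap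

theorem mem_qubits_setupLast {n m : ℕ} {q : Qubit}
    (h : q ∈ Circuit.qubits (fanCopies n m ++ blockMoves n m)) :
    (∃ j < m, q = .data (m - 1 - j)) ∨ (∃ e < 2 ^ (n - m) - 1, (∃ j < m, ∃ i < 2 ^ j,
      q = .blockAddr e j i) ∨ ∃ k < 2 ^ m, q = .buf e k) := by
  rw [Circuit.qubits_append, List.mem_append] at h
  rcases h with h | h
  · obtain ⟨j, hj, i, hi, rfl⟩ := mem_qubits_fanCopies h
    unfold addrFan
    split_ifs with h0
    · exact .inl ⟨j, hj, rfl⟩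
    · exact .inr ⟨i - 1, by omega, .inl ⟨j, hj, 0, Nat.two_pow_pos j, rfl⟩⟩
  · exact .inr (mem_qubits_blockMoves h)

theorem setupOps_pairwise (n m : ℕ) : (setupOps n m).Pairwise Disj := by
  rw [setupOps, List.pairwise_append, List.pairwise_append]
  refine ⟨⟨?_, ?_, ?_⟩, List.pairwise_singleton _ _, ?_⟩
  · refine pairwise_range_map fun k _ k' _ hne q hq hq' => ?_
    obtain ⟨i, -, rfl⟩ := mem_qubits_copy hq
    obtain ⟨i', -, h⟩ := mem_qubits_copy hq'
    exact hne (Qubit.sel.inj h).1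
  · refine pairwise_range_map fun k _ k' _ hne q hq hq' => ?_
    obtain ⟨i, -, rfl⟩ := mem_qubits_copy hq
    obtain ⟨i', -, h⟩ := mem_qubits_copy hq'
    exact hne (Qubit.flag.inj h).1
  · intro C hC D hD q hq hq'
    obtain ⟨k, -, rfl⟩ := List.mem_map.1 hC
    obtain ⟨e, -, rfl⟩ := List.mem_map.1 hD
    obtain ⟨i, -, rfl⟩ := mem_qubits_copy hq
    obtain ⟨i', -, h⟩ := mem_qubits_copy hq'
    exact Qubit.noConfusion h
  · intro C hC D hD q hq hq'
    rw [List.mem_singleton.1 hD] at hq'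
    have h1 := mem_qubits_setupLast hq'
    rcases List.mem_append.1 hC with hC | hC <;> obtain ⟨k, -, rfl⟩ := List.mem_map.1 hC <;>
      obtain ⟨i, -, rfl⟩ := mem_qubits_copy hq <;> simp at h1

theorem valid_setup (n m : ℕ) : (setup n m).Valid := by
  rw [setup_eq, Circuit.valid_append, Circuit.valid_append]
  refine ⟨⟨?_, (fanReg_addr m).valid_copySwap⟩, valid_parEnd ?_ (setupOps_pairwise n m)⟩
  · simp [Circuit.Valid, Layer.qubits, Gate.qubits]
  · intro C hC
    rw [setupOps, List.mem_append, List.mem_append, List.mem_singleton] at hC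
    rcases hC with (hC | hC) | rfl
    · obtain ⟨k, -, rfl⟩ := List.mem_map.1 hC
      exact valid_copy fun i _ j _ h => (Qubit.sel.inj h).2
    · obtain ⟨k, -, rfl⟩ := List.mem_map.1 hC
      exact valid_copy fun i _ j _ h => (Qubit.flag.inj h).2
    · exact Circuit.valid_append.2 ⟨valid_fanCopies n m, valid_blockMoves n m⟩

/-- The bit strings between the parts of the SP+CSP circuit, where only data qubits, angle qubits,
flags, and the first qubits of the blocks of the buffer are in use. -/
def mkBits (dat ang bf fl : ℕ → Fin 2) : Qubit → Fin 2
  | .data q => dat q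
  | .dataCopy _ _ => 0
  | .angle e => ang e
  | .flag e k => if k = 0 then fl e else 0
  | .addr _ _ => 0
  | .blockAddr _ _ _ => 0
  | .sel _ _ => 0
  | .buf e k => if k = 0 then bf e else 0

/-- The bit strings in the course of Setup, for the address `k`: after the loading of the address
(`s = 1`), after the copying of the address bits (`s = 2`), and at the end (`s = 3`). -/
def setupBits (n m k s : ℕ) (dat ang bf fl : ℕ → Fin 2) : Qubit → Fin 2
  | .data q => dat q
  | .dataCopy _ _ => 0
  | .angle e => ang e
  | .flag e x => if x = 0 ∨ s = 3 ∧ e < 2 ^ (n - m) - 1 ∧ x < 2 ^ m then fl e else 0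
  | .addr j i => if j < m ∧ 1 ≤ i ∧ i < 2 ^ j then nbit k j else 0
  | .blockAddr e j i => if 2 ≤ s ∧ e < 2 ^ (n - m) - 1 ∧ j < m ∧ (i = 0 ∨ s = 3 ∧ i < 2 ^ j) then
      nbit k j else 0
  | .sel x l => if x = k ∧ (l = 0 ∨ s = 3 ∧ l < 2 ^ (n - m) - 1) then 1 else 0
  | .buf e x => if x = (if s = 3 ∧ e < 2 ^ (n - m) - 1 then k else 0) then bf e else 0

end

section

theorem mem_copy {Q : Type} {c i : ℕ} {R : ℕ → Q} (hi : i < c) (hi0 : i ≠ 0) :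
    R i ∈ Circuit.qubits (copy R c) := by
  have h3 : i < 2 ^ (Nat.log 2 i + 1) := Nat.lt_pow_succ_log_self (by norm_num) i
  have h4 : 2 ^ Nat.log 2 i ≤ i := Nat.pow_log_le_self 2 hi0
  have h5 := mem_copyLayer (R := R) hi h4 h3
  obtain ⟨L, hL, hq⟩ := Circuit.mem_qubits.1 h5
  refine Circuit.mem_qubits.2 ⟨L, List.mem_flatMap.2 ⟨_, List.mem_range.2 ?_, hL⟩, hq⟩
  rw [Nat.lt_clog_iff_pow_lt (by norm_num)]
  omega

theorem mem_par_copySwapOps {Q : Type} {R : ℕ → ℕ → Q} {S : ℕ → Q} {m i : ℕ} (hi : i < m) {q : Q}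
    {C : Circuit Q} (hC : C ∈ copySwapOps R S m i) (hq : q ∈ C.qubits) :
    q ∈ (copySwap R S m).qubits := by
  obtain ⟨L, hL, hq⟩ := Circuit.mem_qubits.1 (mem_qubits_par.2 ⟨C, hC, hq⟩)
  exact Circuit.mem_qubits.2 ⟨L, List.mem_flatMap.2 ⟨i, List.mem_range.2 hi, hL⟩, hq⟩

theorem control_mem_copySwap {Q : Type} {R : ℕ → ℕ → Q} {S : ℕ → Q} {m j i : ℕ} (hj : j < m)
    (hi : i < 2 ^ j) : R j i ∈ (copySwap R S m).qubits :=
  mem_par_copySwapOps hj List.mem_cons_self (control_mem_cs hi)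

theorem target_mem_copySwap {Q : Type} {R : ℕ → ℕ → Q} {S : ℕ → Q} {m x : ℕ} (hm : m ≠ 0)
    (hx : x < 2 ^ m) : S x ∈ (copySwap R S m).qubits :=
  mem_par_copySwapOps (i := m - 1) (by omega) List.mem_cons_self
    (target_mem_cs (by rwa [show m - 1 + 1 = m by omega]))

theorem setup_load (n : ℕ) {m k : ℕ} (hk : k < 2 ^ m) {dat : ℕ → Fin 2}
    (hdat : ∀ j < m, dat (m - 1 - j) = nbit k j) (ang bf fl : ℕ → Fin 2) :
    Maps ([[.u gX (.sel 0 0)]] ++ copySwap (addrReg m) (fun k => Qubit.sel k 0) m)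
      (mkBits dat ang bf fl) (setupBits n m k 1 dat ang bf fl) := by
  have h1 : Maps [[.u gX (Qubit.sel 0 0)]] (mkBits dat ang bf fl)
      (Function.update (mkBits dat ang bf fl) (Qubit.sel 0 0) 1) := by
    refine (maps_gX (Qubit.sel 0 0) _).of_eq ?_
    simp [mkBits]
  refine h1.append (MapsOn.maps ((fanReg_addr m).copySwap_mapsOn hk (s := 1) ?_ ?_ ?_ ?_) ?_)
  · intro j hj i
    by_cases hi : i = 0
    · simp [addrReg, hi, mkBits, hdat j hj]
    · simp [addrReg, hi, mkBits]
  · intro x _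
    by_cases hx : x = 0
    · simp [hx]
    · simp [hx, mkBits]
  · intro j hj i hi
    by_cases hi0 : i = 0
    · simp [addrReg, hi0, setupBits, hdat j hj]
    · have : 1 ≤ i := by omega
      simp [addrReg, hi0, setupBits, hj, hi, this]
  · intro x _
    simp [setupBits]
  -- For `m = 0` CopySwap is empty and touches nothing; the initial `X` gate has then already
  -- selected the only address.
  · have hS : ∀ x < 2 ^ m, Qubit.sel x 0 ∈
        (copySwap (addrReg m) (fun k => Qubit.sel k 0) m).qubits ∨ m = 0 := by
      intro x hx
      by_cases hm : m = 0
      · exact .inr hm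
      · exact .inl (target_mem_copySwap (S := fun k => Qubit.sel k 0) hm hx)
    intro q hq
    cases q with
    | data q => simp [setupBits, mkBits]
    | dataCopy q i => simp [setupBits, mkBits]
    | angle e => simp [setupBits, mkBits]
    | flag e x => simp [setupBits, mkBits]
    | blockAddr e j i => simp [setupBits, mkBits]
    | buf e x => simp [setupBits, mkBits]
    | addr j i =>
      simp only [setupBits, mkBits, ne_eq, reduceCtorEq, not_false_eq_true, Function.update_of_ne]
      rw [if_neg]
      rintro ⟨hj, hi, hi'⟩
      apply hq
      have h := control_mem_copySwap (R := addrReg m) (S := fun k => Qubit.sel k 0) hj hi'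
      rwa [addrReg, if_neg (by omega)] at h
    | sel x l =>
      simp only [setupBits]
      by_cases hl : l = 0
      · subst hl
        by_cases hm : m = 0
        · subst hm
          obtain rfl : k = 0 := by simpa using hk
          by_cases hx : x = 0
          · simp [hx]
          · simp [hx, mkBits]
        · have hx : ¬ x < 2 ^ m := fun hx => (hS x hx).elim hq hm
          have : 0 < 2 ^ m := Nat.two_pow_pos m
          rw [if_neg (by omega), Function.update_of_ne]
          · rfl
          · intro h
            have := (Qubit.sel.inj h).1
            omega
      · rw [if_neg (by omega), Function.update_of_ne]
        · rfl
        · intro h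
          exact hl (Qubit.sel.inj h).2

/-- `addrFan` sends copy `i ≥ 1` of bit `j` to block `i - 1`, so a register of size `2^(n-m)`
supplies each of the `2^(n-m) - 1` blocks with one copy. -/
theorem fanCopies_maps (n : ℕ) {m k : ℕ} {dat : ℕ → Fin 2}
    (hdat : ∀ j < m, dat (m - 1 - j) = nbit k j) (ang bf fl : ℕ → Fin 2) :
    Maps (fanCopies n m) (setupBits n m k 1 dat ang bf fl) (setupBits n m k 2 dat ang bf fl) := by
  refine MapsOn.maps (MapsOn.par (fanCopies_pairwise n m) fun C hC => ?_) fun q hq => ?_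
  · obtain ⟨j, hj, rfl⟩ := List.mem_map.1 hC
    rw [List.mem_range] at hj
    refine mapsOn_copy (fun i _ i' _ h => (addrFan_injective hj hj h).2) ?_ ?_ <;> intro i hi
    · by_cases hi0 : i = 0
      · simp [hi0]
      · simp [addrFan, hi0, setupBits]
    · by_cases hi0 : i = 0
      · simp [addrFan, hi0, setupBits]
      · have : i - 1 < 2 ^ (n - m) - 1 := by omega
        simp [addrFan, hi0, setupBits, hdat j hj, this, hj]
  · cases q with
    | blockAddr e j i =>
      simp only [setupBits]
      rw [if_neg, if_neg (by omega)]
      rintro ⟨-, he, hj, hi⟩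
      obtain rfl : i = 0 := by omega
      apply hq
      refine mem_qubits_par.2 ⟨_, List.mem_map.2 ⟨j, List.mem_range.2 hj, rfl⟩, ?_⟩
      have : addrFan m j (e + 1) = .blockAddr e j 0 := by simp [addrFan]
      rw [← this]
      exact mem_copy (by omega) (by omega)
    | _ => simp [setupBits]

theorem blockMoves_maps (n : ℕ) {m k : ℕ} (hk : k < 2 ^ m) (dat ang bf fl : ℕ → Fin 2) :
    MapsOn (blockMoves n m) (setupBits n m k 2 dat ang bf fl)
      (setupBits n m k 3 dat ang bf fl) := by
  refine MapsOn.par (blockMoves_pairwise n m) fun C hC => ?_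
  obtain ⟨e, he, rfl⟩ := List.mem_map.1 hC
  rw [List.mem_range] at he
  refine (fanReg_block m e).copySwap_mapsOn hk (s := bf e) ?_ ?_ ?_ ?_
  · intro j hj i
    simp [setupBits, hj, he]
  · intro x _
    simp [setupBits]
  · intro j hj i hi
    simp [setupBits, hj, he, hi]
  · intro x _
    simp [setupBits, he]

/-- Setup maps the basis states with address `k` as described by `setupBits`. -/
theorem setup_maps (n : ℕ) {m k : ℕ} (hk : k < 2 ^ m) {dat : ℕ → Fin 2}
    (hdat : ∀ j < m, dat (m - 1 - j) = nbit k j) (ang bf fl : ℕ → Fin 2) :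
    Maps (setup n m) (mkBits dat ang bf fl) (setupBits n m k 3 dat ang bf fl) := by
  rw [setup_eq]
  refine (setup_load n hk hdat ang bf fl).append ?_
  -- These two circuits share the qubits `blockAddr e j 0`, so they form one sequential member of
  -- the parallel family and are treated together.
  have hlast : MapsOn (fanCopies n m ++ blockMoves n m) (setupBits n m k 1 dat ang bf fl)
      (setupBits n m k 3 dat ang bf fl) := by
    have h1 := blockMoves_maps n hk dat ang bf fl
    refine Maps.mapsOn' ((fanCopies_maps n hdat ang bf fl).append h1) fun q hq => ?_
    split_ifs with h2
    · rfl
    · rw [Circuit.qubits_append, List.mem_append] at hq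
      obtain ⟨j, hj, i, hi, rfl⟩ := mem_qubits_fanCopies (hq.resolve_right h2)
      by_cases hi0 : i = 0
      · simp [addrFan, hi0, setupBits]
      · exfalso
        apply h2
        rw [addrFan, if_neg hi0]
        refine mem_qubits_par.2 ⟨_, List.mem_map.2 ⟨i - 1, List.mem_range.2 (by omega), rfl⟩, ?_⟩
        exact control_mem_copySwap (R := fun j i' => Qubit.blockAddr (i - 1) j i') hj
          (Nat.two_pow_pos j)
  refine MapsOn.maps (MapsOn.parEnd (setupOps_pairwise n m) fun C hC => ?_) fun q hq => ?_
  · rw [setupOps, List.mem_append, List.mem_append, List.mem_singleton] at hC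
    rcases hC with (hC | hC) | rfl
    · obtain ⟨x, -, rfl⟩ := List.mem_map.1 hC
      refine mapsOn_copy (fun i _ j _ h => (Qubit.sel.inj h).2) ?_ ?_ <;> intro l hl
      · by_cases hl0 : l = 0
        · simp [hl0]
        · simp [setupBits, hl0]
      · simp [setupBits, hl]
    · obtain ⟨e, he, rfl⟩ := List.mem_map.1 hC
      rw [List.mem_range] at he
      refine mapsOn_copy (fun i _ j _ h => (Qubit.flag.inj h).2) ?_ ?_ <;> intro x hx
      · by_cases hx0 : x = 0
        · simp [hx0]
        · simp [setupBits, hx0]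
      · simp [setupBits, hx, he]
    · exact hlast
  · rw [mem_qubits_parEnd] at hq
    have h3 : q ∉ Circuit.qubits (fanCopies n m ++ blockMoves n m) := fun h3 =>
      hq ⟨_, by simp [setupOps], h3⟩
    rw [Circuit.qubits_append, List.mem_append, not_or] at h3
    cases q with
    | sel x l =>
      simp only [setupBits]
      by_cases hl0 : l = 0
      · simp [hl0]
      · rw [if_neg, if_neg (by omega)]
        rintro ⟨rfl, h⟩
        have hl : l < 2 ^ (n - m) - 1 := by omega
        refine hq ⟨_, ?_, mem_copy (R := fun l => Qubit.sel x l) hl hl0⟩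
        exact List.mem_append_left _ (List.mem_append_left _
          (List.mem_map.2 ⟨x, List.mem_range.2 hk, rfl⟩))
    | flag e x =>
      simp only [setupBits]
      by_cases hx0 : x = 0
      · simp [hx0]
      · rw [if_neg, if_neg (by omega)]
        rintro h
        have hx : e < 2 ^ (n - m) - 1 ∧ x < 2 ^ m := by omega
        refine hq ⟨_, ?_, mem_copy (R := fun l => Qubit.flag e l) hx.2 hx0⟩
        exact List.mem_append_left _ (List.mem_append_right _
          (List.mem_map.2 ⟨e, List.mem_range.2 hx.1, rfl⟩))
    | blockAddr e j i =>
      simp only [setupBits]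
      rw [if_neg, if_neg (by omega)]
      rintro ⟨-, he, hj, hi⟩
      apply h3.2
      refine mem_qubits_par.2 ⟨_, List.mem_map.2 ⟨e, List.mem_range.2 he, rfl⟩, ?_⟩
      refine control_mem_copySwap (R := fun j i => Qubit.blockAddr e j i) hj ?_
      have := Nat.two_pow_pos j
      omega
    | buf e x =>
      simp only [setupBits]
      by_cases he : e < 2 ^ (n - m) - 1
      · by_cases hm : m = 0
        · subst hm
          obtain rfl : k = 0 := by simpa using hk
          simp
        · have hx : ¬ x < 2 ^ m := by
            intro hx
            apply h3.2
            refine mem_qubits_par.2 ⟨_, List.mem_map.2 ⟨e, List.mem_range.2 he, rfl⟩, ?_⟩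
            exact target_mem_copySwap (S := fun k => Qubit.buf e k) hm hx
          have := Nat.two_pow_pos m
          rw [if_neg, if_neg] <;> split_ifs <;> omega
      · simp [he]
    | _ => simp [setupBits]

end

/-! ### Controlled rotations and the action of LOADF. -/

section

variable {Q : Type}

/-! ### Controlled rotations -/

/-- On `Fin 2` the shift of indices by `1` is multiplication by `X`. Since `X R(-θ/2) X = R(θ/2)`,
the rotations cancel without the flips and add up to `R(θ)` with them. -/
theorem gRy_conj (θ : ℝ) : (∀ i j, ∑ k, (gRy (θ / 2)).1 i k * (gRy (-θ / 2)).1 k j =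
      if i = j then 1 else 0) ∧
    ∀ i j, ∑ k, (gRy (θ / 2)).1 i k * (gRy (-θ / 2)).1 (k + 1) (j + 1) = (gRy θ).1 i j := by
  have e : -θ / 2 / 2 = -(θ / 2 / 2) := by ring
  have h1 : ((Real.cos (θ / 2 / 2) : ℝ) : ℂ) * (Real.cos (θ / 2 / 2) : ℝ)
      + (Real.sin (θ / 2 / 2) : ℝ) * (Real.sin (θ / 2 / 2) : ℝ) = 1 := by
    rw [← Complex.ofReal_mul, ← Complex.ofReal_mul, ← Complex.ofReal_add, ← sq, ← sq,
      Real.cos_sq_add_sin_sq]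
    norm_num
  have h2 : ((Real.cos (θ / 2) : ℝ) : ℂ) = (Real.cos (θ / 2 / 2) : ℝ) * (Real.cos (θ / 2 / 2) : ℝ)
      - (Real.sin (θ / 2 / 2) : ℝ) * (Real.sin (θ / 2 / 2) : ℝ) := by
    rw [← Complex.ofReal_mul, ← Complex.ofReal_mul, ← Complex.ofReal_sub, ← Real.cos_add,
      add_halves]
  have h3 : ((Real.sin (θ / 2) : ℝ) : ℂ) = 2 * ((Real.sin (θ / 2 / 2) : ℝ) *
      (Real.cos (θ / 2 / 2) : ℝ)) := by
    rw [← mul_assoc, ← Complex.ofReal_ofNat, ← Complex.ofReal_mul, ← Complex.ofReal_mul,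
      ← Real.sin_two_mul, mul_div_cancel₀ _ (two_ne_zero)]
  constructor <;> intro i j <;> fin_cases i <;> fin_cases j <;>
    simp [Fin.sum_univ_two, gRy, e, -Complex.ofReal_cos, -Complex.ofReal_sin] <;>
    first | linear_combination h1 | linear_combination -h2 | linear_combination h3 |
      linear_combination -h3 | ring

theorem gRz_conj (θ : ℝ) : (∀ i j, ∑ k, (gRz (θ / 2)).1 i k * (gRz (-θ / 2)).1 k j =
      if i = j then 1 else 0) ∧
    ∀ i j, ∑ k, (gRz (θ / 2)).1 i k * (gRz (-θ / 2)).1 (k + 1) (j + 1) = (gRz θ).1 i j := by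
  constructor <;> intro i j <;> fin_cases i <;> fin_cases j <;>
    simp [Fin.sum_univ_two, gRz, gDiag, ← Complex.exp_add]
  · rw [← Complex.exp_zero]
    ring_nf
  · rw [← Complex.exp_zero]
    ring_nf
  · ring_nf
  · ring_nf

variable [DecidableEq Q]

theorem run_u_ket (U : U2) (q : Q) (b : Q → Fin 2) :
    Circuit.run [[.u U q]] (ket b) = ∑ v, U.1 v (b q) • ket (Function.update b q v) :=
  apply_u_ket U q b

/-- `F` flips the target exactly if `κ = 1`, so the four parts compose to `B A` or to `B X A X`.
With `F` a CNOT or a Toffoli gate this covers all controlled rotations at once. -/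
theorem run_sandwich {F : Circuit Q} {t : Q} {A B U : U2} {β : Q → Fin 2} {κ : Fin 2}
    (hF : ∀ v, Maps F (Function.update β t v) (Function.update β t (v + κ)))
    (h0 : ∀ i j, ∑ k, B.1 i k * A.1 k j = if i = j then 1 else 0)
    (h1 : ∀ i j, ∑ k, B.1 i k * A.1 (k + 1) (j + 1) = U.1 i j) :
    Circuit.run (F ++ [[.u A t]] ++ F ++ [[.u B t]]) (ket β) =
      if κ = 1 then ∑ v, U.1 v (β t) • ket (Function.update β t v) else ket β := by
  have h2 : Circuit.run (F ++ [[.u A t]] ++ F ++ [[.u B t]]) (ket β) =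
      ∑ w, (∑ v, B.1 w (v + κ) * A.1 v (β t + κ)) • ket (Function.update β t w) := by
    have hβ := hF (β t)
    rw [Function.update_eq_self] at hβ
    rw [Circuit.run_append, Circuit.run_append, Circuit.run_append, hβ, run_u_ket,
      Circuit.run_sum]
    simp only [Circuit.run_smul, Function.update_idem, Function.update_self]
    rw [Circuit.run_sum]
    simp only [Circuit.run_smul, fun v => show F.run (ket (Function.update β t v)) = _ from hF v,
      run_u_ket, Function.update_idem, Function.update_self, Finset.smul_sum, smul_smul,
      Finset.sum_smul]
    rw [Finset.sum_comm]
    simp only [mul_comm]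
  rw [h2]
  rcases fin2_cases κ with rfl | rfl
  · simp [h0]
  · rw [if_pos rfl]
    refine Finset.sum_congr rfl fun w _ => ?_
    rw [← h1 w (β t)]
    congr 1
    rw [Fin.sum_univ_two, Fin.sum_univ_two, add_comm]
    rfl

theorem run_cRy (θ : ℝ) {c t : Q} (h : c ≠ t) (β : Q → Fin 2) :
    Circuit.run (cRy θ c t) (ket β) = if β c = 1 then
      ∑ v, (gRy θ).1 v (β t) • ket (Function.update β t v) else ket β := by
  refine run_sandwich (F := [[.cnot c t]]) (κ := β c) (fun v => ?_) (gRy_conj θ).1 (gRy_conj θ).2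
  refine (maps_cnot h _).of_eq ?_
  simp [h]

theorem toffoli_update {a b t : Q} (hab : a ≠ b) (hat : a ≠ t) (hbt : b ≠ t) (β : Q → Fin 2)
    (v : Fin 2) : Maps (toffoli a b t) (Function.update β t v)
      (Function.update β t (v + β a * β b)) := by
  refine (maps_toffoli hab hat hbt _).of_eq ?_
  simp [hat, hbt]

theorem fin2_mul_eq_one {x y : Fin 2} : x * y = 1 ↔ x = 1 ∧ y = 1 := by revert x y; decide

theorem run_ccRy (θ : ℝ) {a b t : Q} (hab : a ≠ b) (hat : a ≠ t) (hbt : b ≠ t) (β : Q → Fin 2) :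
    Circuit.run (ccRy θ a b t) (ket β) = if β a = 1 ∧ β b = 1 then
      ∑ v, (gRy θ).1 v (β t) • ket (Function.update β t v) else ket β := by
  have := run_sandwich (κ := β a * β b) (toffoli_update hab hat hbt β) (gRy_conj θ).1
    (gRy_conj θ).2
  simp only [fin2_mul_eq_one] at this
  exact this

theorem run_ccRz (θ : ℝ) {a b t : Q} (hab : a ≠ b) (hat : a ≠ t) (hbt : b ≠ t) (β : Q → Fin 2) :
    Circuit.run (ccRz θ a b t) (ket β) = if β a = 1 ∧ β b = 1 then
      (gRz θ).1 (β t) (β t) • ket β else ket β := by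
  have := run_sandwich (κ := β a * β b) (toffoli_update hab hat hbt β) (gRz_conj θ).1
    (gRz_conj θ).2
  simp only [fin2_mul_eq_one] at this
  rw [ccRz, this]
  congr 1
  rw [Fin.sum_univ_two]
  rcases fin2_cases (β t) with h | h
  · have : Function.update β t 0 = β := by rw [← h]; simp
    simp [h, gRz, gDiag, this]
  · have : Function.update β t 1 = β := by rw [← h]; simp
    simp [h, gRz, gDiag, this]

/-- For control `1` the rotation contributes `exp (∓iα/2)` to `b = 0, 1`; the phase `α/2` on the
control cancels the first value and completes the second one to `exp (iα)`. -/
theorem run_ccPhase (α : ℝ) {a b : Q} (h : a ≠ b) (β : Q → Fin 2) :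
    Circuit.run (ccPhase α a b) (ket β) = if β a = 1 ∧ β b = 1 then
      Complex.exp (α * Complex.I) • ket β else ket β := by
  have h2 : β b + β a + β a = β b := by rw [add_assoc, fin2_add_self, add_zero]
  simp only [ccPhase, Circuit.run_cons, Layer.apply_cons, Layer.apply_nil, Circuit.run_nil,
    apply_cnot_ket h, gRz, gPhase, apply_gDiag_ket, apply_smul_ket, Function.update_self,
    Function.update_of_ne h, Function.update_idem, h2, Function.update_eq_self, smul_smul]
  rcases fin2_cases (β a) with ha | ha <;> rcases fin2_cases (β b) with hb | hb <;>
    simp only [ha, hb, if_true, ← Complex.exp_add, add_zero, zero_add, fin2_add_self, one_ne_zero,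
      if_false, zero_ne_one, and_self, and_false, false_and] <;> push_cast
  · rw [← one_smul ℂ (ket β), smul_smul, mul_one, ← Complex.exp_zero]
    ring_nf
  · rw [← one_smul ℂ (ket β), smul_smul, mul_one, ← Complex.exp_zero]
    ring_nf
  · rw [← one_smul ℂ (ket β), smul_smul, mul_one, ← Complex.exp_zero]
    ring_nf
  · ring_nf

/-- The matrix of a rotation about the `y`-axis, followed by one about the `z`-axis and a phase. -/
def loadMatrix (θ δ α : ℝ) (v j : Fin 2) : ℂ :=
  Complex.exp (α * Complex.I) * (gRz δ).1 v v * (gRy θ).1 v j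

/-- The doubly controlled operation that loads one qubit of the buffer. -/
def loadGate (θ δ α : ℝ) (a b t : Q) : Circuit Q :=
  ccRy θ a b t ++ ccRz δ a b t ++ ccPhase α a b

theorem run_loadGate (θ δ α : ℝ) {a b t : Q} (hab : a ≠ b) (hat : a ≠ t) (hbt : b ≠ t)
    (β : Q → Fin 2) : Circuit.run (loadGate θ δ α a b t) (ket β) = if β a = 1 ∧ β b = 1 then
      ∑ v, loadMatrix θ δ α v (β t) • ket (Function.update β t v) else ket β := by
  rw [loadGate, Circuit.run_append, Circuit.run_append, run_ccRy θ hab hat hbt]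
  split_ifs with h
  · rw [Circuit.run_sum, Circuit.run_sum]
    refine Finset.sum_congr rfl fun v _ => ?_
    rw [Circuit.run_smul, Circuit.run_smul, run_ccRz δ hab hat hbt, if_pos (by simpa [hat, hbt]),
      Circuit.run_smul, run_ccPhase α hab, if_pos (by simpa [hat, hbt]), smul_smul, smul_smul,
      Function.update_self, loadMatrix]
    congr 1
    ring
  · rw [run_ccRz δ hab hat hbt, if_neg h, run_ccPhase α hab, if_neg h]

/-! ### Products of operations on single qubits -/

/-- The sequence `a` with the first `N` terms replaced by `f`. -/
def overwrite {N : ℕ} (f : Fin N → Fin 2) (a : ℕ → Fin 2) (e : ℕ) : Fin 2 :=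
  if h : e < N then f ⟨e, h⟩ else a e

theorem overwrite_snoc {N : ℕ} (f : Fin N → Fin 2) (v : Fin 2) (a : ℕ → Fin 2) :
    overwrite (Fin.snoc (α := fun _ => Fin 2) f v) a = Function.update (overwrite f a) N v := by
  funext e
  rcases lt_trichotomy e N with h | rfl | h
  · have h1 : e < N + 1 := by omega
    simp [overwrite, h1, h, Fin.snoc, h.ne]
  · simp [overwrite, Fin.snoc]
  · have h1 : ¬ e < N + 1 := by omega
    have h2 : ¬ e < N := by omega
    simp [overwrite, h1, h2, h.ne']

/-- The tensor product expansion, one qubit at a time. Basis states are given by an arbitrary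
function `bb` of the bit sequence, so that it serves for the angle register as well as for the
buffer in its moved position. -/
theorem run_product {N : ℕ} {G : ℕ → Circuit Q} {bb : (ℕ → Fin 2) → Q → Fin 2}
    {M : ℕ → Fin 2 → Fin 2 → ℂ}
    (h : ∀ e < N, ∀ a, (G e).run (ket (bb a)) =
      ∑ v, M e v (a e) • ket (bb (Function.update a e v))) (a : ℕ → Fin 2) :
    Circuit.run ((List.range N).map G).flatten (ket (bb a)) =
      ∑ f : Fin N → Fin 2, (∏ e : Fin N, M e (f e) (a e)) • ket (bb (overwrite f a)) := by
  induction N with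
  | zero =>
    have : ∀ f : Fin 0 → Fin 2, overwrite f a = a := fun f => by
      funext e
      simp [overwrite]
    simp [Circuit.run_nil, this]
  | succ N ih =>
    rw [List.range_succ, List.map_append, List.flatten_append, Circuit.run_append,
      ih fun e he => h e (by omega), Circuit.run_sum,
      ← (Fin.snocEquiv fun _ => Fin 2).sum_comp, Fintype.sum_prod_type_right]
    refine Finset.sum_congr rfl fun f _ => ?_
    have hN : overwrite f a N = a N := by simp [overwrite]
    simp only [List.map_singleton, List.flatten_singleton, Circuit.run_smul, h N (by omega),
      Finset.smul_sum, smul_smul, hN]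
    refine Finset.sum_congr rfl fun v _ => ?_
    rw [Fin.prod_univ_castSucc]
    simp [Fin.snocEquiv, overwrite_snoc]

/-- The part of LOADF between Setup and its inverse. -/
def loadOps (n m : ℕ) (θ δ α : ℕ → ℕ → ℝ) : List (Circuit Qubit) :=
  (List.range (2 ^ m)).flatMap fun k => (List.range (2 ^ (n - m) - 1)).map fun e =>
    loadGate (θ k e) (δ k e) (α k e) (.flag e k) (.sel k e) (.buf e k)

theorem loadf_eq (n m : ℕ) (θ δ α : ℕ → ℕ → ℝ) : loadf n m θ δ α =
    setup n m ++ par (loadOps n m θ δ α) ++ Circuit.dagger (setup n m) := rfl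

omit [DecidableEq Q] in
theorem mem_qubits_loadGate {θ δ α : ℝ} {a b t q : Q} :
    q ∈ (loadGate θ δ α a b t).qubits ↔ q = a ∨ q = b ∨ q = t := by
  rw [loadGate, Circuit.qubits_append, Circuit.qubits_append, List.mem_append, List.mem_append,
    mem_qubits_ccRy, mem_qubits_ccRz, mem_qubits_ccPhase]
  tauto

/-- Setup has given each pair `(k, e)` its own flag, its own selector and its own buffer position,
which is why all loading gates fit into one parallel layer. -/
theorem loadOps_pairwise (n m : ℕ) (θ δ α : ℕ → ℕ → ℝ) : (loadOps n m θ δ α).Pairwise Disj := by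
  rw [loadOps, List.pairwise_flatMap]
  constructor
  · intro k _
    refine pairwise_range_map fun e _ e' _ hne q hq hq' => ?_
    rw [mem_qubits_loadGate] at hq hq'
    rcases hq with rfl | rfl | rfl <;> simp at hq' <;> omega
  · refine List.Pairwise.imp ?_ List.nodup_range
    intro k k' hne C hC D hD q hq hq'
    obtain ⟨e, -, rfl⟩ := List.mem_map.1 hC
    obtain ⟨e', -, rfl⟩ := List.mem_map.1 hD
    rw [mem_qubits_loadGate] at hq hq'
    rcases hq with rfl | rfl | rfl <;> simp at hq' <;> omega

theorem valid_loadf (n m : ℕ) (θ δ α : ℕ → ℕ → ℝ) : (loadf n m θ δ α).Valid := by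
  rw [loadf_eq, Circuit.valid_append, Circuit.valid_append]
  refine ⟨⟨valid_setup n m, valid_par (fun C hC => ?_) (loadOps_pairwise n m θ δ α)⟩,
    (valid_setup n m).dagger⟩
  obtain ⟨k, -, hC⟩ := List.mem_flatMap.1 hC
  obtain ⟨e, -, rfl⟩ := List.mem_map.1 hC
  have h1 : Qubit.flag e k ≠ .sel k e := Qubit.noConfusion
  have h2 : Qubit.flag e k ≠ .buf e k := Qubit.noConfusion
  have h3 : Qubit.sel k e ≠ .buf e k := Qubit.noConfusion
  rw [loadGate, Circuit.valid_append, Circuit.valid_append]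
  exact ⟨⟨valid_ccRy h1 h2 h3, valid_ccRz h1 h2 h3⟩, valid_ccPhase h1⟩

/-- The matrix that LOADF applies to a qubit of the buffer with the flag `c`. -/
def flagMatrix (θ δ α : ℝ) (c v j : Fin 2) : ℂ :=
  if c = 1 then loadMatrix θ δ α v j else if v = j then 1 else 0

/-- Of all addresses only `k` has its selectors set, so the loading is a product over the nodes `e`
of one-qubit operations with the parameters of address `k`. -/
theorem run_loadOps {n m k : ℕ} (hk : k < 2 ^ m) (θ δ α : ℕ → ℕ → ℝ) (dat ang bf fl : ℕ → Fin 2) :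
    (par (loadOps n m θ δ α)).run (ket (setupBits n m k 3 dat ang bf fl)) =
      ∑ f : Fin (2 ^ (n - m) - 1) → Fin 2,
        (∏ e : Fin (2 ^ (n - m) - 1), flagMatrix (θ k e) (δ k e) (α k e) (fl e) (f e) (bf e)) •
          ket (setupBits n m k 3 dat ang (overwrite f bf) fl) := by
  have h1 : ∀ e k : ℕ, Qubit.flag e k ≠ .sel k e := fun _ _ => Qubit.noConfusion
  have h2 : ∀ e k : ℕ, Qubit.flag e k ≠ .buf e k := fun _ _ => Qubit.noConfusion
  have h3 : ∀ e k : ℕ, Qubit.sel k e ≠ .buf e k := fun _ _ => Qubit.noConfusion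
  -- For `x ≠ k` the control `sel x e` is `0`, and the gate acts trivially.
  have hother : ∀ x ≠ k, ∀ a, Circuit.run ((List.range (2 ^ (n - m) - 1)).map fun e =>
      loadGate (θ x e) (δ x e) (α x e) (Qubit.flag e x) (.sel x e) (.buf e x)).flatten
        (ket (setupBits n m k 3 dat ang a fl)) = ket (setupBits n m k 3 dat ang a fl) := by
    intro x hx a
    rw [show ket _ = _ from (Circuit.run_nil _).symm]
    induction List.range (2 ^ (n - m) - 1) with
    | nil => rfl
    | cons e E ih =>
      have hs : setupBits n m k 3 dat ang a fl (.sel x e) ≠ 1 := by simp [setupBits, hx]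
      rw [List.map_cons, List.flatten_cons, Circuit.run_append, Circuit.run_nil,
        run_loadGate _ _ _ (h1 e x) (h2 e x) (h3 e x), if_neg fun h => hs h.2]
      exact ih
  have hthis : ∀ a, Circuit.run ((List.range (2 ^ (n - m) - 1)).map fun e =>
      loadGate (θ k e) (δ k e) (α k e) (Qubit.flag e k) (.sel k e) (.buf e k)).flatten
        (ket (setupBits n m k 3 dat ang a fl)) = ∑ f : Fin (2 ^ (n - m) - 1) → Fin 2,
        (∏ e : Fin (2 ^ (n - m) - 1), flagMatrix (θ k e) (δ k e) (α k e) (fl e) (f e) (a e)) •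
          ket (setupBits n m k 3 dat ang (overwrite f a) fl) := by
    refine run_product (bb := fun a => setupBits n m k 3 dat ang a fl)
      (M := fun e => flagMatrix (θ k e) (δ k e) (α k e) (fl e)) fun e he a => ?_
    have hu : ∀ v, Function.update (setupBits n m k 3 dat ang a fl) (.buf e k) v =
        setupBits n m k 3 dat ang (Function.update a e v) fl := by
      intro v
      funext q
      by_cases hq : q = .buf e k
      · subst hq
        simp [setupBits, he]
      · rw [Function.update_of_ne hq]
        cases q with
        | buf e' x =>
          by_cases hee : e' = e
          · subst hee
            have : x ≠ k := fun h => hq (by rw [h])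
            simp [setupBits, he, this]
          · simp [setupBits, hee]
        | _ => rfl
    have hb : setupBits n m k 3 dat ang a fl (.buf e k) = a e := by simp [setupBits, he]
    have hf : setupBits n m k 3 dat ang a fl (.flag e k) = fl e := by simp [setupBits, he, hk]
    have hs : setupBits n m k 3 dat ang a fl (.sel k e) = 1 := by simp [setupBits, he]
    rw [run_loadGate _ _ _ (h1 e k) (h2 e k) (h3 e k), hb, hf, hs]
    simp only [hu, flagMatrix, and_true]
    split_ifs with h
    · rfl
    · simp
  rw [run_par (loadOps_pairwise n m θ δ α)]
  have hK : ∀ K, Circuit.run ((List.range K).flatMap fun k => (List.range (2 ^ (n - m) - 1)).map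
      fun e => loadGate (θ k e) (δ k e) (α k e) (Qubit.flag e k) (.sel k e) (.buf e k)).flatten
        (ket (setupBits n m k 3 dat ang bf fl)) = if k < K then
      ∑ f : Fin (2 ^ (n - m) - 1) → Fin 2,
        (∏ e : Fin (2 ^ (n - m) - 1), flagMatrix (θ k e) (δ k e) (α k e) (fl e) (f e) (bf e)) •
          ket (setupBits n m k 3 dat ang (overwrite f bf) fl)
      else ket (setupBits n m k 3 dat ang bf fl) := by
    intro K
    induction K with
    | zero => simp [Circuit.run_nil]
    | succ K ih =>
      rw [List.range_succ, List.flatMap_append, List.flatten_append, Circuit.run_append, ih,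
        List.flatMap_singleton]
      rcases lt_trichotomy k K with h | rfl | h
      · rw [if_pos h, if_pos (by omega), Circuit.run_sum]
        exact Finset.sum_congr rfl fun f _ => by rw [Circuit.run_smul, hother K (by omega)]
      · rw [if_neg (by omega), if_pos (by omega), hthis]
      · rw [if_neg (by omega), if_neg (by omega), hother K (by omega)]
  rw [loadOps, hK, if_pos hk]

/-- The gates between the set-up and its inverse change only the bits of the buffer, and
`setup_maps` holds for every content of the buffer; so each term of the sum is returned to the
compact registers. -/
theorem loadf_ket {n m k : ℕ} (hk : k < 2 ^ m) (θ δ α : ℕ → ℕ → ℝ) {dat : ℕ → Fin 2}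
    (hdat : ∀ j < m, dat (m - 1 - j) = nbit k j) (ang bf fl : ℕ → Fin 2) :
    (loadf n m θ δ α).run (ket (mkBits dat ang bf fl)) =
      ∑ f : Fin (2 ^ (n - m) - 1) → Fin 2,
        (∏ e : Fin (2 ^ (n - m) - 1), flagMatrix (θ k e) (δ k e) (α k e) (fl e) (f e) (bf e)) •
          ket (mkBits dat ang (overwrite f bf) fl) := by
  rw [loadf_eq, Circuit.run_append, Circuit.run_append,
    show (setup n m).run (ket _) = _ from setup_maps n hk hdat ang bf fl,
    run_loadOps hk, Circuit.run_sum]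
  refine Finset.sum_congr rfl fun f _ => ?_
  rw [Circuit.run_smul,
    show (Circuit.dagger (setup n m)).run (ket _) = _ from
      (setup_maps n hk hdat ang (overwrite f bf) fl).dagger (valid_setup n m)]

end

/-! ### Paths in the binary tree, and superpositions over its nodes. -/

section

/-! ### The binary tree of angles -/

theorem nodeLevel_node {s p : ℕ} (h : p < 2 ^ s) : nodeLevel (node s p) = s := by
  have h1 := Nat.two_pow_pos s
  rw [nodeLevel, node, Nat.log_eq_iff (Or.inr ⟨by norm_num, by omega⟩), pow_succ]
  omega

theorem nodePos_node {s p : ℕ} (h : p < 2 ^ s) : nodePos (node s p) = p := by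
  have h1 := Nat.two_pow_pos s
  rw [nodePos, nodeLevel_node h, node]
  omega

theorem pow_nodeLevel_le (e : ℕ) : 2 ^ nodeLevel e ≤ e + 1 := Nat.pow_log_le_self 2 (by omega)

theorem lt_pow_nodeLevel (e : ℕ) : e + 1 < 2 ^ (nodeLevel e + 1) :=
  Nat.lt_pow_succ_log_self (by norm_num) _

theorem nodePos_lt (e : ℕ) : nodePos e < 2 ^ nodeLevel e := by
  have h1 := pow_nodeLevel_le e
  have h2 := lt_pow_nodeLevel e
  rw [pow_succ] at h2
  rw [nodePos]
  omega

theorem node_level_pos (e : ℕ) : node (nodeLevel e) (nodePos e) = e := by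
  have h1 := pow_nodeLevel_le e
  have h2 := Nat.two_pow_pos (nodeLevel e)
  rw [node, nodePos]
  omega

theorem node_lt {r s p : ℕ} (hs : s < r) (hp : p < 2 ^ s) : node s p < 2 ^ r - 1 := by
  have h1 : 2 ^ (s + 1) ≤ 2 ^ r := Nat.pow_le_pow_right (by norm_num) hs
  rw [pow_succ] at h1
  rw [node]
  omega

theorem nodeLevel_lt {r e : ℕ} (h : e < 2 ^ r - 1) : nodeLevel e < r := by
  by_contra h1
  have h2 : 2 ^ r ≤ 2 ^ nodeLevel e := Nat.pow_le_pow_right (by norm_num) (by omega)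
  have h3 := pow_nodeLevel_le e
  omega

theorem node_inj {s p s' p' : ℕ} (hp : p < 2 ^ s) (hp' : p' < 2 ^ s') (h : node s p = node s' p') :
    s = s' ∧ p = p' := by
  have h1 := nodeLevel_node hp
  have h2 := nodePos_node hp
  rw [h] at h1 h2
  exact ⟨h1.symm.trans (nodeLevel_node hp'), h2.symm.trans (nodePos_node hp')⟩

/-- The node `e` lies on the path from the root to the leaf `i` of the tree of height `r`. -/
def OnPath (r i e : ℕ) : Prop := nodePos e = i / 2 ^ (r - nodeLevel e)

instance (r i e : ℕ) : Decidable (OnPath r i e) := inferInstanceAs (Decidable (_ = _))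

/-- The bit that the path to the leaf `i` chooses at the node `e`. -/
def pathBit (r i e : ℕ) : Fin 2 := nbit i (r - 1 - nodeLevel e)

theorem div_pow_lt {r i s : ℕ} (hi : i < 2 ^ r) (hs : s ≤ r) : i / 2 ^ (r - s) < 2 ^ s := by
  rw [Nat.div_lt_iff_lt_mul (Nat.two_pow_pos _), ← pow_add]
  rwa [Nat.add_sub_cancel' hs]

theorem onPath_node {r i s p : ℕ} (hp : p < 2 ^ s) :
    OnPath r i (node s p) ↔ p = i / 2 ^ (r - s) := by
  rw [OnPath, nodePos_node hp, nodeLevel_node hp]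

theorem pathBit_node {r i s p : ℕ} (hp : p < 2 ^ s) :
    pathBit r i (node s p) = nbit i (r - 1 - s) := by
  rw [pathBit, nodeLevel_node hp]

/-- The node on level `s` that is reached by following the bits `f`. -/
def descend (f : ℕ → Fin 2) : ℕ → ℕ
  | 0 => 0
  | s + 1 => 2 * descend f s + (f (node s (descend f s)) : ℕ)

theorem descend_eq_pre (f : ℕ → Fin 2) (s : ℕ) :
    descend f s = pre (fun s => f (node s (descend f s))) s := by
  induction s with
  | zero => rfl
  | succ s ih => rw [descend, pre, ← ih]

theorem div_pow_succ (i t : ℕ) : i / 2 ^ t = 2 * (i / 2 ^ (t + 1)) + (nbit i t : ℕ) := by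
  rw [val_nbit, pow_succ, ← Nat.div_div_eq_div_mul]
  omega

theorem pre_nbit {r i u : ℕ} (hi : i < 2 ^ r) (hu : u ≤ r) :
    pre (fun s => nbit i (r - 1 - s)) u = i / 2 ^ (r - u) := by
  induction u with
  | zero => simp [pre, Nat.div_eq_of_lt hi]
  | succ u ih =>
    rw [pre, ih (by omega), div_pow_succ i (r - (u + 1)), show r - (u + 1) + 1 = r - u by omega,
      show r - (u + 1) = r - 1 - u by omega]

/-- The bits `f` lead to the leaf `i`. -/
def LeadsTo (r i : ℕ) (f : ℕ → Fin 2) : Prop := ∀ s < r, f (node s (i / 2 ^ (r - s))) = nbit i (r - 1 - s)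

theorem leadsTo_iff {r i : ℕ} {f : ℕ → Fin 2} (hi : i < 2 ^ r) :
    LeadsTo r i f ↔ ∀ e < 2 ^ r - 1, OnPath r i e → f e = pathBit r i e := by
  constructor
  · intro h e he ho
    have := h _ (nodeLevel_lt he)
    rw [← ho, node_level_pos] at this
    exact this
  · intro h s hs
    have hp := div_pow_lt hi hs.le
    have := h _ (node_lt hs hp) ((onPath_node hp).2 rfl)
    rwa [pathBit_node hp] at this

/-- Every assignment of bits to the nodes reaches exactly one leaf. This partitions the assignments
and permits sorting a sum over them by leaves. -/
theorem leadsTo_iff_eq {r i : ℕ} {f : ℕ → Fin 2} (hi : i < 2 ^ r) :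
    LeadsTo r i f ↔ i = descend f r := by
  constructor
  · intro h
    have : ∀ s ≤ r, i / 2 ^ (r - s) = descend f s := by
      intro s
      induction s with
      | zero => simp [descend, Nat.div_eq_of_lt hi]
      | succ s ih =>
        intro hs
        rw [div_pow_succ, show r - (s + 1) + 1 = r - s by omega, descend, ← ih (by omega), h s hs,
          show r - 1 - s = r - (s + 1) by omega]
    simpa using this r le_rfl
  · rintro rfl s hs
    have h1 : ∀ s ≤ r, descend f r / 2 ^ (r - s) = descend f s := by
      intro s hs
      rw [descend_eq_pre f r, pre_div _ (by omega), show r - (r - s) = s by omega, descend_eq_pre f s]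
    rw [h1 s hs.le]
    refine Fin.ext ?_
    have h2 := div_pow_succ (descend f r) (r - 1 - s)
    rw [show r - 1 - s + 1 = r - s by omega, h1 s hs.le, show r - 1 - s = r - (s + 1) by omega,
      h1 (s + 1) hs, descend] at h2
    rw [show r - 1 - s = r - (s + 1) by omega]
    omega

theorem descend_lt (f : ℕ → Fin 2) (r : ℕ) : descend f r < 2 ^ r := by
  rw [descend_eq_pre]
  exact pre_lt _ _

/-- The bits `f`, with `0` on the path to the leaf `i`. -/
def clearPath (r i : ℕ) (f : ℕ → Fin 2) (e : ℕ) : Fin 2 :=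
  if e < 2 ^ r - 1 ∧ OnPath r i e then 0 else f e

/-- A path meets each level in exactly one node. -/
theorem prod_path {M : Type*} [CommMonoid M] {r i : ℕ} (hi : i < 2 ^ r) (w : ℕ → M) :
    ∏ e : Fin (2 ^ r - 1), (if OnPath r i e then w e else 1) =
      ∏ s ∈ Finset.range r, w (node s (i / 2 ^ (r - s))) := by
  rw [Fin.prod_univ_eq_prod_range (fun e => if OnPath r i e then w e else 1), ← Finset.prod_filter]
  symm
  refine Finset.prod_bij (fun s _ => node s (i / 2 ^ (r - s))) ?_ ?_ ?_ fun _ _ => rfl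
  · intro s hs
    rw [Finset.mem_range] at hs
    have hp := div_pow_lt hi hs.le
    exact Finset.mem_filter.2 ⟨Finset.mem_range.2 (node_lt hs hp), (onPath_node hp).2 rfl⟩
  · intro s hs s' hs' h
    rw [Finset.mem_range] at hs hs'
    exact (node_inj (div_pow_lt hi hs.le) (div_pow_lt hi hs'.le) h).1
  · intro e he
    rw [Finset.mem_filter, Finset.mem_range] at he
    exact ⟨nodeLevel e, Finset.mem_range.2 (nodeLevel_lt he.1), by rw [← he.2, node_level_pos]⟩

/-- A state that is a product over the nodes of the tree, in which the bits on the path that they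
define are cleared, is a sum over the leaves of product states. -/
theorem sum_clearPath {V : Type*} [AddCommGroup V] [Module ℂ V] (r : ℕ) (w : ℕ → Fin 2 → ℂ)
    (Φ : ℕ → (ℕ → Fin 2) → V) :
    ∑ f : Fin (2 ^ r - 1) → Fin 2, (∏ e : Fin (2 ^ r - 1), w e (f e)) •
      Φ (descend (overwrite f 0) r)
        (clearPath r (descend (overwrite f 0) r) (overwrite f 0)) =
    ∑ i ∈ Finset.range (2 ^ r),
      (∏ s ∈ Finset.range r, w (node s (i / 2 ^ (r - s))) (nbit i (r - 1 - s))) •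
        ∑ f : Fin (2 ^ r - 1) → Fin 2, (∏ e : Fin (2 ^ r - 1),
          if OnPath r i e then (if f e = 0 then 1 else 0) else w e (f e)) • Φ i (overwrite f 0) := by
  classical
  -- Each assignment contributes to precisely one leaf; after this the two sums can be exchanged.
  have h1 : ∀ f : Fin (2 ^ r - 1) → Fin 2, (∏ e : Fin (2 ^ r - 1), w e (f e)) •
      Φ (descend (overwrite f 0) r) (clearPath r (descend (overwrite f 0) r) (overwrite f 0)) =
      ∑ i ∈ Finset.range (2 ^ r), if LeadsTo r i (overwrite f 0) then
        (∏ e : Fin (2 ^ r - 1), w e (f e)) • Φ i (clearPath r i (overwrite f 0)) else 0 := by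
    intro f
    rw [Finset.sum_eq_single (descend (overwrite f 0) r)]
    · rw [if_pos ((leadsTo_iff_eq (descend_lt _ _)).2 rfl)]
    · intro i hi hne
      rw [if_neg fun h => hne ((leadsTo_iff_eq (Finset.mem_range.1 hi)).1 h)]
    · intro h
      exact absurd (Finset.mem_range.2 (descend_lt _ _)) h
  rw [Finset.sum_congr rfl fun f _ => h1 f, Finset.sum_comm]
  refine Finset.sum_congr rfl fun i hi => ?_
  rw [Finset.mem_range] at hi
  -- Adding the bits of the path to `i` on that path is a bijection of assignments. It turns the
  -- condition of leading to `i` into the condition of vanishing on the path, which is the form that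
  -- clearing leaves behind.
  have hinv : Function.Involutive fun (f : Fin (2 ^ r - 1) → Fin 2) e =>
      if OnPath r i e then f e + pathBit r i e else f e := by
    intro f
    funext e
    by_cases h : OnPath r i e
    · simp only [h, if_true]
      rw [add_assoc, fin2_add_self, add_zero]
    · simp only [h, if_false]
  rw [Finset.smul_sum, ← Equiv.sum_comp hinv.toPerm]
  refine Finset.sum_congr rfl fun f _ => ?_
  have hpath := prod_path hi fun e => (w e (pathBit r i e) : ℂ)
  have hbit : ∀ s ∈ Finset.range r, w (node s (i / 2 ^ (r - s)))
      (pathBit r i (node s (i / 2 ^ (r - s)))) =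
      w (node s (i / 2 ^ (r - s))) (nbit i (r - 1 - s)) := fun s hs => by
    rw [pathBit_node (div_pow_lt hi (Finset.mem_range.1 hs).le)]
  rw [← Finset.prod_congr rfl hbit, ← hpath, smul_smul, ← Finset.prod_mul_distrib]
  simp only [Function.Involutive.coe_toPerm]
  by_cases h : LeadsTo r i (overwrite (fun e : Fin (2 ^ r - 1) =>
      if OnPath r i e then f e + pathBit r i e else f e) 0)
  · refine (if_pos h).trans ?_
    rw [leadsTo_iff hi] at h
    have h2 : ∀ e : Fin (2 ^ r - 1), OnPath r i e → f e = 0 := by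
      intro e ho
      have := h e e.2 ho
      simp only [overwrite, e.2, dif_pos, ho, if_true] at this
      simpa using this
    congr 1
    · refine Finset.prod_congr rfl fun e _ => ?_
      by_cases ho : OnPath r i e
      · simp [ho, h2 e ho]
      · simp [ho]
    · congr 1
      funext e
      simp only [clearPath, overwrite]
      by_cases he : e < 2 ^ r - 1
      · by_cases ho : OnPath r i e
        · simp [he, ho, h2 ⟨e, he⟩ ho]
        · simp [he, ho]
      · simp [he]
  · refine (if_neg h).trans ?_
    rw [leadsTo_iff hi] at h
    push Not at h
    obtain ⟨e, he, ho, hne⟩ := h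
    -- An assignment that does not vanish on the path does not occur on the left, and has a
    -- vanishing factor on the right.
    have h2 : f ⟨e, he⟩ ≠ 0 := by
      intro h0
      simp [overwrite, he, ho, h0] at hne
    rw [Finset.prod_eq_zero (Finset.mem_univ (⟨e, he⟩ : Fin (2 ^ r - 1))) ?_, zero_smul]
    simp [ho, h2]

/-! ### SPF and FLAG on the registers of the circuit -/

/-- The string `dat` with the `r` bits of the number `i` from position `off` on. -/
def writeBits (off r i : ℕ) (dat : ℕ → Fin 2) (q : ℕ) : Fin 2 :=
  if off ≤ q ∧ q < off + r then nbit i (r - 1 - (q - off)) else dat q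

/-- The flags of the nodes off the path to the leaf `i`. -/
def offPath (r i e : ℕ) : Fin 2 := if e < 2 ^ r - 1 ∧ ¬ OnPath r i e then 1 else 0

/-- The flags of all nodes of the tree of height `r`. -/
def allFlags (r e : ℕ) : Fin 2 := if e < 2 ^ r - 1 then 1 else 0

theorem dataReg_inj {q i q' i' : ℕ} (h : dataReg q i = dataReg q' i') : q = q' ∧ i = i' := by
  unfold dataReg at h
  split_ifs at h <;> simp_all

theorem treeReg_of (off : ℕ) {r : ℕ} {f : ℕ → Qubit} (hf : Function.Injective f)
    (hne : ∀ q i e, dataReg q i ≠ f e) :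
    TreeReg r (fun q i => dataReg (off + q) i) (fun s p => f (node s p)) where
  injD q _ q' _ i i' h := by
    have := dataReg_inj h
    omega
  injA u _ u' _ p hp p' hp' h := node_inj hp hp' (hf h)
  ne q _ u _ p _ i := hne _ _ _

theorem treeReg_angle (off r : ℕ) :
    TreeReg r (fun q i => dataReg (off + q) i) (fun s p => .angle (node s p)) :=
  treeReg_of off (fun _ _ h => Qubit.angle.inj h) fun q i e => by
    unfold dataReg
    split_ifs <;> exact Qubit.noConfusion

theorem treeReg_flag (off r : ℕ) :
    TreeReg r (fun q i => dataReg (off + q) i) (fun s p => .flag (node s p) 0) :=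
  treeReg_of off (f := fun e => .flag e 0) (fun _ _ h => (Qubit.flag.inj h).1) fun q i e => by
    unfold dataReg
    split_ifs <;> exact Qubit.noConfusion

theorem treeReg_buf (off r : ℕ) :
    TreeReg r (fun q i => dataReg (off + q) i) (fun s p => .buf (node s p) 0) :=
  treeReg_of off (f := fun e => .buf e 0) (fun _ _ h => (Qubit.buf.inj h).1) fun q i e => by
    unfold dataReg
    split_ifs <;> exact Qubit.noConfusion

theorem mkBits_dataReg (dat ang bf fl : ℕ → Fin 2) (q i : ℕ) :
    mkBits dat ang bf fl (dataReg q i) = if i = 0 then dat q else 0 := by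
  unfold dataReg
  split_ifs <;> rfl

theorem clearPath_node {r i s p : ℕ} (hs : s < r) (hp : p < 2 ^ s) (f : ℕ → Fin 2) :
    clearPath r i f (node s p) = if p = i / 2 ^ (r - s) then 0 else f (node s p) := by
  simp [clearPath, node_lt hs hp, onPath_node hp]

theorem offPath_node {r i s p : ℕ} (hs : s < r) (hp : p < 2 ^ s) :
    offPath r i (node s p) = if p = i / 2 ^ (r - s) then 0 else 1 := by
  simp [offPath, node_lt hs hp, onPath_node hp]

theorem writeBits_of_ne {off r i : ℕ} {dat : ℕ → Fin 2} {q : ℕ}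
    (h : ∀ u < r, dataReg (off + u) 0 ≠ .data q) : writeBits off r i dat q = dat q := by
  refine if_neg fun h1 => h (q - off) (by omega) ?_
  simp [dataReg, h1.1]

theorem clearPath_of_ne {r i : ℕ} {f : ℕ → Fin 2} {e : ℕ}
    (h : ∀ u < r, ∀ p < 2 ^ u, node u p ≠ e) : clearPath r i f e = f e :=
  if_neg fun h1 => h _ (nodeLevel_lt h1.1) _ (nodePos_lt e) (node_level_pos e)

/-- `LeadsTo` is the consistency hypothesis of `TreeReg.spf_maps`: the bit at the node reached after
`s` steps is the `s`-th digit of `i`, most significant first. -/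
theorem spf_angle_maps {r i : ℕ} (hi : i < 2 ^ r) {dat f : ℕ → Fin 2} (hf : LeadsTo r i f)
    (hdat : ∀ u < r, dat u = 0) (bf fl : ℕ → Fin 2) :
    Maps (spf dataReg (fun s p => .angle (node s p)) r) (mkBits dat f bf fl)
      (mkBits (writeBits 0 r i dat) (clearPath r i f) bf fl) := by
  have hr := treeReg_angle 0 r
  simp only [zero_add] at hr
  refine hr.spf_maps (d := fun s => nbit i (r - 1 - s)) (a := fun s p => f (node s p)) ?_ ?_ ?_ ?_ ?_ ?_
  · intro u hu
    rw [pre_nbit hi hu.le]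
    exact (hf u hu).symm
  · intro q hq j
    rw [mkBits_dataReg, hdat q hq, ite_self]
  · intro u hu p hp
    rfl
  · intro q hq j
    simp [mkBits_dataReg, writeBits, hq]
  · intro u hu p hp
    rw [pre_nbit hi hu.le]
    exact clearPath_node hu hp f
  · intro x hD hA
    cases x with
    | data q => exact writeBits_of_ne fun u hu => by simpa using hD u hu 0
    | angle e => exact clearPath_of_ne fun u hu p hp h => hA u hu p hp (by rw [h])
    | _ => rfl

theorem spf_buf_maps {off r i : ℕ} (hi : i < 2 ^ r) {dat f : ℕ → Fin 2} (hf : LeadsTo r i f)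
    (hdat : ∀ u < r, dat (off + u) = 0) (ang fl : ℕ → Fin 2) :
    Maps (spf (fun q i => dataReg (off + q) i) (fun s p => .buf (node s p) 0) r)
      (mkBits dat ang f fl) (mkBits (writeBits off r i dat) ang (clearPath r i f) fl) := by
  refine (treeReg_buf off r).spf_maps (d := fun s => nbit i (r - 1 - s))
    (a := fun s p => f (node s p)) ?_ ?_ ?_ ?_ ?_ ?_
  · intro u hu
    rw [pre_nbit hi hu.le]
    exact (hf u hu).symm
  · intro q hq j
    rw [mkBits_dataReg, hdat q hq, ite_self]
  · intro u hu p hp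
    rfl
  · intro q hq j
    simp [mkBits_dataReg, writeBits, hq]
  · intro u hu p hp
    rw [pre_nbit hi hu.le]
    exact clearPath_node hu hp f
  · intro x hD hA
    cases x with
    | data q => exact writeBits_of_ne fun u hu => by simpa using hD u hu 0
    | buf e k =>
      by_cases hk : k = 0
      · subst hk
        exact clearPath_of_ne fun u hu p hp h => hA u hu p hp (by rw [h])
      · simp [mkBits, hk]
    | _ => rfl

theorem flag_flag_maps {off r i : ℕ} (hi : i < 2 ^ r) (dat ang bf : ℕ → Fin 2) :
    Maps (flag (fun q i => dataReg (off + q) i) (fun s p => .flag (node s p) 0) r)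
      (mkBits (writeBits off r i dat) ang bf (allFlags r))
      (mkBits (writeBits off r i dat) ang bf (offPath r i)) := by
  refine (treeReg_flag off r).flag_maps (d := fun s => nbit i (r - 1 - s)) ?_ ?_ ?_ ?_ ?_
  · intro q hq j
    simp [mkBits_dataReg, writeBits, hq]
  · intro u hu p hp
    simp [mkBits, allFlags, node_lt hu hp]
  · intro q hq j
    simp [mkBits_dataReg, writeBits, hq]
  · intro u hu p hp
    rw [pre_nbit hi hu.le]
    exact offPath_node hu hp
  · intro x hD hF
    cases x with
    | flag e k =>
      by_cases hk : k = 0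
      · subst hk
        have : ¬ e < 2 ^ r - 1 := fun he =>
          hF _ (nodeLevel_lt he) _ (nodePos_lt e) (by rw [node_level_pos])
        simp [mkBits, offPath, allFlags, this]
      · simp [mkBits, hk]
    | _ => rfl

theorem gX_flags_maps (r : ℕ) (dat ang bf : ℕ → Fin 2) :
    Maps [(List.range (2 ^ r - 1)).map fun e => .u gX (.flag e 0)] (mkBits dat ang bf 0)
      (mkBits dat ang bf (allFlags r)) := by
  refine (MapsOn.layer (pairwise_u List.nodup_range fun _ _ _ _ h => (Qubit.flag.inj h).1)
    fun e he => mapsOn_gX ?_).maps ?_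
  · simp [mkBits, allFlags, List.mem_range.1 he]
  · intro q hq
    rw [mem_qubits_u] at hq
    cases q with
    | flag e k =>
      by_cases hk : k = 0
      · subst hk
        have : ¬ e < 2 ^ r - 1 := fun he => hq ⟨e, List.mem_range.2 he, rfl⟩
        simp [mkBits, allFlags, this]
      · simp [mkBits, hk]
    | _ => rfl

theorem valid_gX_flags (N : ℕ) :
    Circuit.Valid [(List.range N).map fun e => .u gX (Qubit.flag e 0)] :=
  valid_u List.nodup_range fun _ _ _ _ h => (Qubit.flag.inj h).1

theorem gX_flags_maps' (r : ℕ) (dat ang bf : ℕ → Fin 2) :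
    Maps [(List.range (2 ^ r - 1)).map fun e => .u gX (.flag e 0)] (mkBits dat ang bf (allFlags r))
      (mkBits dat ang bf 0) := by
  refine (MapsOn.layer (pairwise_u List.nodup_range fun _ _ _ _ h => (Qubit.flag.inj h).1)
    fun e he => mapsOn_gX ?_).maps ?_
  · simp [mkBits, allFlags, List.mem_range.1 he]
  · intro q hq
    rw [mem_qubits_u] at hq
    cases q with
    | flag e k =>
      by_cases hk : k = 0
      · subst hk
        have : ¬ e < 2 ^ r - 1 := fun he => hq ⟨e, List.mem_range.2 he, rfl⟩
        simp [mkBits, allFlags, this]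
      · simp [mkBits, hk]
    | _ => rfl

end

/-! ### The states produced by the SP and CSP circuits. -/

section

theorem update_mkBits_angle (dat ang bf fl : ℕ → Fin 2) (e : ℕ) (v : Fin 2) :
    Function.update (mkBits dat ang bf fl) (.angle e) v =
      mkBits dat (Function.update ang e v) bf fl := by
  funext q
  cases q with
  | angle e' =>
    by_cases h : e' = e
    · subst h
      simp [mkBits]
    · simp [mkBits, h]
  | _ => rfl

theorem overwrite_overwrite {N : ℕ} (f g : Fin N → Fin 2) (a : ℕ → Fin 2) :
    overwrite g (overwrite f a) = overwrite g a := by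
  funext e
  unfold overwrite
  split_ifs <;> rfl

theorem overwrite_zero {N : ℕ} : overwrite (0 : Fin N → Fin 2) 0 = 0 := by
  funext e
  unfold overwrite
  split_ifs <;> rfl

/-- The coefficient of `Ψ g` factors over the nodes (`Finset.prod_univ_sum`), and each factor is `1`
or `0` according to whether `g e = 0`. Thus a product state is undone node by node. -/
theorem sum_product_cancel {V : Type*} [AddCommGroup V] [Module ℂ V] {N : ℕ}
    {w : ℕ → Fin 2 → ℂ} {M : ℕ → Fin 2 → Fin 2 → ℂ}
    (h : ∀ e < N, ∀ g, ∑ v, w e v * M e g v = if g = 0 then 1 else 0)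
    (Ψ : (Fin N → Fin 2) → V) :
    ∑ f : Fin N → Fin 2, (∏ e : Fin N, w e (f e)) •
      ∑ g : Fin N → Fin 2, (∏ e : Fin N, M e (g e) (f e)) • Ψ g = Ψ 0 := by
  simp only [Finset.smul_sum, smul_smul, ← Finset.prod_mul_distrib]
  rw [Finset.sum_comm]
  simp only [← Finset.sum_smul]
  have h1 : ∀ g : Fin N → Fin 2, ∑ f : Fin N → Fin 2, ∏ e : Fin N, w e (f e) * M e (g e) (f e) =
      if g = 0 then 1 else 0 := by
    intro g
    have := Finset.prod_univ_sum (fun _ : Fin N => Finset.univ)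
      fun (e : Fin N) v => w e v * M e (g e) v
    rw [Fintype.piFinset_univ] at this
    rw [← this, Finset.prod_congr rfl fun (e : Fin N) _ => h e e.2 (g e)]
    split_ifs with hg
    · subst hg
      simp
    · obtain ⟨e, he⟩ := Function.ne_iff.1 hg
      exact Finset.prod_eq_zero (Finset.mem_univ e) (if_neg he)
  simp only [h1]
  simp

theorem gRy_neg_mul (θ : ℝ) (g : Fin 2) :
    ∑ v, (gRy θ).1 v 0 * (gRy (-θ)).1 g v = if g = 0 then 1 else 0 := by
  have h := congrFun (congrFun (Matrix.mem_unitaryGroup_iff'.1 (gRy θ).2) g) 0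
  rw [Matrix.mul_apply, Matrix.one_apply] at h
  rw [← h]
  refine Finset.sum_congr rfl fun v _ => ?_
  rw [mul_comm]
  congr 1
  fin_cases g <;> fin_cases v <;>
    simp [gRy, Matrix.star_apply, neg_div, -Complex.ofReal_cos, -Complex.ofReal_sin]

theorem cRy_pairwise (N : ℕ) (θ : ℕ → ℝ) :
    ((List.range N).map fun e => cRy (θ e) (.flag e 0) (Qubit.angle e)).Pairwise Disj := by
  refine pairwise_range_map fun e _ e' _ hne q hq hq' => ?_
  rw [mem_qubits_cRy] at hq hq'
  rcases hq with rfl | rfl <;> simp [hne] at hq'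

/-- The uncontrolled state of the angle qubits off the path is rotated back to zero. -/
theorem run_unrotate {m i : ℕ} (θ : ℕ → ℝ) (dat : ℕ → Fin 2) :
    (par ((List.range (2 ^ m - 1)).map fun e => cRy (-θ e) (.flag e 0) (Qubit.angle e))).run
      (∑ f : Fin (2 ^ m - 1) → Fin 2, (∏ e : Fin (2 ^ m - 1),
        if OnPath m i e then (if f e = 0 then 1 else 0) else (gRy (θ e)).1 (f e) 0) •
          ket (mkBits dat (overwrite f 0) 0 (offPath m i))) =
      ket (mkBits dat 0 0 (offPath m i)) := by
  have hfe : ∀ e, Qubit.flag e 0 ≠ .angle e := fun _ => Qubit.noConfusion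
  -- The flag is `0` on the path, where the gate is the identity, and `1` elsewhere, where it is the
  -- inverse rotation.
  have h1 := run_product (N := 2 ^ m - 1) (bb := fun a => mkBits dat a 0 (offPath m i))
    (G := fun e => cRy (-θ e) (.flag e 0) (Qubit.angle e))
    (M := fun e v j => if OnPath m i e then (if v = j then 1 else 0) else (gRy (-θ e)).1 v j)
    fun e he a => by
      rw [run_cRy _ (hfe e)]
      simp only [mkBits, update_mkBits_angle, if_true, offPath, he, true_and]
      by_cases ho : OnPath m i e
      · simp [ho]
      · simp [ho]
  rw [Circuit.run_sum]
  simp only [Circuit.run_smul]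
  simp only [run_par (cRy_pairwise (2 ^ m - 1) fun e => -θ e), h1, overwrite_overwrite]
  have h2 := sum_product_cancel (N := 2 ^ m - 1)
    (w := fun e v => if OnPath m i e then (if v = 0 then 1 else 0) else (gRy (θ e)).1 v 0)
    (M := fun e v j => if OnPath m i e then (if v = j then 1 else 0) else (gRy (-θ e)).1 v j)
    (fun e _ g => by
      by_cases ho : OnPath m i e
      · simp [ho]
      · simp only [ho, if_false, gRy_neg_mul])
    fun g => ket (mkBits dat (overwrite g 0) 0 (offPath m i))
  rw [overwrite_zero] at h2
  rw [← h2]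
  refine Finset.sum_congr rfl fun f _ => ?_
  congr 1
  refine Finset.sum_congr rfl fun g _ => ?_
  congr 1
  refine Finset.prod_congr rfl fun e _ => ?_
  simp [overwrite]

theorem zero_eq_mkBits : (0 : Qubit → Fin 2) = mkBits 0 0 0 0 := by
  funext q
  cases q <;> simp [mkBits]

theorem run_rotate (m : ℕ) (θ : ℕ → ℝ) :
    Circuit.run [(List.range (2 ^ m - 1)).map fun e => .u (gRy (θ e)) (.angle e)]
      (zeroState Qubit) = ∑ f : Fin (2 ^ m - 1) → Fin 2,
        (∏ e : Fin (2 ^ m - 1), (gRy (θ e)).1 (f e) 0) • ket (mkBits 0 (overwrite f 0) 0 0) := by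
  rw [zeroState_eq_ket, zero_eq_mkBits, Circuit.run_layer_map]
  refine run_product (bb := fun a => mkBits 0 a 0 0) (M := fun e v j => (gRy (θ e)).1 v j)
    (G := fun e => [[.u (gRy (θ e)) (.angle e)]]) (fun e he a => ?_) 0
  rw [run_u_ket]
  simp only [update_mkBits_angle, mkBits]

theorem valid_flag_dataReg (off r : ℕ) :
    (flag (fun q i => dataReg (off + q) i) (fun s p => .flag (node s p) 0) r).Valid :=
  (treeReg_flag off r).valid_flag

/-- The circuit `U_SP` prepares, in the data qubits, the state with the product of the rotation
amplitudes along the path to `i` as its amplitude of `i`. -/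
theorem run_spCircuit (m : ℕ) (θ : ℕ → ℝ) :
    (spCircuit m θ).run (zeroState Qubit) = ∑ i ∈ Finset.range (2 ^ m),
      (∏ s ∈ Finset.range m,
        (gRy (θ (node s (i / 2 ^ (m - s))))).1 (nbit i (m - 1 - s)) 0) •
          ket (mkBits (writeBits 0 m i 0) 0 0 0) := by
  have hflag : ∀ i < 2 ^ m, ∀ ang : ℕ → Fin 2,
      Maps (flag dataReg (fun s p => .flag (node s p) 0) m)
        (mkBits (writeBits 0 m i 0) ang 0 (allFlags m))
        (mkBits (writeBits 0 m i 0) ang 0 (offPath m i)) := fun i hi ang => by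
    simpa using flag_flag_maps (off := 0) hi 0 ang 0
  have hvalid : (flag dataReg (fun s p => Qubit.flag (node s p) 0) m).Valid := by
    simpa using valid_flag_dataReg 0 m
  simp only [spCircuit, Circuit.run_append]
  rw [run_rotate]
  have h1 : ∀ f : Fin (2 ^ m - 1) → Fin 2,
      Circuit.run (flag dataReg (fun s p => .flag (node s p) 0) m)
        (Circuit.run [(List.range (2 ^ m - 1)).map fun e => .u gX (.flag e 0)]
          (Circuit.run (spf dataReg (fun s p => .angle (node s p)) m)
            (ket (mkBits 0 (overwrite f 0) 0 0)))) =
      ket (mkBits (writeBits 0 m (descend (overwrite f 0) m) 0)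
        (clearPath m (descend (overwrite f 0) m) (overwrite f 0)) 0
        (offPath m (descend (overwrite f 0) m))) := by
    intro f
    have hi := descend_lt (overwrite f 0) m
    rw [show Circuit.run (spf _ _ _) (ket _) = _ from
        spf_angle_maps hi ((leadsTo_iff_eq hi).2 rfl) (dat := 0) (fun _ _ => rfl) 0 0,
      show Circuit.run [_] (ket _) = _ from gX_flags_maps m _ _ _]
    exact hflag _ hi _
  rw [Circuit.run_sum, Circuit.run_sum, Circuit.run_sum]
  simp only [Circuit.run_smul, h1]
  -- Here the superposition over assignments becomes one over leaves, with the residual state off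
  -- the path separated from the amplitude.
  rw [sum_clearPath m (fun e v => (gRy (θ e)).1 v 0)
    fun i f => ket (mkBits (writeBits 0 m i 0) f 0 (offPath m i))]
  rw [Circuit.run_sum, Circuit.run_sum, Circuit.run_sum]
  refine Finset.sum_congr rfl fun i hi => ?_
  rw [Finset.mem_range] at hi
  simp only [Circuit.run_smul, run_unrotate]
  rw [show Circuit.run (Circuit.dagger _) (ket _) = _ from (hflag i hi 0).dagger hvalid,
    show Circuit.run [_] (ket _) = _ from gX_flags_maps' m _ _ _]

/-- The state before the unloading in `U_CSP`: the loading applied to the prepared data qubits, with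
the flags of the nodes off the path. -/
theorem run_cspCircuit_prefix {n m k : ℕ} (hk : k < 2 ^ m) (θ δ α : ℕ → ℕ → ℝ) {dat : ℕ → Fin 2}
    (hdat : ∀ j < m, dat (m - 1 - j) = nbit k j) (h0 : ∀ u < n - m, dat (m + u) = 0) :
    Circuit.run (flag (fun q i => dataReg (m + q) i) (fun s p => .flag (node s p) 0) (n - m))
      (Circuit.run (spf (fun q i => dataReg (m + q) i) (fun s p => .buf (node s p) 0) (n - m))
        (Circuit.run (loadf n m θ δ α)
          (Circuit.run [(List.range (2 ^ (n - m) - 1)).map fun e => .u gX (.flag e 0)]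
            (ket (mkBits dat 0 0 0))))) =
      (loadf n m θ δ α).run (∑ l ∈ Finset.range (2 ^ (n - m)),
        (∏ s ∈ Finset.range (n - m),
          loadMatrix (θ k (node s (l / 2 ^ (n - m - s)))) (δ k (node s (l / 2 ^ (n - m - s))))
            (α k (node s (l / 2 ^ (n - m - s)))) (nbit l (n - m - 1 - s)) 0) •
          ket (mkBits (writeBits m (n - m) l dat) 0 0 (offPath (n - m) l))) := by
  have hdat' : ∀ l, ∀ j < m, writeBits m (n - m) l dat (m - 1 - j) = nbit k j := by
    intro l j hj
    rw [← hdat j hj]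
    exact if_neg (by omega)
  have h1 : ∀ f : Fin (2 ^ (n - m) - 1) → Fin 2,
      Circuit.run (flag (fun q i => dataReg (m + q) i) (fun s p => .flag (node s p) 0) (n - m))
          (Circuit.run (spf (fun q i => dataReg (m + q) i) (fun s p => .buf (node s p) 0) (n - m))
            (ket (mkBits dat 0 (overwrite f 0) (allFlags (n - m))))) =
      ket (mkBits (writeBits m (n - m) (descend (overwrite f 0) (n - m)) dat) 0
        (clearPath (n - m) (descend (overwrite f 0) (n - m)) (overwrite f 0))
        (offPath (n - m) (descend (overwrite f 0) (n - m)))) := by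
    intro f
    have hi := descend_lt (overwrite f 0) (n - m)
    rw [show Circuit.run (spf _ _ _) (ket _) = _ from
        spf_buf_maps hi ((leadsTo_iff_eq hi).2 rfl) h0 _ _]
    exact flag_flag_maps hi _ _ _
  rw [show Circuit.run [_] (ket _) = _ from gX_flags_maps (n - m) _ _ _, loadf_ket hk _ _ _ hdat]
  rw [Circuit.run_sum, Circuit.run_sum]
  simp only [Circuit.run_smul, h1]
  -- All flags are set during the first loading, so every node receives its state.
  have hw : ∀ f : Fin (2 ^ (n - m) - 1) → Fin 2,
      ∏ e : Fin (2 ^ (n - m) - 1), flagMatrix (θ k e) (δ k e) (α k e) (allFlags (n - m) e) (f e)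
        ((0 : ℕ → Fin 2) e) =
      ∏ e : Fin (2 ^ (n - m) - 1), loadMatrix (θ k e) (δ k e) (α k e) (f e) 0 := fun f =>
    Finset.prod_congr rfl fun e _ => by simp [flagMatrix, allFlags]
  simp only [hw]
  rw [sum_clearPath (n - m) (fun e v => loadMatrix (θ k e) (δ k e) (α k e) v 0)
    fun i f => ket (mkBits (writeBits m (n - m) i dat) 0 f (offPath (n - m) i))]
  rw [Circuit.run_sum]
  refine Finset.sum_congr rfl fun l hl => ?_
  rw [Finset.mem_range] at hl
  -- Applied to an empty buffer with the flags of `offPath`, LOADF produces exactly the residue that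
  -- SPF left: zeros on the path and loaded states elsewhere. So the whole state is in this form an
  -- image under LOADF.
  have h2 := loadf_ket (n := n) hk θ δ α (hdat' l) 0 0 (offPath (n - m) l)
  have h3 : ∀ f : Fin (2 ^ (n - m) - 1) → Fin 2,
      ∏ e : Fin (2 ^ (n - m) - 1), flagMatrix (θ k e) (δ k e) (α k e) (offPath (n - m) l e) (f e)
        ((0 : ℕ → Fin 2) e) =
      ∏ e : Fin (2 ^ (n - m) - 1), if OnPath (n - m) l e then (if f e = 0 then 1 else 0) else
        loadMatrix (θ k e) (δ k e) (α k e) (f e) 0 := fun f =>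
    Finset.prod_congr rfl fun e _ => by
      by_cases ho : OnPath (n - m) l e <;> simp [flagMatrix, offPath, ho]
  simp only [h3] at h2
  rw [Circuit.run_smul, ← h2]

/-- The circuit `U_CSP`, for the address `k`, prepares in the other data qubits the state with the
product of the amplitudes along the path to `l` as its amplitude of `l`. -/
theorem run_cspCircuit {n m k : ℕ} (hk : k < 2 ^ m) (θ δ α : ℕ → ℕ → ℝ) {dat : ℕ → Fin 2}
    (hdat : ∀ j < m, dat (m - 1 - j) = nbit k j) (h0 : ∀ u < n - m, dat (m + u) = 0) :
    (cspCircuit n m θ δ α).run (ket (mkBits dat 0 0 0)) = ∑ l ∈ Finset.range (2 ^ (n - m)),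
      (∏ s ∈ Finset.range (n - m),
        loadMatrix (θ k (node s (l / 2 ^ (n - m - s)))) (δ k (node s (l / 2 ^ (n - m - s))))
          (α k (node s (l / 2 ^ (n - m - s)))) (nbit l (n - m - 1 - s)) 0) •
          ket (mkBits (writeBits m (n - m) l dat) 0 0 0) := by
  simp only [cspCircuit, Circuit.run_append]
  -- The inverse of LOADF cancels the LOADF exhibited by the previous lemma, and the buffer becomes
  -- empty.
  rw [run_cspCircuit_prefix hk θ δ α hdat h0, (valid_loadf n m θ δ α).run_dagger_run,
    Circuit.run_sum, Circuit.run_sum]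
  refine Finset.sum_congr rfl fun l hl => ?_
  rw [Finset.mem_range] at hl
  rw [Circuit.run_smul, Circuit.run_smul, show Circuit.run (Circuit.dagger _) (ket _) = _ from
      (flag_flag_maps hl dat 0 0).dagger (valid_flag_dataReg m (n - m)),
    show Circuit.run [_] (ket _) = _ from gX_flags_maps' (n - m) _ _ _]

end

/-! ### Evaluation of the amplitudes and exact preparation. -/

section

theorem sum_range_mul_add {M : Type*} [AddCommMonoid M] (K L : ℕ) (g : ℕ → M) :
    ∑ X ∈ Finset.range (K * L), g X =
      ∑ k ∈ Finset.range K, ∑ l ∈ Finset.range L, g (k * L + l) := by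
  induction K with
  | zero => simp
  | succ K ih => rw [Nat.succ_mul, Finset.sum_range_add, ih, Finset.sum_range_succ]

/-- The weight of the subtree below the node `p` on level `s`. -/
def treeWeight (v : ℕ → ℝ) (r s p : ℕ) : ℝ :=
  ∑ l ∈ Finset.range (2 ^ (r - s)), v (p * 2 ^ (r - s) + l) ^ 2

theorem treeWeight_nonneg (v : ℕ → ℝ) (r s p : ℕ) : 0 ≤ treeWeight v r s p :=
  Finset.sum_nonneg fun _ _ => sq_nonneg _

theorem treeWeight_split (v : ℕ → ℝ) {r s : ℕ} (hs : s < r) (p : ℕ) : treeWeight v r s p =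
    treeWeight v r (s + 1) (2 * p) + treeWeight v r (s + 1) (2 * p + 1) := by
  have h : 2 ^ (r - s) = 2 ^ (r - (s + 1)) + 2 ^ (r - (s + 1)) := by
    rw [show r - s = r - (s + 1) + 1 by omega, pow_succ, mul_two]
  rw [treeWeight, treeWeight, treeWeight, h, Finset.sum_range_add]
  congr 1 <;> refine Finset.sum_congr rfl fun l _ => ?_ <;> congr 2 <;> ring

theorem treeAngle_eq (v : ℕ → ℝ) {r s : ℕ} (hs : s < r) (p : ℕ) : treeAngle v r s p =
    2 * Real.arccos (√(treeWeight v r (s + 1) (2 * p)) / √(treeWeight v r s p)) := by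
  have h : 2 ^ (r - s) = 2 * 2 ^ (r - (s + 1)) := by
    rw [show r - s = r - (s + 1) + 1 by omega, pow_succ']
  rw [treeAngle, treeWeight, treeWeight, Nat.sub_sub, h]
  congr 6
  funext l
  congr 2
  ring

/-- Half the angle has cosine `√(S0/S)` and sine `√(S1/S)`, where `S = S0 + S1`. Multiplication by
`√S` avoids division and keeps the identity true for subtrees of weight zero. -/
theorem gRy_treeAngle (v : ℕ → ℝ) {r s : ℕ} (hs : s < r) (p : ℕ) (c : Fin 2) :
    (gRy (treeAngle v r s p)).1 c 0 * (√(treeWeight v r s p) : ℝ) =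
      (√(treeWeight v r (s + 1) (2 * p + c)) : ℝ) := by
  have h0 := treeWeight_nonneg v r s p
  have h1 := treeWeight_nonneg v r (s + 1) (2 * p)
  have h2 := treeWeight_nonneg v r (s + 1) (2 * p + 1)
  have hsum := treeWeight_split v hs p
  rw [treeAngle_eq v hs]
  set S := treeWeight v r s p
  set S0 := treeWeight v r (s + 1) (2 * p)
  set S1 := treeWeight v r (s + 1) (2 * p + 1)
  -- If `S = 0` both children have weight zero, so both sides vanish whatever the default angle is.
  rcases h0.eq_or_lt with hS | hS
  · have h3 : S0 = 0 := by linarith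
    have h4 : S1 = 0 := by linarith
    rw [← hS]
    fin_cases c
    · simp [show treeWeight v r (s + 1) (2 * p) = 0 from h3]
    · simp [show treeWeight v r (s + 1) (2 * p + 1) = 0 from h4]
  have hS' : √S ≠ 0 := (Real.sqrt_pos.2 hS).ne'
  have hx0 : 0 ≤ √S0 / √S := by positivity
  have hx1 : √S0 / √S ≤ 1 := by
    rw [div_le_one (Real.sqrt_pos.2 hS)]
    exact Real.sqrt_le_sqrt (by linarith)
  fin_cases c
  · simp only [gRy, mul_div_cancel_left₀ _ (two_ne_zero' ℝ), Real.cos_arccos (by linarith) hx1]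
    simp only [Fin.zero_eta, Matrix.of_apply, Matrix.cons_val_zero, Fin.isValue, Matrix.cons_val',
      add_zero]
    rw [← Complex.ofReal_mul, div_mul_cancel₀ _ hS']
  · simp only [gRy, mul_div_cancel_left₀ _ (two_ne_zero' ℝ), Real.sin_arccos]
    simp only [Fin.mk_one, Matrix.of_apply, Matrix.cons_val_zero, Fin.isValue, Matrix.cons_val',
      Matrix.cons_val_one]
    rw [← Complex.ofReal_mul, ← Real.sqrt_mul' _ h0, div_pow, Real.sq_sqrt h1, Real.sq_sqrt h0]
    congr 2
    field_simp
    linarith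

/-- The product telescopes: after `t` levels it equals, multiplied by the root of the total weight,
the root of the weight below the `t`-th node. At a leaf this is `√(v i ^ 2)`. -/
theorem prod_gRy_treeAngle (v : ℕ → ℝ) {r i : ℕ} (hi : i < 2 ^ r) :
    (∏ s ∈ Finset.range r, (gRy (treeAngle v r s (i / 2 ^ (r - s)))).1 (nbit i (r - 1 - s)) 0) *
      (√(∑ l ∈ Finset.range (2 ^ r), v l ^ 2) : ℝ) = (|v i| : ℝ) := by
  have h : ∀ t ≤ r, (∏ s ∈ Finset.range t,
      (gRy (treeAngle v r s (i / 2 ^ (r - s)))).1 (nbit i (r - 1 - s)) 0) *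
      (√(treeWeight v r 0 0) : ℝ) = (√(treeWeight v r t (i / 2 ^ (r - t))) : ℝ) := by
    intro t
    induction t with
    | zero => simp [Nat.div_eq_of_lt hi]
    | succ t ih =>
      intro ht
      rw [Finset.prod_range_succ, mul_right_comm, ih (by omega), mul_comm, gRy_treeAngle v ht,
        div_pow_succ i (r - (t + 1)), show r - (t + 1) + 1 = r - t by omega,
        show r - 1 - t = r - (t + 1) by omega]
  have h1 := h r le_rfl
  have h2 : treeWeight v r r (i / 2 ^ (r - r)) = v i ^ 2 := by simp [treeWeight]
  have h3 : treeWeight v r 0 0 = ∑ l ∈ Finset.range (2 ^ r), v l ^ 2 := by simp [treeWeight]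
  rwa [h2, h3, Real.sqrt_sq_eq_abs] at h1

theorem loadMatrix_zero (θ : ℝ) (c : Fin 2) : loadMatrix θ 0 0 c 0 = (gRy θ).1 c 0 := by
  have : (gRz 0).1 c c = 1 := by
    fin_cases c <;> simp [gRz, gDiag]
  rw [loadMatrix, this]
  simp

/-- Half the difference of the two phases, with the sign given by `c`, added to their mean gives the
phase of the chosen leaf. -/
theorem loadMatrix_phase (θ : ℝ) (φ : ℕ → ℝ) (p : ℕ) (c : Fin 2) :
    loadMatrix θ (φ (2 * p + 1) - φ (2 * p)) ((φ (2 * p) + φ (2 * p + 1)) / 2) c 0 =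
      Complex.exp (φ (2 * p + c) * Complex.I) * (gRy θ).1 c 0 := by
  rw [loadMatrix]
  congr 1
  fin_cases c
  · simp [gRz, gDiag, ← Complex.exp_add]
    ring_nf
  · simp [gRz, gDiag, ← Complex.exp_add]
    ring_nf

variable {n : ℕ} (x : EuclideanSpace ℂ (Fin (2 ^ n)))

/-- As before the factor `blockAmplitude` is kept on the left, so that zero blocks need no separate
treatment. Phases enter only on the last level, where a node has two leaves as children. -/
theorem prod_loadMatrix {m : ℕ} (hm : m < n) (k : ℕ) {l : ℕ} (hl : l < 2 ^ (n - m)) :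
    (∏ s ∈ Finset.range (n - m),
        loadMatrix (cspAngle m x k (node s (l / 2 ^ (n - m - s))))
          (cspRz m x k (node s (l / 2 ^ (n - m - s))))
          (cspGlobalPhase m x k (node s (l / 2 ^ (n - m - s)))) (nbit l (n - m - 1 - s)) 0) *
      (blockAmplitude m x k : ℝ) = coeff x (k * 2 ^ (n - m) + l) := by
  obtain ⟨r, hr⟩ : ∃ r, n - m = r + 1 := ⟨n - m - 1, by omega⟩
  have h := prod_gRy_treeAngle (fun j => ‖coeff x (k * 2 ^ (n - m) + j)‖) hl
  have hp : ∀ s ≤ n - m, l / 2 ^ (n - m - s) < 2 ^ s := fun s hs => div_pow_lt hl hs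
  rw [blockAmplitude, ← Complex.norm_mul_exp_arg_mul_I (coeff x (k * 2 ^ (n - m) + l)),
    ← abs_norm (coeff x (k * 2 ^ (n - m) + l)), ← h, mul_right_comm]
  congr 1
  have h1 : ∀ s < r, loadMatrix (cspAngle m x k (node s (l / 2 ^ (n - m - s))))
          (cspRz m x k (node s (l / 2 ^ (n - m - s))))
          (cspGlobalPhase m x k (node s (l / 2 ^ (n - m - s)))) (nbit l (n - m - 1 - s)) 0 =
      (gRy (treeAngle (fun j => ‖coeff x (k * 2 ^ (n - m) + j)‖) (n - m) s
        (l / 2 ^ (n - m - s)))).1 (nbit l (n - m - 1 - s)) 0 := by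
    intro s hs
    have hsn : s + 1 ≠ n - m := by omega
    have hp := hp s (by omega)
    rw [cspAngle, cspRz, cspGlobalPhase, nodeLevel_node hp, nodePos_node hp, if_neg hsn,
      if_neg hsn, loadMatrix_zero]
  have h2 : loadMatrix (cspAngle m x k (node r (l / 2 ^ (n - m - r))))
          (cspRz m x k (node r (l / 2 ^ (n - m - r))))
          (cspGlobalPhase m x k (node r (l / 2 ^ (n - m - r)))) (nbit l (n - m - 1 - r)) 0 =
      Complex.exp (Complex.arg (coeff x (k * 2 ^ (n - m) + l)) * Complex.I) *
      (gRy (treeAngle (fun j => ‖coeff x (k * 2 ^ (n - m) + j)‖) (n - m) r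
        (l / 2 ^ (n - m - r)))).1 (nbit l (n - m - 1 - r)) 0 := by
    have hp := hp r (by omega)
    -- On the last level the chosen child of the node is the leaf `l` itself.
    have hl' : 2 * (l / 2 ^ (n - m - r)) + (nbit l (n - m - 1 - r) : ℕ) = l := by
      have := div_pow_succ l 0
      rw [show n - m - r = 0 + 1 by omega, show n - m - 1 - r = 0 by omega, ← this]
      simp
    have := loadMatrix_phase (treeAngle (fun j => ‖coeff x (k * 2 ^ (n - m) + j)‖) (n - m) r
        (l / 2 ^ (n - m - r))) (cspPhase m x k) (l / 2 ^ (n - m - r)) (nbit l (n - m - 1 - r))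
    rw [hl'] at this
    rw [cspAngle, cspRz, cspGlobalPhase, nodeLevel_node hp, nodePos_node hp, if_pos hr.symm,
      if_pos hr.symm, this, cspPhase]
  rw [hr, Finset.prod_range_succ, Finset.prod_range_succ, ← hr, h2,
    Finset.prod_congr rfl fun s hs => h1 s (Finset.mem_range.1 hs)]
  ring

theorem sum_norm_coeff_sq : ∑ X ∈ Finset.range (2 ^ n), ‖coeff x X‖ ^ 2 = ‖x‖ ^ 2 := by
  rw [EuclideanSpace.norm_sq_eq, ← Fin.sum_univ_eq_sum_range fun X => ‖coeff x X‖ ^ 2]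
  simp [coeff]

/-- Telescoping for the vector of block amplitudes, whose squares add up to `‖x‖ ^ 2`. -/
theorem prod_spAngle {m : ℕ} (hm : m ≤ n) {k : ℕ} (hk : k < 2 ^ m) :
    (∏ s ∈ Finset.range m,
        (gRy (spAngle m x (node s (k / 2 ^ (m - s))))).1 (nbit k (m - 1 - s)) 0) * (‖x‖ : ℝ) =
      (blockAmplitude m x k : ℝ) := by
  have h := prod_gRy_treeAngle (blockAmplitude m x) hk
  have h0 : ∀ k, blockAmplitude m x k ^ 2 =
      ∑ l ∈ Finset.range (2 ^ (n - m)), ‖coeff x (k * 2 ^ (n - m) + l)‖ ^ 2 := fun k =>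
    Real.sq_sqrt (Finset.sum_nonneg fun _ _ => sq_nonneg _)
  have h1 : ∑ k ∈ Finset.range (2 ^ m), blockAmplitude m x k ^ 2 = ‖x‖ ^ 2 := by
    simp only [h0]
    rw [← sum_range_mul_add (2 ^ m) (2 ^ (n - m)) fun X => ‖coeff x X‖ ^ 2, ← pow_add,
      Nat.add_sub_cancel' hm, sum_norm_coeff_sq]
  rw [h1, Real.sqrt_sq (norm_nonneg _), show |blockAmplitude m x k| = _ from
    abs_of_nonneg (Real.sqrt_nonneg _)] at h
  rw [← h]
  refine congrArg (fun z : ℂ => z * (‖x‖ : ℝ)) (Finset.prod_congr rfl fun s hs => ?_)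
  have hp := div_pow_lt hk (Finset.mem_range.1 hs).le
  rw [spAngle, nodeLevel_node hp, nodePos_node hp]

theorem nbit_of_lt {k l a j : ℕ} (hj : j < a) : nbit (k * 2 ^ a + l) j = nbit l j := by
  refine Fin.ext ?_
  rw [val_nbit, val_nbit, show a = j + (a - j - 1 + 1) by omega, pow_add, pow_succ]
  rw [show k * (2 ^ j * (2 ^ (a - j - 1) * 2)) + l = l + 2 ^ j * (2 * (k * 2 ^ (a - j - 1))) by ring,
    Nat.add_mul_div_left _ _ (Nat.two_pow_pos j)]
  omega

theorem nbit_of_le {k l a j : ℕ} (hl : l < 2 ^ a) (hj : a ≤ j) :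
    nbit (k * 2 ^ a + l) j = nbit k (j - a) := by
  refine Fin.ext ?_
  rw [val_nbit, val_nbit]
  rw [show 2 ^ j = 2 ^ a * 2 ^ (j - a) by rw [← pow_add, Nat.add_sub_cancel' hj], ← Nat.div_div_eq_div_mul, add_comm (k * 2 ^ a), Nat.add_mul_div_right _ _
    (Nat.two_pow_pos a), Nat.div_eq_of_lt hl, zero_add]

theorem writeBits_writeBits {m k l : ℕ} (hm : m ≤ n) (hl : l < 2 ^ (n - m)) :
    writeBits m (n - m) l (writeBits 0 m k 0) = writeBits 0 n (k * 2 ^ (n - m) + l) 0 := by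
  funext q
  unfold writeBits
  by_cases h1 : q < m
  · rw [if_neg (by omega), if_pos (by omega), if_pos (by omega), nbit_of_le hl (by omega)]
    congr 1
    omega
  · by_cases h2 : q < n
    · rw [if_pos (by omega), if_pos (by omega), nbit_of_lt (by omega)]
      congr 1
      omega
    · rw [if_neg (by omega), if_neg (by omega), if_neg (by omega)]

theorem pre_eq_sum (d : ℕ → Fin 2) (n : ℕ) :
    pre d n = ∑ i ∈ Finset.range n, (d i : ℕ) * 2 ^ (n - 1 - i) := by
  induction n with
  | zero => rfl
  | succ n ih =>
    rw [pre, ih, Finset.sum_range_succ, Finset.mul_sum]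
    congr 1
    · refine Finset.sum_congr rfl fun i hi => ?_
      rw [Finset.mem_range] at hi
      rw [show n + 1 - 1 - i = n - 1 - i + 1 by omega, pow_succ]
      ring
    · simp

theorem bitsToNat_eq_pre (d : ℕ → Fin 2) : bitsToNat (fun i : Fin n => d i) = pre d n := by
  rw [bitsToNat, pre_eq_sum,
    Fin.sum_univ_eq_sum_range fun i => (d i : ℕ) * 2 ^ (n - 1 - i)]

theorem dataState_eq_sum : dataState (dataQubits n) x =
    ∑ X ∈ Finset.range (2 ^ n), (coeff x X / (‖x‖ : ℂ)) • ket (mkBits (writeBits 0 n X 0) 0 0 0) := by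
  funext b
  rw [Finset.sum_apply]
  simp only [Pi.smul_apply, smul_eq_mul]
  have hdata : ∀ X < 2 ^ n, (∀ i < n, b (.data i) = nbit X (n - 1 - i)) →
      X = bitsToNat fun i => b (dataQubits n i) := by
    intro X hX h
    rw [show (fun i => b (dataQubits n i)) = fun i : Fin n => b (.data i) from rfl,
      bitsToNat_eq_pre fun i => b (.data i), ← Nat.div_one X, ← pow_zero 2,
      ← Nat.sub_self n, ← pre_nbit hX le_rfl, pre_eq_sum, pre_eq_sum]
    exact Finset.sum_congr rfl fun i hi => by rw [h i (Finset.mem_range.1 hi)]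
  rw [dataState]
  split_ifs with h
  · have hpre : bitsToNat (fun i => b (dataQubits n i)) = pre (fun i => b (.data i)) n :=
      bitsToNat_eq_pre fun i => b (.data i)
    have hlt : bitsToNat (fun i => b (dataQubits n i)) < 2 ^ n := hpre ▸ pre_lt _ _
    have hb : mkBits (writeBits 0 n (bitsToNat fun i => b (dataQubits n i)) 0) 0 0 0 = b := by
      have hz : ∀ q, (∀ i : Fin n, Qubit.data i ≠ q) → b q = 0 := fun q hq =>
        h q fun ⟨i, hi⟩ => hq i hi
      funext q
      cases q with
      | data q =>
        simp only [mkBits, writeBits]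
        split_ifs with hq
        · refine Fin.ext ?_
          rw [hpre, val_nbit, Nat.sub_zero, pre_div _ (by omega),
            show n - (n - 1 - q) = q + 1 by omega, pre_succ_mod]
        · rw [hz]
          · rfl
          · intro i hi
            have := i.2
            have := Qubit.data.inj hi
            omega
      | _ => simp [mkBits, hz]
    rw [Finset.sum_eq_single (bitsToNat fun i => b (dataQubits n i))]
    · rw [hb, ket_apply_self, mul_one]
    · intro X hX hne
      rw [ket_apply_of_ne, mul_zero]
      rintro rfl
      refine hne (hdata X (Finset.mem_range.1 hX) fun i hi => ?_)
      simp [mkBits, writeBits, hi]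
    · intro h1
      exact absurd (Finset.mem_range.2 hlt) h1
  · symm
    refine Finset.sum_eq_zero fun X _ => ?_
    rw [ket_apply_of_ne, mul_zero]
    rintro rfl
    refine h fun q hq => ?_
    cases q with
    | data q =>
      have : ¬ q < n := fun hlt => hq ⟨⟨q, hlt⟩, rfl⟩
      simp [mkBits, writeBits, this]
    | _ => simp [mkBits]

theorem spcsp_prepares {m : ℕ} (hm : m < n) (hx : x ≠ 0) :
    (spcspCircuit n m x).Prepares (dataQubits n) x := by
  have hx' : ((‖x‖ : ℝ) : ℂ) ≠ 0 := by simpa using hx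
  rw [Circuit.Prepares, dataState_eq_sum, spcspCircuit, Circuit.run_append, run_spCircuit,
    Circuit.run_sum]
  rw [show Finset.range (2 ^ n) = Finset.range (2 ^ m * 2 ^ (n - m)) by
    rw [← pow_add, Nat.add_sub_cancel' hm.le], sum_range_mul_add]
  refine Finset.sum_congr rfl fun k hk => ?_
  rw [Finset.mem_range] at hk
  have h1 := prod_spAngle x hm.le hk
  rw [Circuit.run_smul, run_cspCircuit hk, Finset.smul_sum]
  · refine Finset.sum_congr rfl fun l hl => ?_
    rw [Finset.mem_range] at hl
    have h2 := prod_loadMatrix x hm k hl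
    -- With `R` and `P` the products for SP and CSP, `x_j = P y_k` and `y_k = R ‖x‖`; hence `R P =
    -- x_j / ‖x‖`, and only the nonzero `‖x‖` is divided by.
    rw [writeBits_writeBits hm.le hl, smul_smul, ← h2, ← h1]
    congr 1
    field_simp
  · intro j hj
    simp only [writeBits]
    rw [if_pos (by omega)]
    congr 1
    omega
  · intro u hu
    simp [writeBits]

end

/-! ### Validity, and cost measures for spacetime allocation. -/

section

/-! ### Validity -/

theorem valid_spCircuit (m : ℕ) (θ : ℕ → ℝ) : (spCircuit m θ).Valid := by
  have h1 := treeReg_angle 0 m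
  have h2 := valid_flag_dataReg 0 m
  simp only [zero_add] at h1 h2
  simp only [spCircuit, Circuit.valid_append]
  refine ⟨⟨⟨⟨⟨⟨valid_u List.nodup_range fun _ _ _ _ h => Qubit.angle.inj h, h1.valid_spf⟩,
    valid_gX_flags _⟩, h2⟩, valid_par ?_ (cRy_pairwise _ fun e => -θ e)⟩, h2.dagger⟩,
    valid_gX_flags _⟩
  intro C hC
  obtain ⟨e, -, rfl⟩ := List.mem_map.1 hC
  exact valid_cRy Qubit.noConfusion

theorem valid_cspCircuit (n m : ℕ) (θ δ α : ℕ → ℕ → ℝ) : (cspCircuit n m θ δ α).Valid := by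
  simp only [cspCircuit, Circuit.valid_append]
  exact ⟨⟨⟨⟨⟨⟨valid_gX_flags _, valid_loadf n m θ δ α⟩, (treeReg_buf m (n - m)).valid_spf⟩,
    valid_flag_dataReg m (n - m)⟩, (valid_loadf n m θ δ α).dagger⟩,
    (valid_flag_dataReg m (n - m)).dagger⟩, valid_gX_flags _⟩

theorem valid_spcspCircuit (n m : ℕ) (x : EuclideanSpace ℂ (Fin (2 ^ n))) :
    (spcspCircuit n m x).Valid :=
  Circuit.valid_append.2 ⟨valid_spCircuit m _, valid_cspCircuit n m _ _ _⟩

/-! ### Size measures of circuits -/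

variable {Q : Type}

/-- The number of pairs of a layer and a qubit that a gate of the layer acts on. -/
def touches (C : Circuit Q) : ℕ := (Circuit.qubits C).length

/-- The spacetime allocation of the qubits that the circuit acts on, from the first layer that acts
on them to the end, bounded by counting them once for each layer that acts on them. -/
def weight : Circuit Q → ℕ
  | [] => 0
  | L :: C => (C.length + 1) * (Layer.qubits L).length + weight C

/-- The total number of touches of the final segments of a circuit. -/
def weightRev : Circuit Q → ℕ
  | [] => 0
  | L :: C => touches (L :: C) + weightRev C

theorem touches_nil : touches ([] : Circuit Q) = 0 := rfl

theorem touches_cons (L : Layer Q) (C : Circuit Q) :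
    touches (L :: C) = (Layer.qubits L).length + touches C := by
  rw [touches, Circuit.qubits_cons, List.length_append, touches]

theorem touches_append (C D : Circuit Q) : touches (C ++ D) = touches C + touches D := by
  rw [touches, Circuit.qubits_append, List.length_append, touches, touches]

theorem touches_dagger (C : Circuit Q) : touches (Circuit.dagger C) = touches C := by
  induction C with
  | nil => rfl
  | cons L C ih =>
    rw [Circuit.dagger_cons, touches_append, ih, touches_cons, touches_cons, touches_nil,
      Layer.qubits_dagger]
    omega

theorem touches_par₂ (C D : Circuit Q) : touches (par₂ C D) = touches C + touches D := by
  induction C generalizing D with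
  | nil => simp [par₂, touches_nil]
  | cons L C ih =>
    cases D with
    | nil => simp [par₂, touches_nil]
    | cons K D =>
      rw [par₂, touches_cons, touches_cons, touches_cons, Layer.qubits_append, List.length_append, ih]
      omega

theorem touches_par (Cs : List (Circuit Q)) : touches (par Cs) = (Cs.map touches).sum := by
  induction Cs with
  | nil => rfl
  | cons C Cs ih => rw [par, List.foldr_cons, ← par, touches_par₂, ih, List.map_cons, List.sum_cons]

theorem touches_reverse (C : Circuit Q) : touches C.reverse = touches C := by
  induction C with
  | nil => rfl
  | cons L C ih =>
    rw [List.reverse_cons, touches_append, ih, touches_cons, touches_cons, touches_nil]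
    omega

theorem touches_parEnd (Cs : List (Circuit Q)) : touches (parEnd Cs) = (Cs.map touches).sum := by
  rw [parEnd, touches_reverse, touches_par, List.map_map]
  congr 1
  exact List.map_congr_left fun C _ => touches_reverse C

theorem sum_map_range (f : ℕ → ℕ) (N : ℕ) :
    ((List.range N).map f).sum = ∑ i ∈ Finset.range N, f i := by
  induction N with
  | zero => rfl
  | succ N ih => rw [List.range_succ, List.map_append, List.sum_append, ih, Finset.sum_range_succ,
      List.map_singleton, List.sum_singleton]

theorem touches_par_range (N : ℕ) (f : ℕ → Circuit Q) :
    touches (par ((List.range N).map f)) = ∑ i ∈ Finset.range N, touches (f i) := by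
  rw [touches_par, List.map_map, ← sum_map_range]
  rfl

theorem touches_flatMap {ι : Type*} (l : List ι) (f : ι → Circuit Q) :
    touches (l.flatMap f) = (l.map fun i => touches (f i)).sum := by
  induction l with
  | nil => rfl
  | cons i l ih => rw [List.flatMap_cons, touches_append, ih, List.map_cons, List.sum_cons]

theorem touches_flatMap_range (N : ℕ) (f : ℕ → Circuit Q) :
    touches ((List.range N).flatMap f) = ∑ i ∈ Finset.range N, touches (f i) := by
  rw [touches_flatMap, sum_map_range]

theorem weight_append (C D : Circuit Q) :
    weight (C ++ D) = weight C + D.length * touches C + weight D := by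
  induction C with
  | nil => simp [weight, touches_nil]
  | cons L C ih =>
    rw [List.cons_append, weight, ih, weight, touches_cons, List.length_append]
    ring

theorem weight_le (C : Circuit Q) : weight C ≤ C.length * touches C := by
  induction C with
  | nil => rfl
  | cons L C ih =>
    rw [weight, touches_cons, List.length_cons]
    nlinarith

theorem weightRev_append (C D : Circuit Q) :
    weightRev (C ++ D) = weightRev C + C.length * touches D + weightRev D := by
  induction C with
  | nil => simp [weightRev]
  | cons L C ih =>
    rw [List.cons_append, weightRev, ih, weightRev, ← List.cons_append, touches_append,
      List.length_cons]
    ring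

/-- Reversal of time exchanges the duration after a touch with the duration up to a touch, so that
uncomputation costs as little as computation. -/
theorem weightRev_dagger (C : Circuit Q) : weightRev (Circuit.dagger C) = weight C := by
  induction C with
  | nil => rfl
  | cons L C ih =>
    rw [Circuit.dagger_cons, weightRev_append, ih, weight, Circuit.length_dagger]
    simp only [weightRev, touches_cons, touches_nil, Layer.qubits_dagger]
    ring

theorem weightRev_reverse (C : Circuit Q) : weightRev C.reverse = weight C := by
  induction C with
  | nil => rfl
  | cons L C ih =>
    rw [List.reverse_cons, weightRev_append, ih, weight, List.length_reverse]
    simp only [weightRev, touches_cons, touches_nil]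
    ring

theorem weightRev_par₂ (C D : Circuit Q) : weightRev (par₂ C D) = weightRev C + weightRev D := by
  induction C generalizing D with
  | nil => simp [par₂, weightRev]
  | cons L C ih =>
    cases D with
    | nil => simp [par₂, weightRev]
    | cons K D =>
      rw [par₂, weightRev, weightRev, weightRev, ih, touches_cons, touches_cons, touches_cons,
        Layer.qubits_append, List.length_append, touches_par₂]
      ring

/-- When all circuits end together, no touched qubit waits for a longer neighbour. Hence `weight` is
additive without a condition on the lengths, unlike for `par` in `weight_par₂`. -/
theorem weight_parEnd (Cs : List (Circuit Q)) : weight (parEnd Cs) = (Cs.map weight).sum := by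
  rw [← weightRev_reverse, parEnd, List.reverse_reverse]
  induction Cs with
  | nil => rfl
  | cons C Cs ih =>
    rw [List.map_cons, par, List.foldr_cons, ← par, weightRev_par₂, ih, weightRev_reverse,
      List.map_cons, List.sum_cons]

theorem length_par₂ (C D : Circuit Q) : (par₂ C D).length = max C.length D.length := by
  induction C generalizing D with
  | nil => simp [par₂]
  | cons L C ih =>
    cases D with
    | nil => simp [par₂]
    | cons K D => simp [par₂, ih]

theorem length_par_le {Cs : List (Circuit Q)} {N : ℕ} (h : ∀ C ∈ Cs, C.length ≤ N) :
    (par Cs).length ≤ N := by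
  induction Cs with
  | nil => exact Nat.zero_le N
  | cons C Cs ih =>
    rw [par, List.foldr_cons, ← par, length_par₂]
    exact max_le (h C List.mem_cons_self) (ih fun D hD => h D (List.mem_cons_of_mem C hD))

theorem length_parEnd_le {Cs : List (Circuit Q)} {N : ℕ} (h : ∀ C ∈ Cs, C.length ≤ N) :
    (parEnd Cs).length ≤ N := by
  rw [parEnd, List.length_reverse]
  refine length_par_le fun C hC => ?_
  obtain ⟨D, hD, rfl⟩ := List.mem_map.1 hC
  rw [List.length_reverse]
  exact h D hD

theorem le_length_par {Cs : List (Circuit Q)} {C : Circuit Q} (h : C ∈ Cs) :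
    C.length ≤ (par Cs).length := by
  induction Cs with
  | nil => simp at h
  | cons D Cs ih =>
    rw [par, List.foldr_cons, ← par, length_par₂]
    rcases List.mem_cons.1 h with rfl | h
    · exact le_max_left _ _
    · exact (ih h).trans (le_max_right _ _)

theorem length_flatMap_le {ι : Type*} {l : List ι} {f : ι → Circuit Q} {N : ℕ}
    (h : ∀ i ∈ l, (f i).length ≤ N) : (l.flatMap f).length ≤ l.length * N := by
  induction l with
  | nil => simp
  | cons i l ih =>
    rw [List.flatMap_cons, List.length_append, List.length_cons, Nat.succ_mul]
    have h1 := h i List.mem_cons_self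
    have h2 := ih fun j hj => h j (List.mem_cons_of_mem i hj)
    omega

/-- A touch in block `i` is charged for at most the `N - i` blocks that remain. For geometrically
growing blocks this replaces the crude factor `N`. -/
theorem weight_flatMap_range_le {f : ℕ → Circuit Q} {l : ℕ} (N : ℕ)
    (hl : ∀ i < N, (f i).length ≤ l) :
    weight ((List.range N).flatMap f) ≤ ∑ i ∈ Finset.range N, (N - i) * l * touches (f i) := by
  induction N with
  | zero => rfl
  | succ N ih =>
    have h1 := ih fun i hi => hl i (by omega)
    have h2 := (weight_le (f N)).trans (Nat.mul_le_mul_right _ (hl N (by omega)))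
    have h3 := Nat.mul_le_mul_right (touches ((List.range N).flatMap f)) (hl N (by omega))
    rw [List.range_succ, List.flatMap_append, List.flatMap_singleton, weight_append,
      Finset.sum_range_succ]
    have h4 : ∑ i ∈ Finset.range N, (N + 1 - i) * l * touches (f i) =
        ∑ i ∈ Finset.range N, (N - i) * l * touches (f i) +
          l * touches ((List.range N).flatMap f) := by
      rw [touches_flatMap_range, Finset.mul_sum, ← Finset.sum_add_distrib]
      refine Finset.sum_congr rfl fun i hi => ?_
      rw [Finset.mem_range] at hi
      rw [show N + 1 - i = N - i + 1 by omega]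
      ring
    rw [h4, show N + 1 - N = 1 by omega, one_mul]
    omega

/-! ### Spacetime allocation -/

/-- In the state `ψ` all qubits outside `Z` are in the state `|0⟩`. -/
def ZeroOff (Z : Finset Q) (ψ : State Q) : Prop := ∀ b, ψ b ≠ 0 → ∀ q ∉ Z, b q = 0

theorem ZeroOff.mono {Z Z' : Finset Q} {ψ : State Q} (h : ZeroOff Z ψ) (hZ : Z ⊆ Z') :
    ZeroOff Z' ψ := fun b hb q hq => h b hb q fun h' => hq (hZ h')

theorem ZeroOff.smul {Z : Finset Q} {ψ : State Q} (h : ZeroOff Z ψ) (c : ℂ) : ZeroOff Z (c • ψ) :=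
  fun b hb => h b fun h' => hb (by rw [Pi.smul_apply, h', smul_zero])

theorem ZeroOff.sum {ι : Type*} {s : Finset ι} {Z : Finset Q} {ψ : ι → State Q}
    (h : ∀ i ∈ s, ZeroOff Z (ψ i)) : ZeroOff Z (∑ i ∈ s, ψ i) := by
  intro b hb
  rw [Finset.sum_apply] at hb
  obtain ⟨i, hi, hne⟩ := Finset.exists_ne_zero_of_sum_ne_zero hb
  exact h i hi b hne

variable [DecidableEq Q]

omit [DecidableEq Q] in
theorem zeroOff_ket {Z : Finset Q} {b : Q → Fin 2} (h : ∀ q ∉ Z, b q = 0) : ZeroOff Z (ket b) := by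
  intro b' hb
  have : b' = b := by
    by_contra hne
    exact hb (ket_apply_of_ne hne)
  rwa [this]

omit [DecidableEq Q] in
theorem zeroOff_zeroState : ZeroOff ∅ (zeroState Q) := by
  rw [zeroState_eq_ket]
  exact zeroOff_ket fun _ _ => rfl

theorem ZeroOff.run {Z : Finset Q} {ψ : State Q} (h : ZeroOff Z ψ) (C : Circuit Q) :
    ZeroOff (Z ∪ (Circuit.qubits C).toFinset) (C.run ψ) := by
  intro b hb q hq
  rw [Finset.mem_union, List.mem_toFinset, not_or] at hq
  exact Circuit.run_support hq.2 (fun b hb => h b hb q hq.1) b hb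

theorem ZeroOff.run_of_subset {Z : Finset Q} {ψ : State Q} (h : ZeroOff Z ψ) {C : Circuit Q}
    (hC : ∀ q ∈ C.qubits, q ∈ Z) : ZeroOff Z (C.run ψ) :=
  (h.run C).mono (Finset.union_subset subset_rfl fun q hq => hC q (List.mem_toFinset.1 hq))

/-- A qubit that the remaining circuit does not touch must already have its final value; seen by
applying the inverse circuit. -/
theorem ZeroOff.of_run {Z : Finset Q} {ψ : State Q} {C : Circuit Q} (hC : C.Valid)
    (h : ZeroOff Z (C.run ψ)) : ZeroOff (Z ∪ (Circuit.qubits C).toFinset) ψ := by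
  have h1 := h.run (Circuit.dagger C)
  rw [hC.run_dagger_run] at h1
  refine h1.mono fun q hq => ?_
  rw [Finset.mem_union, List.mem_toFinset] at hq ⊢
  rwa [Circuit.mem_qubits_dagger] at hq

theorem ZeroOff.activeQubits_subset {Z : Finset Q} {ψ : State Q} (h : ZeroOff Z ψ) (L : Layer Q) :
    activeQubits L ψ ⊆ ↑(Z ∪ (Layer.qubits L).toFinset) := by
  intro q hq
  rw [Finset.mem_coe, Finset.mem_union, List.mem_toFinset]
  rcases hq with hq | ⟨b, hb, hne⟩
  · exact .inr hq
  · by_contra hn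
    have := h b hne q fun hZ => hn (.inl hZ)
    rw [this] at hb
    exact zero_ne_one hb

theorem ZeroOff.ncard_activeQubits_le {Z : Finset Q} {ψ : State Q} (h : ZeroOff Z ψ)
    (L : Layer Q) : (activeQubits L ψ).ncard ≤ Z.card + (Layer.qubits L).length := by
  refine (Set.ncard_le_ncard (h.activeQubits_subset L) (Finset.finite_toSet _)).trans ?_
  rw [Set.ncard_coe_finset]
  exact (Finset.card_union_le _ _).trans (Nat.add_le_add_left (List.toFinset_card_le _) _)

theorem ZeroOff.apply {Z : Finset Q} {ψ : State Q} (h : ZeroOff Z ψ) (L : Layer Q) :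
    ZeroOff (Z ∪ (Layer.qubits L).toFinset) (Layer.apply L ψ) := by
  have := h.run [L]
  rwa [Circuit.qubits_cons, Circuit.qubits_nil, List.append_nil] at this

theorem allocationFrom_append (C D : Circuit Q) (ψ : State Q) :
    Circuit.allocationFrom ψ (C ++ D) =
      Circuit.allocationFrom ψ C + Circuit.allocationFrom (C.run ψ) D := by
  induction C generalizing ψ with
  | nil => simp [Circuit.allocationFrom, Circuit.run_nil]
  | cons L C ih =>
    rw [List.cons_append, Circuit.allocationFrom, ih, Circuit.allocationFrom, Circuit.run_cons]
    omega

theorem card_union_toFinset_le (Z : Finset Q) (l : List Q) :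
    (Z ∪ l.toFinset).card ≤ Z.card + l.length :=
  (Finset.card_union_le _ _).trans (Nat.add_le_add_left (List.toFinset_card_le _) _)

/-- Qubits of `Z` are charged for every layer; any other qubit is still `0`, and inactive, until the
first gate acts on it. -/
theorem allocationFrom_le {Z : Finset Q} {ψ : State Q} (h : ZeroOff Z ψ) (C : Circuit Q) :
    Circuit.allocationFrom ψ C ≤ C.length * Z.card + weight C := by
  induction C generalizing ψ Z with
  | nil => simp [Circuit.allocationFrom]
  | cons L C ih =>
    have h1 := ih (h.apply L)
    have h2 := Nat.mul_le_mul_left C.length (card_union_toFinset_le Z (Layer.qubits L))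
    have h3 := h.ncard_activeQubits_le L
    rw [Circuit.allocationFrom, weight, List.length_cons]
    nlinarith

/-- The mirror image of `allocationFrom_le`: if the final state is supported on `Z`, a qubit outside
`Z` is active only up to its last gate. -/
theorem allocationFrom_le_of_final {Z : Finset Q} {ψ : State Q} {C : Circuit Q} (hC : C.Valid)
    (h : ZeroOff Z (C.run ψ)) :
    Circuit.allocationFrom ψ C ≤ C.length * Z.card + weightRev C := by
  induction C generalizing ψ with
  | nil => simp [Circuit.allocationFrom]
  | cons L C ih =>
    have h1 := ih (ψ := Layer.apply L ψ) (Circuit.valid_cons.1 hC).2 h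
    have h2 : (activeQubits L ψ).ncard ≤ Z.card + touches (L :: C) := by
      refine le_trans ?_ (card_union_toFinset_le Z (Circuit.qubits (L :: C)))
      rw [← Set.ncard_coe_finset]
      refine Set.ncard_le_ncard ?_ (Finset.finite_toSet _)
      refine ((h.of_run hC).activeQubits_subset L).trans ?_
      rw [Finset.coe_subset]
      refine Finset.union_subset subset_rfl fun q hq => ?_
      rw [List.mem_toFinset] at hq
      rw [Finset.mem_union, List.mem_toFinset, Circuit.qubits_cons]
      exact .inr (List.mem_append_left _ hq)
    rw [Circuit.allocationFrom, weightRev, List.length_cons, Nat.succ_mul]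
    omega

theorem allocationFrom_le_of_subset {Z : Finset Q} {ψ : State Q} (h : ZeroOff Z ψ)
    {C : Circuit Q} (hC : ∀ q ∈ C.qubits, q ∈ Z) :
    Circuit.allocationFrom ψ C ≤ C.length * Z.card := by
  induction C generalizing ψ with
  | nil => simp [Circuit.allocationFrom]
  | cons L C ih =>
    rw [Circuit.qubits_cons] at hC
    have hL : ∀ q ∈ Layer.qubits L, q ∈ Z := fun q hq => hC q (List.mem_append_left _ hq)
    have hZ : Z ∪ (Layer.qubits L).toFinset = Z :=
      Finset.union_eq_left.2 fun q hq => hL q (List.mem_toFinset.1 hq)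
    have h1 := h.apply L
    have h2 := h.activeQubits_subset L
    rw [hZ] at h1 h2
    have h3 := Set.ncard_le_ncard h2 (Finset.finite_toSet _)
    rw [Set.ncard_coe_finset] at h3
    have h4 := ih h1 fun q hq => hC q (List.mem_append_right _ hq)
    rw [Circuit.allocationFrom, List.length_cons, Nat.succ_mul]
    omega

theorem touches_le_allocationFrom {Z : Finset Q} {ψ : State Q} (h : ZeroOff Z ψ) {C : Circuit Q}
    (hC : C.Valid) : touches C ≤ Circuit.allocationFrom ψ C := by
  induction C generalizing ψ Z with
  | nil => exact Nat.zero_le _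
  | cons L C ih =>
    have h1 := ih (h.apply L) (Circuit.valid_cons.1 hC).2
    -- Validity makes the touched qubits distinct. The support bound gives finiteness of the active
    -- set, without which `ncard` would be `0`.
    have h2 : (Layer.qubits L).length ≤ (activeQubits L ψ).ncard := by
      rw [← List.toFinset_card_of_nodup (Circuit.valid_cons.1 hC).1, ← Set.ncard_coe_finset]
      refine Set.ncard_le_ncard (fun q hq => .inl ?_)
        ((Finset.finite_toSet _).subset (h.activeQubits_subset L))
      simpa using hq
    rw [touches_cons, Circuit.allocationFrom]
    omega

/-- The allocation of a circuit that sets up a configuration, acts, and undoes the set-up. -/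
theorem allocationFrom_conj_le {Z : Finset Q} {ψ : State Q} {S M : Circuit Q} (hS : S.Valid)
    (h : ZeroOff Z ψ) (h' : ZeroOff Z ((S ++ M ++ Circuit.dagger S).run ψ)) :
    Circuit.allocationFrom ψ (S ++ M ++ Circuit.dagger S) ≤
      2 * (S.length * Z.card + weight S) + M.length * (Z.card + touches S + touches M) := by
  rw [Circuit.run_append] at h'
  have h1 := allocationFrom_le h S
  have h2 := allocationFrom_le (h.run S) M
  -- The last third is estimated from its end, where the state is again confined to `Z`.
  have h3 := allocationFrom_le_of_final hS.dagger h'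
  have h4 := Nat.mul_le_mul_left M.length (card_union_toFinset_le Z (Circuit.qubits S))
  have h5 := weight_le M
  rw [allocationFrom_append, allocationFrom_append]
  rw [weightRev_dagger, Circuit.length_dagger] at h3
  rw [← touches] at h4
  nlinarith

end

/-! ### Sizes of the subroutines. -/

section

variable {Q : Type}

/-! ### Sums of powers of two -/

theorem sum_two_pow (m : ℕ) : ∑ i ∈ Finset.range m, 2 ^ i + 1 = 2 ^ m := by
  induction m with
  | zero => rfl
  | succ m ih =>
    rw [Finset.sum_range_succ, pow_succ]
    omega

theorem sum_two_pow_le (m : ℕ) : ∑ i ∈ Finset.range m, 2 ^ i ≤ 2 ^ m := by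
  have := sum_two_pow m
  omega

theorem sum_two_pow_reflect (m : ℕ) : ∑ q ∈ Finset.range m, 2 ^ (m - 1 - q) ≤ 2 ^ m := by
  rw [Finset.sum_range_reflect (fun i => 2 ^ i)]
  exact sum_two_pow_le m

/-- An exact formula suited to induction. The quadratic weight arises from `m - i` touched registers
in round `i`, each living for `m - i` further rounds. -/
theorem sum_sq_two_pow (m : ℕ) :
    ∑ i ∈ Finset.range m, (m - i) ^ 2 * 2 ^ i + (m ^ 2 + 4 * m + 6) = 6 * 2 ^ m := by
  induction m with
  | zero => rfl
  | succ m ih =>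
    have h : ∑ i ∈ Finset.range m, (m + 1 - (i + 1)) ^ 2 * 2 ^ (i + 1) =
        2 * ∑ i ∈ Finset.range m, (m - i) ^ 2 * 2 ^ i := by
      rw [Finset.mul_sum]
      refine Finset.sum_congr rfl fun i _ => ?_
      rw [Nat.add_sub_add_right, pow_succ]
      ring
    rw [Finset.sum_range_succ', h, pow_succ 2 m]
    simp only [Nat.sub_zero, pow_zero, mul_one]
    nlinarith

theorem sum_sq_two_pow_le (m : ℕ) : ∑ i ∈ Finset.range m, (m - i) ^ 2 * 2 ^ i ≤ 6 * 2 ^ m := by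
  have := sum_sq_two_pow m
  omega

theorem sum_mul_two_pow_le (m : ℕ) : ∑ i ∈ Finset.range m, (m - i) * 2 ^ i ≤ 6 * 2 ^ m :=
  (Finset.sum_le_sum fun _ _ => Nat.mul_le_mul_right _ (Nat.le_self_pow two_ne_zero _)).trans
    (sum_sq_two_pow_le m)

theorem sq_le_two_mul_two_pow (m : ℕ) : m ^ 2 ≤ 2 * 2 ^ m := by
  induction m with
  | zero => simp
  | succ m ih =>
    rcases Nat.lt_or_ge m 3 with h | h
    · interval_cases m <;> norm_num
    · rw [pow_succ 2 m]
      nlinarith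

/-! ### Sizes of the gates -/

theorem touches_cswap (c a b : Q) : touches (cswap c a b) = 25 := rfl

theorem length_par_eq {Cs : List (Circuit Q)} {N : ℕ} (h : ∀ C ∈ Cs, C.length ≤ N)
    (h' : ∃ C ∈ Cs, C.length = N) : (par Cs).length = N := by
  obtain ⟨C, hC, rfl⟩ := h'
  exact le_antisymm (length_par_le h) (le_length_par hC)

theorem length_cs (t : ℕ) (R S : ℕ → Q) : (cs t R S).length = 13 := by
  refine length_par_eq (fun C hC => ?_) ⟨_, List.mem_map.2 ⟨0, by simp, rfl⟩, rfl⟩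
  obtain ⟨i, -, rfl⟩ := List.mem_map.1 hC
  rfl

theorem touches_cs (t : ℕ) (R S : ℕ → Q) : touches (cs t R S) = 25 * 2 ^ t := by
  rw [cs, touches_par_range]
  simp [touches_cswap, mul_comm]

theorem touches_layer_le {ι : Type*} (l : List ι) (f : ι → Gate Q) {N : ℕ}
    (h : ∀ i, (f i).qubits.length ≤ N) : touches [l.map f] ≤ N * l.length := by
  induction l with
  | nil => rfl
  | cons i l ih =>
    rw [touches_cons, touches_nil] at ih ⊢
    rw [List.map_cons, Layer.qubits_cons, List.length_append, List.length_cons]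
    have := h i
    nlinarith

theorem touches_copyLayer_le (R : ℕ → Q) (c t : ℕ) : touches (copyLayer R c t) ≤ 2 * 2 ^ t := by
  refine (touches_layer_le (N := 2) _ _ fun i => by simp [Gate.qubits]).trans ?_
  refine Nat.mul_le_mul_left 2 ((List.length_filter_le _ _).trans ?_)
  rw [List.length_range]

theorem length_copy (R : ℕ → Q) (c : ℕ) : (copy R c).length = Nat.clog 2 c := by
  rw [copy]
  simp [copyLayer, List.length_flatMap]

theorem touches_copy_le (R : ℕ → Q) {c a : ℕ} (h : c ≤ 2 ^ a) : touches (copy R c) ≤ 2 * 2 ^ a := by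
  rw [copy, touches_flatMap_range]
  refine (Finset.sum_le_sum fun t _ => touches_copyLayer_le R c t).trans ?_
  rw [← Finset.mul_sum]
  refine Nat.mul_le_mul_left 2 ((sum_two_pow_le _).trans ?_)
  exact Nat.pow_le_pow_right (by norm_num) (Nat.clog_le_of_le_pow h)

/-- Most copies are made in the last layers: `∑ (a - t) 2^t` is linear in `2^a`, with no logarithmic
factor. -/
theorem weight_copy_le (R : ℕ → Q) {c a : ℕ} (h : c ≤ 2 ^ a) : weight (copy R c) ≤ 12 * 2 ^ a := by
  refine (weight_flatMap_range_le (l := 1) _ fun i _ => le_of_eq rfl).trans ?_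
  have h1 : ∀ i ∈ Finset.range (Nat.clog 2 c), (Nat.clog 2 c - i) * 1 * touches (copyLayer R c i) ≤
      2 * ((Nat.clog 2 c - i) * 2 ^ i) := fun i _ => by
    have := Nat.mul_le_mul_left (Nat.clog 2 c - i) (touches_copyLayer_le R c i)
    linarith
  refine (Finset.sum_le_sum h1).trans ?_
  rw [← Finset.mul_sum]
  have h2 := sum_mul_two_pow_le (Nat.clog 2 c)
  have h3 : 2 ^ Nat.clog 2 c ≤ 2 ^ a :=
    Nat.pow_le_pow_right (by norm_num) (Nat.clog_le_of_le_pow h)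
  omega

theorem length_par_copySwapOps (R : ℕ → ℕ → Q) (S : ℕ → Q) (m i : ℕ) :
    (par (copySwapOps R S m i)).length = 13 := by
  refine length_par_eq (fun C hC => ?_) ⟨_, List.mem_cons_self, length_cs _ _ _⟩
  rcases List.mem_cons.1 hC with rfl | hC
  · exact (length_cs _ _ _).le
  · obtain ⟨j, -, rfl⟩ := List.mem_map.1 hC
    simp [copyLayer]

theorem length_copySwap (R : ℕ → ℕ → Q) (S : ℕ → Q) (m : ℕ) :
    (copySwap R S m).length = 13 * m := by
  rw [copySwap_eq, List.length_flatMap]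
  simp [length_par_copySwapOps, mul_comm]

/-- The controlled swaps cost `25 · 2^i`, and each of the fewer than `m - i` copying layers at most
`2 · 2^i`. -/
theorem touches_par_copySwapOps_le (R : ℕ → ℕ → Q) (S : ℕ → Q) {m i : ℕ} (hi : i < m) :
    touches (par (copySwapOps R S m i)) ≤ 27 * ((m - i) * 2 ^ i) := by
  have h1 : (((List.range m).filter fun j => i < j).map fun j =>
      touches (copyLayer (R j) (2 ^ j) i)).sum ≤ (m - i) * (2 * 2 ^ i) := by
    refine (List.sum_le_card_nsmul _ (2 * 2 ^ i) fun x hx => ?_).trans ?_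
    · obtain ⟨j, -, rfl⟩ := List.mem_map.1 hx
      exact touches_copyLayer_le _ _ _
    · rw [smul_eq_mul, List.length_map]
      refine Nat.mul_le_mul_right _ ?_
      have h2 : ((List.range m).filter fun j => decide (i < j)).toFinset ⊆ Finset.Ico i m := by
        intro j hj
        simp only [List.mem_toFinset, List.mem_filter, List.mem_range, decide_eq_true_eq] at hj
        exact Finset.mem_Ico.2 ⟨hj.2.le, hj.1⟩
      have h3 := Finset.card_le_card h2
      rwa [List.toFinset_card_of_nodup (List.nodup_range.filter _), Nat.card_Ico] at h3
  rw [touches_par, copySwapOps, List.map_cons, List.sum_cons, touches_cs, List.map_map]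
  have h4 : 1 * 2 ^ i ≤ (m - i) * 2 ^ i := Nat.mul_le_mul_right _ (by omega)
  have h5 : (List.map (touches ∘ fun j => copyLayer (R j) (2 ^ j) i)
      ((List.range m).filter fun j => i < j)).sum ≤ (m - i) * (2 * 2 ^ i) := h1
  linarith

theorem touches_copySwap_le (R : ℕ → ℕ → Q) (S : ℕ → Q) (m : ℕ) :
    touches (copySwap R S m) ≤ 162 * 2 ^ m := by
  rw [copySwap_eq, touches_flatMap_range]
  refine (Finset.sum_le_sum fun i hi =>
    touches_par_copySwapOps_le R S (Finset.mem_range.1 hi)).trans ?_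
  rw [← Finset.mul_sum]
  have := sum_mul_two_pow_le m
  omega

theorem weight_copySwap_le (R : ℕ → ℕ → Q) (S : ℕ → Q) (m : ℕ) :
    weight (copySwap R S m) ≤ 2106 * 2 ^ m := by
  rw [copySwap_eq]
  refine (weight_flatMap_range_le m fun i _ => (length_par_copySwapOps R S m i).le).trans ?_
  -- `351 = 13 · 27`: thirteen layers per round and the touch count just proved. The sum of the
  -- squares then contributes the factor `6`.
  have h1 : ∀ i ∈ Finset.range m, (m - i) * 13 * touches (par (copySwapOps R S m i)) ≤
      351 * ((m - i) ^ 2 * 2 ^ i) := fun i hi => by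
    have := Nat.mul_le_mul_left ((m - i) * 13)
      (touches_par_copySwapOps_le R S (Finset.mem_range.1 hi))
    refine this.trans (le_of_eq ?_)
    ring
  refine (Finset.sum_le_sum h1).trans ?_
  rw [← Finset.mul_sum]
  have := sum_sq_two_pow_le m
  omega

/-! ### The sizes of SPF and FLAG -/

theorem length_onlyIf_le (p : Bool) (C : Circuit Q) : (onlyIf p C).length ≤ C.length := by
  unfold onlyIf
  split_ifs <;> simp

theorem length_spfStep_le (inject : Bool) (D A : ℕ → ℕ → Q) (m τ : ℕ) :
    (spfStep inject D A m τ).length ≤ 13 := by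
  refine length_par_le fun C hC => ?_
  obtain ⟨q, -, hC⟩ := List.mem_flatMap.1 hC
  simp only [List.mem_append, List.mem_singleton, List.mem_map] at hC
  rcases hC with (rfl | ⟨k, -, rfl⟩) | ⟨k, -, rfl⟩
  · exact (length_onlyIf_le _ _).trans (by simp [swap])
  · exact (length_onlyIf_le _ _).trans (length_cs _ _ _).le
  · exact (length_onlyIf_le _ _).trans (by simp [copyLayer])

theorem length_spf_le (D A : ℕ → ℕ → Q) (m : ℕ) : (spf D A m).length ≤ 78 * m := by
  have h1 := length_flatMap_le (l := List.range (3 * m)) (f := fun τ => spfStep true D A m τ) (N := 13)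
    fun τ _ => length_spfStep_le _ _ _ _ _
  have h2 := length_flatMap_le (l := (List.range (3 * m)).reverse) 
    (f := fun τ => spfStep false D A m τ) (N := 13) fun τ _ => length_spfStep_le _ _ _ _ _
  rw [List.length_range] at h1
  rw [List.length_reverse, List.length_range] at h2
  rw [spf, List.length_append]
  omega

/-- It is enough to count the steps `3q + 2`, which contain the swap into data qubit `q`. -/
theorem le_length_spf (D A : ℕ → ℕ → Q) (m : ℕ) : m ≤ (spf D A m).length := by
  have h : ∀ T ≤ m, T ≤ ((List.range (3 * T)).flatMap fun τ => spfStep true D A m τ).length := by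
    intro T
    induction T with
    | zero => simp
    | succ T ih =>
      intro hT
      have h1 := ih (by omega)
      have h2 : 3 ≤ (spfStep true D A m (3 * T + 2)).length := by
        refine le_length_par (C := onlyIf (true && 3 * T + 2 == 3 * T + 2) (swap (D T 0) (A T 0)))
          (List.mem_flatMap.2 ⟨T, List.mem_range.2 hT, ?_⟩) |> le_trans ?_
        · simp only [beq_self_eq_true, Bool.and_self, onlyIf, if_true]
          exact le_of_eq rfl
        · simp
      rw [show 3 * (T + 1) = 3 * T + 2 + 1 by ring, List.range_succ, List.flatMap_append,
        List.length_append, List.flatMap_singleton, List.range_succ, List.flatMap_append,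
        List.length_append, List.range_succ, List.flatMap_append, List.length_append]
      omega
  rw [spf, List.length_append]
  exact (h m le_rfl).trans (Nat.le_add_right _ _)

theorem sum_touches_onlyIf_le {p : ℕ → Bool} {c : ℕ} (hp : ∀ τ, p τ = true → τ = c)
    (C : Circuit Q) (T : ℕ) :
    ∑ τ ∈ Finset.range T, touches (onlyIf (p τ) C) ≤ touches C := by
  have h : ∀ τ ∈ Finset.range T, touches (onlyIf (p τ) C) ≤ if τ = c then touches C else 0 := by
    intro τ _
    unfold onlyIf
    by_cases h1 : p τ = true
    · rw [if_pos h1, if_pos (hp τ h1)]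
    · simp [h1, touches_nil]
  refine (Finset.sum_le_sum h).trans ?_
  rw [Finset.sum_ite_eq']
  split_ifs <;> simp

theorem sum_touches_spfStep_le (inject : Bool) (D A : ℕ → ℕ → Q) (m T : ℕ) :
    ∑ τ ∈ Finset.range T, touches (spfStep inject D A m τ) ≤ 33 * 2 ^ m := by
  have h1 : ∀ τ, touches (spfStep inject D A m τ) = ∑ q ∈ Finset.range m,
      (touches (onlyIf (inject && τ == 3 * q + 2) (swap (D q 0) (A q 0))) +
        ∑ k ∈ Finset.range (m - 1 - q),
          touches (onlyIf (τ == 3 * q + 4 + 2 * k) (cs k (D q) (A (q + 1 + k)))) +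
        ∑ k ∈ Finset.range (m - 2 - q),
          touches (onlyIf (τ == 3 * q + 5 + 2 * k) (copyLayer (D q) (2 ^ (m - 2 - q)) k))) := by
    intro τ
    rw [spfStep, par_flatMap, touches_par_range]
    refine Finset.sum_congr rfl fun q _ => ?_
    rw [par_append, par_append, touches_par₂, touches_par₂, par_singleton, touches_par_range,
      touches_par_range]
  simp only [h1]
  rw [Finset.sum_comm]
  -- Every operation occurs at a single time, so summing over `τ` counts it once: `33 = 6 + 25 + 2`
  -- for the swap, the controlled swaps and the copying layers.
  have h2 : ∀ q ∈ Finset.range m, ∑ τ ∈ Finset.range T,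
      (touches (onlyIf (inject && τ == 3 * q + 2) (swap (D q 0) (A q 0))) +
        ∑ k ∈ Finset.range (m - 1 - q),
          touches (onlyIf (τ == 3 * q + 4 + 2 * k) (cs k (D q) (A (q + 1 + k)))) +
        ∑ k ∈ Finset.range (m - 2 - q),
          touches (onlyIf (τ == 3 * q + 5 + 2 * k) (copyLayer (D q) (2 ^ (m - 2 - q)) k))) ≤
      33 * 2 ^ (m - 1 - q) := by
    intro q _
    rw [Finset.sum_add_distrib, Finset.sum_add_distrib]
    have h3 : ∑ τ ∈ Finset.range T, touches (onlyIf (inject && τ == 3 * q + 2)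
        (swap (D q 0) (A q 0))) ≤ 6 :=
      sum_touches_onlyIf_le (p := fun τ => inject && τ == 3 * q + 2) (c := 3 * q + 2)
        (fun τ h => by simp at h; exact h.2) _ T
    have h4 : ∑ τ ∈ Finset.range T, ∑ k ∈ Finset.range (m - 1 - q),
          touches (onlyIf (τ == 3 * q + 4 + 2 * k) (cs k (D q) (A (q + 1 + k)))) ≤
        25 * 2 ^ (m - 1 - q) := by
      rw [Finset.sum_comm]
      refine (Finset.sum_le_sum fun k _ => (sum_touches_onlyIf_le
        (p := fun τ => τ == 3 * q + 4 + 2 * k) (c := 3 * q + 4 + 2 * k) (fun τ h => by simpa using h)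
        _ T).trans (touches_cs _ _ _).le).trans ?_
      rw [← Finset.mul_sum]
      exact Nat.mul_le_mul_left 25 (sum_two_pow_le _)
    have h5 : ∑ τ ∈ Finset.range T, ∑ k ∈ Finset.range (m - 2 - q),
          touches (onlyIf (τ == 3 * q + 5 + 2 * k) (copyLayer (D q) (2 ^ (m - 2 - q)) k)) ≤
        2 * 2 ^ (m - 1 - q) := by
      rw [Finset.sum_comm]
      refine (Finset.sum_le_sum fun k _ => (sum_touches_onlyIf_le
        (p := fun τ => τ == 3 * q + 5 + 2 * k) (c := 3 * q + 5 + 2 * k) (fun τ h => by simpa using h)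
        _ T).trans (touches_copyLayer_le _ _ _)).trans ?_
      rw [← Finset.mul_sum]
      exact Nat.mul_le_mul_left 2 ((sum_two_pow_le _).trans
        (Nat.pow_le_pow_right (by norm_num) (by omega)))
    have h6 := Nat.one_le_two_pow (n := m - 1 - q)
    omega
  refine (Finset.sum_le_sum h2).trans ?_
  rw [← Finset.mul_sum]
  exact Nat.mul_le_mul_left 33 (sum_two_pow_reflect m)

theorem touches_spf_le (D A : ℕ → ℕ → Q) (m : ℕ) : touches (spf D A m) ≤ 66 * 2 ^ m := by
  have h1 := sum_touches_spfStep_le true D A m (3 * m)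
  have h2 := sum_touches_spfStep_le false D A m (3 * m)
  rw [spf, touches_append, touches_flatMap_range, touches_flatMap, List.map_reverse,
    List.sum_reverse, sum_map_range]
  omega

theorem length_flagCopy_le (D : ℕ → ℕ → Q) (m : ℕ) : (flagCopy D m).length ≤ m := by
  refine length_par_le fun C hC => ?_
  obtain ⟨q, -, rfl⟩ := List.mem_map.1 hC
  rw [length_copy]
  exact (Nat.clog_le_of_le_pow le_rfl).trans (by omega)

theorem touches_flagCopy_le (D : ℕ → ℕ → Q) (m : ℕ) : touches (flagCopy D m) ≤ 2 * 2 ^ m := by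
  rw [flagCopy, touches_par_range]
  refine (Finset.sum_le_sum fun q _ => touches_copy_le (D q) le_rfl).trans ?_
  rw [← Finset.mul_sum]
  have h := sum_two_pow_reflect (m - 1)
  rw [show m - 1 - 1 = m - 2 by omega] at h
  exact Nat.mul_le_mul_left 2 (h.trans (Nat.pow_le_pow_right (by norm_num) (by omega)))

theorem length_flag_le (D F : ℕ → ℕ → Q) (m : ℕ) : (flag D F m).length ≤ 1 + 15 * m := by
  have h1 := length_flagCopy_le D m
  have h2 := length_flatMap_le (l := List.range (m - 1)) (f := flagStep D F m) (N := 13)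
    fun i _ => length_par_le fun C hC => by
      obtain ⟨q, -, rfl⟩ := List.mem_map.1 hC
      exact (length_cs _ _ _).le
  rw [List.length_range] at h2
  rw [flag_eq, List.length_append, List.length_append, List.length_append, Circuit.length_dagger,
    List.length_singleton]
  omega

theorem touches_flag_le (D F : ℕ → ℕ → Q) (m : ℕ) : touches (flag D F m) ≤ 155 * 2 ^ m := by
  have h1 := touches_flagCopy_le D m
  have h2 := touches_layer_le (N := 1) (List.range m) (fun j => .u gX (F j 0))
    fun j => by simp [Gate.qubits]
  have h3 : ∑ i ∈ Finset.range (m - 1), touches (flagStep D F m i) ≤ 150 * 2 ^ m := by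
    have h4 : ∀ i ∈ Finset.range (m - 1), touches (flagStep D F m i) =
        25 * ((m - 1 - i) * 2 ^ i) := fun i _ => by
      rw [flagStep, touches_par_range]
      simp only [touches_cs, Finset.sum_const, Finset.card_range, smul_eq_mul]
      ring
    rw [Finset.sum_congr rfl h4, ← Finset.mul_sum]
    have h5 := sum_mul_two_pow_le (m - 1)
    have h6 : 2 ^ (m - 1) ≤ 2 ^ m := Nat.pow_le_pow_right (by norm_num) (by omega)
    omega
  have h7 : m < 2 ^ m := Nat.lt_two_pow_self
  rw [List.length_range] at h2
  rw [flag_eq, touches_append, touches_append, touches_append, touches_dagger,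
    touches_flatMap_range]
  omega

/-! ### The sizes of Setup and LOADF -/

/-- With `par₂` the shorter circuit would be charged for waiting until the longer one ends, whence
the condition of equal lengths. -/
theorem weight_par₂ {C D : Circuit Q} (h : C.length = D.length) :
    weight (par₂ C D) = weight C + weight D := by
  induction C generalizing D with
  | nil => simp [par₂, weight]
  | cons L C ih =>
    cases D with
    | nil => simp at h
    | cons K D =>
      simp only [List.length_cons, Nat.add_right_cancel_iff] at h
      rw [par₂, weight, weight, weight, ih h, Layer.qubits_append, List.length_append,
        length_par₂, ← h, max_self]
      ring

theorem weight_par_eq {Cs : List (Circuit Q)} {N : ℕ} (h : ∀ C ∈ Cs, C.length = N) :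
    weight (par Cs) = (Cs.map weight).sum := by
  induction Cs with
  | nil => rfl
  | cons C Cs ih =>
    have h1 := fun D hD => h D (List.mem_cons_of_mem C hD)
    rw [par, List.foldr_cons, ← par, List.map_cons, List.sum_cons, ← ih h1]
    cases Cs with
    | nil =>
      rw [show par ([] : List (Circuit Q)) = [] from rfl, par₂_nil]
      rfl
    | cons D Cs =>
      refine weight_par₂ ?_
      rw [length_par_eq (fun D hD => (h1 D hD).le) ⟨D, List.mem_cons_self, h1 D List.mem_cons_self⟩]
      exact h C List.mem_cons_self

theorem weight_par_range_eq {M N : ℕ} {f : ℕ → Circuit Q} (h : ∀ i, (f i).length = N) :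
    weight (par ((List.range M).map f)) = ∑ i ∈ Finset.range M, weight (f i) := by
  rw [weight_par_eq (N := N), List.map_map, ← sum_map_range]
  · rfl
  · intro C hC
    obtain ⟨i, -, rfl⟩ := List.mem_map.1 hC
    exact h i

theorem sum_range_le_mul {f : ℕ → ℕ} {N B : ℕ} (h : ∀ i, f i ≤ B) :
    ∑ i ∈ Finset.range N, f i ≤ N * B := by
  refine (Finset.sum_le_card_nsmul _ _ B fun i _ => h i).trans ?_
  rw [Finset.card_range, smul_eq_mul]

theorem length_fanCopies_le (n m : ℕ) : (fanCopies n m).length ≤ n - m := by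
  refine length_par_le fun C hC => ?_
  obtain ⟨j, -, rfl⟩ := List.mem_map.1 hC
  rw [length_copy]
  exact Nat.clog_le_of_le_pow le_rfl

theorem touches_fanCopies_le (n m : ℕ) : touches (fanCopies n m) ≤ m * (2 * 2 ^ (n - m)) := by
  rw [fanCopies, touches_par_range]
  exact sum_range_le_mul fun j => touches_copy_le _ le_rfl

theorem weight_fanCopies_le (n m : ℕ) : weight (fanCopies n m) ≤ m * (12 * 2 ^ (n - m)) := by
  rw [fanCopies, weight_par_range_eq (N := Nat.clog 2 (2 ^ (n - m))) fun j => length_copy _ _]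
  exact sum_range_le_mul fun j => weight_copy_le _ le_rfl

theorem length_blockMoves_le (n m : ℕ) : (blockMoves n m).length ≤ 13 * m := by
  refine length_par_le fun C hC => ?_
  obtain ⟨j, -, rfl⟩ := List.mem_map.1 hC
  rw [length_copySwap]

theorem touches_blockMoves_le (n m : ℕ) :
    touches (blockMoves n m) ≤ 2 ^ (n - m) * (162 * 2 ^ m) := by
  rw [blockMoves, touches_par_range]
  exact (sum_range_le_mul fun j => touches_copySwap_le _ _ _).trans
    (Nat.mul_le_mul_right _ (Nat.sub_le _ _))

theorem weight_blockMoves_le (n m : ℕ) :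
    weight (blockMoves n m) ≤ 2 ^ (n - m) * (2106 * 2 ^ m) := by
  rw [blockMoves, weight_par_range_eq (N := 13 * m) fun j => length_copySwap _ _ _]
  exact (sum_range_le_mul fun j => weight_copySwap_le _ _ _).trans
    (Nat.mul_le_mul_right _ (Nat.sub_le _ _))

theorem length_parEnd_setupOps_le (n m : ℕ) :
    (parEnd (setupOps n m)).length ≤ n - m + 13 * m := by
  refine length_parEnd_le fun C hC => ?_
  simp only [setupOps, List.mem_append, List.mem_map, List.mem_singleton] at hC
  rcases hC with (⟨k, -, rfl⟩ | ⟨e, -, rfl⟩) | rfl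
  · rw [length_copy]
    exact (Nat.clog_le_of_le_pow (Nat.sub_le _ _)).trans (Nat.le_add_right _ _)
  · rw [length_copy]
    exact (Nat.clog_le_of_le_pow le_rfl).trans (by omega)
  · rw [List.length_append]
    exact Nat.add_le_add (length_fanCopies_le n m) (length_blockMoves_le n m)

theorem touches_parEnd_setupOps_le (n m : ℕ) :
    touches (parEnd (setupOps n m)) ≤ 168 * (2 ^ m * 2 ^ (n - m)) := by
  rw [touches_parEnd, setupOps, List.map_append, List.map_append, List.sum_append, List.sum_append,
    List.map_map, List.map_map, List.map_singleton, List.sum_singleton, touches_append]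
  have h1 : (List.map (touches ∘ fun k => copy (fun l => Qubit.sel k l) (2 ^ (n - m) - 1))
      (List.range (2 ^ m))).sum ≤ 2 ^ m * (2 * 2 ^ (n - m)) := by
    rw [sum_map_range]
    exact sum_range_le_mul fun k => touches_copy_le _ (Nat.sub_le _ _)
  have h2 : (List.map (touches ∘ fun e => copy (fun k => Qubit.flag e k) (2 ^ m))
      (List.range (2 ^ (n - m) - 1))).sum ≤ 2 ^ (n - m) * (2 * 2 ^ m) := by
    rw [sum_map_range]
    exact (sum_range_le_mul fun k => touches_copy_le _ le_rfl).trans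
      (Nat.mul_le_mul_right _ (Nat.sub_le _ _))
  have h3 := touches_fanCopies_le n m
  have h4 := touches_blockMoves_le n m
  have h5 : m * 2 ^ (n - m) ≤ 2 ^ m * 2 ^ (n - m) :=
    Nat.mul_le_mul_right _ Nat.lt_two_pow_self.le
  linarith

theorem weight_parEnd_setupOps_le (n m : ℕ) :
    weight (parEnd (setupOps n m)) ≤ 2194 * (2 ^ m * 2 ^ (n - m)) := by
  rw [weight_parEnd, setupOps, List.map_append, List.map_append, List.sum_append, List.sum_append,
    List.map_map, List.map_map, List.map_singleton, List.sum_singleton, weight_append]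
  have h1 : (List.map (weight ∘ fun k => copy (fun l => Qubit.sel k l) (2 ^ (n - m) - 1))
      (List.range (2 ^ m))).sum ≤ 2 ^ m * (12 * 2 ^ (n - m)) := by
    rw [sum_map_range]
    exact sum_range_le_mul fun k => weight_copy_le _ (Nat.sub_le _ _)
  have h2 : (List.map (weight ∘ fun e => copy (fun k => Qubit.flag e k) (2 ^ m))
      (List.range (2 ^ (n - m) - 1))).sum ≤ 2 ^ (n - m) * (12 * 2 ^ m) := by
    rw [sum_map_range]
    exact (sum_range_le_mul fun k => weight_copy_le _ le_rfl).trans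
      (Nat.mul_le_mul_right _ (Nat.sub_le _ _))
  have h3 := weight_fanCopies_le n m
  have h4 := weight_blockMoves_le n m
  -- The copied address bits persist during the block moves, at a cost of `26 m² 2^(n-m)`; the
  -- inequality `m² ≤ 2 · 2^m` absorbs it.
  have h5 := Nat.mul_le_mul (length_blockMoves_le n m) (touches_fanCopies_le n m)
  have h6 : m * 2 ^ (n - m) ≤ 2 ^ m * 2 ^ (n - m) :=
    Nat.mul_le_mul_right _ Nat.lt_two_pow_self.le
  have h7 := Nat.mul_le_mul_right (2 ^ (n - m)) (sq_le_two_mul_two_pow m)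
  linarith

theorem length_setup_le (n m : ℕ) : (setup n m).length ≤ 1 + 26 * m + (n - m) := by
  have := length_parEnd_setupOps_le n m
  rw [setup_eq, List.length_append, List.length_append, length_copySwap, List.length_singleton]
  omega

theorem touches_setup_le (n m : ℕ) : touches (setup n m) ≤ 331 * (2 ^ m * 2 ^ (n - m)) := by
  have h1 := touches_parEnd_setupOps_le n m
  have h2 := touches_copySwap_le (addrReg m) (fun k => Qubit.sel k 0) m
  have h3 : 2 ^ m * 1 ≤ 2 ^ m * 2 ^ (n - m) := Nat.mul_le_mul_left _ Nat.one_le_two_pow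
  have h4 := Nat.one_le_two_pow (n := m)
  have h5 : touches [[Gate.u gX (Qubit.sel 0 0)]] = 1 := rfl
  rw [setup_eq, touches_append, touches_append, h5]
  linarith

theorem weight_setup_le (n m : ℕ) :
    weight (setup n m) ≤ 5000 * (m * 2 ^ m + 2 ^ m * 2 ^ (n - m)) := by
  have h1 := weight_parEnd_setupOps_le n m
  have h2 := touches_copySwap_le (addrReg m) (fun k => Qubit.sel k 0) m
  have h3 := weight_copySwap_le (addrReg m) (fun k => Qubit.sel k 0) m
  have h4 : 2 ^ m * 1 ≤ 2 ^ m * 2 ^ (n - m) := Nat.mul_le_mul_left _ Nat.one_le_two_pow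
  have h5 := Nat.one_le_two_pow (n := m)
  have h6 : touches [[Gate.u gX (Qubit.sel 0 0)]] = 1 := rfl
  have h7 : weight [[Gate.u gX (Qubit.sel 0 0)]] = 1 := rfl
  have h8 : (n - m) * 2 ^ m ≤ 2 ^ (n - m) * 2 ^ m :=
    Nat.mul_le_mul_right _ Nat.lt_two_pow_self.le
  have h9 : m < 2 ^ m := Nat.lt_two_pow_self
  -- The address register, of size `O(2^m)`, is loaded first and waits during the parallel stage of
  -- depth `n - m + 13m`. The part with `n - m` is `O(2^n)`; the part with `m` is the source of the
  -- term `m 2^m`.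
  have h10 : (parEnd (setupOps n m)).length *
      (1 + touches (copySwap (addrReg m) (fun k => Qubit.sel k 0) m)) ≤
      (n - m + 13 * m) * (163 * 2 ^ m) :=
    Nat.mul_le_mul (length_parEnd_setupOps_le n m) (by omega)
  rw [setup_eq, weight_append, weight_append, touches_append, h6, h7, length_copySwap]
  generalize 2 ^ m = M at *
  generalize 2 ^ (n - m) = R at *
  generalize n - m = r at *
  have h11 := Nat.zero_le (m * M)
  linarith

theorem length_par_loadOps_le (n m : ℕ) (θ δ α : ℕ → ℕ → ℝ) :
    (par (loadOps n m θ δ α)).length ≤ 53 := by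
  refine length_par_le fun C hC => ?_
  obtain ⟨k, -, hC⟩ := List.mem_flatMap.1 hC
  obtain ⟨e, -, rfl⟩ := List.mem_map.1 hC
  exact le_of_eq rfl

theorem touches_par_loadOps (n m : ℕ) (θ δ α : ℕ → ℕ → ℝ) :
    touches (par (loadOps n m θ δ α)) = 95 * (2 ^ m * (2 ^ (n - m) - 1)) := by
  have h : ∀ k, touches (par ((List.range (2 ^ (n - m) - 1)).map fun e =>
      loadGate (θ k e) (δ k e) (α k e) (Qubit.flag e k) (.sel k e) (.buf e k))) =
      (2 ^ (n - m) - 1) * 95 := fun k => by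
    rw [touches_par_range, Finset.sum_congr rfl fun e _ => show touches (loadGate (θ k e) (δ k e)
      (α k e) (Qubit.flag e k) (.sel k e) (.buf e k)) = 95 from rfl, Finset.sum_const,
      Finset.card_range, smul_eq_mul]
  rw [loadOps, par_flatMap, touches_par_range, Finset.sum_congr rfl fun k _ => h k,
    Finset.sum_const, Finset.card_range, smul_eq_mul]
  ring

theorem length_loadf_le (n m : ℕ) (θ δ α : ℕ → ℕ → ℝ) :
    (loadf n m θ δ α).length ≤ 55 + 52 * m + 2 * (n - m) := by
  have h1 := length_setup_le n m
  have h2 := length_par_loadOps_le n m θ δ α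
  rw [loadf_eq, List.length_append, List.length_append, Circuit.length_dagger]
  omega

theorem touches_loadf_le (n m : ℕ) (θ δ α : ℕ → ℕ → ℝ) :
    touches (loadf n m θ δ α) ≤ 757 * (2 ^ m * 2 ^ (n - m)) := by
  have h1 := touches_setup_le n m
  have h2 := touches_par_loadOps n m θ δ α
  have h3 : 2 ^ m * (2 ^ (n - m) - 1) ≤ 2 ^ m * 2 ^ (n - m) :=
    Nat.mul_le_mul_left _ (Nat.sub_le _ _)
  rw [loadf_eq, touches_append, touches_append, touches_dagger]
  omega

end

/-! ### Depth, ancillas and allocation of the SP+CSP circuit. -/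

section

/-! ### Depth and number of gates of the SP+CSP circuit -/

theorem touches_gX_flags_le (r : ℕ) :
    touches [(List.range (2 ^ r - 1)).map fun e => .u gX (Qubit.flag e 0)] ≤ 2 ^ r := by
  refine (touches_layer_le (N := 1) _ _ fun e => by simp [Gate.qubits]).trans ?_
  rw [List.length_range, one_mul]
  exact Nat.sub_le _ _

theorem length_spCircuit_le (m : ℕ) (θ : ℕ → ℝ) : (spCircuit m θ).length ≤ 9 + 108 * m := by
  have h1 := length_spf_le dataReg (fun s p => Qubit.angle (node s p)) m
  have h2 := length_flag_le dataReg (fun s p => Qubit.flag (node s p) 0) m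
  have h3 : (par ((List.range (2 ^ m - 1)).map fun e =>
      cRy (-θ e) (.flag e 0) (Qubit.angle e))).length ≤ 4 := length_par_le fun C hC => by
    obtain ⟨e, -, rfl⟩ := List.mem_map.1 hC
    exact le_of_eq rfl
  simp only [spCircuit, List.length_append, Circuit.length_dagger, List.length_singleton]
  omega

theorem le_length_spCircuit (m : ℕ) (θ : ℕ → ℝ) : m ≤ (spCircuit m θ).length := by
  have h1 := le_length_spf dataReg (fun s p => Qubit.angle (node s p)) m
  simp only [spCircuit, List.length_append]
  omega

theorem touches_spCircuit_le (m : ℕ) (θ : ℕ → ℝ) : touches (spCircuit m θ) ≤ 385 * 2 ^ m := by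
  have h1 := touches_spf_le dataReg (fun s p => Qubit.angle (node s p)) m
  have h2 := touches_flag_le dataReg (fun s p => Qubit.flag (node s p) 0) m
  have h3 : touches (par ((List.range (2 ^ m - 1)).map fun e =>
      cRy (-θ e) (.flag e 0) (Qubit.angle e))) ≤ 2 ^ m * 6 := by
    rw [touches_par_range]
    refine (sum_range_le_mul (B := 6) fun e => ?_).trans
      (Nat.mul_le_mul_right _ (Nat.sub_le _ _))
    exact le_of_eq rfl
  have h4 := touches_gX_flags_le m
  have h5 : touches [(List.range (2 ^ m - 1)).map fun e => .u (gRy (θ e)) (Qubit.angle e)] ≤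
      2 ^ m := by
    refine (touches_layer_le (N := 1) _ _ fun e => by simp [Gate.qubits]).trans ?_
    rw [List.length_range, one_mul]
    exact Nat.sub_le _ _
  simp only [spCircuit, touches_append, touches_dagger]
  omega

theorem length_cspCircuit_le (n m : ℕ) (θ δ α : ℕ → ℕ → ℝ) :
    (cspCircuit n m θ δ α).length ≤ 114 + 104 * m + 112 * (n - m) := by
  have h1 := length_spf_le (fun q i => dataReg (m + q) i) (fun s p => Qubit.buf (node s p) 0) (n - m)
  have h2 := length_flag_le (fun q i => dataReg (m + q) i) (fun s p => Qubit.flag (node s p) 0)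
    (n - m)
  have h3 := length_loadf_le n m θ δ α
  simp only [cspCircuit, List.length_append, Circuit.length_dagger, List.length_singleton]
  omega

theorem le_length_cspCircuit (n m : ℕ) (θ δ α : ℕ → ℕ → ℝ) :
    n - m ≤ (cspCircuit n m θ δ α).length := by
  have h1 := le_length_spf (fun q i => dataReg (m + q) i) (fun s p => Qubit.buf (node s p) 0) (n - m)
  simp only [cspCircuit, List.length_append]
  omega

theorem touches_cspCircuit_le (n m : ℕ) (θ δ α : ℕ → ℕ → ℝ) :
    touches (cspCircuit n m θ δ α) ≤ 2000 * (2 ^ m * 2 ^ (n - m)) := by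
  have h1 := touches_spf_le (fun q i => dataReg (m + q) i) (fun s p => Qubit.buf (node s p) 0) (n - m)
  have h2 := touches_flag_le (fun q i => dataReg (m + q) i) (fun s p => Qubit.flag (node s p) 0)
    (n - m)
  have h3 := touches_loadf_le n m θ δ α
  have h4 := touches_gX_flags_le (n - m)
  have h5 : 1 * 2 ^ (n - m) ≤ 2 ^ m * 2 ^ (n - m) := Nat.mul_le_mul_right _ Nat.one_le_two_pow
  simp only [cspCircuit, touches_append, touches_dagger]
  omega

theorem le_touches_cspCircuit (n m : ℕ) (θ δ α : ℕ → ℕ → ℝ) :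
    2 ^ m * (2 ^ (n - m) - 1) ≤ touches (cspCircuit n m θ δ α) := by
  have h := touches_par_loadOps n m θ δ α
  simp only [cspCircuit, loadf_eq, touches_append]
  omega

variable {n : ℕ} (m : ℕ) (x : EuclideanSpace ℂ (Fin (2 ^ n)))

theorem touches_spcspCircuit_le (hm : m < n) :
    touches (spcspCircuit n m x) ≤ 2385 * 2 ^ n := by
  have h1 := touches_spCircuit_le m (spAngle m x)
  have h2 := touches_cspCircuit_le n m (cspAngle m x) (cspRz m x) (cspGlobalPhase m x)
  have h3 : 2 ^ m * 2 ^ (n - m) = 2 ^ n := by rw [← pow_add, Nat.add_sub_cancel' hm.le]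
  have h4 : 2 ^ m ≤ 2 ^ n := Nat.pow_le_pow_right (by norm_num) hm.le
  rw [spcspCircuit, touches_append]
  omega

theorem depth_spcspCircuit_le (hm : m < n) : (spcspCircuit n m x).depth ≤ 400 * n := by
  have h1 := length_spCircuit_le m (spAngle m x)
  have h2 := length_cspCircuit_le n m (cspAngle m x) (cspRz m x) (cspGlobalPhase m x)
  rw [Circuit.depth, spcspCircuit, List.length_append]
  omega

theorem le_depth_spcspCircuit (hm : m < n) : n ≤ (spcspCircuit n m x).depth := by
  have h1 := le_length_spCircuit m (spAngle m x)
  have h2 := le_length_cspCircuit n m (cspAngle m x) (cspRz m x) (cspGlobalPhase m x)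
  rw [Circuit.depth, spcspCircuit, List.length_append]
  omega

theorem numAncillas_le_touches {Q : Type} (C : Circuit Q) (d : Fin n ↪ Q) :
    C.numAncillas d ≤ touches C := by
  classical
  refine (Set.ncard_le_ncard (t := ↑(Circuit.qubits C).toFinset) (fun q hq => ?_)
    (Finset.finite_toSet _)).trans ?_
  · simpa using hq.1
  · rw [Set.ncard_coe_finset]
    exact List.toFinset_card_le _

theorem le_allocation_spcspCircuit (hm : m < n) :
    2 ^ n ≤ 2 * (spcspCircuit n m x).spacetimeAllocation := by
  have h1 := touches_le_allocationFrom (zeroOff_zeroState (Q := Qubit)) (valid_spcspCircuit n m x)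
  have h2 := le_touches_cspCircuit n m (cspAngle m x) (cspRz m x) (cspGlobalPhase m x)
  have h3 : 2 ^ n = 2 * (2 ^ m * 2 ^ (n - m - 1)) := by
    rw [← pow_add, ← pow_succ']
    congr 1
    omega
  -- As `m < n`, each tree has at least half as many nodes as leaves; so the loading gates alone
  -- give half of `2^n`.
  have h4 : 2 ^ (n - m - 1) ≤ 2 ^ (n - m) - 1 := by
    have h5 : 2 ^ (n - m) = 2 * 2 ^ (n - m - 1) := by
      rw [← pow_succ']
      congr 1
      omega
    have := Nat.one_le_two_pow (n := n - m - 1)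
    omega
  have h6 := Nat.mul_le_mul_left (2 ^ m) h4
  rw [spcspCircuit, touches_append, ← spcspCircuit] at h1
  rw [Circuit.spacetimeAllocation]
  omega

/-! ### The spacetime allocation of CSP -/

/-- The qubits that CSP uses outside LOADF. -/
def cspBase (n m : ℕ) : Finset Qubit :=
  (Finset.range n).image Qubit.data
    ∪ (Finset.range (2 ^ (n - m) - 1)).image (fun e => Qubit.flag e 0)
    ∪ (Finset.range (2 ^ (n - m) - 1)).image (fun e => Qubit.buf e 0)
    ∪ (Circuit.qubits (spf (fun q i => dataReg (m + q) i)
        (fun s p => Qubit.buf (node s p) 0) (n - m))).toFinset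
    ∪ (Circuit.qubits (flag (fun q i => dataReg (m + q) i)
        (fun s p => Qubit.flag (node s p) 0) (n - m))).toFinset

theorem card_cspBase_le (n m : ℕ) : (cspBase n m).card ≤ n + 223 * 2 ^ (n - m) := by
  have h1 := touches_spf_le (fun q i => dataReg (m + q) i) (fun s p => Qubit.buf (node s p) 0) (n - m)
  have h2 := touches_flag_le (fun q i => dataReg (m + q) i) (fun s p => Qubit.flag (node s p) 0)
    (n - m)
  have h3 : ∀ f : ℕ → Qubit, ((Finset.range (2 ^ (n - m) - 1)).image f).card ≤ 2 ^ (n - m) :=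
    fun f => Finset.card_image_le.trans ((Finset.card_range _).le.trans (Nat.sub_le _ _))
  have h4 : ((Finset.range n).image Qubit.data).card ≤ n :=
    Finset.card_image_le.trans (Finset.card_range n).le
  have h5 := h3 fun e => Qubit.flag e 0
  have h6 := h3 fun e => Qubit.buf e 0
  refine (card_union_toFinset_le _ _).trans ((Nat.add_le_add_right
    (card_union_toFinset_le _ _) _).trans ?_)
  have h7 := Finset.card_union_le ((Finset.range n).image Qubit.data
    ∪ (Finset.range (2 ^ (n - m) - 1)).image (fun e => Qubit.flag e 0))
    ((Finset.range (2 ^ (n - m) - 1)).image (fun e => Qubit.buf e 0))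
  have h8 := Finset.card_union_le ((Finset.range n).image Qubit.data)
    ((Finset.range (2 ^ (n - m) - 1)).image (fun e => Qubit.flag e 0))
  rw [touches] at h1 h2
  omega

theorem zeroOff_mkBits {dat bf fl : ℕ → Fin 2} (hdat : ∀ q, n ≤ q → dat q = 0)
    (hbf : ∀ e, 2 ^ (n - m) - 1 ≤ e → bf e = 0) (hfl : ∀ e, 2 ^ (n - m) - 1 ≤ e → fl e = 0) :
    ZeroOff (cspBase n m) (ket (mkBits dat 0 bf fl)) := by
  refine zeroOff_ket fun q hq => ?_
  simp only [cspBase, Finset.mem_union, Finset.mem_image, Finset.mem_range, not_or, not_exists,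
    not_and] at hq
  obtain ⟨⟨⟨⟨h1, h2⟩, h3⟩, -⟩, -⟩ := hq
  cases q with
  | data q => exact hdat q (not_lt.1 fun h => h1 q h rfl)
  | flag e k =>
    by_cases hk : k = 0
    · subst hk
      exact hfl e (not_lt.1 fun h => h2 e h rfl)
    · simp [mkBits, hk]
  | buf e k =>
    by_cases hk : k = 0
    · subst hk
      exact hbf e (not_lt.1 fun h => h3 e h rfl)
    · simp [mkBits, hk]
  | _ => rfl

theorem overwrite_of_le {N : ℕ} (f : Fin N → Fin 2) {e : ℕ} (h : N ≤ e) :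
    overwrite f 0 e = 0 := dif_neg (not_lt.2 h)

theorem dagger_loadf (n m : ℕ) (θ δ α : ℕ → ℕ → ℝ) : Circuit.dagger (loadf n m θ δ α) =
    setup n m ++ Circuit.dagger (par (loadOps n m θ δ α)) ++ Circuit.dagger (setup n m) := by
  rw [loadf_eq, Circuit.dagger_append, Circuit.dagger_append, Circuit.dagger_dagger,
    List.append_assoc]

/-- A bound for the allocation of LOADF. -/
def loadBound (n m : ℕ) : ℕ :=
  2 * ((1 + 26 * m + (n - m)) * (cspBase n m).card + 5000 * (m * 2 ^ m + 2 ^ m * 2 ^ (n - m))) +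
    53 * ((cspBase n m).card + 426 * (2 ^ m * 2 ^ (n - m)))

/-- LOADF and its inverse are both conjugations by the same Setup and differ only in the middle part
`M`; one bound serves for both. -/
theorem allocationFrom_conj_setup_le {ψ : State Qubit} {M : Circuit Qubit}
    (h : ZeroOff (cspBase n m) ψ)
    (h' : ZeroOff (cspBase n m) ((setup n m ++ M ++ Circuit.dagger (setup n m)).run ψ))
    (hl : M.length ≤ 53) (ht : touches M = 95 * (2 ^ m * (2 ^ (n - m) - 1))) :
    Circuit.allocationFrom ψ (setup n m ++ M ++ Circuit.dagger (setup n m)) ≤ loadBound n m := by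
  refine (allocationFrom_conj_le (valid_setup n m) h h').trans ?_
  have h1 := Nat.mul_le_mul_right (cspBase n m).card (length_setup_le n m)
  have h2 := weight_setup_le n m
  have h3 := touches_setup_le n m
  have h4 : 2 ^ m * (2 ^ (n - m) - 1) ≤ 2 ^ m * 2 ^ (n - m) :=
    Nat.mul_le_mul_left _ (Nat.sub_le _ _)
  refine Nat.add_le_add (Nat.mul_le_mul_left 2 (Nat.add_le_add h1 h2)) (Nat.mul_le_mul hl ?_)
  omega

/-- At the boundary of each part of CSP the state is supported on `cspBase`. Only the two loadings
use further qubits, and SPF, FLAG and the flips cost at most the size of `cspBase` times their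
depth, `4 + 108 (n - m)` in all. -/
theorem allocationFrom_cspCircuit_le (hm : m < n) (θ δ α : ℕ → ℕ → ℝ) (c : ℕ → ℂ) :
    Circuit.allocationFrom (∑ k ∈ Finset.range (2 ^ m), c k • ket (mkBits (writeBits 0 m k 0) 0 0 0))
      (cspCircuit n m θ δ α) ≤ 2 * loadBound n m + (4 + 108 * (n - m)) * (cspBase n m).card := by
  set ψ : State Qubit := ∑ k ∈ Finset.range (2 ^ m), c k • ket (mkBits (writeBits 0 m k 0) 0 0 0)
    with hψ
  have hread : ∀ k, ∀ j < m, writeBits 0 m k 0 (m - 1 - j) = nbit k j := fun k j hj => by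
    rw [writeBits, if_pos (by omega)]
    congr 1
    omega
  have hzero : ∀ k, ∀ u < n - m, writeBits 0 m k 0 (m + u) = 0 := fun k u _ => by
    simp [writeBits]
  have hdat : ∀ k q, n ≤ q → writeBits 0 m k 0 q = 0 := fun k q hq => by
    rw [writeBits, if_neg (by omega)]
    rfl
  have hdat' : ∀ l k q, n ≤ q → writeBits m (n - m) l (writeBits 0 m k 0) q = 0 := fun l k q hq => by
    rw [writeBits, if_neg (by omega), hdat k q hq]
  have hall : ∀ e, 2 ^ (n - m) - 1 ≤ e → allFlags (n - m) e = 0 := fun e he =>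
    if_neg (not_lt.2 he)
  have hoff : ∀ l e, 2 ^ (n - m) - 1 ≤ e → offPath (n - m) l e = 0 := fun l e he =>
    if_neg fun h => absurd h.1 (not_lt.2 he)
  set X : Circuit Qubit := [(List.range (2 ^ (n - m) - 1)).map fun e => .u gX (.flag e 0)] with hX
  set S := spf (fun q i => dataReg (m + q) i) (fun s p => Qubit.buf (node s p) 0) (n - m) with hS
  set F := flag (fun q i => dataReg (m + q) i) (fun s p => Qubit.flag (node s p) 0) (n - m) with hF
  have hXZ : ∀ q ∈ X.qubits, q ∈ cspBase n m := by
    intro q hq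
    obtain ⟨e, he, rfl⟩ := mem_qubits_u.1 hq
    simp only [cspBase, Finset.mem_union, Finset.mem_image]
    exact .inl (.inl (.inl (.inr ⟨e, by simpa using he, rfl⟩)))
  have hSZ : ∀ q ∈ S.qubits, q ∈ cspBase n m := fun q hq =>
    Finset.mem_union_left _ (Finset.mem_union_right _ (List.mem_toFinset.2 hq))
  have hFZ : ∀ q ∈ F.qubits, q ∈ cspBase n m := fun q hq =>
    Finset.mem_union_right _ (List.mem_toFinset.2 hq)
  have hFZ' : ∀ q ∈ (Circuit.dagger F).qubits, q ∈ cspBase n m := fun q hq =>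
    hFZ q (Circuit.mem_qubits_dagger.1 hq)
  have z0 : ZeroOff (cspBase n m) ψ := ZeroOff.sum fun k _ => (zeroOff_mkBits m (hdat k)
    (fun _ _ => rfl) fun _ _ => rfl).smul _
  have z1 := z0.run_of_subset hXZ
  have z2 : ZeroOff (cspBase n m) ((loadf n m θ δ α).run (X.run ψ)) := by
    rw [hψ, Circuit.run_sum, Circuit.run_sum]
    refine ZeroOff.sum fun k hk => ?_
    rw [Circuit.run_smul, show X.run (ket _) = _ from gX_flags_maps (n - m) _ _ _, Circuit.run_smul,
      loadf_ket (Finset.mem_range.1 hk) _ _ _ (hread k)]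
    exact (ZeroOff.sum fun f _ => (zeroOff_mkBits m (hdat k) (fun e he => overwrite_of_le f he)
      hall).smul _).smul _
  have z3 := z2.run_of_subset hSZ
  have z4 := z3.run_of_subset hFZ
  -- That unloading returns to `cspBase` is not a matter of supports but of the exact cancellation
  -- in `run_cspCircuit_prefix`.
  have z5 : ZeroOff (cspBase n m) ((Circuit.dagger (loadf n m θ δ α)).run
      (F.run (S.run ((loadf n m θ δ α).run (X.run ψ))))) := by
    rw [hψ, Circuit.run_sum, Circuit.run_sum, Circuit.run_sum, Circuit.run_sum, Circuit.run_sum]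
    refine ZeroOff.sum fun k hk => ?_
    rw [Circuit.run_smul, Circuit.run_smul, Circuit.run_smul, Circuit.run_smul,
      run_cspCircuit_prefix (Finset.mem_range.1 hk) θ δ α (hread k) (hzero k), Circuit.run_smul,
      (valid_loadf n m θ δ α).run_dagger_run]
    exact (ZeroOff.sum fun l _ => (zeroOff_mkBits m (hdat' l k) (fun _ _ => rfl)
      (hoff l)).smul _).smul _
  have z6 := z5.run_of_subset hFZ'
  have a1 := allocationFrom_le_of_subset z0 hXZ
  have a2 : Circuit.allocationFrom (X.run ψ) (loadf n m θ δ α) ≤ loadBound n m := by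
    rw [loadf_eq] at z2 ⊢
    exact allocationFrom_conj_setup_le m z1 z2 (length_par_loadOps_le n m θ δ α)
      (touches_par_loadOps n m θ δ α)
  have a3 := allocationFrom_le_of_subset z2 hSZ
  have a4 := allocationFrom_le_of_subset z3 hFZ
  have a5 : Circuit.allocationFrom (F.run (S.run ((loadf n m θ δ α).run (X.run ψ))))
      (Circuit.dagger (loadf n m θ δ α)) ≤ loadBound n m := by
    rw [dagger_loadf] at z5 ⊢
    refine allocationFrom_conj_setup_le m z4 z5 ?_ ?_
    · rw [Circuit.length_dagger]
      exact length_par_loadOps_le n m θ δ α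
    · rw [touches_dagger]
      exact touches_par_loadOps n m θ δ α
  have a6 := allocationFrom_le_of_subset z5 hFZ'
  have a7 := allocationFrom_le_of_subset z6 hXZ
  have l1 : X.length = 1 := rfl
  have l2 : S.length ≤ 78 * (n - m) := length_spf_le _ _ _
  have l3 : F.length ≤ 1 + 15 * (n - m) := length_flag_le _ _ _
  have b2 := Nat.mul_le_mul_right (cspBase n m).card l2
  have b3 := Nat.mul_le_mul_right (cspBase n m).card l3
  rw [Circuit.length_dagger] at a6
  rw [l1] at a1 a7
  have hsplit : cspCircuit n m θ δ α = X ++ loadf n m θ δ α ++ S ++ F ++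
      Circuit.dagger (loadf n m θ δ α) ++ Circuit.dagger F ++ X := rfl
  rw [hsplit]
  simp only [allocationFrom_append, Circuit.run_append]
  generalize (cspBase n m).card = z at *
  nlinarith

theorem allocation_spcspCircuit_le (hm : m < n) : (spcspCircuit n m x).spacetimeAllocation ≤
    200000 * (m * 2 ^ m + 2 ^ n + (n - m) * 2 ^ (n - m)) := by
  rw [Circuit.spacetimeAllocation, spcspCircuit, allocationFrom_append, run_spCircuit]
  have h1 : Circuit.allocationFrom (zeroState Qubit) (spCircuit m (spAngle m x)) ≤
      (9 + 108 * m) * (385 * 2 ^ m) := by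
    refine (allocationFrom_le zeroOff_zeroState _).trans ?_
    rw [Finset.card_empty, mul_zero, zero_add]
    exact (weight_le _).trans (Nat.mul_le_mul (length_spCircuit_le _ _) (touches_spCircuit_le _ _))
  have h2 := allocationFrom_cspCircuit_le m hm (cspAngle m x) (cspRz m x) (cspGlobalPhase m x)
    fun k => ∏ s ∈ Finset.range m,
      (gRy (spAngle m x (node s (k / 2 ^ (m - s))))).1 (nbit k (m - 1 - s)) 0
  refine (Nat.add_le_add h1 h2).trans ?_
  have h3 := card_cspBase_le n m
  rw [loadBound]
  obtain ⟨r, rfl⟩ : ∃ r, n = m + r := ⟨n - m, by omega⟩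
  rw [Nat.add_sub_cancel_left] at h3 ⊢
  generalize (cspBase (m + r) m).card = z at *
  -- The total coefficient of the base register is linear in `n`, and its size is at most `n + 223 ·
  -- 2^(n-m)`. The product is controlled by `n² ≤ 2 · 2^n`, `m ≤ 2^m` and the allowed term `(n-m)
  -- 2^(n-m)`.
  have h4 := Nat.mul_le_mul_left (114 + 104 * m + 112 * r) h3
  have h5 := sq_le_two_mul_two_pow (m + r)
  have h6 : m * 2 ^ r ≤ 2 ^ m * 2 ^ r := Nat.mul_le_mul_right _ Nat.lt_two_pow_self.le
  have h7 : m < 2 ^ m := Nat.lt_two_pow_self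
  have h8 : r < 2 ^ r := Nat.lt_two_pow_self
  have h9 : 2 ^ m * 1 ≤ 2 ^ m * 2 ^ r := Nat.mul_le_mul_left _ Nat.one_le_two_pow
  have h10 : 1 * 2 ^ r ≤ 2 ^ m * 2 ^ r := Nat.mul_le_mul_right _ Nat.one_le_two_pow
  rw [pow_add] at h5 ⊢
  generalize 2 ^ m = M at *
  generalize 2 ^ r = R at *
  have h11 := Nat.zero_le (m * M)
  have h12 := Nat.zero_le (r * R)
  have h13 : m * r ≤ M * R := Nat.mul_le_mul h7.le h8.le
  nlinarith

end

/-! ### Lower bounds from transcendence degree and light cones. -/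

section

/-! ### Counting parameters -/

/-- The closure in the matroid of algebraic independence consists of the numbers algebraic over
`ℚ[S]`, and these are stable under field operations. Rank in this matroid then does the counting. -/
theorem mem_matroid_closure_of_mem_adjoin {S : Set ℂ} {z : ℂ}
    (hz : z ∈ IntermediateField.adjoin ℚ S) :
    z ∈ (AlgebraicIndependent.matroid ℚ ℂ).closure S := by
  rw [AlgebraicIndependent.matroid_closure_eq, SetLike.mem_coe]
  induction hz using IntermediateField.adjoin_induction with
  | mem z hz =>
    exact isAlgebraic_algebraMap (⟨z, Algebra.subset_adjoin hz⟩ : Algebra.adjoin ℚ S)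
  | algebraMap z =>
    exact isAlgebraic_algebraMap (algebraMap ℚ (Algebra.adjoin ℚ S) z)
  | add z w _ _ hz hw => exact IsAlgebraic.add hz hw
  | inv z _ hz => exact IsAlgebraic.inv hz
  | mul z w _ _ hz hw => exact IsAlgebraic.mul hz hw

/-- Algebraically independent numbers in a finitely generated field are at most as many as the
generators. -/
theorem card_le_of_algebraicIndependent {N : ℕ} {y : Fin N → ℂ} (hy : AlgebraicIndependent ℚ y)
    {S : Set ℂ} (hS : ∀ i, y i ∈ IntermediateField.adjoin ℚ S) : (N : ℕ∞) ≤ S.encard := by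
  have h1 : (AlgebraicIndependent.matroid ℚ ℂ).Indep (Set.range y) :=
    AlgebraicIndependent.matroid_indep_iff.2 hy.coe_range
  have h2 : Set.range y ⊆ (AlgebraicIndependent.matroid ℚ ℂ).closure S := by
    rintro _ ⟨i, rfl⟩
    exact mem_matroid_closure_of_mem_adjoin (hS i)
  have h3 := h1.encard_le_eRk_of_subset h2
  rw [Matroid.eRk_closure_eq] at h3
  have h4 : (Set.range y).encard = N := by
    rw [← Set.image_univ, hy.injective.encard_image]
    simp
  rw [← h4]
  exact h3.trans (Matroid.eRk_le_encard _ _)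

theorem exists_algebraicIndependent (N : ℕ) : ∃ y : Fin N → ℂ, AlgebraicIndependent ℚ y := by
  obtain ⟨ι, v, hv⟩ := exists_isTranscendenceBasis' ℚ ℂ
  -- An uncountable algebraically closed field has a transcendence basis over `ℚ` of its own
  -- cardinality, in particular an infinite one.
  have h := IsAlgClosed.cardinal_eq_cardinal_transcendence_basis_of_aleph0_lt' v hv
    Cardinal.mk_le_aleph0 (by rw [Cardinal.mk_complex]; exact Cardinal.aleph0_lt_continuum)
  have h2 : Infinite ι := by
    rw [Cardinal.infinite_iff, ← h, Cardinal.mk_complex]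
    exact Cardinal.aleph0_le_continuum
  let f : Fin N ↪ ι := Fin.valEmbedding.trans (Infinite.natEmbedding ι)
  exact ⟨v ∘ f, hv.1.comp f f.injective⟩

variable {Q : Type}

/-- The matrix entries of a gate that is not fixed. -/
def Gate.entries : Gate Q → List ℂ
  | .u U _ => [U.1 0 0, U.1 0 1, U.1 1 0, U.1 1 1]
  | .cnot _ _ => []

/-- The matrix entries of the single-qubit gates of a layer. -/
def Layer.entries (L : Layer Q) : List ℂ := L.flatMap Gate.entries

theorem Layer.length_entries_le (L : Layer Q) : (Layer.entries L).length ≤ 4 * L.length := by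
  induction L with
  | nil => simp [Layer.entries]
  | cons g L ih =>
    have : g.entries.length ≤ 4 := by cases g <;> simp [Gate.entries]
    simp only [Layer.entries, List.flatMap_cons, List.length_append, List.length_cons] at ih ⊢
    omega

theorem Gate.length_qubits_le (g : Gate Q) : g.qubits.length ≤ 2 := by
  cases g <;> simp [Gate.qubits]

theorem nodup_qubits_of_mem {L : Layer Q} (hL : (Layer.qubits L).Nodup) {g : Gate Q}
    (hg : g ∈ L) : g.qubits.Nodup :=
  (List.nodup_flatMap.1 hL).1 g hg

theorem Circuit.length_flatten_le_touches (C : Circuit Q) : C.flatten.length ≤ touches C := by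
  have h : ∀ L : Layer Q, L.length ≤ (Layer.qubits L).length := by
    intro L
    induction L with
    | nil => simp
    | cons g L ih =>
      have : 0 < g.qubits.length := by cases g <;> simp [Gate.qubits]
      rw [Layer.qubits_cons, List.length_append, List.length_cons]
      omega
  rw [touches, ← Circuit.qubits_flatten]
  exact h _

theorem zeroState_mem (F : IntermediateField ℚ ℂ) (b : Q → Fin 2) : zeroState Q b ∈ F := by
  unfold zeroState
  split_ifs
  exacts [one_mem F, zero_mem F]

variable [DecidableEq Q]

/-- Amplitudes are polynomials in the entries of the gates, so they never leave the field these
generate. -/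
theorem Gate.apply_mem {g : Gate Q} {F : IntermediateField ℚ ℂ} (hg : ∀ z ∈ g.entries, z ∈ F)
    {ψ : State Q} (hψ : ∀ b, ψ b ∈ F) (b : Q → Fin 2) : g.apply ψ b ∈ F := by
  cases g with
  | u U q =>
    refine sum_mem fun v _ => mul_mem (hg _ ?_) (hψ _)
    generalize b q = w
    fin_cases v <;> fin_cases w <;> simp [Gate.entries]
  | cnot c t => exact hψ _

theorem Layer.apply_mem {L : Layer Q} {F : IntermediateField ℚ ℂ}
    (hL : ∀ z ∈ Layer.entries L, z ∈ F) {ψ : State Q} (hψ : ∀ b, ψ b ∈ F) (b : Q → Fin 2) :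
    Layer.apply L ψ b ∈ F := by
  induction L generalizing ψ with
  | nil => exact hψ b
  | cons g L ih =>
    simp only [Layer.entries, List.flatMap_cons, List.mem_append] at hL
    exact ih (fun z hz => hL z (.inr hz)) (Gate.apply_mem (fun z hz => hL z (.inl hz)) hψ)

/-! ### Gates that avoid a register -/

variable {n : ℕ}

/-- The state of the other qubits if the register `d` is found in the basis state `a`. -/
def slice (d : Fin n ↪ Q) (ψ : State Q) (a : Fin n → Fin 2) : State Q :=
  fun b => ψ (Function.extend d a b)

theorem extend_update (d : Fin n ↪ Q) (a : Fin n → Fin 2) (b : Q → Fin 2) {q : Q}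
    (hq : q ∉ Set.range d) (v : Fin 2) :
    Function.extend d a (Function.update b q v) = Function.update (Function.extend d a b) q v := by
  funext p
  by_cases hp : ∃ i, d i = p
  · obtain ⟨i, rfl⟩ := hp
    rw [Function.update_of_ne fun h => hq ⟨i, h⟩, d.injective.extend_apply,
      d.injective.extend_apply]
  · rw [Function.extend_apply' _ _ _ hp]
    by_cases h : p = q
    · subst h
      simp
    · rw [Function.update_of_ne h, Function.update_of_ne h, Function.extend_apply' _ _ _ hp]

theorem Gate.apply_slice {d : Fin n ↪ Q} {g : Gate Q} (hg : ∀ q ∈ g.qubits, q ∉ Set.range d)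
    (ψ : State Q) (a : Fin n → Fin 2) : g.apply (slice d ψ a) = slice d (g.apply ψ) a := by
  funext b
  cases g with
  | u U q =>
    have hq : q ∉ Set.range d := hg q (by simp [Gate.qubits])
    have h : Function.extend d a b q = b q := Function.extend_apply' _ _ _ hq
    simp only [Gate.apply, slice, extend_update d a b hq, h]
  | cnot c t =>
    have hc : c ∉ Set.range d := hg c (by simp [Gate.qubits])
    have ht : t ∉ Set.range d := hg t (by simp [Gate.qubits])
    have h : Function.extend d a b c = b c := Function.extend_apply' _ _ _ hc
    have h' : Function.extend d a b t = b t := Function.extend_apply' _ _ _ ht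
    simp only [Gate.apply, slice, extend_update d a b ht, h, h']

theorem Layer.apply_slice {d : Fin n ↪ Q} {L : Layer Q}
    (hL : ∀ q ∈ Layer.qubits L, q ∉ Set.range d) (ψ : State Q) (a : Fin n → Fin 2) :
    Layer.apply L (slice d ψ a) = slice d (Layer.apply L ψ) a := by
  induction L generalizing ψ with
  | nil => rfl
  | cons g L ih =>
    simp only [Layer.qubits_cons, List.mem_append] at hL
    rw [Layer.apply_cons, Layer.apply_cons, Gate.apply_slice fun q hq => hL q (.inl hq),
      ih fun q hq => hL q (.inr hq)]

theorem Layer.apply_injective {L : Layer Q} (hL : ∀ g ∈ L, g.qubits.Nodup) :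
    Function.Injective (Layer.apply L) := by
  induction L with
  | nil => exact fun _ _ h => h
  | cons g L ih =>
    intro ψ φ h
    have h1 : g.apply ψ = g.apply φ := ih (fun k hk => hL k (by simp [hk])) h
    rw [← Gate.dagger_apply_apply (hL g (by simp)) ψ, h1,
      Gate.dagger_apply_apply (hL g (by simp))]

/-- The digits of `j < 2 ^ n`, most significant digit first. -/
def digits (n j : ℕ) (i : Fin n) : Fin 2 := nbit j (n - 1 - i)

/-- The prepared state is a product, so all its slices are multiples of one state of the ancillas,
with the amplitudes of `x` as factors. -/
theorem slice_dataState (d : Fin n ↪ Q) {x : EuclideanSpace ℂ (Fin (2 ^ n))}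
    (a : Fin n → Fin 2) (b : Q → Fin 2) :
    slice d (dataState d x) a b = coeff x (bitsToNat a) * slice d (zeroState Q) 0 b / ‖x‖ := by
  unfold slice dataState zeroState
  have h : (∀ q, Function.extend d (0 : Fin n → Fin 2) b q = 0) ↔
      ∀ q ∉ Set.range d, Function.extend d a b q = 0 := by
    constructor
    · intro h q hq
      have := h q
      rwa [Function.extend_apply' _ _ _ hq] at this ⊢
    · intro h q
      by_cases hq : q ∈ Set.range d
      · obtain ⟨i, rfl⟩ := hq
        rw [d.injective.extend_apply]
        rfl
      · have := h q hq
        rwa [Function.extend_apply' _ _ _ hq] at this ⊢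
  simp only [d.injective.extend_apply]
  split_ifs with h1 h2 h2
  · simp
  · exact absurd (h.2 h1) h2
  · exact absurd (h.1 h2) h1
  · simp

end

section

variable {Q : Type} [DecidableEq Q] {n : ℕ}

theorem bitsToNat_digits {j : ℕ} (hj : j < 2 ^ n) : bitsToNat (digits n j) = j := by
  have h := bitsToNat_eq_pre (n := n) fun i => nbit j (n - 1 - i)
  rw [pre_nbit hj le_rfl, Nat.sub_self, pow_zero, Nat.div_one] at h
  exact h

/-- If gates that avoid the data qubits turn `φ` into a prepared state, the ratios of the prepared
amplitudes are ratios of amplitudes of `φ`. -/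
theorem coeff_mem_of_apply_eq_dataState {d : Fin n ↪ Q} {x : EuclideanSpace ℂ (Fin (2 ^ n))}
    (hx : coeff x 0 = 1) {G : Layer Q} (hG : ∀ g ∈ G, g.qubits.Nodup)
    (hd : ∀ q ∈ Layer.qubits G, q ∉ Set.range d) {φ : State Q}
    (h : Layer.apply G φ = dataState d x) {F : IntermediateField ℚ ℂ} (hF : ∀ b, φ b ∈ F)
    {j : ℕ} (hj : j < 2 ^ n) : coeff x j ∈ F := by
  have hx0 : x ≠ 0 := by
    rintro rfl
    simp [coeff] at hx
  have hnorm : (‖x‖ : ℂ) ≠ 0 := by simpa using hx0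
  have h1 : ∀ i < 2 ^ n, Layer.apply G (slice d φ (digits n i)) =
      (coeff x i / ‖x‖) • slice d (zeroState Q) 0 := by
    intro i hi
    rw [Layer.apply_slice hd, h]
    funext b
    rw [slice_dataState, bitsToNat_digits hi, Pi.smul_apply, smul_eq_mul]
    ring
  -- The gates `G` act on each slice separately and injectively, so the proportionality of the
  -- slices holds already before `G`.
  have h2 : slice d φ (digits n j) = coeff x j • slice d φ (digits n 0) := by
    apply Layer.apply_injective hG
    rw [(Layer.isLinearMap G).map_smul, h1 j hj, h1 0 (Nat.two_pow_pos n), hx, smul_smul]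
    congr 1
    ring
  have h3 : slice d φ (digits n 0) ≠ 0 := by
    intro h0
    have h4 := h1 0 (Nat.two_pow_pos n)
    rw [h0, (Layer.isLinearMap G).map_zero, hx] at h4
    have h5 := congrFun h4 0
    have h6 : slice d (zeroState Q) 0 0 = 1 := by
      have : Function.extend d (0 : Fin n → Fin 2) (0 : Q → Fin 2) = 0 := by
        funext q
        by_cases hq : ∃ i, d i = q
        · obtain ⟨i, rfl⟩ := hq
          rw [d.injective.extend_apply]
          rfl
        · rw [Function.extend_apply' _ _ _ hq]
      simp [slice, zeroState, this]
    rw [Pi.smul_apply, h6] at h5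
    simp at h5
    exact hnorm h5.symm
  obtain ⟨b, hb⟩ := Function.ne_iff.1 h3
  rw [Pi.zero_apply] at hb
  have h4 := congrFun h2 b
  rw [Pi.smul_apply, smul_eq_mul] at h4
  -- At a string where the reference slice does not vanish, the coefficient is a quotient of two
  -- amplitudes of `φ`; the norm of `x` has cancelled.
  rw [eq_div_of_mul_eq hb h4.symm]
  exact div_mem (hF _) (hF _)

/-- The vector with entries `1, y 0, y 1, …`. -/
def consVec (y : Fin (2 ^ n - 1) → ℂ) : EuclideanSpace ℂ (Fin (2 ^ n)) :=
  WithLp.toLp 2 fun i => if h : 0 < (i : ℕ) then y ⟨i - 1, by omega⟩ else 1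

theorem coeff_consVec_zero (y : Fin (2 ^ n - 1) → ℂ) : coeff (consVec y) 0 = 1 := by
  simp [coeff, consVec]

theorem coeff_consVec_succ (y : Fin (2 ^ n - 1) → ℂ) (i : Fin (2 ^ n - 1)) :
    coeff (consVec y) (i + 1) = y i := by
  have h : (i : ℕ) + 1 < 2 ^ n := by omega
  simp [coeff, consVec, h]

theorem consVec_ne_zero (y : Fin (2 ^ n - 1) → ℂ) : consVec y ≠ 0 := by
  intro h
  have := coeff_consVec_zero y
  rw [h] at this
  simp [coeff] at this

/-- A generic state can only be prepared with at least `(2 ^ n - 1) / 4` gates, even if gates that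
avoid the data qubits follow for free. -/
theorem two_pow_sub_one_le_of_apply_eq_dataState {d : Fin n ↪ Q} {y : Fin (2 ^ n - 1) → ℂ}
    (hy : AlgebraicIndependent ℚ y) {G H : Layer Q} (hH : ∀ g ∈ H, g.qubits.Nodup)
    (hd : ∀ q ∈ Layer.qubits H, q ∉ Set.range d)
    (h : Layer.apply H (Layer.apply G (zeroState Q)) = dataState d (consVec y)) :
    2 ^ n - 1 ≤ 4 * G.length := by
  have h1 : ∀ i, y i ∈ IntermediateField.adjoin ℚ {z | z ∈ Layer.entries G} := by
    intro i
    rw [← coeff_consVec_succ y i]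
    refine coeff_mem_of_apply_eq_dataState (coeff_consVec_zero y) hH hd h (fun b => ?_) (by omega)
    exact Layer.apply_mem (fun z hz => IntermediateField.subset_adjoin ℚ _ hz)
      (zeroState_mem _) b
  have h2 := card_le_of_algebraicIndependent hy h1
  have h3 : {z | z ∈ Layer.entries G}.encard ≤ ((Layer.entries G).length : ℕ∞) := by
    classical
    rw [← List.coe_toFinset, Set.encard_coe_eq_coe_finsetCard]
    exact_mod_cast List.toFinset_card_le _
  exact (by exact_mod_cast h2.trans h3 : 2 ^ n - 1 ≤ (Layer.entries G).length).trans
    (Layer.length_entries_le G)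

/-! ### Light cones -/

theorem Layer.apply_filter {L : Layer Q} (hL : (Layer.qubits L).Nodup) (p : Gate Q → Bool)
    (ψ : State Q) :
    Layer.apply L ψ = Layer.apply (L.filter fun g => !p g) (Layer.apply (L.filter p) ψ) := by
  induction L generalizing ψ with
  | nil => rfl
  | cons g L ih =>
    rw [Layer.qubits_cons, List.nodup_append] at hL
    obtain ⟨-, h2, h3⟩ := hL
    rw [Layer.apply_cons, ih h2]
    by_cases hp : p g
    · simp [hp, Layer.apply_cons]
    · have h4 : ∀ q ∈ g.qubits, q ∉ Layer.qubits (L.filter p) := by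
        intro q hq hq'
        obtain ⟨k, hk, hq'⟩ := List.mem_flatMap.1 hq'
        exact h3 q hq q (List.mem_flatMap.2 ⟨k, (List.mem_filter.1 hk).1, hq'⟩) rfl
      simp [hp, Layer.apply_cons, Layer.apply_comm_gate h4]

theorem length_filter_touching_le {L : Layer Q} (hL : (Layer.qubits L).Nodup) (T : Finset Q) :
    (L.filter fun g => g.qubits.any (· ∈ T)).length ≤ T.card := by
  have h : (L.filter fun g => g.qubits.any (· ∈ T)).length ≤
      ((Layer.qubits L).filter (· ∈ T)).length := by
    clear hL
    induction L with
    | nil => simp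
    | cons g L ih =>
      rw [Layer.qubits_cons, List.filter_append, List.length_append, List.filter_cons]
      split_ifs with hg
      · obtain ⟨q, hq, hqT⟩ := List.any_eq_true.1 hg
        have : 0 < (g.qubits.filter (· ∈ T)).length :=
          List.length_pos_of_mem (List.mem_filter.2 ⟨hq, hqT⟩)
        rw [List.length_cons]
        omega
      · omega
  refine h.trans ?_
  rw [← List.toFinset_card_of_nodup (hL.filter _)]
  refine Finset.card_le_card fun q hq => ?_
  simp only [List.mem_toFinset, List.mem_filter, decide_eq_true_eq] at hq
  exact hq.2

/-- A gate that meets `T` has at most two qubits, one of them in `T`, so it adds at most one; and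
disjoint gates meet `T` in different qubits. Hence a light cone at most doubles per layer. -/
theorem card_union_touching_le {L : Layer Q} (hL : (Layer.qubits L).Nodup) (T : Finset Q) :
    (T ∪ (Layer.qubits (L.filter fun g => g.qubits.any (· ∈ T))).toFinset).card ≤ 2 * T.card := by
  have h : ((Layer.qubits (L.filter fun g => g.qubits.any (· ∈ T))).filter (· ∉ T)).length ≤
      (L.filter fun g => g.qubits.any (· ∈ T)).length := by
    clear hL
    induction L with
    | nil => simp [Layer.qubits]
    | cons g L ih =>
      rw [List.filter_cons]
      split_ifs with hg
      · obtain ⟨q, hq, hqT⟩ := List.any_eq_true.1 hg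
        have h1 : (g.qubits.filter (· ∉ T)).length < g.qubits.length :=
          List.length_filter_lt_length_iff_exists.2 ⟨q, hq, by simpa using hqT⟩
        have h2 := g.length_qubits_le
        rw [Layer.qubits_cons, List.filter_append, List.length_append, List.length_cons]
        omega
      · exact ih
  have h1 : T ∪ (Layer.qubits (L.filter fun g => g.qubits.any (· ∈ T))).toFinset ⊆
      T ∪ ((Layer.qubits (L.filter fun g => g.qubits.any (· ∈ T))).filter (· ∉ T)).toFinset := by
    intro q hq
    simp only [Finset.mem_union, List.mem_toFinset] at hq ⊢
    by_cases hqT : q ∈ T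
    · exact .inl hqT
    · exact .inr (List.mem_filter.2 ⟨hq.resolve_left hqT, by simpa using hqT⟩)
  have h2 := (Finset.card_le_card h1).trans (Finset.card_union_le _ _)
  have h3 := List.toFinset_card_le
    ((Layer.qubits (L.filter fun g => g.qubits.any (· ∈ T))).filter (· ∉ T))
  have h4 := length_filter_touching_le hL T
  omega

/-- Only the gates in the backward light cone of `T` matter for `T`; their number is bounded in terms
of the depth. -/
theorem exists_lightCone {C : Circuit Q} (hC : C.Valid) (T : Finset Q) :
    ∃ G H : Layer Q, (∀ ψ, C.run ψ = Layer.apply H (Layer.apply G ψ)) ∧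
      (∀ g ∈ H, g.qubits.Nodup) ∧ (∀ q ∈ Layer.qubits H, q ∉ T) ∧
      G.length + T.card ≤ T.card * 2 ^ C.length := by
  induction C using List.reverseRecOn generalizing T with
  | nil => exact ⟨[], [], fun _ => rfl, by simp, by simp [Layer.qubits], by simp⟩
  | append_singleton C L ih =>
    obtain ⟨hC, hL⟩ := Circuit.valid_append.1 hC
    replace hL := hL L (by simp)
    let p : Gate Q → Bool := fun g => g.qubits.any (· ∈ T)
    -- Going backwards, the layers before `L` must be controlled on all qubits that influence `T`
    -- through `L`. Here a `Layer` is just a list of gates executed in order.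
    obtain ⟨G, H, h1, h2, h3, h4⟩ := ih hC (T ∪ (Layer.qubits (L.filter p)).toFinset)
    refine ⟨G ++ L.filter p, H ++ L.filter fun g => !p g, fun ψ => ?_, fun g hg => ?_,
      fun q hq hqT => ?_, ?_⟩
    -- The discarded gates `H` avoid the enlarged set, so they commute past the relevant gates of
    -- the last layer.
    · have h5 : ∀ q ∈ Layer.qubits H, q ∉ Layer.qubits (L.filter p) := fun q hq hq' =>
        h3 q hq (Finset.mem_union_right _ (List.mem_toFinset.2 hq'))
      rw [Circuit.run_append, Circuit.run_cons, Circuit.run_nil, h1, Layer.apply_filter hL p,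
        Layer.apply_append, Layer.apply_append, Layer.apply_comm h5]
    · rcases List.mem_append.1 hg with hg | hg
      · exact h2 g hg
      · exact nodup_qubits_of_mem hL (List.mem_filter.1 hg).1
    · rw [Layer.qubits_append, List.mem_append] at hq
      rcases hq with hq | hq
      · exact h3 q hq (Finset.mem_union_left _ hqT)
      · obtain ⟨g, hg, hq⟩ := List.mem_flatMap.1 hq
        have h5 := (List.mem_filter.1 hg).2
        have h6 : p g = true := List.any_eq_true.2 ⟨q, hq, by simpa using hqT⟩
        simp [h6] at h5
    · have h5 : (L.filter p).length ≤ T.card := length_filter_touching_le hL T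
      have h6 : (T ∪ (Layer.qubits (L.filter p)).toFinset).card ≤ 2 * T.card :=
        card_union_touching_le hL T
      have h7 : T.card ≤ (T ∪ (Layer.qubits (L.filter p)).toFinset).card :=
        Finset.card_le_card Finset.subset_union_left
      generalize (T ∪ (Layer.qubits (L.filter p)).toFinset).card = t at *
      -- With `2^D = k + 1` the induction hypothesis reads `G.length ≤ t k`, free of subtraction,
      -- and `t ≤ 2 |T|` finishes the count.
      obtain ⟨k, hk⟩ : ∃ k, 2 ^ C.length = k + 1 := ⟨2 ^ C.length - 1, by
        have := Nat.two_pow_pos C.length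
        omega⟩
      rw [List.length_append, List.length_append, List.length_singleton, pow_succ]
      rw [hk] at h4 ⊢
      have h8 := Nat.mul_le_mul_right k h6
      nlinarith

/-! ### The lower bounds -/

theorem le_of_two_pow_le {n D : ℕ} (hn : 1 ≤ n) (h : 2 ^ n - 1 + 4 * n ≤ 4 * (n * 2 ^ D)) :
    n ≤ 10 * D := by
  -- If `n = D + k > 10 D`, cancelling `2^D` leaves `2^k ≤ 4 (D + k)` with `k > 9D`, which fails
  -- against `5k < 2^k` for `k ≥ 6`.
  by_contra! hD
  have h1 : D < n := by omega
  obtain ⟨k, rfl⟩ : ∃ k, n = D + k := ⟨n - D, by omega⟩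
  have h2 : 2 ^ k ≤ 4 * (D + k) := by
    have h3 : 2 ^ (D + k) ≤ 4 * ((D + k) * 2 ^ D) := by omega
    rw [pow_add, ← mul_assoc, mul_comm] at h3
    exact Nat.le_of_mul_le_mul_right h3 (Nat.two_pow_pos D)
  have h3 : 9 * D < k := by omega
  -- For small `k` the depth is `0`, and the summand `4 * n` in the hypothesis is needed: it leaves
  -- `2^n ≤ 1`.
  by_cases hk : k < 6
  · have hD0 : D = 0 := by omega
    subst hD0
    have := Nat.two_pow_pos k
    simp at h
    interval_cases k <;> omega
  · have h4 : ∀ j, 6 ≤ j → 5 * j < 2 ^ j := by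
      intro j hj
      induction j, hj using Nat.le_induction with
      | base => norm_num
      | succ j hj ih => rw [pow_succ]; omega
    have := h4 k (by omega)
    omega

theorem le_depth_of_prepares (hn : 1 ≤ n) {d : Fin n ↪ Q} {y : Fin (2 ^ n - 1) → ℂ}
    (hy : AlgebraicIndependent ℚ y) {C : Circuit Q} (hC : C.Valid)
    (h : C.Prepares d (consVec y)) : n ≤ 10 * C.depth := by
  obtain ⟨G, H, h1, h2, h3, h4⟩ := exists_lightCone hC (Finset.univ.map d)
  rw [Circuit.Prepares, h1] at h
  have h5 := two_pow_sub_one_le_of_apply_eq_dataState hy h2 (fun q hq => by simpa using h3 q hq) h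
  rw [Finset.card_map, Finset.card_univ, Fintype.card_fin] at h4
  refine le_of_two_pow_le hn ?_
  rw [Circuit.depth]
  omega

theorem le_allocation_of_prepares (hn : 1 ≤ n) {d : Fin n ↪ Q} {y : Fin (2 ^ n - 1) → ℂ}
    (hy : AlgebraicIndependent ℚ y) {C : Circuit Q} (hC : C.Valid)
    (h : C.Prepares d (consVec y)) : 2 ^ n ≤ 10 * C.spacetimeAllocation := by
  rw [Circuit.Prepares, Circuit.run_eq_flatten] at h
  have h1 := two_pow_sub_one_le_of_apply_eq_dataState (H := []) hy (by simp)
    (by simp [Layer.qubits]) h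
  have h2 : touches C ≤ C.spacetimeAllocation := touches_le_allocationFrom zeroOff_zeroState hC
  have h3 := C.length_flatten_le_touches
  have h4 : 2 ^ 1 ≤ 2 ^ n := Nat.pow_le_pow_right (by norm_num) hn
  omega

end

end QSP

end

/-! ### Choice of the constants and assembly. -/

theorem mainTheorem1 :
    ∃ c K : ℝ, 0 < c ∧ 0 < K ∧
      (∀ n m : ℕ, m < n → ∀ x : EuclideanSpace ℂ (Fin (2 ^ n)), x ≠ 0 →
        (QSP.spcspCircuit n m x).Valid ∧
        (QSP.spcspCircuit n m x).Prepares (QSP.dataQubits n) x ∧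
        c * n ≤ ((QSP.spcspCircuit n m x).depth : ℝ) ∧
        ((QSP.spcspCircuit n m x).depth : ℝ) ≤ K * n ∧
        ((QSP.spcspCircuit n m x).numAncillas (QSP.dataQubits n) : ℝ) ≤ K * 2 ^ n ∧
        c * 2 ^ n ≤ ((QSP.spcspCircuit n m x).spacetimeAllocation : ℝ) ∧
        ((QSP.spcspCircuit n m x).spacetimeAllocation : ℝ)
          ≤ K * (m * 2 ^ m + 2 ^ n + (n - m) * 2 ^ (n - m)) ∧
        (⌈Real.logb 2 n⌉ ≤ (m : ℤ) → (m : ℤ) ≤ ⌊(n : ℝ) - Real.logb 2 n⌋ →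
          ((QSP.spcspCircuit n m x).spacetimeAllocation : ℝ) ≤ K * 2 ^ n)) ∧
      (∀ n : ℕ, 1 ≤ n → ∃ x : EuclideanSpace ℂ (Fin (2 ^ n)), x ≠ 0 ∧
        ∀ (Q : Type) [DecidableEq Q] (d : Fin n ↪ Q) (C : QSP.Circuit Q),
          C.Valid → C.Prepares d x →
            c * n ≤ (C.depth : ℝ) ∧ c * 2 ^ n ≤ (C.spacetimeAllocation : ℝ)) := by
  -- The lower bounds for arbitrary circuits give `1/10`. In the balanced range each of the three
  -- terms is at most `2^n`, so the constant is three times `200000`.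
  refine ⟨1 / 10, 600000, by norm_num, by norm_num, fun n m hm x hx => ?_, fun n hn => ?_⟩
  · have h1 : (n : ℝ) ≤ (QSP.spcspCircuit n m x).depth :=
      mod_cast QSP.le_depth_spcspCircuit m x hm
    have h2 : ((QSP.spcspCircuit n m x).depth : ℝ) ≤ 400 * n :=
      mod_cast QSP.depth_spcspCircuit_le m x hm
    have h3 : ((QSP.spcspCircuit n m x).numAncillas (QSP.dataQubits n) : ℝ) ≤ 2385 * 2 ^ n :=
      mod_cast (QSP.numAncillas_le_touches _ _).trans (QSP.touches_spcspCircuit_le m x hm)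
    have h4 : (2 ^ n : ℝ) ≤ 2 * (QSP.spcspCircuit n m x).spacetimeAllocation :=
      mod_cast QSP.le_allocation_spcspCircuit m x hm
    have h5 : ((QSP.spcspCircuit n m x).spacetimeAllocation : ℝ) ≤
        200000 * (m * 2 ^ m + 2 ^ n + (n - m) * 2 ^ (n - m)) := by
      rw [← Nat.cast_sub hm.le]
      exact_mod_cast QSP.allocation_spcspCircuit_le m x hm
    have hn : (0 : ℝ) < n := Nat.cast_pos.2 (by omega)
    have hmn : (0 : ℝ) ≤ n - m := sub_nonneg.2 (Nat.cast_le.2 hm.le)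
    have h6 : (0 : ℝ) ≤ m * 2 ^ m + 2 ^ n + (n - m) * 2 ^ (n - m) := by positivity
    have h7 : (0 : ℝ) < 2 ^ n := by positivity
    refine ⟨QSP.valid_spcspCircuit n m x, QSP.spcsp_prepares x hm hx, by linarith, by linarith,
      by linarith, by linarith, by linarith, fun hlo hhi => ?_⟩
    -- The two conditions on `m` say `n ≤ 2^m` and `n ≤ 2^(n-m)`. They are used crosswise: the
    -- second bounds `m 2^m`, the first `(n-m) 2^(n-m)`.
    have h8 : (n : ℝ) ≤ 2 ^ m := by
      have : Real.logb 2 n ≤ m := mod_cast Int.ceil_le.1 hlo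
      rwa [Real.logb_le_iff_le_rpow one_lt_two hn, Real.rpow_natCast] at this
    have h9 : (n : ℝ) ≤ 2 ^ (n - m) := by
      have h : (m : ℝ) ≤ n - Real.logb 2 n := mod_cast Int.le_floor.1 hhi
      have : Real.logb 2 n ≤ (n - m : ℕ) := by
        rw [Nat.cast_sub hm.le]
        linarith
      rwa [Real.logb_le_iff_le_rpow one_lt_two hn, Real.rpow_natCast] at this
    have h10 : (2 ^ m * 2 ^ (n - m) : ℝ) = 2 ^ n := by
      rw [← pow_add, Nat.add_sub_cancel' hm.le]
    have h11 : (m * 2 ^ m : ℝ) ≤ 2 ^ n := by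
      rw [← h10, mul_comm]
      exact mul_le_mul_of_nonneg_left (by linarith) (by positivity)
    have h12 : ((n - m) * 2 ^ (n - m) : ℝ) ≤ 2 ^ n := by
      rw [← h10]
      exact mul_le_mul_of_nonneg_right (by linarith [Nat.cast_nonneg (α := ℝ) m]) (by positivity)
    linarith
  -- Only ratios of amplitudes are accessible, hence one entry is fixed to `1` and the other `2^n -
  -- 1` are generic.
  · obtain ⟨y, hy⟩ := QSP.exists_algebraicIndependent (2 ^ n - 1)
    refine ⟨QSP.consVec y, QSP.consVec_ne_zero y, fun Q _ d C hC h => ⟨?_, ?_⟩⟩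
    · have h1 : (n : ℝ) ≤ 10 * C.depth := mod_cast QSP.le_depth_of_prepares hn hy hC h
      linarith
    · have h1 : (2 ^ n : ℝ) ≤ 10 * C.spacetimeAllocation :=
        mod_cast QSP.le_allocation_of_prepares hn hy hC h
      linarith
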